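/- Let $\mathbb K$ be $\mathbb R$ or $\mathbb C$, let $\mathcal M$ be a finite-dimensional $\mathbb Z$-graded manifold (locally, its functions are formal power series in finitely many graded coordinates with smooth $\mathbb K$-valued coefficients), let $Q$ be a homological vector field on $\mathcal M$ (degree $+1$, $Q\circ Q=0$), and let $\nabla$ be a torsion-free affine connection on $\mathcal M$. Write $\mathcal R=C^\infty(\mathcal M)$, $\mathcal D(\mathcal M)$ for the differential operators, $\odot$ and $\Delta$ for the product and the shuffle comultiplication of the graded symmetric algebra $\Gamma(S(T_{\mathcal M}))$ over $\mathcal R$, and $\varepsilon_k=(-1)^{|X_k|(|X_1|+\cdots+|X_{k-1}|)}$. For $\boldsymbol X=X_1\odot\cdots\odot X_n$ with homogeneous $X_i$, let $\boldsymbol X^{\{k\}}$ be the product without the factor $X_k$. Set $$\mathrm{At}^\nabla(X,Y)=[Q,\nabla_XY]-\nabla_{[Q,X]}Y-(-1)^{|X|}\nabla_X[Q,Y],$$ and let $R^\nabla$ be the curvature of $\nabla$. There is a unique $\mathbb K$-linear map $\mathrm{pbw}^\nabla:\Gamma(S(T_{\mathcal M}))\to\mathcal D(\mathcal M)$ with $\mathrm{pbw}^\nabla(f)=f$,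 $\mathrm{pbw}^\nabla(X)=X$ and $$\mathrm{pbw}^\nabla(\boldsymbol X)=\frac1n\sum_{k=1}^n\varepsilon_k\left(X_k\,\mathrm{pbw}^\nabla(\boldsymbol X^{\{k\}})-\mathrm{pbw}^\nabla(\nabla_{X_k}\boldsymbol X^{\{k\}})\right)\qquad(n\ge2),$$ and it is bijective. Put $$\delta^\nabla=(\mathrm{pbw}^\nabla)^{-1}\circ[Q,-]\circ\mathrm{pbw}^\nabla,\qquad B^\nabla(Y;\boldsymbol X)=(\mathrm{pbw}^\nabla)^{-1}\big(Y\cdot\mathrm{pbw}^\nabla(\boldsymbol X)\big)-\nabla_Y\boldsymbol X.$$ For an $\mathcal R$-linear map $T:\Gamma(S^k(T_{\mathcal M}))\to\mathfrak X(\mathcal M)$ let $\bar T$ be its extension by zero to $\Gamma(S(T_{\mathcal M}))$ and $(\bar T\star\mathrm{id})(\boldsymbol X)=\bar T(\boldsymbol X_{(1)})\odot\boldsymbol X_{(2)}$, where $\Delta\boldsymbol X=\boldsymbol X_{(1)}\otimes\boldsymbol X_{(2)}$ in Sweedler notation; if $T$ has degree $+1$, let $$(\widetilde{d^\nabla}T)(\boldsymbol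 X)=\sum_{k}\varepsilon_k\left((-1)^{|X_k|}\nabla_{X_k}\big(T(\boldsymbol X^{\{k\}})\big)-T(\nabla_{X_k}\boldsymbol X^{\{k\}})\right).$$ There is a unique family of sections $R_n\in\Gamma(S^n(T^\vee_{\mathcal M})\otimes T_{\mathcal M})$, $n\ge0$, of degree $+1$ with $\delta^\nabla-\mathcal L_Q=\sum_{k\ge0}\bar R_k\star\mathrm{id}$; the $R_n$ with $n\ge2$ are the higher brackets of the Kapranov $L_\infty[1]$ algebra. One has $R_2=-\mathrm{At}^\nabla$, and: (i) The sections $R_n$ are completely determined by $\mathrm{At}^\nabla$, $R^\nabla$ and their higher covariant derivatives: for every $n\ge3$, on $\Gamma(S^n(T_{\mathcal M}))$, $$R_n=\frac2n(\bar R_2\star\mathrm{id})+\frac1n\sum_{k=2}^{n-1}\left[\big(\overline{\widetilde{d^\nabla}R_k}\star\mathrm{id}\big)+(1-k)(\bar R_k\star\mathrm{id})-B^\nabla\circ(\bar R_k\otimes\mathrm{id})\circ\Delta\right],$$ and for every $n\ge2$ there is a universal expression, independent of $\mathbb K$, $\mathcal M$, $Q$ and $\nabla$, that gives $R_n$ in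 terms of $\mathrm{At}^\nabla$ and $R^\nabla$ by covariant derivatives, compositions, permutations of arguments (with Koszul signs) and rational linear combinations. (ii) If $R^\nabla=0$, then $R_2=-\mathrm{At}^\nabla$ and $R_n=\frac1n\widetilde{d^\nabla}R_{n-1}$ for all $n\ge3$. -/

import Mathlib

open scoped Manifold ContDiff
open TopologicalSpace CategoryTheory

universe u

noncomputable section

namespace DGMfd

/-- Formal expressions built from the symbols `At` and `R` (Atiyah cocycle and curvature) by
covariant derivatives, compositions, permutations of the arguments and rational linear
combinations. `TExpr n p` are the expressions for tensors of type `(1, n)` and parity `p`. -/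
inductive TExpr : ℕ → ZMod 2 → Type
  | atiyah : TExpr 2 1
  | curv : TExpr 3 0
  | cov {n : ℕ} {p : ZMod 2} : TExpr n p → TExpr (n + 1) p
  | comp {n m : ℕ} {p q : ZMod 2} : TExpr (n + 1) p → TExpr m q → TExpr (m + n) (p + q)
  | perm {n : ℕ} {p : ZMod 2} : Equiv.Perm (Fin n) → TExpr n p → TExpr n p
  | add {n : ℕ} {p : ZMod 2} : TExpr n p → TExpr n p → TExpr n p
  | smul {n : ℕ} {p : ZMod 2} : ℚ → TExpr n p → TExpr n p

/-! ## Differential calculus on a (completed) `ℤ`-graded commutative algebra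

`R` is the algebra of functions and `c k f` is the component of degree `k` of the function `f`.
A function may have infinitely many non-zero components, but it is always the sum of an even and
of an odd function; all Koszul signs only depend on parities. -/

section Calculus

variable {K R : Type*} [Field K] [Ring R] [Algebra K R] (c : ℤ → R →ₗ[K] R)

/-- `f` is homogeneous of degree `k`. -/
def IsDeg (k : ℤ) (f : R) : Prop := c k f = f

/-- Functions of parity `p`: all components of the other parity vanish. -/
def par (p : ZMod 2) : Submodule K R where
  carrier := {f | ∀ k : ℤ, (k : ZMod 2) ≠ p → c k f = 0}
  add_mem' := fun ha hb k hk => by simp [ha k hk, hb k hk]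
  zero_mem' := fun k _ => by simp
  smul_mem' := fun a f hf k hk => by simp [hf k hk]

/-- Graded derivations of parity `p`. -/
def derPar (p : ZMod 2) : Submodule K (Module.End K R) where
  carrier := {D | (∀ q, ∀ f ∈ par c q, D f ∈ par c (p + q)) ∧
    ∀ q, ∀ f ∈ par c q, ∀ g, D (f * g) = D f * g + (-1 : ℤˣ) ^ (p * q) • (f * D g)}
  add_mem' := by
    rintro D D' ⟨h1, h2⟩ ⟨h1', h2'⟩
    refine ⟨fun q f hf => add_mem (h1 q f hf) (h1' q f hf), fun q f hf g => ?_⟩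
    simp only [LinearMap.add_apply, h2 q f hf g, h2' q f hf g, add_mul, mul_add, smul_add]
    abel
  zero_mem' := ⟨fun q f _ => by simp, fun q f _ g => by simp⟩
  smul_mem' := by
    rintro a D ⟨h1, h2⟩
    refine ⟨fun q f hf => Submodule.smul_mem _ _ (h1 q f hf), fun q f hf g => ?_⟩
    simp only [LinearMap.smul_apply, h2 q f hf g, smul_add, smul_mul_assoc, mul_smul_comm]
    rw [smul_comm]

/-- The left `R`-module of vector fields, generated by the homogeneous derivations of `R`
(so it is the sum of the even and of the odd derivations). -/
def Vect : Submodule R (Module.End K R) :=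
  Submodule.span R (⋃ p : ZMod 2, (derPar c p : Set (Module.End K R)))

/-- The derivation `X` is homogeneous of degree `k`. -/
def HasDeg (k : ℤ) (X : Module.End K R) : Prop :=
  X ∈ derPar c (k : ZMod 2) ∧ ∀ j f, IsDeg c j f → IsDeg c (k + j) (X f)

/-- The supercommutator of homogeneous derivations is a homogeneous derivation. -/
theorem commutator_mem {p q : ZMod 2} {X Y : Module.End K R} (hX : X ∈ derPar c p)
    (hY : Y ∈ derPar c q) : X * Y - (-1 : ℤˣ) ^ (p * q) • (Y * X) ∈ derPar c (p + q) := by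
  obtain ⟨hX1, hX2⟩ := hX
  obtain ⟨hY1, hY2⟩ := hY
  have hu : ∀ (v : ℤˣ) (s : ZMod 2) (f : R), f ∈ par c s → v • f ∈ par c s := by
    intro v s f hf
    rcases Int.units_eq_one_or v with h | h <;> simp [h, hf, Units.smul_def]
  refine ⟨fun r f hf => ?_, fun r f hf g => ?_⟩
  · have h1 := hX1 _ _ (hY1 _ _ hf)
    have h2 := hY1 _ _ (hX1 _ _ hf)
    rw [show p + (q + r) = p + q + r by ring] at h1
    rw [show q + (p + r) = p + q + r by ring] at h2
    simp only [LinearMap.sub_apply, LinearMap.smul_apply, Module.End.mul_apply]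
    exact sub_mem h1 (hu _ _ _ h2)
  · have e1 := hX2 _ _ (hY1 _ _ hf) g
    have e2 := hY2 _ _ (hX1 _ _ hf) g
    have e3 := hX2 _ _ hf (Y g)
    have e4 := hY2 _ _ hf (X g)
    have hlin : ∀ (v : ℤˣ) (D : Module.End K R) (f : R), D (v • f) = v • D f := by
      intro v D f
      rcases Int.units_eq_one_or v with h | h <;> simp [h, Units.smul_def]
    simp only [LinearMap.sub_apply, LinearMap.smul_apply, Module.End.mul_apply, hX2 _ _ hf g,
      hY2 _ _ hf g, map_add, hlin, e1, e2, e3, e4, mul_add, add_mul, uzpow_add,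
      mul_comm q p]
    rcases Int.units_eq_one_or ((-1 : ℤˣ) ^ (p * q)) with h | h <;>
    rcases Int.units_eq_one_or ((-1 : ℤˣ) ^ (p * r)) with h' | h' <;>
    rcases Int.units_eq_one_or ((-1 : ℤˣ) ^ (q * r)) with h'' | h'' <;>
    simp [h, h', h'', Units.smul_def, sub_mul, mul_sub, add_mul, mul_add] <;> abel

/-- A homogeneous vector field, together with its parity. -/
structure HomVF where
  par : ZMod 2
  der : Module.End K R
  mem : der ∈ derPar c par

variable {c}

/-- The underlying vector field. -/
def HomVF.vf (X : HomVF c) : Vect c :=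
  ⟨X.der, Submodule.subset_span (Set.mem_iUnion.2 ⟨X.par, X.mem⟩)⟩

/-- The graded commutator `[X, Y] = X ∘ Y - (-1) ^ (|X| |Y|) Y ∘ X`. -/
def HomVF.lie (X Y : HomVF c) : HomVF c :=
  ⟨X.par + Y.par, X.der * Y.der - (-1 : ℤˣ) ^ (X.par * Y.par) • (Y.der * X.der),
    commutator_mem c X.mem Y.mem⟩

/-- Total parity of a list of homogeneous vector fields. -/
def lpar (l : List (HomVF c)) : ZMod 2 := (l.map HomVF.par).sum

variable (c)

/-- A homological vector field: a derivation of degree `+1` with `Q ∘ Q = 0`. -/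
structure Homological where
  der : Module.End K R
  hasDeg : HasDeg c 1 der
  sq : der * der = 0

/-- An affine connection. -/
structure Connection where
  nabla : Vect c →ₗ[K] Vect c →ₗ[K] Vect c
  /-- `∇` has degree `0`. -/
  parity : ∀ (X Y : HomVF c), (nabla X.vf Y.vf : Module.End K R) ∈ derPar c (X.par + Y.par)
  degree : ∀ (i j : ℤ) (X Y : Vect c), HasDeg c i X.1 → HasDeg c j Y.1 →
    HasDeg c (i + j) (nabla X Y).1
  smul_left : ∀ (f : R) (X Y : Vect c), nabla (f • X) Y = f • nabla X Y
  leibniz : ∀ (q : ZMod 2) (f : R), f ∈ par c q → ∀ (X : HomVF c) (Y : Vect c),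
    nabla X.vf (f • Y) = X.der f • Y + (-1 : ℤˣ) ^ (X.par * q) • (f • nabla X.vf Y)

variable {c}

/-- The homological vector field as a homogeneous vector field of parity `1`. -/
def Homological.hom (Q : Homological c) : HomVF c :=
  ⟨1, Q.der, by simpa using Q.hasDeg.1⟩

namespace Connection

variable (D : Connection c)

/-- `∇_X Y` for homogeneous `X` and `Y`. -/
def ap (X Y : HomVF c) : HomVF c := ⟨X.par + Y.par, (D.nabla X.vf Y.vf).1, D.parity X Y⟩

/-- `∇_X Y - (-1) ^ (|X| |Y|) ∇_Y X = [X, Y]`. -/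
def TorsionFree : Prop := ∀ X Y : HomVF c,
  (D.ap X Y).vf - (-1 : ℤˣ) ^ (X.par * Y.par) • (D.ap Y X).vf = (X.lie Y).vf

/-- The curvature
`R(X, Y) Z = ∇_X ∇_Y Z - (-1) ^ (|X| |Y|) ∇_Y ∇_X Z - ∇_[X, Y] Z`. -/
def curv (X Y Z : HomVF c) : Vect c :=
  (D.ap X (D.ap Y Z)).vf - (-1 : ℤˣ) ^ (X.par * Y.par) • (D.ap Y (D.ap X Z)).vf
    - (D.ap (X.lie Y) Z).vf

/-- The connection is flat. -/
def Flat : Prop := ∀ X Y Z : HomVF c, D.curv X Y Z = 0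

/-- The Atiyah cocycle
`At(X, Y) = [Q, ∇_X Y] - ∇_[Q, X] Y - (-1) ^ |X| ∇_X [Q, Y]`. -/
def atiyah (Q : Homological c) (X Y : HomVF c) : Vect c :=
  (Q.hom.lie (D.ap X Y)).vf - (D.ap (Q.hom.lie X) Y).vf
    - (-1 : ℤˣ) ^ X.par • (D.ap X (Q.hom.lie Y)).vf

end Connection

/-! ### The symmetric coalgebra of vector fields -/

variable (c)

/-- The relations of the graded symmetric `R`-algebra of the `R`-module of vector fields. A letter
`Sum.inl f` stands for the function `f`, a letter `Sum.inr X` for the vector field `X`. -/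
inductive SymRel : FreeAlgebra K (R ⊕ Vect c) → FreeAlgebra K (R ⊕ Vect c) → Prop
  | fn_const (a : K) : SymRel (.ι K (.inl (algebraMap K R a))) (algebraMap K _ a)
  | fn_add (f g : R) : SymRel (.ι K (.inl (f + g))) (.ι K (.inl f) + .ι K (.inl g))
  | fn_mul (f g : R) : SymRel (.ι K (.inl (f * g))) (.ι K (.inl f) * .ι K (.inl g))
  | vf_add (X Y : Vect c) : SymRel (.ι K (.inr (X + Y))) (.ι K (.inr X) + .ι K (.inr Y))
  | vf_smul (f : R) (X : Vect c) : SymRel (.ι K (.inr (f • X))) (.ι K (.inl f) * .ι K (.inr X))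
  | vf_fn (X : HomVF c) (q : ZMod 2) (f : R) (hf : f ∈ par c q) :
      SymRel (.ι K (.inr X.vf) * .ι K (.inl f))
        ((-1 : ℤˣ) ^ (X.par * q) • (.ι K (.inl f) * .ι K (.inr X.vf)))
  | vf_vf (X Y : HomVF c) :
      SymRel (.ι K (.inr X.vf) * .ι K (.inr Y.vf))
        ((-1 : ℤˣ) ^ (X.par * Y.par) • (.ι K (.inr Y.vf) * .ι K (.inr X.vf)))

/-- `Γ(S(T))`: the graded symmetric algebra over `R` of the module of vector fields; its product
is `⊙`. -/
abbrev SymT : Type _ := RingQuot (SymRel c)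

/-- A function as an element of `S⁰`. -/
def sfn (f : R) : SymT c := RingQuot.mkAlgHom K (SymRel c) (.ι K (.inl f))

/-- A vector field as an element of `S¹`. -/
def svf (X : Vect c) : SymT c := RingQuot.mkAlgHom K (SymRel c) (.ι K (.inr X))

variable {c}

/-- `X₁ ⊙ ⋯ ⊙ Xₙ`. -/
def mon (l : List (HomVF c)) : SymT c := (l.map fun X => svf c X.vf).prod

variable (c)

/-- `Γ(Sⁿ(T))`. -/
def symPow (n : ℕ) : Submodule K (SymT c) :=
  Submodule.span K {s | ∃ (f : R) (l : List (HomVF c)), l.length = n ∧ s = sfn c f * mon l}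

variable {c}

/-- The terms of the comultiplication
`Δ(X₁ ⊙ ⋯ ⊙ Xₙ) = ∑ ε (X_σ(1) ⊙ ⋯ ⊙ X_σ(k)) ⊗ (X_σ(k+1) ⊙ ⋯ ⊙ X_σ(n))`,
the sum being over all `k` from `0` to `n` and all `(k, n-k)`-shuffles `σ`. A term is recorded as
the Koszul sign `ε` and the two lists of factors. -/
def coprod : List (HomVF c) → List (ℤˣ × List (HomVF c) × List (HomVF c))
  | [] => [(1, [], [])]
  | X :: l => (coprod l).flatMap fun t =>
      [(t.1, X :: t.2.1, t.2.2), ((-1 : ℤˣ) ^ (X.par * lpar t.2.1) * t.1, t.2.1, X :: t.2.2)]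

/-- `(T̄ ⋆ id)(X₁ ⊙ ⋯ ⊙ Xₙ) = ∑ ε T(𝐗₍₁₎) ⊙ 𝐗₍₂₎`. -/
def conv (T : List (HomVF c) → Vect c) (l : List (HomVF c)) : SymT c :=
  ((coprod l).map fun t => t.1 • (svf c (T t.2.1) * mon t.2.2)).sum

/-- The Koszul sign of moving the factor number `k` of `X₁ ⊙ ⋯ ⊙ Xₙ` to the front. -/
def frontSign (l : List (HomVF c)) (k : Fin l.length) : ℤˣ :=
  (-1 : ℤˣ) ^ ((l.get k).par * lpar (l.take k))

/-- `∇_Y (X₁ ⊙ ⋯ ⊙ Xₙ)`, by the Leibniz rule. -/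
def Connection.onMon (D : Connection c) (Y : HomVF c) : List (HomVF c) → SymT c
  | [] => 0
  | X :: l => svf c (D.ap Y X).vf * mon l
      + (-1 : ℤˣ) ^ (Y.par * X.par) • (svf c X.vf * D.onMon Y l)

/-- The Lie derivative `L_Q (X₁ ⊙ ⋯ ⊙ Xₙ)`, by the Leibniz rule. -/
def Homological.onMon (Q : Homological c) : List (HomVF c) → SymT c
  | [] => 0
  | X :: l => svf c (Q.hom.lie X).vf * mon l
      + (-1 : ℤˣ) ^ X.par • (svf c X.vf * Q.onMon l)

/-! ### Differential operators and the Poincaré–Birkhoff–Witt map -/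

variable (c)

/-- The algebra of differential operators: the algebra of operators on `R` generated by the
multiplications by functions and the vector fields. -/
def DiffOp : Subalgebra K (Module.End K R) :=
  Algebra.adjoin K (Set.range (LinearMap.mulLeft K : R → Module.End K R) ∪ (Vect c : Set _))

/-- A function as a differential operator of order `0`. -/
def opFn (f : R) : DiffOp c :=
  ⟨LinearMap.mulLeft K f, Algebra.subset_adjoin (Or.inl ⟨f, rfl⟩)⟩

/-- A vector field as a differential operator. -/
def opVF (X : Vect c) : DiffOp c := ⟨X.1, Algebra.subset_adjoin (Or.inr X.2)⟩

variable {c}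

/-- `P` satisfies the inductive formula that defines the map `pbw^∇`:
`pbw(X₁ ⊙ ⋯ ⊙ Xₙ) = (1/n) ∑ₖ εₖ (Xₖ pbw(𝐗^{k}) - pbw(∇_{Xₖ} 𝐗^{k}))`, where `𝐗^{k}` is
`X₁ ⊙ ⋯ ⊙ Xₙ` without the factor `Xₖ`. -/
structure Connection.IsPBW (D : Connection c) (P : SymT c → DiffOp c) : Prop where
  fn : ∀ f : R, P (sfn c f) = opFn c f
  vf : ∀ X : Vect c, P (svf c X) = opVF c X
  mon : ∀ l : List (HomVF c), 2 ≤ l.length →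
    P (mon l) = (1 / (l.length : K)) • ∑ k : Fin l.length, frontSign l k •
      (opVF c (l.get k).vf * P (DGMfd.mon (l.eraseIdx k))
        - P (D.onMon (l.get k) (l.eraseIdx k)))

/-- The differential `δ^∇ = pbw⁻¹ ∘ ⟦Q, -⟧ ∘ pbw`, evaluated on `X₁ ⊙ ⋯ ⊙ Xₙ`. -/
def delta (Q : Homological c) (P : SymT c ≃ₗ[K] DiffOp c) (l : List (HomVF c)) : SymT c :=
  P.symm (opVF c Q.hom.vf * P (mon l) - (-1 : ℤˣ) ^ lpar l • (P (mon l) * opVF c Q.hom.vf))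

/-- The bundle map `B^∇(Y; X₁ ⊙ ⋯ ⊙ Xₙ) = pbw⁻¹(Y · pbw(X₁ ⊙ ⋯ ⊙ Xₙ)) - ∇_Y (X₁ ⊙ ⋯ ⊙ Xₙ)`. -/
def Connection.bmap (D : Connection c) (P : SymT c ≃ₗ[K] DiffOp c) (Y : HomVF c)
    (l : List (HomVF c)) : SymT c :=
  P.symm (opVF c Y.vf * P (mon l)) - D.onMon Y l

/-! ### Sections of `Sⁿ(T^∨) ⊗ T` and the Kapranov brackets -/

variable (c)

/-- A section of degree `+1` of `Sⁿ(T^∨) ⊗ T`, i.e. an `R`-linear map of degree `+1` from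
`Γ(Sⁿ(T))` to vector fields, extended by zero to the other symmetric powers. -/
structure SymSection (n : ℕ) where
  map : SymT c →ₗ[K] Vect c
  supp : ∀ m, m ≠ n → ∀ s ∈ symPow c m, map s = 0
  smul : ∀ (q : ZMod 2) (f : R), f ∈ par c q → ∀ s, map (sfn c f * s) = (-1 : ℤˣ) ^ q • f • map s
  parity : ∀ l : List (HomVF c), (map (mon l)).1 ∈ derPar c (1 + lpar l)
  degree : ∀ (l : List (HomVF c)) (d : List ℤ),
    List.Forall₂ (fun (X : HomVF c) k => HasDeg c k X.der) l d →
      HasDeg c (1 + d.sum) (map (mon l)).1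

variable {c}

namespace SymSection

variable {n : ℕ} (T : SymSection c n)

/-- `T(X₁ ⊙ ⋯ ⊙ Xₘ)`, which is `0` if `m ≠ n`. -/
def ap (l : List (HomVF c)) : Vect c := T.map (mon l)

/-- `T(X₁ ⊙ ⋯ ⊙ Xₘ)` as a homogeneous vector field. -/
def hom (l : List (HomVF c)) : HomVF c := ⟨1 + lpar l, (T.map (mon l)).1, T.parity l⟩

/-- The symmetrized covariant derivative
`∑ₖ εₖ ((-1) ^ |Xₖ| ∇_{Xₖ} (T(𝐗^{k})) - T(∇_{Xₖ} 𝐗^{k}))`, where `𝐗^{k}` is `X₁ ⊙ ⋯ ⊙ Xₙ` without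
the factor `Xₖ`. -/
def symCov (D : Connection c) (l : List (HomVF c)) : Vect c :=
  ∑ k : Fin l.length, frontSign l k •
    ((-1 : ℤˣ) ^ (l.get k).par • D.nabla (l.get k).vf (T.ap (l.eraseIdx k))
      - T.map (D.onMon (l.get k) (l.eraseIdx k)))

/-- `B^∇ ∘ (T̄ ⊗ id) ∘ Δ` on `X₁ ⊙ ⋯ ⊙ Xₙ`, i.e. `∑ ε B^∇(T(𝐗₍₁₎); 𝐗₍₂₎)`. -/
def bconv (D : Connection c) (P : SymT c ≃ₗ[K] DiffOp c) (l : List (HomVF c)) : SymT c :=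
  ((coprod l).map fun t => t.1 • D.bmap P (T.hom t.2.1) t.2.2).sum

end SymSection

/-- The family `(Rₙ)` consists of the Taylor coefficients of the coderivation `δ^∇ - L_Q`:
`δ^∇ - L_Q = ∑ₖ R̄ₖ ⋆ id`. (On `X₁ ⊙ ⋯ ⊙ Xₙ` the terms with `k > n` vanish.) Its members with
`n ≥ 2` are the higher brackets of the Kapranov `L_∞[1]` algebra. -/
def IsKapranov (Q : Homological c) (P : SymT c ≃ₗ[K] DiffOp c)
    (T : (n : ℕ) → SymSection c n) : Prop :=
  ∀ l : List (HomVF c),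
    delta Q P l - Q.onMon l = ∑ k ∈ Finset.range (l.length + 1), conv (T k).ap l

/-! ### Universal tensor expressions in the Atiyah cocycle and the curvature -/

/-- A tensor of type `(1, n)` and parity `p`, given by its values on homogeneous vector fields. -/
structure Tens (c : ℤ → R →ₗ[K] R) (n : ℕ) (p : ZMod 2) where
  val : (Fin n → HomVF c) → Vect c
  mem : ∀ X, (val X).1 ∈ derPar c (p + ∑ i, (X i).par)

/-- The value of a tensor as a homogeneous vector field. -/
def Tens.hom {n : ℕ} {p : ZMod 2} (T : Tens c n p) (X : Fin n → HomVF c) : HomVF c :=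
  ⟨p + ∑ i, (X i).par, (T.val X).1, T.mem X⟩

/-- Koszul sign of `X₁, …, Xₙ ↦ X_σ(1), …, X_σ(n)`. -/
def koszul {n : ℕ} (σ : Equiv.Perm (Fin n)) (X : Fin n → HomVF c) : ℤˣ :=
  ∏ i, ∏ j, if i < j ∧ σ j < σ i then (-1 : ℤˣ) ^ ((X (σ i)).par * (X (σ j)).par) else 1


theorem sign_smul_mem {p : ZMod 2} {X : Module.End K R} (v : ℤˣ) (hX : X ∈ derPar c p) :
    v • X ∈ derPar c p := by
  rcases Int.units_eq_one_or v with h | h <;> simp [h, hX, Units.smul_def]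

namespace Tens

/-- The Atiyah cocycle as a tensor. -/
def atiyah (D : Connection c) (Q : Homological c) : Tens c 2 1 where
  val X := D.atiyah Q (X 0) (X 1)
  mem X := by
    have h1 := (Q.hom.lie (D.ap (X 0) (X 1))).mem
    have h2 := (D.ap (Q.hom.lie (X 0)) (X 1)).mem
    have h3 := (D.ap (X 0) (Q.hom.lie (X 1))).mem
    have e : ∀ a b : ZMod 2, a + (1 + b) = 1 + (a + b) := fun a b => by ring
    have e' : ∀ a b : ZMod 2, 1 + a + b = 1 + (a + b) := fun a b => by ring
    simp only [HomVF.lie, Connection.ap, Homological.hom, e, e'] at h1 h2 h3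
    rw [Fin.sum_univ_two]
    exact sub_mem (sub_mem h1 h2) (sign_smul_mem _ h3)

/-- The curvature as a tensor. -/
def curv (D : Connection c) : Tens c 3 0 where
  val X := D.curv (X 0) (X 1) (X 2)
  mem X := by
    have h1 := (D.ap (X 0) (D.ap (X 1) (X 2))).mem
    have h2 := (D.ap (X 1) (D.ap (X 0) (X 2))).mem
    have h3 := (D.ap ((X 0).lie (X 1)) (X 2)).mem
    have e : ∀ a b d : ZMod 2, b + (a + d) = a + b + d := fun a b d => by ring
    simp only [HomVF.lie, Connection.ap] at h1 h2 h3
    rw [← add_assoc] at h1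
    rw [e] at h2
    rw [Fin.sum_univ_three, zero_add]
    exact sub_mem (sub_mem h1 (sign_smul_mem _ h2)) h3

/-- The covariant derivative
`(∇T)(X₀, …, Xₙ) = (-1) ^ (|T| |X₀|) ∇_{X₀} (T(X₁, …, Xₙ)) - ∑ⱼ ε T(X₁, …, ∇_{X₀} Xⱼ, …, Xₙ)`. -/
def cov (D : Connection c) {n : ℕ} {p : ZMod 2} (T : Tens c n p) : Tens c (n + 1) p where
  val X := (-1 : ℤˣ) ^ (p * (X 0).par) • (D.ap (X 0) (T.hom (Fin.tail X))).vf
    - ∑ j : Fin n, (-1 : ℤˣ) ^ ((X 0).par * ∑ i ∈ Finset.Iio j, (Fin.tail X i).par) •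
        T.val (Function.update (Fin.tail X) j (D.ap (X 0) (Fin.tail X j)))
  mem X := by
    have h1 := (D.ap (X 0) (T.hom (Fin.tail X))).mem
    have h2 : ∀ j : Fin n,
        (T.val (Function.update (Fin.tail X) j (D.ap (X 0) (Fin.tail X j)))).1
          ∈ derPar c (p + ∑ i, (X i).par) := by
      intro j
      have h := T.mem (Function.update (Fin.tail X) j (D.ap (X 0) (Fin.tail X j)))
      have e : ∑ i, (Function.update (Fin.tail X) j (D.ap (X 0) (Fin.tail X j)) i).par
          = ∑ i, (X i).par := by
        rw [Fin.sum_univ_succ, ← Finset.add_sum_erase _ _ (Finset.mem_univ j),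
          ← Finset.add_sum_erase _ (fun i : Fin n => (X i.succ).par) (Finset.mem_univ j),
          Function.update_self]
        simp only [Connection.ap, Fin.tail, add_assoc]
        congr 2
        refine Finset.sum_congr rfl fun i hi => ?_
        rw [Function.update_of_ne (Finset.ne_of_mem_erase hi)]
        rfl
      rwa [e] at h
    have e : (D.ap (X 0) (T.hom (Fin.tail X))).par = p + ∑ i, (X i).par := by
      rw [Fin.sum_univ_succ]
      simp only [Connection.ap, Tens.hom, Fin.tail]
      ring
    rw [e] at h1
    simp only [AddSubgroupClass.coe_sub, AddSubmonoidClass.coe_finsetSum]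
    exact sub_mem (sign_smul_mem _ h1) (sum_mem fun j _ => sign_smul_mem _ (h2 j))

/-- `T(S(X₁, …, Xₘ), Xₘ₊₁, …, Xₘ₊ₙ)`. -/
def comp {n m : ℕ} {p q : ZMod 2} (T : Tens c (n + 1) p) (S : Tens c m q) :
    Tens c (m + n) (p + q) where
  val X := T.val (Fin.cons (S.hom fun i => X (Fin.castAdd n i)) fun j => X (Fin.natAdd m j))
  mem X := by
    have h := T.mem (Fin.cons (S.hom fun i => X (Fin.castAdd n i)) fun j => X (Fin.natAdd m j))
    rw [Fin.sum_univ_succ] at h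
    simp only [Fin.cons_zero, Fin.cons_succ] at h
    rw [Fin.sum_univ_add, add_assoc, ← add_assoc q]
    exact h

/-- Permutation of the arguments, with Koszul sign. -/
def perm {n : ℕ} {p : ZMod 2} (σ : Equiv.Perm (Fin n)) (T : Tens c n p) : Tens c n p where
  val X := koszul σ X • T.val (X ∘ σ)
  mem X := by
    have h := T.mem (X ∘ σ)
    simp only [Function.comp_apply] at h
    rw [Equiv.sum_comp σ fun i => (X i).par] at h
    exact sign_smul_mem _ h

/-- Sum. -/
def add {n : ℕ} {p : ZMod 2} (S T : Tens c n p) : Tens c n p :=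
  ⟨fun X => S.val X + T.val X, fun X => add_mem (S.mem X) (T.mem X)⟩

/-- Multiplication by a rational number. -/
def smul {n : ℕ} {p : ZMod 2} (r : ℚ) (T : Tens c n p) : Tens c n p :=
  ⟨fun X => (r : K) • T.val X, fun X => Submodule.smul_mem _ (r : K) (T.mem X)⟩

end Tens

/-- The tensor that is described by an expression. -/
def TExpr.eval (D : Connection c) (Q : Homological c) {n : ℕ} {p : ZMod 2} :
    TExpr n p → Tens c n p
  | .atiyah => Tens.atiyah D Q
  | .curv => Tens.curv D
  | .cov T => (T.eval D Q).cov D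
  | .comp T S => (T.eval D Q).comp (S.eval D Q)
  | .perm σ T => (T.eval D Q).perm σ
  | .add S T => (S.eval D Q).add (T.eval D Q)
  | .smul r T => (T.eval D Q).smul r

end Calculus

/-! ## Graded manifolds -/

section Manifold

/-- The algebra of smooth `K`-valued functions on an open subset of a manifold. -/
def smoothFn (K : Type) [RCLike K] {m : ℕ} {M : Type u} [TopologicalSpace M]
    [ChartedSpace (EuclideanSpace ℝ (Fin m)) M] (U : Opens M) : Subalgebra K (U → K) where
  carrier := {f | ContMDiff (𝓡 m) 𝓘(ℝ, K) ∞ f}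
  mul_mem' := fun hf hg =>
    (contDiff_mul (𝕜 := ℝ) (𝔸 := K) (n := ∞)).contMDiff.comp (hf.prodMk_space hg)
  add_mem' := fun hf hg => hf.add hg
  algebraMap_mem' := fun _ => contMDiff_const

/-- Sign in `ξᵃ ξᵇ = ± ξᵃ⁺ᵇ`, where `ξᵃ = ξ₁^a₁ ⋯ ξᵣ^aᵣ` and `ξᵢ` has degree `dᵢ`. -/
def idxSign {r : ℕ} (d : Fin r → ℤ) (a b : Fin r →₀ ℕ) : ℤˣ :=
  (-1 : ℤˣ) ^ (∑ i, ∑ j ∈ Finset.Iio i, (a i : ℤ) * b j * d i * d j)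

/-- A multi-index is admissible if odd coordinates appear at most once. -/
def Admissible {r : ℕ} (d : Fin r → ℤ) (a : Fin r →₀ ℕ) : Prop := ∀ i, Odd (d i) → a i ≤ 1

variable (K : Type) [RCLike K] {m : ℕ} {M : Type u} [TopologicalSpace M]
  [ChartedSpace (EuclideanSpace ℝ (Fin m)) M]

/-- A sheaf of graded algebras over the sheaf of smooth `K`-valued functions of the manifold `M`.
The sections are allowed to have infinitely many non-zero homogeneous components. -/
structure GradedSheaf (m : ℕ) (M : Type u) [TopologicalSpace M]
    [ChartedSpace (EuclideanSpace ℝ (Fin m)) M] where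
  sheaf : TopCat.Sheaf (AlgCat.{u} K) (TopCat.of M)
  /-- The component of degree `k` of a section. -/
  comp : ∀ U : Opens M, ℤ → sheaf.1.obj (.op U) →ₗ[K] sheaf.1.obj (.op U)
  comp_res : ∀ (U V : Opens M) (h : V ≤ U) (k : ℤ) (f : sheaf.1.obj (.op U)),
    comp V k ((sheaf.1.map (homOfLE h).op).hom f) = (sheaf.1.map (homOfLE h).op).hom (comp U k f)
  /-- The structure of algebra over the smooth functions. -/
  ofFn : ∀ U : Opens M, smoothFn K (m := m) U →ₐ[K] sheaf.1.obj (.op U)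
  ofFn_res : ∀ (U V : Opens M) (h : V ≤ U) (f : smoothFn K (m := m) U)
    (g : smoothFn K (m := m) V), (∀ x : V, g.1 x = f.1 ⟨x.1, h x.2⟩) →
      (sheaf.1.map (homOfLE h).op).hom (ofFn U f) = ofFn V g

variable {K}

/-- An isomorphism, over the open set `U`, of a sheaf of graded algebras with the sheaf of formal
power series `f = ∑ₐ fₐ ξᵃ` with smooth coefficients in graded commuting variables `ξ₁, …, ξᵣ` of
degrees `d₁, …, dᵣ`; it is given by the coefficients `fₐ` of a section `f`. -/
structure LocalCoord (S : GradedSheaf K m M) {r : ℕ} (d : Fin r → ℤ) (U : Opens M) where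
  coeff : ∀ V : Opens M, V ≤ U → (Fin r →₀ ℕ) → S.sheaf.1.obj (.op V) →ₗ[K] smoothFn K (m := m) V
  coeff_res : ∀ (V W : Opens M) (hV : V ≤ U) (hW : W ≤ V) (a : Fin r →₀ ℕ)
    (f : S.sheaf.1.obj (.op V)) (x : W),
      (coeff W (hW.trans hV) a ((S.sheaf.1.map (homOfLE hW).op).hom f)).1 x
        = (coeff V hV a f).1 ⟨x.1, hW x.2⟩
  coeff_eq_zero : ∀ (V : Opens M) (hV : V ≤ U) (a : Fin r →₀ ℕ), ¬ Admissible d a →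
    ∀ f, coeff V hV a f = 0
  exists_unique : ∀ (V : Opens M) (hV : V ≤ U) (F : (Fin r →₀ ℕ) → smoothFn K (m := m) V),
    (∀ a, ¬ Admissible d a → F a = 0) → ∃! f, ∀ a, coeff V hV a f = F a
  coeff_mul : ∀ (V : Opens M) (hV : V ≤ U) (a : Fin r →₀ ℕ), Admissible d a →
    ∀ f g, coeff V hV a (f * g) = ∑ t ∈ Finset.HasAntidiagonal.antidiagonal a,
      idxSign d t.1 t.2 • (coeff V hV t.1 f * coeff V hV t.2 g)
  coeff_ofFn : ∀ (V : Opens M) (hV : V ≤ U) (a : Fin r →₀ ℕ) (f : smoothFn K (m := m) V),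
    coeff V hV a (S.ofFn V f) = if a = 0 then f else 0
  coeff_comp : ∀ (V : Opens M) (hV : V ≤ U) (a : Fin r →₀ ℕ) (k : ℤ) (f : S.sheaf.1.obj (.op V)),
    coeff V hV a (S.comp V k f) = if ∑ i, (a i : ℤ) * d i = k then coeff V hV a f else 0

variable (K)

/-- A finite-dimensional graded manifold with support `M`: locally the functions are the formal
power series in finitely many graded coordinates, of the same degrees everywhere. In particular
they form graded commutative algebras. -/
structure GradedManifold (m : ℕ) (M : Type u) [TopologicalSpace M]
    [ChartedSpace (EuclideanSpace ℝ (Fin m)) M] extends GradedSheaf K m M where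
  rank : ℕ
  deg : Fin rank → ℤ
  locally_free : ∀ x : M, ∃ U : Opens M, x ∈ U ∧ Nonempty (LocalCoord toGradedSheaf deg U)

variable {K}

/-- The algebra of functions `C^∞(𝓜)`, the global sections. -/
abbrev GradedManifold.Fn (G : GradedManifold K m M) : Type u := G.sheaf.1.obj (.op ⊤)

/-- The homogeneous components of the functions on a graded manifold. -/
abbrev GradedManifold.gr (G : GradedManifold K m M) : ℤ → G.Fn →ₗ[K] G.Fn := G.comp ⊤

end Manifold

end DGMfd

end

open DGMfd

/-! The theorem is algebraic once two facts about the algebra `R` of functions are known: `R` is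
graded commutative and splits into even and odd parts, and vector fields have a finite dual basis, X
= ∑ ± X(gᵢ) Yᵢ. This package is `Frame`. `kapranov_of_frame` deduces everything from it over a field
of characteristic zero, and `exists_frame` supplies it for a graded manifold.

The PBW map. Let ιᵢ be the contraction with dgᵢ. The Euler operator E = ∑ Yᵢ ⊙ ιᵢ multiplies Sⁿ by
n, so the recursion for pbw becomes pbw(E s) = ∑ (Yᵢ pbw(ιᵢ s) - pbw(∇_{Yᵢ} ιᵢ s)) (`pbw_euler`).
Right multiplication by a function g corresponds under pbw to an explicit operator ρ_g (`pbw_rho`)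
that differs from multiplication by g by terms of lower symmetric degree; for g = gᵢ the leading
correction is ιᵢ. An element killed by pbw therefore has vanishing leading term, which gives
injectivity. Surjectivity holds because Y pbw(s) and pbw(Y ⊙ s) agree up to lower order
(`der_mul_pbw`).

Coderivations. The comultiplication is replaced by a supercentralizer, that of the multiplications
by functions and the contractions. An operator whose supercommutators preserve this centralizer,
with the right parity and vanishing counit on monomials, is the convolution of its degree-one part
with the identity (`IsCod.eq_conv`). The same centralizer is cut out by functions and the ρ_g
(`cent_gensRho`). Write λ_X for left composition with X and δ_X for the commutator with X, both
transported by pbw. Then [λ_X, ρ_g] = 0 and [δ_X, ρ_g] = ρ_{Xg}, so both operators preserve the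
centralizer. Hence δ - L_Q and B(Y; -) = λ_Y - ∇_Y are `R`-linear coderivations.

The recursion. Transported back through pbw, the PBW recursion says E = ∑ (λ_{Yᵢ} - ∇_{Yᵢ}) ιᵢ = ∑
B(Yᵢ; ιᵢ -) (`euler_eq`). Commuting Φ = δ - L_Q with this expression (`euler_comm`, `phi_master`)
uses [δ, λ_X] = λ_{[Q,X]} and gives on Sⁿ (n - E) Φ = (Atiyah term) - ∑ [Φ, ∇_{Xₖ}] - ∑ B(R(𝐗₍₁₎);
𝐗₍₂₎). Since R̄ₖ ⋆ id maps Sⁿ to Sⁿ⁻ᵏ⁺¹, the left side contributes (k - 1) R̄ₖ ⋆ id; the Atiyah term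
is 2 R̄₂ ⋆ id by symmetry of the cocycle; the commutators with ∇ give the symmetrized covariant
derivatives; and the k = n term of the last sum is Rₙ itself. Solving for n Rₙ is formula (i)
(`bracket_formula`). The same computation with λ_Y and ∇_Y in place of δ and L_Q (`bop_master`) is a
recursion for B that starts with the curvature (`bl_three`). Both recursions use only covariant
derivatives, compositions, permutations and rational numbers, so induction yields universal
expressions (`univ_bl`, `univ_brk`), and these also show that the brackets have degree +1. If the
curvature vanishes, so do all higher coefficients of B, and (ii) remains.

The dual basis. A second countable manifold is covered by finitely many `Patch`es, each a disjoint
union of coordinate domains (`exists_coloured_cover`). On each of them global functions are built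
that are coordinates near the support of a cutoff ρ, together with the cut-off partial derivatives.
By Hadamard's lemma a derivation that kills the coordinates vanishes there, so ρ X = ∑ X(gᵢ) Yᵢ, and
a partition of unity adds up these identities. -/

noncomputable section

namespace DGMfd

/-! ### Koszul signs as scalars -/

section Signs

variable (K : Type*) [Field K]

/-- A sign as a scalar. -/
def usgn (v : ℤˣ) : K := ((v : ℤ) : K)

/-- The sign `(-1) ^ p` as a scalar. -/
def sgn (p : ZMod 2) : K := usgn K ((-1 : ℤˣ) ^ p)

variable {K}

theorem units_smul {M : Type*} [AddCommGroup M] [Module K M] (v : ℤˣ) (x : M) :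
    v • x = usgn K v • x := by
  rcases Int.units_eq_one_or v with h | h <;> simp [h, usgn, Units.smul_def]

theorem sgn_smul {M : Type*} [AddCommGroup M] [Module K M] (p : ZMod 2) (x : M) :
    (-1 : ℤˣ) ^ p • x = sgn K p • x := units_smul _ x

theorem usgn_mul (v w : ℤˣ) : usgn K (v * w) = usgn K v * usgn K w := by simp [usgn]

theorem usgn_mul_self (v : ℤˣ) : usgn K v * usgn K v = 1 := by
  rw [← usgn_mul, Int.units_mul_self]; simp [usgn]

theorem usgn_sgn (p : ZMod 2) : usgn K ((-1 : ℤˣ) ^ p) = sgn K p := rfl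

theorem sgn_add (p q : ZMod 2) : sgn K (p + q) = sgn K p * sgn K q := by
  simp [sgn, usgn, uzpow_add]

@[simp] theorem usgn_one : usgn K 1 = 1 := by simp [usgn]

@[simp] theorem sgn_zero : sgn K 0 = 1 := by simp [sgn, usgn]

@[simp] theorem sgn_one : sgn K 1 = -1 := by simp [sgn, usgn]

@[simp] theorem sgn_mul_self (p : ZMod 2) : sgn K p * sgn K p = 1 := usgn_mul_self _

theorem sgn_ne_zero (p : ZMod 2) : sgn K p ≠ 0 := fun h => by
  simpa [h] using sgn_mul_self (K := K) p

theorem sgn_cases (p : ZMod 2) : sgn K p = 1 ∨ sgn K p = -1 := by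
  unfold sgn usgn
  rcases Int.units_eq_one_or ((-1 : ℤˣ) ^ p) with h | h <;> simp [h]

theorem zmod_two_cases (p : ZMod 2) : p = 0 ∨ p = 1 := by revert p; decide

theorem sgn_smul_sgn_smul {M : Type*} [AddCommMonoid M] [Module K M] (p : ZMod 2) (x : M) :
    sgn K p • sgn K p • x = x := by rw [smul_smul, sgn_mul_self, one_smul]

theorem zmod_add_self (p : ZMod 2) : p + p = 0 := CharTwo.add_self_eq_zero p

end Signs

/-! ### Graded commutative algebras with a finite dual basis of vector fields -/

section Frame

variable {K R : Type*} [Field K] [Ring R] [Algebra K R]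

/-- A graded commutative algebra of functions with a finite dual basis `(dgᵢ, Yᵢ)` for the vector
fields. -/
structure Frame (c : ℤ → R →ₗ[K] R) where
  comm : ∀ (p q : ZMod 2) (f g : R), f ∈ par c p → g ∈ par c q → f * g = sgn K (p * q) • (g * f)
  mul_mem : ∀ (p q : ZMod 2) (f g : R), f ∈ par c p → g ∈ par c q → f * g ∈ par c (p + q)
  one_mem : (1 : R) ∈ par c 0
  compl : IsCompl (par c 0) (par c 1)
  N : ℕ
  g : Fin N → R
  Y : Fin N → HomVF c
  g_mem : ∀ i, g i ∈ par c (Y i).par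
  spec : ∀ X : Vect c, X = ∑ i, sgn K (Y i).par • (X.1 (g i) • (Y i).vf)

variable {c : ℤ → R →ₗ[K] R}

@[simp] theorem HomVF.vf_coe (X : HomVF c) : (X.vf : Module.End K R) = X.der := rfl

/-- Assumes only graded commutativity and multiplicativity of parity, because it is also needed
while the dual basis of a graded manifold is still under construction. -/
theorem smul_mem_derPar_of_comm
    (comm : ∀ (p q : ZMod 2) (f g : R), f ∈ par c p → g ∈ par c q → f * g = sgn K (p * q) • (g * f))
    (mul_mem : ∀ (p q : ZMod 2) (f g : R), f ∈ par c p → g ∈ par c q → f * g ∈ par c (p + q))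
    {p q : ZMod 2} {f : R} {X : Module.End K R} (hf : f ∈ par c p) (hX : X ∈ derPar c q) :
    f • X ∈ derPar c (p + q) := by
  refine ⟨fun r h hh => ?_, fun r h hh h' => ?_⟩
  · rw [add_assoc]
    exact mul_mem _ _ _ _ hf (hX.1 r h hh)
  · simp only [LinearMap.smul_apply, smul_eq_mul, hX.2 r h hh h', sgn_smul (K := K), mul_add,
      mul_assoc, mul_smul_comm]
    rw [← mul_assoc f h, comm _ _ _ _ hf hh, smul_mul_assoc, smul_smul, ← sgn_add, mul_assoc]
    congr 3
    ring

namespace Frame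

theorem exists_split (F : Frame c) (f : R) : ∃ f0 ∈ par c 0, ∃ f1 ∈ par c 1, f = f0 + f1 := by
  have : f ∈ par c 0 ⊔ par c 1 := by rw [F.compl.sup_eq_top]; trivial
  obtain ⟨a, ha, b, hb, h⟩ := Submodule.mem_sup.1 this
  exact ⟨a, ha, b, hb, h.symm⟩

/-- To prove an additive statement about functions one may assume they are homogeneous. -/
theorem fn_induction (F : Frame c) {C : R → Prop} (hadd : ∀ f g, C f → C g → C (f + g))
    (hhom : ∀ q, ∀ f ∈ par c q, C f) (f : R) : C f := by
  obtain ⟨a, ha, b, hb, rfl⟩ := F.exists_split f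
  exact hadd _ _ (hhom _ _ ha) (hhom _ _ hb)

variable (F : Frame c)

/-- The parity involution of the functions, as a linear map. -/
def tauLin : R →ₗ[K] R := (2 : K) • (par c 0).projection (par c 1) F.compl - LinearMap.id

theorem tauLin_apply {q : ZMod 2} {f : R} (hf : f ∈ par c q) : F.tauLin f = sgn K q • f := by
  rcases zmod_two_cases q with rfl | rfl
  · simp [tauLin, Submodule.projection_apply_of_mem_left F.compl hf, two_smul]
  · simp [tauLin, (Submodule.projection_apply_eq_zero_iff F.compl).2 hf]

/-- The parity involution of the functions. -/
def tauR : R →ₐ[K] R := AlgHom.ofLinearMap F.tauLin (by simp [F.tauLin_apply F.one_mem]) (by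
  intro f g
  induction f using F.fn_induction with
  | hadd f f' h h' => simp only [add_mul, map_add, h, h']
  | hhom p f hf =>
    induction g using F.fn_induction with
    | hadd f f' h h' => simp only [mul_add, map_add, h, h']
    | hhom q g hg =>
      rw [F.tauLin_apply (F.mul_mem _ _ _ _ hf hg), F.tauLin_apply hf, F.tauLin_apply hg, sgn_add]
      simp [smul_smul, mul_comm])

theorem tauR_apply {q : ZMod 2} {f : R} (hf : f ∈ par c q) : F.tauR f = sgn K q • f :=
  F.tauLin_apply hf

@[simp] theorem tauR_tauR (f : R) : F.tauR (F.tauR f) = f := by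
  induction f using F.fn_induction with
  | hadd f g hf hg => simp only [map_add, hf, hg]
  | hhom q f hf => rw [F.tauR_apply hf, map_smul, F.tauR_apply hf, sgn_smul_sgn_smul]

/-- As 2 is invertible, the homogeneous parts are exactly the eigenspaces of the parity involution.
Parity thus becomes a linear equation that can be carried through operators. -/
theorem mem_par_of_tauR [CharZero K] {q : ZMod 2} {f : R} (h : F.tauR f = sgn K q • f) :
    f ∈ par c q := by
  obtain ⟨a, ha, b, hb, rfl⟩ := F.exists_split f
  rw [map_add, F.tauR_apply ha, F.tauR_apply hb] at h
  rcases zmod_two_cases q with rfl | rfl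
  · have : (2 : K) • b = 0 := by
      simp only [sgn_zero, sgn_one] at h
      linear_combination (norm := module) (-1 : K) • h
    have hb0 : b = 0 := (smul_eq_zero.1 this).resolve_left two_ne_zero
    simpa [hb0] using ha
  · have : (2 : K) • a = 0 := by
      simp only [sgn_zero, sgn_one] at h
      linear_combination (norm := module) (1 : K) • h
    have hb0 : a = 0 := (smul_eq_zero.1 this).resolve_left two_ne_zero
    simpa [hb0] using hb

theorem smul_mem_derPar (F : Frame c) {p q : ZMod 2} {f : R} {X : Module.End K R} (hf : f ∈ par c p)
    (hX : X ∈ derPar c q) : f • X ∈ derPar c (p + q) :=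
  smul_mem_derPar_of_comm F.comm F.mul_mem hf hX

/-- A homogeneous multiple of a homogeneous vector field. -/
def fsmul {p : ZMod 2} {f : R} (hf : f ∈ par c p) (X : HomVF c) : HomVF c :=
  ⟨p + X.par, f • X.der, F.smul_mem_derPar hf X.mem⟩

theorem fsmul_vf {p : ZMod 2} {f : R} (hf : f ∈ par c p) (X : HomVF c) :
    (F.fsmul hf X).vf = f • X.vf := rfl

theorem vect_split (F : Frame c) (X : Vect c) : ∃ X0 X1 : HomVF c, X0.par = 0 ∧ X1.par = 1 ∧
    X = X0.vf + X1.vf := by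
  suffices h : ∀ D ∈ Vect c, ∃ D0 ∈ derPar c 0, ∃ D1 ∈ derPar c 1, D = D0 + D1 by
    obtain ⟨D0, h0, D1, h1, e⟩ := h X.1 X.2
    exact ⟨⟨0, D0, h0⟩, ⟨1, D1, h1⟩, rfl, rfl, Subtype.ext e⟩
  intro D hD
  induction hD using Submodule.span_induction with
  | mem D hD =>
    obtain ⟨p, hp⟩ := Set.mem_iUnion.1 hD
    rcases zmod_two_cases p with rfl | rfl
    · exact ⟨D, hp, 0, zero_mem _, by simp⟩
    · exact ⟨0, zero_mem _, D, hp, by simp⟩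
  | zero => exact ⟨0, zero_mem _, 0, zero_mem _, by simp⟩
  | add D D' h h' ih ih' =>
    obtain ⟨X0, m0, X1, m1, rfl⟩ := ih
    obtain ⟨X0', m0', X1', m1', rfl⟩ := ih'
    exact ⟨X0 + X0', add_mem m0 m0', X1 + X1', add_mem m1 m1', by abel⟩
  | smul f D h ih =>
    obtain ⟨X0, m0, X1, m1, rfl⟩ := ih
    obtain ⟨a, ha, b, hb, rfl⟩ := F.exists_split f
    refine ⟨a • X0 + b • X1, add_mem ?_ ?_, a • X1 + b • X0, add_mem ?_ ?_, ?_⟩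
    · simpa only [zero_add] using F.smul_mem_derPar ha m0
    · simpa only [zmod_add_self] using F.smul_mem_derPar hb m1
    · simpa only [zero_add] using F.smul_mem_derPar ha m1
    · simpa only [add_zero] using F.smul_mem_derPar hb m0
    · simp only [add_smul, smul_add]; abel

/-- To prove an additive statement about vector fields one may assume they are homogeneous. -/
theorem vf_induction (F : Frame c) {C : Vect c → Prop} (hadd : ∀ f g, C f → C g → C (f + g))
    (hhom : ∀ X : HomVF c, C X.vf) (X : Vect c) : C X := by
  obtain ⟨a, b, -, -, rfl⟩ := F.vect_split X
  exact hadd _ _ (hhom _) (hhom _)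

/-- Conjugation by the parity involution. -/
def conjR : Module.End K R →ₗ[K] Module.End K R :=
  LinearMap.mulLeft K F.tauR.toLinearMap ∘ₗ LinearMap.mulRight K F.tauR.toLinearMap

theorem conjR_apply (X : Module.End K R) (f : R) : F.conjR X f = F.tauR (X (F.tauR f)) := rfl

theorem conjR_of_mem {p : ZMod 2} {X : Module.End K R} (hX : X ∈ derPar c p) :
    F.conjR X = sgn K p • X := by
  ext f
  rw [conjR_apply]
  induction f using F.fn_induction with
  | hadd f g hf hg => simp only [map_add, hf, hg]
  | hhom q f hf =>
    rw [F.tauR_apply hf, map_smul, map_smul, F.tauR_apply (hX.1 q f hf), sgn_add, smul_smul,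
      mul_left_comm, sgn_mul_self, mul_one]
    rfl

theorem conjR_mul (X X' : Module.End K R) : F.conjR (X * X') = F.conjR X * F.conjR X' := by
  ext f; simp [conjR_apply]

theorem conjR_mem (X : Vect c) : F.conjR X.1 ∈ Vect c := by
  induction X using F.vf_induction with
  | hadd f g hf hg => rw [Submodule.coe_add, map_add]; exact add_mem hf hg
  | hhom X =>
    rw [HomVF.vf_coe, F.conjR_of_mem X.mem]
    exact (sgn K X.par • X.vf).2

/-- The parity involution of the vector fields. -/
def tauV : Vect c →ₗ[K] Vect c where
  toFun X := ⟨F.conjR X.1, F.conjR_mem X⟩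
  map_add' X Y := Subtype.ext (map_add F.conjR X.1 Y.1)
  map_smul' a X := Subtype.ext (map_smul F.conjR a X.1)

theorem tauV_coe (X : Vect c) : (F.tauV X : Module.End K R) = F.conjR X := rfl

theorem tauV_vf (X : HomVF c) : F.tauV X.vf = sgn K X.par • X.vf :=
  Subtype.ext (F.conjR_of_mem X.mem)

theorem tauV_smul (f : R) (X : Vect c) : F.tauV (f • X) = F.tauR f • F.tauV X := by
  apply Subtype.ext; ext g; simp [tauV_coe, conjR_apply]

@[simp] theorem tauV_tauV (X : Vect c) : F.tauV (F.tauV X) = X := by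
  apply Subtype.ext; ext g; simp [tauV_coe, conjR_apply]

theorem mem_derPar_of_tauV [CharZero K] {p : ZMod 2} {X : Vect c} (h : F.tauV X = sgn K p • X) :
    X.1 ∈ derPar c p := by
  obtain ⟨a, b, ha, hb, rfl⟩ := F.vect_split X
  rw [map_add, F.tauV_vf, F.tauV_vf, ha, hb] at h
  simp only [sgn_zero, sgn_one] at h
  rcases zmod_two_cases p with rfl | rfl
  · have : (2 : K) • b.vf = 0 := by
      simp only [sgn_zero] at h
      linear_combination (norm := module) (-1 : K) • h
    have hb0 : b.vf = 0 := (smul_eq_zero.1 this).resolve_left two_ne_zero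
    rw [hb0, add_zero, ← ha]; exact a.mem
  · have : (2 : K) • a.vf = 0 := by
      simp only [sgn_one] at h
      linear_combination (norm := module) (1 : K) • h
    have hb0 : a.vf = 0 := (smul_eq_zero.1 this).resolve_left two_ne_zero
    rw [hb0, zero_add, ← hb]; exact b.mem

end Frame

end Frame

section SymAlg

variable {K R : Type*} [Field K] [Ring R] [Algebra K R] {c : ℤ → R →ₗ[K] R}

/-! ### The graded symmetric algebra -/

theorem mkAlgHom_rel {x y : FreeAlgebra K (R ⊕ Vect c)} (h : SymRel c x y) :
    RingQuot.mkAlgHom K (SymRel c) x = RingQuot.mkAlgHom K (SymRel c) y :=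
  RingQuot.mkAlgHom_rel K h

theorem sfn_add (f g : R) : sfn c (f + g) = sfn c f + sfn c g := by
  simpa [sfn] using mkAlgHom_rel (SymRel.fn_add (c := c) f g)

theorem sfn_mul (f g : R) : sfn c (f * g) = sfn c f * sfn c g := by
  simpa [sfn] using mkAlgHom_rel (SymRel.fn_mul (c := c) f g)

theorem sfn_algebraMap (a : K) : sfn c (algebraMap K R a) = algebraMap K _ a := by
  simpa [sfn] using mkAlgHom_rel (SymRel.fn_const (c := c) a)

@[simp] theorem sfn_one : sfn c 1 = 1 := by simpa using sfn_algebraMap (c := c) 1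

@[simp] theorem sfn_zero : sfn c 0 = 0 := by simpa using sfn_algebraMap (c := c) 0

theorem sfn_smul (a : K) (f : R) : sfn c (a • f) = a • sfn c f := by
  rw [Algebra.smul_def, sfn_mul, sfn_algebraMap, ← Algebra.smul_def]

theorem svf_add (X Y : Vect c) : svf c (X + Y) = svf c X + svf c Y := by
  simpa [svf] using mkAlgHom_rel (SymRel.vf_add X Y)

theorem svf_fsmul (f : R) (X : Vect c) : svf c (f • X) = sfn c f * svf c X := by
  simpa [svf, sfn] using mkAlgHom_rel (SymRel.vf_smul f X)

theorem svf_smul (a : K) (X : Vect c) : svf c (a • X) = a • svf c X := by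
  rw [← algebraMap_smul R a X, svf_fsmul, sfn_algebraMap, ← Algebra.smul_def]

/-- The inclusion of the functions into the symmetric algebra. -/
def sfnA (c : ℤ → R →ₗ[K] R) : R →ₐ[K] SymT c :=
  AlgHom.ofLinearMap ⟨⟨sfn c, sfn_add⟩, sfn_smul⟩ sfn_one sfn_mul

/-- The inclusion of the vector fields into the symmetric algebra. -/
def svfL (c : ℤ → R →ₗ[K] R) : Vect c →ₗ[K] SymT c := ⟨⟨svf c, svf_add⟩, svf_smul⟩

theorem sfnA_apply (f : R) : sfnA c f = sfn c f := rfl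

theorem svfL_apply (X : Vect c) : svfL c X = svf c X := rfl

@[simp] theorem svf_zero : svf c 0 = 0 := map_zero (svfL c)

theorem sfn_sub (X Y : R) : sfn c (X - Y) = sfn c X - sfn c Y := map_sub (sfnA c) X Y

theorem svf_sum {J : Type*} (s : Finset J) (X : J → Vect c) :
    svf c (∑ i ∈ s, X i) = ∑ i ∈ s, svf c (X i) := map_sum (svfL c) X s

theorem sfn_sum {J : Type*} (s : Finset J) (X : J → R) :
    sfn c (∑ i ∈ s, X i) = ∑ i ∈ s, sfn c (X i) := map_sum (sfnA c) X s

theorem svf_mul_sfn (X : HomVF c) {q : ZMod 2} {f : R} (hf : f ∈ par c q) :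
    svf c X.vf * sfn c f = sgn K (X.par * q) • (sfn c f * svf c X.vf) := by
  have := mkAlgHom_rel (SymRel.vf_fn X q f hf)
  rw [sgn_smul (K := K), map_smul, map_mul, map_mul] at this
  exact this

theorem svf_mul_svf (X Y : HomVF c) :
    svf c X.vf * svf c Y.vf = sgn K (X.par * Y.par) • (svf c Y.vf * svf c X.vf) := by
  have := mkAlgHom_rel (SymRel.vf_vf X Y)
  rw [sgn_smul (K := K), map_smul, map_mul, map_mul] at this
  exact this

/-- The universal property of the symmetric algebra. -/
def symLift {B : Type*} [Semiring B] [Algebra K B] (φ : R →ₐ[K] B) (ψ : Vect c →ₗ[K] B)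
    (h1 : ∀ f X, ψ (f • X) = φ f * ψ X)
    (h2 : ∀ (X : HomVF c) q, ∀ f ∈ par c q, ψ X.vf * φ f = sgn K (X.par * q) • (φ f * ψ X.vf))
    (h3 : ∀ X Y : HomVF c, ψ X.vf * ψ Y.vf = sgn K (X.par * Y.par) • (ψ Y.vf * ψ X.vf)) :
    SymT c →ₐ[K] B :=
  RingQuot.liftAlgHom K ⟨FreeAlgebra.lift K (Sum.elim φ ψ), by
    intro x y h
    cases h with
    | fn_const a => simp
    | fn_add f g => simp
    | fn_mul f g => simp
    | vf_add X Y => simp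
    | vf_smul f X => simp [h1]
    | vf_fn X q f hf => simp [sgn_smul (K := K), h2 X q f hf]
    | vf_vf X Y => simp [sgn_smul (K := K), h3 X Y]⟩

@[simp] theorem symLift_sfn {B : Type*} [Semiring B] [Algebra K B] (φ : R →ₐ[K] B)
    (ψ : Vect c →ₗ[K] B) (h1 h2 h3) (f : R) : symLift φ ψ h1 h2 h3 (sfn c f) = φ f := by
  simp [symLift, sfn]

@[simp] theorem symLift_svf {B : Type*} [Semiring B] [Algebra K B] (φ : R →ₐ[K] B)
    (ψ : Vect c →ₗ[K] B) (h1 h2 h3) (f : Vect c) : symLift φ ψ h1 h2 h3 (svf c f) = ψ f := by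
  simp [symLift, svf]

theorem sym_hom_ext {B : Type*} [Semiring B] [Algebra K B] {φ ψ : SymT c →ₐ[K] B}
    (h1 : ∀ f, φ (sfn c f) = ψ (sfn c f)) (h2 : ∀ X, φ (svf c X) = ψ (svf c X)) : φ = ψ := by
  apply RingQuot.ringQuot_ext'
  apply FreeAlgebra.hom_ext
  funext x
  cases x with
  | inl f => exact h1 f
  | inr X => exact h2 X

@[simp] theorem mon_nil : mon ([] : List (HomVF c)) = 1 := rfl

theorem mon_cons (X : HomVF c) (l : List (HomVF c)) : mon (X :: l) = svf c X.vf * mon l := by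
  simp [mon]

theorem mon_singleton (X : HomVF c) : mon [X] = svf c X.vf := by simp [mon]

@[simp] theorem lpar_nil : lpar ([] : List (HomVF c)) = 0 := rfl

theorem lpar_cons (X : HomVF c) (l : List (HomVF c)) : lpar (X :: l) = X.par + lpar l := by
  simp [lpar]

/-- The symmetric algebra is spanned by `f X₁ ⊙ ⋯ ⊙ Xₙ` with homogeneous `f` and `Xᵢ`. -/
theorem sym_induction (F : Frame c) {C : SymT c → Prop} (hadd : ∀ s s', C s → C s' → C (s + s'))
    (hmon : ∀ q, ∀ f ∈ par c q, ∀ l, C (sfn c f * mon l)) (s : SymT c) : C s := by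
  let W : AddSubmonoid (SymT c) := AddSubmonoid.closure
    {s | ∃ q, ∃ f ∈ par c q, ∃ l, s = sfn c f * mon l}
  have hW : ∀ s ∈ W, C s := by
    intro s hs
    induction hs using AddSubmonoid.closure_induction with
    | mem x h => obtain ⟨q, f, hf, l, rfl⟩ := h; exact hmon q f hf l
    | zero => simpa using hmon 0 0 (zero_mem _) []
    | add x y _ _ h h' => exact hadd _ _ h h'
  -- The additive span `W` of the normal forms is stable under left multiplication by functions
  -- (`hf`) and by vector fields (`hX`), hence by the whole algebra; since it contains 1 it is
  -- everything.
  have hf : ∀ f : R, ∀ s ∈ W, sfn c f * s ∈ W := by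
    intro f s hs
    induction hs using AddSubmonoid.closure_induction with
    | mem x h =>
      obtain ⟨q, g, hg, l, rfl⟩ := h
      rw [← mul_assoc, ← sfn_mul]
      induction f using F.fn_induction with
      | hadd f f' h h' => rw [add_mul, sfn_add, add_mul]; exact add_mem h h'
      | hhom p f hf => exact AddSubmonoid.subset_closure ⟨_, _, F.mul_mem _ _ _ _ hf hg, l, rfl⟩
    | zero => rw [mul_zero]; exact zero_mem _
    | add x y _ _ h h' => rw [mul_add]; exact add_mem h h'
  have hX : ∀ X : Vect c, ∀ s ∈ W, svf c X * s ∈ W := by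
    intro X s hs
    induction hs using AddSubmonoid.closure_induction with
    | mem x h =>
      obtain ⟨q, g, hg, l, rfl⟩ := h
      induction X using F.vf_induction with
      | hadd f f' h h' => rw [svf_add, add_mul]; exact add_mem h h'
      | hhom X =>
        rw [← mul_assoc, svf_mul_sfn X hg, smul_mul_assoc, mul_assoc, ← mon_cons, ← smul_mul_assoc,
          ← sfn_smul]
        exact AddSubmonoid.subset_closure ⟨q, _, Submodule.smul_mem _ _ hg, _, rfl⟩
    | zero => rw [mul_zero]; exact zero_mem _
    | add x y _ _ h h' => rw [mul_add]; exact add_mem h h'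
  have key : ∀ (x : FreeAlgebra K (R ⊕ Vect c)), ∀ s ∈ W, RingQuot.mkAlgHom K (SymRel c) x * s ∈ W := by
    intro x
    induction x using FreeAlgebra.induction with
    | grade0 a =>
      intro s hs
      rw [AlgHom.commutes, ← sfn_algebraMap]
      exact hf _ s hs
    | grade1 x =>
      cases x with
      | inl f => exact hf f
      | inr X => exact hX X
    | mul a b ha hb => intro s hs; rw [map_mul, mul_assoc]; exact ha _ (hb _ hs)
    | add a b ha hb => intro s hs; rw [map_add, add_mul]; exact add_mem (ha _ hs) (hb _ hs)
  obtain ⟨x, rfl⟩ := RingQuot.mkAlgHom_surjective K (SymRel c) s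
  have h1 : (1 : SymT c) ∈ W :=
    AddSubmonoid.subset_closure ⟨0, 1, F.one_mem, [], by simp⟩
  simpa using hW _ (key x 1 h1)

/-! #### The grading by symmetric powers -/

/-- The homomorphism that records the polynomial degree, on vector fields. -/
def degVF (c : ℤ → R →ₗ[K] R) : Vect c →ₗ[K] Polynomial (SymT c) where
  toFun X := Polynomial.monomial 1 (svf c X)
  map_add' X Y := by rw [svf_add, map_add]
  map_smul' a X := by rw [svf_smul, RingHom.id_apply, Polynomial.smul_monomial]

theorem degVF_apply (X : Vect c) : degVF c X = Polynomial.monomial 1 (svf c X) := rfl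

/-- The homomorphism that records the polynomial degree, on functions. -/
def degFn (c : ℤ → R →ₗ[K] R) : R →ₐ[K] Polynomial (SymT c) :=
  AlgHom.ofLinearMap
    { toFun f := Polynomial.C (sfn c f)
      map_add' f g := by rw [sfn_add, map_add]
      map_smul' a f := by rw [sfn_smul, RingHom.id_apply, Polynomial.smul_C] }
    (by simp) (fun f g => by simp [sfn_mul])

theorem degFn_apply (f : R) : degFn c f = Polynomial.C (sfn c f) := rfl

/-- The homomorphism that records the polynomial degree. -/
def degHom (c : ℤ → R →ₗ[K] R) : SymT c →ₐ[K] Polynomial (SymT c) :=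
  symLift (degFn c) (degVF c)
    (fun f X => by rw [degVF_apply, degVF_apply, degFn_apply, svf_fsmul, Polynomial.C_mul_monomial])
    (fun X q f hf => by
      rw [degVF_apply, degFn_apply, Polynomial.C_mul_monomial, Polynomial.monomial_mul_C,
        svf_mul_sfn X hf, Polynomial.smul_monomial])
    (fun X Y => by
      rw [degVF_apply, degVF_apply, Polynomial.monomial_mul_monomial,
        Polynomial.monomial_mul_monomial, Polynomial.smul_monomial, svf_mul_svf X Y])

theorem degHom_sfn (f : R) : degHom c (sfn c f) = Polynomial.C (sfn c f) :=
  symLift_sfn _ _ _ _ _ f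

theorem degHom_svf (X : Vect c) : degHom c (svf c X) = Polynomial.monomial 1 (svf c X) :=
  symLift_svf _ _ _ _ _ X

/-- Marking every vector field with the polynomial variable respects all relations, so the universal
property provides the grading: the coefficients of the resulting polynomial are the homogeneous
components. -/
theorem degHom_mon (f : R) (l : List (HomVF c)) :
    degHom c (sfn c f * mon l) = Polynomial.monomial l.length (sfn c f * mon l) := by
  have h : degHom c (mon l) = Polynomial.monomial l.length (mon l) := by
    induction l with
    | nil => simp [Polynomial.monomial_zero_left]
    | cons X l ih =>
      rw [mon_cons, map_mul, ih, List.length_cons]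
      rw [degHom_svf, Polynomial.monomial_mul_monomial, add_comm]
  rw [map_mul, h, degHom_sfn, Polynomial.C_mul_monomial]

/-- The projection onto the `n`-th symmetric power. -/
def pr (c : ℤ → R →ₗ[K] R) (n : ℕ) : SymT c →ₗ[K] SymT c where
  toFun s := (degHom c s).coeff n
  map_add' s s' := by simp
  map_smul' a s := by simp

theorem pr_mon (n : ℕ) (f : R) (l : List (HomVF c)) :
    pr c n (sfn c f * mon l) = if l.length = n then sfn c f * mon l else 0 := by
  change (degHom c _).coeff n = _
  rw [degHom_mon, Polynomial.coeff_monomial]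

theorem pr_of_mem {n : ℕ} {s : SymT c} (hs : s ∈ symPow c n) (m : ℕ) :
    pr c m s = if n = m then s else 0 := by
  induction hs using Submodule.span_induction with
  | mem x h => obtain ⟨f, l, rfl, rfl⟩ := h; exact pr_mon _ _ _
  | zero => simp
  | add x y _ _ h h' => rw [map_add, h, h']; split_ifs <;> simp
  | smul a x _ h => rw [map_smul, h]; split_ifs <;> simp

theorem mon_mem (f : R) (l : List (HomVF c)) : sfn c f * mon l ∈ symPow c l.length :=
  Submodule.subset_span ⟨f, l, rfl, rfl⟩

theorem mon_mem' (l : List (HomVF c)) : mon l ∈ symPow c l.length := by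
  simpa using mon_mem 1 l

theorem pr_mem (F : Frame c) (n : ℕ) (s : SymT c) : pr c n s ∈ symPow c n := by
  induction s using sym_induction F with
  | hadd s s' h h' => rw [map_add]; exact add_mem h h'
  | hmon q f hf l =>
    rw [pr_mon]
    split_ifs with h
    · rw [← h]; exact mon_mem f l
    · exact zero_mem _

theorem pr_bound (s : SymT c) : ∃ N, ∀ n ≥ N, pr c n s = 0 :=
  ⟨(degHom c s).natDegree + 1, fun _ hn => Polynomial.coeff_eq_zero_of_natDegree_lt hn⟩

/-- The elements of degree less than `n`. -/
def fil (c : ℤ → R →ₗ[K] R) (n : ℕ) : Submodule K (SymT c) where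
  carrier := {s | ∀ k, n ≤ k → pr c k s = 0}
  add_mem' h h' k hk := by rw [map_add, h k hk, h' k hk, add_zero]
  zero_mem' k _ := map_zero _
  smul_mem' a s h k hk := by rw [map_smul, h k hk, smul_zero]

theorem exists_fil (s : SymT c) : ∃ n, s ∈ fil c n := pr_bound s

theorem fil_mono {m n : ℕ} (h : m ≤ n) : fil c m ≤ fil c n := fun _ hs k hk => hs k (h.trans hk)

theorem symPow_le_fil {m n : ℕ} (h : m < n) : symPow c m ≤ fil c n := fun s hs k hk => by
  rw [pr_of_mem hs, if_neg (by omega)]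

theorem sum_pr (F : Frame c) {N : ℕ} {s : SymT c} (hs : s ∈ fil c N) :
    ∑ n ∈ Finset.range N, pr c n s = s := by
  have key : ∃ M, ∀ N ≥ M, ∑ n ∈ Finset.range N, pr c n s = s := by
    clear hs
    induction s using sym_induction F with
    | hadd s s' h h' =>
      obtain ⟨M, h⟩ := h
      obtain ⟨M', h'⟩ := h'
      refine ⟨max M M', fun N hN => ?_⟩
      simp only [map_add, Finset.sum_add_distrib]
      rw [h N (le_trans (le_max_left _ _) hN), h' N (le_trans (le_max_right _ _) hN)]
    | hmon q f hf l =>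
      refine ⟨l.length + 1, fun N hN => ?_⟩
      simp only [pr_mon]
      rw [Finset.sum_ite_eq, if_pos (Finset.mem_range.2 hN)]
  obtain ⟨M, hM⟩ := key
  rw [← hM (max M N) (le_max_left _ _)]
  nth_rewrite 1 [hM (max M N) (le_max_left _ _)]
  refine Finset.sum_subset (Finset.range_mono (le_max_right _ _)) fun n _ hn => ?_
  exact hs n (by simpa using hn)

theorem eq_zero_of_fil_zero (F : Frame c) {s : SymT c} (hs : s ∈ fil c 0) : s = 0 := by
  simpa using (sum_pr F hs).symm

/-- Additive statements may be checked on the symmetric powers. -/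
theorem graded_induction (F : Frame c) {C : SymT c → Prop}
    (hadd : ∀ s s', C s → C s' → C (s + s')) (h : ∀ n, ∀ s ∈ symPow c n, C s) (s : SymT c) :
    C s :=
  sym_induction F hadd (fun _ f _ l => h _ _ (mon_mem f l)) s

theorem mul_mem_symPow (F : Frame c) {m n : ℕ} {a b : SymT c} (ha : a ∈ symPow c m)
    (hb : b ∈ symPow c n) : a * b ∈ symPow c (m + n) := by
  have h : pr c (m + n) (a * b) = a * b := by
    have h1 : ∀ {m} {a : SymT c}, a ∈ symPow c m → degHom c a = Polynomial.monomial m a := by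
      intro m a ha
      ext k
      rw [Polynomial.coeff_monomial]
      exact pr_of_mem ha k
    change (degHom c (a * b)).coeff _ = _
    rw [map_mul, h1 ha, h1 hb, Polynomial.monomial_mul_monomial, Polynomial.coeff_monomial,
      if_pos rfl]
  rw [← h]
  exact pr_mem F _ _

theorem sfn_mem (f : R) : sfn c f ∈ symPow c 0 := by simpa using mon_mem f ([] : List (HomVF c))

theorem svf_mem (F : Frame c) (X : Vect c) : svf c X ∈ symPow c 1 := by
  induction X using F.vf_induction with
  | hadd f g h h' => rw [svf_add]; exact add_mem h h'
  | hhom X => simpa [mon] using mon_mem 1 [X]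

/-- The projection onto the functions. -/
def counit (c : ℤ → R →ₗ[K] R) : SymT c →ₐ[K] R :=
  symLift (AlgHom.id K R) 0 (by simp) (by simp) (by simp)

@[simp] theorem counit_sfn (f : R) : counit c (sfn c f) = f := by simp [counit]

@[simp] theorem counit_svf (X : Vect c) : counit c (svf c X) = 0 := by simp [counit]

theorem counit_mon_cons (f : R) (X : HomVF c) (l : List (HomVF c)) :
    counit c (sfn c f * mon (X :: l)) = 0 := by simp [mon_cons]

theorem counit_of_mem {n : ℕ} (hn : n ≠ 0) {s : SymT c} (hs : s ∈ symPow c n) :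
    counit c s = 0 := by
  induction hs using Submodule.span_induction with
  | mem x h =>
    obtain ⟨f, l, rfl, rfl⟩ := h
    cases l with
    | nil => simp at hn
    | cons X l => exact counit_mon_cons f X l
  | zero => simp
  | add x y _ _ h h' => rw [map_add, h, h', add_zero]
  | smul a x _ h => rw [map_smul, h, smul_zero]

theorem eq_sfn_counit {s : SymT c} (hs : s ∈ symPow c 0) : s = sfn c (counit c s) := by
  induction hs using Submodule.span_induction with
  | mem x h =>
    obtain ⟨f, l, hl, rfl⟩ := h
    rw [List.length_eq_zero_iff] at hl
    simp [hl]
  | zero => simp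
  | add x y _ _ h h' => rw [map_add, sfn_add, ← h, ← h']
  | smul a x _ h => rw [map_smul, sfn_smul, ← h]

theorem eq_sfn_of_fil_one (F : Frame c) {s : SymT c} (hs : s ∈ fil c 1) :
    s = sfn c (counit c s) := by
  have h := sum_pr F hs
  rw [Finset.sum_range_one] at h
  rw [← h]
  exact eq_sfn_counit (pr_mem F 0 s)

theorem sfn_injective {f g : R} (h : sfn c f = sfn c g) : f = g := by
  simpa using congrArg (counit c) h

/-! #### Parity -/

namespace Frame

variable (F : Frame c)

/-- The parity involution of the symmetric algebra. -/
def tauS : SymT c →ₐ[K] SymT c :=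
  symLift ((sfnA c).comp F.tauR) (svfL c ∘ₗ F.tauV)
    (fun f X => by simp [tauV_smul, sfnA_apply, svfL_apply, svf_fsmul])
    (fun X q f hf => by
      simp [F.tauV_vf, F.tauR_apply hf, sfnA_apply, svfL_apply, svf_mul_sfn X hf, smul_smul]
      congr 1; ring)
    (fun X Y => by
      simp [F.tauV_vf, svfL_apply, svf_mul_svf X Y, smul_smul]
      congr 1; ring)

@[simp] theorem tauS_sfn (f : R) : F.tauS (sfn c f) = sfn c (F.tauR f) :=
  symLift_sfn _ _ _ _ _ f

@[simp] theorem tauS_svf (X : Vect c) : F.tauS (svf c X) = svf c (F.tauV X) :=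
  symLift_svf _ _ _ _ _ X

@[simp] theorem tauS_tauS (s : SymT c) : F.tauS (F.tauS s) = s := by
  have : F.tauS.comp F.tauS = AlgHom.id K _ := sym_hom_ext (by simp) (by simp)
  exact DFunLike.congr_fun this s

/-- The powers of the parity involution. -/
def tpow (p : ZMod 2) : SymT c →ₐ[K] SymT c := if p = 0 then AlgHom.id K _ else F.tauS

@[simp] theorem tpow_zero : F.tpow 0 = AlgHom.id K _ := rfl

@[simp] theorem tpow_one : F.tpow 1 = F.tauS := rfl

theorem tpow_tpow (p q : ZMod 2) (s : SymT c) : F.tpow p (F.tpow q s) = F.tpow (p + q) s := by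
  rcases zmod_two_cases p with rfl | rfl <;> rcases zmod_two_cases q with rfl | rfl <;>
    simp [zmod_add_self]

/-- Elements of parity `q` of the symmetric algebra. -/
def spar (q : ZMod 2) : Submodule K (SymT c) where
  carrier := {s | F.tauS s = sgn K q • s}
  add_mem' h h' := by
    change F.tauS _ = _ at h
    change F.tauS _ = _ at h'
    change F.tauS _ = _
    rw [map_add, h, h', smul_add]
  zero_mem' := by simp
  smul_mem' a s h := by
    change F.tauS _ = _ at h
    change F.tauS _ = _
    rw [map_smul, h, smul_comm]

variable {F}

theorem mem_spar {q : ZMod 2} {s : SymT c} : s ∈ F.spar q ↔ F.tauS s = sgn K q • s := Iff.rfl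

theorem tpow_of_mem {q : ZMod 2} {s : SymT c} (hs : s ∈ F.spar q) (p : ZMod 2) :
    F.tpow p s = sgn K (p * q) • s := by
  rcases zmod_two_cases p with rfl | rfl
  · simp
  · rw [tpow_one, one_mul]; exact hs

theorem sfn_mem_spar {q : ZMod 2} {f : R} (hf : f ∈ par c q) : sfn c f ∈ F.spar q := by
  rw [mem_spar, tauS_sfn, F.tauR_apply hf, sfn_smul]

theorem svf_mem_spar (X : HomVF c) : svf c X.vf ∈ F.spar X.par := by
  rw [mem_spar, tauS_svf, F.tauV_vf, svf_smul]

theorem mul_mem_spar {p q : ZMod 2} {a b : SymT c} (ha : a ∈ F.spar p) (hb : b ∈ F.spar q) :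
    a * b ∈ F.spar (p + q) := by
  rw [mem_spar, map_mul, mem_spar.1 ha, mem_spar.1 hb, sgn_add]
  simp [smul_smul, mul_comm]

theorem one_mem_spar : (1 : SymT c) ∈ F.spar 0 := by simp [mem_spar]

theorem mon_mem_spar (l : List (HomVF c)) : mon l ∈ F.spar (lpar l) := by
  induction l with
  | nil => exact one_mem_spar
  | cons X l ih => rw [mon_cons, lpar_cons]; exact mul_mem_spar (svf_mem_spar X) ih

/-- Writing the Koszul sign as the operator `F.tpow q` makes graded commutativity additive in `s`,
so that it makes sense for inhomogeneous elements. -/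
theorem sfn_comm {q : ZMod 2} {f : R} (hf : f ∈ par c q) (s : SymT c) :
    s * sfn c f = sfn c f * F.tpow q s := by
  induction s using sym_induction F with
  | hadd s s' h h' => simp only [map_add, add_mul, mul_add, h, h']
  | hmon p g hg l =>
    have h : mon l * sfn c f = sfn c f * F.tpow q (mon l) := by
      induction l with
      | nil => simp
      | cons X l ih =>
        rw [mon_cons, mul_assoc, ih, ← mul_assoc, svf_mul_sfn X hf, map_mul,
          tpow_of_mem (svf_mem_spar X)]
        simp [mul_assoc, mul_comm]
    rw [mul_assoc, h, map_mul, tpow_of_mem (sfn_mem_spar hg), ← mul_assoc, ← sfn_mul,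
      F.comm _ _ _ _ hg hf, sfn_smul, sfn_mul]
    simp [mul_assoc, mul_comm]

theorem svf_comm (X : HomVF c) (s : SymT c) :
    s * svf c X.vf = svf c X.vf * F.tpow X.par s := by
  induction s using sym_induction F with
  | hadd s s' h h' => simp only [map_add, add_mul, mul_add, h, h']
  | hmon p g hg l =>
    have h : mon l * svf c X.vf = svf c X.vf * F.tpow X.par (mon l) := by
      induction l with
      | nil => simp
      | cons Y l ih =>
        rw [mon_cons, mul_assoc, ih, ← mul_assoc, svf_mul_svf Y X, map_mul,
          tpow_of_mem (svf_mem_spar Y)]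
        simp [mul_assoc, mul_comm]
    rw [mul_assoc, h, map_mul, tpow_of_mem (sfn_mem_spar hg), ← mul_assoc,
      smul_mul_assoc, mul_smul_comm, ← mul_assoc, svf_mul_sfn X hg, smul_mul_assoc,
      sgn_smul_sgn_smul]

/-- The symmetric algebra is graded commutative. -/
theorem spar_comm {q : ZMod 2} {b : SymT c} (hb : b ∈ F.spar q) (s : SymT c) :
    s * b = b * F.tpow q s := by
  induction s using sym_induction F with
  | hadd s s' h h' => simp only [map_add, add_mul, mul_add, h, h']
  | hmon p g hg l =>
    have h : mon l * b = b * F.tpow q (mon l) := by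
      induction l with
      | nil => simp
      | cons Y l ih =>
        rw [mon_cons, mul_assoc, ih, ← mul_assoc, map_mul, tpow_of_mem (svf_mem_spar Y),
          smul_mul_assoc, mul_smul_comm, ← mul_assoc b, svf_comm Y b, tpow_of_mem hb,
          mul_smul_comm, smul_mul_assoc, mul_comm q, sgn_smul_sgn_smul]
    rw [mul_assoc, h, map_mul, tpow_of_mem (sfn_mem_spar hg), ← mul_assoc, ← mul_assoc,
      mul_smul_comm, sfn_comm hg b, tpow_of_mem hb, mul_smul_comm, mul_comm q,
      sgn_smul_sgn_smul]

end Frame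

end SymAlg

section SuperBracket

variable (K : Type*) [Field K] {A : Type*} [Ring A] [Algebra K A]

/-! ### Supercommutators -/

/-- The supercommutator, with explicit parity labels. -/
def br (p q : ZMod 2) (a b : A) : A := a * b - sgn K (p * q) • (b * a)

variable {K}

@[simp] theorem br_zero_left (p q : ZMod 2) (b : A) : br K p q 0 b = 0 := by simp [br]

@[simp] theorem br_zero_right (p q : ZMod 2) (b : A) : br K p q b 0 = 0 := by simp [br]

theorem br_add_left (p q : ZMod 2) (a a' b : A) :
    br K p q (a + a') b = br K p q a b + br K p q a' b := by
  simp only [br, add_mul, mul_add, smul_add]; abel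

theorem br_sub_left (p q : ZMod 2) (a a' b : A) :
    br K p q (a - a') b = br K p q a b - br K p q a' b := by
  simp only [br, sub_mul, mul_sub, smul_sub]; abel

theorem br_sub_right (p q : ZMod 2) (a b b' : A) :
    br K p q a (b - b') = br K p q a b - br K p q a b' := by
  simp only [br, sub_mul, mul_sub, smul_sub]; abel

theorem br_smul_left (p q : ZMod 2) (x : K) (a b : A) :
    br K p q (x • a) b = x • br K p q a b := by
  simp only [br, smul_mul_assoc, mul_smul_comm, smul_sub]
  rw [smul_comm]

theorem br_smul_right (p q : ZMod 2) (x : K) (a b : A) :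
    br K p q a (x • b) = x • br K p q a b := by
  simp only [br, smul_mul_assoc, mul_smul_comm, smul_sub]
  rw [smul_comm]

theorem br_sum_right {J : Type*} (s : Finset J) (p q : ZMod 2) (a : A) (b : J → A) :
    br K p q a (∑ i ∈ s, b i) = ∑ i ∈ s, br K p q a (b i) := by
  simp only [br, Finset.sum_mul, Finset.mul_sum, Finset.smul_sum, Finset.sum_sub_distrib]

theorem br_antisymm (p q : ZMod 2) (a b : A) : br K q p b a = -(sgn K (p * q) • br K p q a b) := by
  simp only [br, smul_sub, sgn_smul_sgn_smul, mul_comm q p]; abel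

theorem br_mul_left (p q r : ZMod 2) (a b d : A) : br K (p + q) r (a * b) d =
    a * br K q r b d + sgn K (q * r) • (br K p r a d * b) := by
  simp only [br, mul_sub, sub_mul, smul_sub, mul_smul_comm, smul_mul_assoc, smul_smul, ← sgn_add,
    mul_assoc, add_mul, add_comm (q * r)]
  abel

theorem br_mul_right (p q r : ZMod 2) (a b d : A) : br K p (q + r) a (b * d) =
    br K p q a b * d + sgn K (p * q) • (b * br K p r a d) := by
  simp only [br, mul_sub, sub_mul, smul_sub, mul_smul_comm, smul_mul_assoc, smul_smul, ← sgn_add,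
    mul_assoc, mul_add]
  abel

theorem br_jacobi (p q r : ZMod 2) (a b d : A) : br K (p + q) r (br K p q a b) d =
    br K p (q + r) a (br K q r b d) - sgn K (p * q) • br K q (p + r) b (br K p r a d) := by
  have e : p * q + (q * p + q * r) = q * r := by
    rw [mul_comm q p, ← add_assoc, zmod_add_self, zero_add]
  have e' : p * r + (p * q + q * r) = p * q + (p * r + q * r) := by ring
  have e'' : p * q + (p * r + (p * q + q * r)) = p * r + q * r := by
    rw [e', ← add_assoc, zmod_add_self, zero_add]
  have e3 : p * q + (p * q + p * r) = p * r := by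
    rw [← add_assoc, zmod_add_self, zero_add]
  simp only [br, mul_sub, sub_mul, smul_sub, mul_smul_comm, smul_mul_assoc, smul_smul, ← sgn_add,
    mul_assoc, mul_add, add_mul]
  rcases zmod_two_cases p with rfl | rfl <;> rcases zmod_two_cases q with rfl | rfl <;>
    rcases zmod_two_cases r with rfl | rfl <;> simp [zmod_add_self] <;> abel

/-- The supercentralizer of a family of elements with parity labels. -/
def cent (K : Type*) [Field K] {A : Type*} [Ring A] [Algebra K A] (S : ZMod 2 → Set A)
    (p : ZMod 2) : Submodule K A where
  carrier := {u | ∀ q, ∀ s ∈ S q, br K p q u s = 0}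
  add_mem' h h' q s hs := by rw [br_add_left, h q s hs, h' q s hs, add_zero]
  zero_mem' q s _ := br_zero_left _ _ _
  smul_mem' x u h q s hs := by rw [br_smul_left, h q s hs, smul_zero]

/-- The double supercentralizer. -/
def cent2 (K : Type*) [Field K] {A : Type*} [Ring A] [Algebra K A] (S : ZMod 2 → Set A)
    (p : ZMod 2) : Submodule K A := cent K (fun q => (cent K S q : Set A)) p

/-- The elements whose supercommutators preserve the supercentralizer. -/
def centNorm (K : Type*) [Field K] {A : Type*} [Ring A] [Algebra K A] (S : ZMod 2 → Set A)
    (p : ZMod 2) : Submodule K A where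
  carrier := {a | ∀ q, ∀ u ∈ cent K S q, br K p q a u ∈ cent K S (p + q)}
  add_mem' h h' q s hs := by rw [br_add_left]; exact add_mem (h q s hs) (h' q s hs)
  zero_mem' q s _ := by rw [br_zero_left]; exact zero_mem _
  smul_mem' x u h q s hs := by rw [br_smul_left]; exact Submodule.smul_mem _ _ (h q s hs)

variable {S : ZMod 2 → Set A} {p q : ZMod 2} {a b : A}

theorem br_eq_zero_symm (h : br K p q a b = 0) : br K q p b a = 0 := by
  rw [br_antisymm, h, smul_zero, neg_zero]

theorem mem_cent2 (h : a ∈ S p) : a ∈ cent2 K S p := fun _ _ hu => br_eq_zero_symm (hu _ _ h)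

theorem br_of_cent_of_cent2 (h : a ∈ cent K S p) (h' : b ∈ cent2 K S q) : br K p q a b = 0 :=
  br_eq_zero_symm (h' _ _ h)

theorem mul_mem_cent (h : a ∈ cent K S p) (h' : b ∈ cent K S q) : a * b ∈ cent K S (p + q) :=
  fun r s hs => by rw [br_mul_left, h r s hs, h' r s hs]; simp

theorem mul_mem_cent2 (h : a ∈ cent2 K S p) (h' : b ∈ cent2 K S q) : a * b ∈ cent2 K S (p + q) :=
  mul_mem_cent h h'

/-- By the Jacobi identity [[a, u], s] = [a, [u, s]] ± [u, [a, s]] for u in the centralizer: the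
first bracket is zero, and the second vanishes because [a, s] is in the double centralizer. Only the
generators need to be tested. -/
theorem mem_centNorm (h : ∀ r, ∀ s ∈ S r, br K p r a s ∈ cent2 K S (p + r)) :
    a ∈ centNorm K S p := fun q u hu r s hs => by
  rw [br_jacobi, hu r s hs, br_of_cent_of_cent2 hu (h r s hs)]; simp

theorem br_mem_cent2 (h : a ∈ centNorm K S p) (h' : b ∈ cent2 K S q) :
    br K p q a b ∈ cent2 K S (p + q) := fun r u hu => by
  rw [br_jacobi, h' r u hu, h' _ _ (h r u hu)]; simp

theorem sub_mem_cent (ha : a ∈ cent K S p) (hb : b ∈ cent K S p) : a - b ∈ cent K S p :=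
  sub_mem ha hb

theorem neg_mem_cent2 (ha : a ∈ cent2 K S p) : -a ∈ cent2 K S p := neg_mem ha

theorem sub_mem_centNorm (ha : a ∈ centNorm K S p) (hb : b ∈ centNorm K S p) :
    a - b ∈ centNorm K S p := sub_mem ha hb

theorem br_mem_centNorm (ha : a ∈ centNorm K S p) (hb : b ∈ centNorm K S q) :
    br K p q a b ∈ centNorm K S (p + q) := by
  intro r u hu
  have h1 := ha _ _ (hb r u hu)
  have h2 := hb _ _ (ha r u hu)
  rw [br_jacobi, add_assoc]
  refine sub_mem h1 (Submodule.smul_mem _ _ ?_)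
  rwa [add_left_comm] at h2

/-- In [ab, u] = a [b, u] ± [a, u] b the first term vanishes and the second is a product in the
centralizer. It is applied with `b` a contraction, which belongs both to the centralizer and to the
double centralizer. -/
theorem mul_mem_centNorm (ha : a ∈ centNorm K S p) (hb : b ∈ cent K S q) (hb' : b ∈ cent2 K S q) :
    a * b ∈ centNorm K S (p + q) := by
  intro r u hu
  have h1 := mul_mem_cent (ha r u hu) hb
  rw [br_mul_left, hb' r u hu, mul_zero, zero_add]
  refine Submodule.smul_mem _ _ ?_
  rwa [add_right_comm] at h1

end SuperBracket

section Derivations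

variable {K R : Type*} [Field K] [Ring R] [Algebra K R] {c : ℤ → R →ₗ[K] R}

/-! ### Superderivations of the symmetric algebra -/

/-- Operators on the symmetric algebra. -/
abbrev Op (c : ℤ → R →ₗ[K] R) : Type _ := Module.End K (SymT c)

/-- Left multiplication. -/
def lm (a : SymT c) : Op c := LinearMap.mulLeft K a

@[simp] theorem lm_apply (a s : SymT c) : lm a s = a * s := rfl

theorem sym_gen_induction (F : Frame c) {C : SymT c → Prop}
    (hadd : ∀ s s', C s → C s' → C (s + s')) (hmul : ∀ s s', C s → C s' → C (s * s'))
    (hf : ∀ f, C (sfn c f)) (hX : ∀ X, C (svf c X)) (s : SymT c) : C s := by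
  induction s using sym_induction F with
  | hadd s s' h h' => exact hadd _ _ h h'
  | hmon q f _ l =>
    refine hmul _ _ (hf f) ?_
    induction l with
    | nil => simpa using hf 1
    | cons X l ih => rw [mon_cons]; exact hmul _ _ (hX _) ih

namespace Frame

variable (F : Frame c)

/-- Powers of the parity involution on functions. -/
def trpow (p : ZMod 2) : R →ₐ[K] R := if p = 0 then AlgHom.id K _ else F.tauR

/-- Powers of the parity involution on vector fields. -/
def tvpow (p : ZMod 2) : Vect c →ₗ[K] Vect c := if p = 0 then LinearMap.id else F.tauV

theorem tpow_sfn (p : ZMod 2) (f : R) : F.tpow p (sfn c f) = sfn c (F.trpow p f) := by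
  rcases zmod_two_cases p with rfl | rfl <;> simp [trpow]

theorem tpow_svf (p : ZMod 2) (X : Vect c) : F.tpow p (svf c X) = svf c (F.tvpow p X) := by
  rcases zmod_two_cases p with rfl | rfl <;> simp [tvpow]

theorem trpow_apply (p : ZMod 2) {q : ZMod 2} {f : R} (hf : f ∈ par c q) :
    F.trpow p f = sgn K (p * q) • f := by
  rcases zmod_two_cases p with rfl | rfl <;> simp [trpow, F.tauR_apply hf]

theorem tvpow_vf (p : ZMod 2) (X : HomVF c) : F.tvpow p X.vf = sgn K (p * X.par) • X.vf := by
  rcases zmod_two_cases p with rfl | rfl <;> simp [tvpow, F.tauV_vf]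

theorem tvpow_smul (p : ZMod 2) (f : R) (X : Vect c) :
    F.tvpow p (f • X) = F.trpow p f • F.tvpow p X := by
  rcases zmod_two_cases p with rfl | rfl <;> simp [tvpow, trpow, F.tauV_smul]

theorem tauV_tvpow (p : ZMod 2) (X : Vect c) :
    F.tauV (F.tvpow p X) = F.tvpow p (F.tauV X) := by
  rcases zmod_two_cases p with rfl | rfl <;> simp [tvpow]

theorem tauR_vect (X : Vect c) (f : R) : F.tauR (X.1 f) = (F.tauV X).1 (F.tauR f) := by
  simp [tauV_coe, conjR_apply]

/-- Derivations of parity `p` of the symmetric algebra. -/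
structure IsDer (p : ZMod 2) (d : Op c) : Prop where
  leib : ∀ a b, d (a * b) = d a * b + F.tpow p a * d b
  tau : ∀ a, F.tauS (d a) = sgn K p • d (F.tauS a)

variable {F}

theorem IsDer.tpow {p : ZMod 2} {d : Op c} (hd : F.IsDer p d) (q : ZMod 2) (a : SymT c) :
    F.tpow q (d a) = sgn K (q * p) • d (F.tpow q a) := by
  rcases zmod_two_cases q with rfl | rfl <;> simp [hd.tau]

theorem IsDer.ext {p : ZMod 2} {d d' : Op c} (hd : F.IsDer p d) (hd' : F.IsDer p d')
    (hf : ∀ f, d (sfn c f) = d' (sfn c f)) (hX : ∀ X : HomVF c, d (svf c X.vf) = d' (svf c X.vf)) :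
    d = d' := by
  ext s
  induction s using sym_gen_induction F with
  | hadd s s' h h' => simp only [map_add, h, h']
  | hmul s s' h h' => rw [hd.leib, hd'.leib, h, h']
  | hf f => exact hf f
  | hX X =>
    induction X using F.vf_induction with
    | hadd X Y h h' => simp only [svf_add, map_add, h, h']
    | hhom X => exact hX X

theorem IsDer.zero (p : ZMod 2) : F.IsDer p 0 := ⟨by simp, by simp⟩

theorem IsDer.add {p : ZMod 2} {d d' : Op c} (hd : F.IsDer p d) (hd' : F.IsDer p d') :
    F.IsDer p (d + d') :=
  ⟨fun a b => by simp only [LinearMap.add_apply, hd.leib, hd'.leib, add_mul, mul_add]; abel,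
    fun a => by simp only [LinearMap.add_apply, map_add, hd.tau, hd'.tau, smul_add]⟩

theorem IsDer.smul {p : ZMod 2} {d : Op c} (hd : F.IsDer p d) (a : K) : F.IsDer p (a • d) :=
  ⟨fun x b => by
    simp only [LinearMap.smul_apply, hd.leib, smul_add, smul_mul_assoc, mul_smul_comm],
    fun x => by simp only [LinearMap.smul_apply, map_smul, hd.tau]; rw [smul_comm]⟩

theorem IsDer.sub {p : ZMod 2} {d d' : Op c} (hd : F.IsDer p d) (hd' : F.IsDer p d') :
    F.IsDer p (d - d') := by
  have e : d - d' = d + (-1 : K) • d' := by module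
  rw [e]
  exact hd.add (hd'.smul (-1))

theorem IsDer.sum {J : Type*} {s : Finset J} {p : ZMod 2} {d : J → Op c}
    (hd : ∀ i ∈ s, F.IsDer p (d i)) : F.IsDer p (∑ i ∈ s, d i) := by
  classical
  induction s using Finset.induction_on with
  | empty => simpa using IsDer.zero p
  | insert a s ha ih =>
    rw [Finset.sum_insert ha]
    exact (hd a (by simp)).add (ih fun i hi => hd i (by simp [hi]))

theorem IsDer.fmul {p q : ZMod 2} {d : Op c} (hd : F.IsDer p d) {f : R} (hf : f ∈ par c q) :
    F.IsDer (q + p) (lm (sfn c f) * d) := by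
  refine ⟨fun a b => ?_, fun a => ?_⟩
  · simp only [Module.End.mul_apply, lm_apply, hd.leib, mul_add]
    have : F.tpow q (F.tpow p a) * sfn c f = sfn c f * F.tpow p a := by
      rw [sfn_comm hf, tpow_tpow, tpow_tpow, zmod_add_self, zero_add]
    rw [← mul_assoc, ← mul_assoc, ← mul_assoc, ← F.tpow_tpow, this]
  · simp only [Module.End.mul_apply, lm_apply, map_mul, hd.tau, tauS_sfn, F.tauR_apply hf,
      sfn_smul, sgn_add]
    simp [smul_smul, mul_comm]

theorem IsDer.brDer {p q : ZMod 2} {d e : Op c} (hd : F.IsDer p d) (he : F.IsDer q e) :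
    F.IsDer (p + q) (br K p q d e) := by
  refine ⟨fun a b => ?_, fun a => ?_⟩
  · simp only [br, LinearMap.sub_apply, LinearMap.smul_apply, Module.End.mul_apply, hd.leib,
      he.leib, map_add, hd.tpow, he.tpow, tpow_tpow, smul_add, sub_mul, mul_sub, smul_mul_assoc,
      mul_smul_comm, add_comm q p, mul_comm q p, sgn_smul_sgn_smul]
    abel
  · simp only [br, LinearMap.sub_apply, LinearMap.smul_apply, Module.End.mul_apply, map_sub,
      map_smul, hd.tau, he.tau, smul_smul, smul_sub, sgn_add]
    congr 2; ring

variable (F)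

-- A twisted derivation d is the same thing as an algebra homomorphism s ↦ (τᵖ s, d s; 0, s) into
-- upper triangular 2 × 2 matrices. The universal property of the symmetric algebra then reduces its
-- existence to the relations between functions and vector fields.
set_option maxHeartbeats 800000 in
theorem exists_der (p : ZMod 2) (dR : R →ₗ[K] SymT c) (dV : Vect c →ₗ[K] SymT c)
    (hRp : ∀ f, F.tauS (dR f) = sgn K p • dR (F.tauR f))
    (hVp : ∀ X, F.tauS (dV X) = sgn K p • dV (F.tauV X))
    (hR : ∀ f g, dR (f * g) = dR f * sfn c g + F.tpow p (sfn c f) * dR g)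
    (hV : ∀ f X, dV (f • X) = dR f * svf c X + F.tpow p (sfn c f) * dV X) :
    ∃ d : Op c, F.IsDer p d ∧ (∀ f, d (sfn c f) = dR f) ∧ ∀ X, d (svf c X) = dV X := by
  have h1 : dR 1 = 0 := by simpa using hR 1 1
  let φ : R →ₐ[K] Matrix (Fin 2) (Fin 2) (SymT c) := AlgHom.ofLinearMap
    { toFun f := !![F.tpow p (sfn c f), dR f; 0, sfn c f]
      map_add' f g := by ext i j; fin_cases i <;> fin_cases j <;> simp [sfn_add]
      map_smul' a f := by ext i j; fin_cases i <;> fin_cases j <;> simp [sfn_smul] }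
    (by
      change !![F.tpow p (sfn c 1), dR 1; 0, sfn c 1] = 1
      rw [h1, sfn_one, map_one]; exact Matrix.one_fin_two.symm)
    (fun f g => by
      change !![F.tpow p (sfn c (f * g)), dR (f * g); 0, sfn c (f * g)] =
        !![F.tpow p (sfn c f), dR f; 0, sfn c f] * !![F.tpow p (sfn c g), dR g; 0, sfn c g]
      rw [Matrix.mul_fin_two, hR, sfn_mul]; simp [add_comm])
  let ψ : Vect c →ₗ[K] Matrix (Fin 2) (Fin 2) (SymT c) :=
    { toFun f := !![F.tpow p (svf c f), dV f; 0, svf c f]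
      map_add' f g := by ext i j; fin_cases i <;> fin_cases j <;> simp [svf_add]
      map_smul' a f := by ext i j; fin_cases i <;> fin_cases j <;> simp [svf_smul] }
  have hφ : ∀ f, φ f = !![F.tpow p (sfn c f), dR f; 0, sfn c f] := fun _ => rfl
  have hψ : ∀ f, ψ f = !![F.tpow p (svf c f), dV f; 0, svf c f] := fun _ => rfl
  have mR : ∀ {q f}, f ∈ par c q → dR f ∈ F.spar (p + q) := by
    intro q f hf
    rw [mem_spar, hRp, F.tauR_apply hf, map_smul, sgn_add, smul_smul]
  have mV : ∀ X : HomVF c, dV X.vf ∈ F.spar (p + X.par) := by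
    intro X
    rw [mem_spar, hVp, F.tauV_vf, map_smul, sgn_add, smul_smul]
  let Φ := symLift φ ψ
    (fun f X => by
      rw [hφ, hψ, hψ, Matrix.mul_fin_two, hV, svf_fsmul]; simp [add_comm])
    (fun X q f hf => by
      rw [hφ, hψ, Matrix.mul_fin_two, Matrix.mul_fin_two, Matrix.smul_of]
      have e1 : sfn c f * dV X.vf = sgn K ((p + X.par) * q) • (dV X.vf * sfn c f) := by
        rw [sfn_comm hf, tpow_of_mem (mV X), mul_smul_comm, mul_comm q, sgn_smul_sgn_smul]
      have e2 : svf c X.vf * dR f = sgn K ((p + q) * X.par) • (dR f * svf c X.vf) := by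
        rw [spar_comm (mR hf), tpow_of_mem (svf_mem_spar X), mul_smul_comm]
      have e3 : ∀ p q x : ZMod 2, p * x + (p + q) * x = x * q := by decide
      ext i j
      fin_cases i <;> fin_cases j <;>
        simp [tpow_of_mem (svf_mem_spar X), tpow_of_mem (sfn_mem_spar hf), svf_mul_sfn X hf, e1, e2,
          smul_smul, ← sgn_add, e3, mul_comm X.par]
      · congr 2; ring
      · rw [add_comm])
    (fun X Y => by
      rw [hψ, hψ, Matrix.mul_fin_two, Matrix.mul_fin_two, Matrix.smul_of]
      have e1 : svf c Y.vf * dV X.vf = sgn K ((p + X.par) * Y.par) • (dV X.vf * svf c Y.vf) := by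
        rw [spar_comm (mV X), tpow_of_mem (svf_mem_spar Y), mul_smul_comm]
      have e2 : svf c X.vf * dV Y.vf = sgn K ((p + Y.par) * X.par) • (dV Y.vf * svf c X.vf) := by
        rw [spar_comm (mV Y), tpow_of_mem (svf_mem_spar X), mul_smul_comm]
      have e3 : ∀ p q x : ZMod 2, p * x + (p + q) * x = x * q := by decide
      ext i j
      fin_cases i <;> fin_cases j <;>
        simp [tpow_of_mem (svf_mem_spar X), tpow_of_mem (svf_mem_spar Y), svf_mul_svf X Y, e1, e2,
          smul_smul, ← sgn_add, e3]
      · congr 2; ring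
      · rw [mul_comm Y.par, zmod_add_self, sgn_zero, one_smul, add_comm])
  have Φf : ∀ f, Φ (sfn c f) = !![F.tpow p (sfn c f), dR f; 0, sfn c f] := fun f =>
    symLift_sfn _ _ _ _ _ f
  have ΦX : ∀ f, Φ (svf c f) = !![F.tpow p (svf c f), dV f; 0, svf c f] := fun f =>
    symLift_svf _ _ _ _ _ f
  -- The matrices stay triangular with the prescribed diagonal, so multiplicativity of `Φ` in the
  -- upper right corner is the twisted Leibniz rule.
  have key : ∀ s, Φ s 0 0 = F.tpow p s ∧ Φ s 1 0 = 0 ∧ Φ s 1 1 = s := by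
    intro s
    induction s using sym_gen_induction F with
    | hadd s s' h h' => simp [h.1, h'.1, h.2.1, h'.2.1, h.2.2, h'.2.2]
    | hmul s s' h h' =>
      simp [Matrix.mul_apply, Fin.sum_univ_two, h.1, h'.1, h.2.1, h'.2.1, h.2.2, h'.2.2]
    | hf f => simp [Φf]
    | hX f => simp [ΦX]
  let d : Op c :=
    { toFun s := Φ s 0 1
      map_add' s s' := by simp
      map_smul' a s := by simp }
  have dd : ∀ s, d s = Φ s 0 1 := fun _ => rfl
  have leib : ∀ a b, d (a * b) = d a * b + F.tpow p a * d b := fun a b => by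
    rw [dd, dd, dd, map_mul, Matrix.mul_apply, Fin.sum_univ_two, (key a).1, (key b).2.2, add_comm]
  have df : ∀ f, d (sfn c f) = dR f := fun f => by rw [dd, Φf]; rfl
  have dX : ∀ f, d (svf c f) = dV f := fun f => by rw [dd, ΦX]; rfl
  refine ⟨d, ⟨leib, fun a => ?_⟩, df, dX⟩
  induction a using sym_gen_induction F with
  | hadd s s' h h' => simp only [map_add, h, h', smul_add]
  | hmul s s' h h' =>
    have : F.tauS (F.tpow p s) = F.tpow p (F.tauS s) := by
      rw [← tpow_one, tpow_tpow, tpow_tpow, add_comm]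
    rw [map_mul F.tauS s s', leib, leib, map_add, map_mul, map_mul, h, h', this]
    simp
  | hf f => rw [df, hRp, tauS_sfn, df]
  | hX f => rw [dX, hVp, tauS_svf, dX]

/-! #### Contractions -/

/-- The value of the contraction with `dgᵢ` on a homogeneous vector field. -/
def ival (i : Fin F.N) (X : HomVF c) : R := sgn K (X.par * (F.Y i).par) • X.der (F.g i)

theorem ival_mem (i : Fin F.N) (X : HomVF c) : F.ival i X ∈ par c (X.par + (F.Y i).par) :=
  Submodule.smul_mem _ _ (X.mem.1 _ _ (F.g_mem i))

theorem exists_iota (i : Fin F.N) : ∃ d : Op c, F.IsDer (F.Y i).par d ∧ (∀ f, d (sfn c f) = 0) ∧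
    ∀ X, d (svf c X) = sfn c ((F.tvpow (F.Y i).par X).1 (F.g i)) := by
  have := F.exists_der (F.Y i).par 0
    { toFun X := sfn c ((F.tvpow (F.Y i).par X).1 (F.g i))
      map_add' X Y := by simp [sfn_add]
      map_smul' a X := by simp [sfn_smul] } (by simp)
    (fun X => by
      change F.tauS (sfn c _) = _ • sfn c _
      rw [tauS_sfn, tauR_vect, F.tauR_apply (F.g_mem i), map_smul, sfn_smul, tauV_tvpow]) (by simp)
    (fun f X => by
      change sfn c _ = _ + _ * sfn c _
      rw [F.tvpow_smul, tpow_sfn, ← sfn_mul]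
      simp)
  exact this

/-- The contraction with `dgᵢ`. -/
def iota (i : Fin F.N) : Op c := (F.exists_iota i).choose

theorem iota_der (i : Fin F.N) : F.IsDer (F.Y i).par (F.iota i) := (F.exists_iota i).choose_spec.1

@[simp] theorem iota_sfn (i : Fin F.N) (f : R) : F.iota i (sfn c f) = 0 :=
  (F.exists_iota i).choose_spec.2.1 f

theorem iota_svf (i : Fin F.N) (X : Vect c) :
    F.iota i (svf c X) = sfn c ((F.tvpow (F.Y i).par X).1 (F.g i)) :=
  (F.exists_iota i).choose_spec.2.2 X

theorem iota_vf (i : Fin F.N) (X : HomVF c) :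
    F.iota i (svf c X.vf) = sfn c (F.ival i X) := by
  rw [iota_svf, F.tvpow_vf, ival, mul_comm]; rfl

theorem iota_fmul (i : Fin F.N) (f : R) (s : SymT c) :
    F.iota i (sfn c f * s) = sfn c (F.trpow (F.Y i).par f) * F.iota i s := by
  rw [(F.iota_der i).leib, iota_sfn, zero_mul, zero_add, tpow_sfn]

theorem iota_vmul (i : Fin F.N) (X : HomVF c) (s : SymT c) :
    F.iota i (svf c X.vf * s) = sfn c (F.ival i X) * s
      + sgn K ((F.Y i).par * X.par) • (svf c X.vf * F.iota i s) := by
  rw [(F.iota_der i).leib, iota_vf, tpow_svf, F.tvpow_vf, svf_smul, smul_mul_assoc]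

/-- The dual basis property. -/
theorem sum_ival (X : HomVF c) :
    ∑ i, svf c (F.Y i).vf * sfn c (F.ival i X) = svf c X.vf := by
  conv_rhs => rw [F.spec X.vf, svf_sum]
  refine Finset.sum_congr rfl fun i _ => ?_
  rw [svf_mul_sfn _ (F.ival_mem i X), ival, sfn_smul, svf_smul, svf_fsmul, smul_mul_assoc,
    smul_smul, ← sgn_add]
  congr 2
  -- Identities between Koszul signs are identities between parities in `ZMod 2`, decided by running
  -- through all values. The same device recurs below.
  generalize X.par = a; generalize (F.Y i).par = b; revert a b; decide

/-- The Euler operator. -/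
def euler : Op c := ∑ i, lm (svf c (F.Y i).vf) * F.iota i

/-- The operator satisfies E(X ⊙ s) = X ⊙ s + X ⊙ E(s): the terms in which X is contracted rebuild X
from the dual basis, and in the others the sign of exchanging Yᵢ and X occurs twice. -/
theorem euler_mon (f : R) (l : List (HomVF c)) :
    F.euler (sfn c f * mon l) = (l.length : K) • (sfn c f * mon l) := by
  have hv : ∀ (X : HomVF c) s, F.euler (svf c X.vf * s) = svf c X.vf * s + svf c X.vf * F.euler s := by
    intro X s
    have : ∀ i, (lm (svf c (F.Y i).vf) * F.iota i) (svf c X.vf * s) =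
        (svf c (F.Y i).vf * sfn c (F.ival i X)) * s
          + svf c X.vf * (lm (svf c (F.Y i).vf) * F.iota i) s := by
      intro i
      rw [Module.End.mul_apply, iota_vmul, lm_apply, mul_add, mul_smul_comm, ← mul_assoc,
        ← mul_assoc, svf_mul_svf, smul_mul_assoc, sgn_smul_sgn_smul, Module.End.mul_apply,
        lm_apply, mul_assoc (svf c X.vf)]
    simp only [euler, LinearMap.sum_apply, this, Finset.sum_add_distrib, ← Finset.sum_mul,
      ← Finset.mul_sum, F.sum_ival X]
  have hfn : ∀ (f : R) s, F.euler (sfn c f * s) = sfn c f * F.euler s := by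
    intro f s
    induction f using F.fn_induction with
    | hadd f g h h' => simp only [sfn_add, add_mul, map_add, h, h']
    | hhom q f hf =>
      simp only [euler, LinearMap.sum_apply, Finset.mul_sum]
      refine Finset.sum_congr rfl fun i _ => ?_
      rw [Module.End.mul_apply, iota_fmul, lm_apply, Module.End.mul_apply, lm_apply,
        F.trpow_apply _ hf, sfn_smul, smul_mul_assoc, mul_smul_comm, ← mul_assoc, svf_mul_sfn _ hf,
        smul_mul_assoc, sgn_smul_sgn_smul, mul_assoc]
  rw [hfn]
  induction l generalizing f with
  | nil =>
    have : F.euler 1 = 0 := by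
      rw [← sfn_one (c := c)]
      simp [euler, -sfn_one]
    simp [this]
  | cons X l ih =>
    rw [mon_cons, hv, mul_add, ← mul_assoc, ← mul_assoc]
    induction f using F.fn_induction with
    | hadd f g h h' => simp only [sfn_add, add_mul, smul_add, ← h, ← h']; abel
    | hhom q f hf =>
      have : sfn c f * svf c X.vf = sgn K (X.par * q) • (svf c X.vf * sfn c f) := by
        rw [svf_mul_sfn X hf, sgn_smul_sgn_smul]
      rw [this, smul_mul_assoc, smul_mul_assoc, mul_assoc _ _ (F.euler _), ih f, mul_smul_comm,
        ← mul_assoc, List.length_cons]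
      push_cast
      module

theorem euler_of_mem {n : ℕ} {s : SymT c} (hs : s ∈ symPow c n) : F.euler s = (n : K) • s := by
  induction hs using Submodule.span_induction with
  | mem x h => obtain ⟨f, l, rfl, rfl⟩ := h; exact F.euler_mon f l
  | zero => simp
  | add x y _ _ h h' => rw [map_add, h, h', smul_add]
  | smul a x _ h => rw [map_smul, h, smul_comm]

theorem iota_mem {i : Fin F.N} {n : ℕ} {s : SymT c} (hs : s ∈ symPow c (n + 1)) :
    F.iota i s ∈ symPow c n := by
  have key : ∀ (l : List (HomVF c)), F.iota i (mon l) ∈ symPow c (l.length - 1) := by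
    intro l
    induction l with
    | nil => rw [mon_nil, ← sfn_one, iota_sfn]; exact zero_mem _
    | cons X l ih =>
      rw [mon_cons, iota_vmul]
      refine add_mem (mon_mem _ _) (Submodule.smul_mem _ _ ?_)
      cases l with
      | nil => rw [mon_nil, ← sfn_one, iota_sfn, mul_zero]; exact zero_mem _
      | cons Y l =>
        have := mul_mem_symPow F (svf_mem F X.vf) ih
        rwa [List.length_cons, Nat.add_sub_cancel, add_comm] at this
  induction hs using Submodule.span_induction with
  | mem x h =>
    obtain ⟨f, l, hl, rfl⟩ := h
    rw [iota_fmul]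
    have := mul_mem_symPow F (sfn_mem (F.trpow (F.Y i).par f)) (key l)
    rwa [hl, zero_add, Nat.add_sub_cancel] at this
  | zero => simp
  | add x y _ _ h h' => rw [map_add]; exact add_mem h h'
  | smul a x _ h => rw [map_smul]; exact Submodule.smul_mem _ _ h

theorem iota_zero {i : Fin F.N} {s : SymT c} (hs : s ∈ symPow c 0) : F.iota i s = 0 := by
  rw [eq_sfn_counit hs, iota_sfn]

theorem pr_iota (i : Fin F.N) (n : ℕ) (s : SymT c) :
    pr c n (F.iota i s) = F.iota i (pr c (n + 1) s) := by
  induction s using graded_induction F with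
  | hadd s s' h h' => simp only [map_add, h, h']
  | h m s hs =>
    rw [pr_of_mem hs]
    cases m with
    | zero => simp [F.iota_zero hs]
    | succ m =>
      rw [pr_of_mem (F.iota_mem hs)]
      simp only [add_left_inj]
      split_ifs <;> simp

/-! #### The component in degree one -/

/-- The component of degree `1`, as a vector field. -/
def vpart : SymT c →ₗ[K] Vect c where
  toFun s := ∑ i, F.trpow (F.Y i).par (counit c (F.iota i s)) • (F.Y i).vf
  map_add' s s' := by simp [add_smul, Finset.sum_add_distrib]
  map_smul' a s := by simp [Finset.smul_sum]

theorem vpart_apply (s : SymT c) :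
    F.vpart s = ∑ i, F.trpow (F.Y i).par (counit c (F.iota i s)) • (F.Y i).vf := rfl

@[simp] theorem vpart_svf (X : Vect c) : F.vpart (svf c X) = X := by
  induction X using F.vf_induction with
  | hadd X Y h h' => rw [svf_add, map_add, h, h']
  | hhom X =>
    conv_rhs => rw [F.spec X.vf]
    rw [vpart_apply]
    refine Finset.sum_congr rfl fun i _ => ?_
    rw [iota_vf, counit_sfn, F.trpow_apply _ (F.ival_mem i X), ival, smul_smul, ← sgn_add,
      smul_assoc]
    congr 2
    generalize X.par = a; generalize (F.Y i).par = b; revert a b; decide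

theorem vpart_of_mem {n : ℕ} (hn : n ≠ 1) {s : SymT c} (hs : s ∈ symPow c n) : F.vpart s = 0 := by
  rw [vpart_apply]
  refine Finset.sum_eq_zero fun i _ => ?_
  cases n with
  | zero => rw [F.iota_zero hs]; simp
  | succ n => rw [counit_of_mem (by omega) (F.iota_mem hs)]; simp

theorem vpart_fmul (f : R) (s : SymT c) : F.vpart (sfn c f * s) = f • F.vpart s := by
  rw [vpart_apply, vpart_apply, Finset.smul_sum]
  refine Finset.sum_congr rfl fun i _ => ?_
  have : F.trpow (F.Y i).par (F.trpow (F.Y i).par f) = f := by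
    rcases zmod_two_cases (F.Y i).par with h | h <;> simp [h, trpow]
  rw [iota_fmul, map_mul, map_mul, counit_sfn, this, mul_smul]

theorem svf_vpart (s : SymT c) : svf c (F.vpart s) = pr c 1 s := by
  induction s using sym_induction F with
  | hadd s s' h h' => simp only [map_add, svf_add, h, h']
  | hmon q f hf l =>
    rw [vpart_fmul, svf_fsmul, pr_mon]
    split_ifs with h
    · obtain ⟨X, rfl⟩ := List.length_eq_one_iff.1 h
      rw [mon_singleton, vpart_svf]
    · rw [F.vpart_of_mem h (mon_mem' l), svf_zero, mul_zero]

theorem svf_injective (F : Frame c) {X Y : Vect c} (h : svf c X = svf c Y) : X = Y := by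
  simpa using congrArg F.vpart h

theorem vpart_tauS (s : SymT c) : F.vpart (F.tauS s) = F.tauV (F.vpart s) := by
  induction s using sym_induction F with
  | hadd s s' h h' => simp only [map_add, h, h']
  | hmon q f hf l =>
    rw [map_mul, vpart_fmul, tauS_sfn, vpart_fmul, F.tauV_smul]
    congr 1
    by_cases h : l.length = 1
    · obtain ⟨X, rfl⟩ := List.length_eq_one_iff.1 h
      rw [mon_singleton, tauS_svf, vpart_svf, vpart_svf]
    · rw [mem_spar.1 (mon_mem_spar (F := F) l), map_smul, F.vpart_of_mem h (mon_mem' l)]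
      simp

theorem eq_svf_vpart {s : SymT c} (hs : s ∈ symPow c 1) : s = svf c (F.vpart s) := by
  rw [svf_vpart, pr_of_mem hs, if_pos rfl]

end Frame

end Derivations

/-! ### Covariant derivatives and the PBW map -/

section PBW

variable {K R : Type*} [Field K] [Ring R] [Algebra K R] {c : ℤ → R →ₗ[K] R}

/-! ### Sums over the selection of one factor -/

/-- The sum over all factors `Xₖ` of `X₁ ⊙ ⋯ ⊙ Xₙ`, with the Koszul sign of moving it to the
front. -/
def sel {N : Type*} [AddCommGroup N] [Module K N] (H : HomVF c → List (HomVF c) → N)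
    (l : List (HomVF c)) : N :=
  ∑ k : Fin l.length, usgn K (frontSign l k) • H (l.get k) (l.eraseIdx k)

theorem vect_units_smul (v : ℤˣ) (Z : Vect c) : v • Z = usgn K v • Z := by
  apply Subtype.ext
  rw [Submodule.coe_smul_of_tower, Submodule.coe_smul_of_tower, units_smul (K := K)]

theorem vect_sgn_smul (p : ZMod 2) (Z : Vect c) : (-1 : ℤˣ) ^ p • Z = sgn K p • Z := by
  rw [vect_units_smul, usgn_sgn]

section Sel

variable {N : Type*} [AddCommGroup N] [Module K N]

@[simp] theorem sel_nil (H : HomVF c → List (HomVF c) → N) : sel H [] = 0 := by simp [sel]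

theorem sel_cons (H : HomVF c → List (HomVF c) → N) (X : HomVF c) (l : List (HomVF c)) :
    sel H (X :: l) = H X l + sel (fun Y l' => sgn K (X.par * Y.par) • H Y (X :: l')) l := by
  unfold sel
  refine (Fin.sum_univ_succ (n := l.length) _).trans ?_
  congr 1
  · simp [frontSign, usgn]
  · refine Finset.sum_congr rfl fun k _ => ?_
    have : frontSign (X :: l) k.succ = frontSign l k * (-1 : ℤˣ) ^ (X.par * (l.get k).par) := by
      unfold frontSign
      rw [← uzpow_add]
      congr 1
      simp [lpar_cons]
      ring
    rw [this, usgn_mul, usgn_sgn, mul_smul]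
    rfl

theorem sel_congr {H H' : HomVF c → List (HomVF c) → N} {l : List (HomVF c)}
    (h : ∀ X l', l'.length + 1 = l.length → H X l' = H' X l') : sel H l = sel H' l := by
  refine Finset.sum_congr rfl fun k _ => ?_
  rw [h _ _ (by rw [List.length_eraseIdx_add_one k.2])]

theorem sel_add (H H' : HomVF c → List (HomVF c) → N) (l : List (HomVF c)) :
    sel (fun X l' => H X l' + H' X l') l = sel H l + sel H' l := by
  simp [sel, Finset.sum_add_distrib]

theorem map_sel {N' : Type*} [AddCommGroup N'] [Module K N'] (φ : N →ₗ[K] N')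
    (H : HomVF c → List (HomVF c) → N) (l : List (HomVF c)) :
    φ (sel H l) = sel (fun X l' => φ (H X l')) l := by
  simp [sel]

theorem sum_sel {J : Type*} (s : Finset J) (H : J → HomVF c → List (HomVF c) → N)
    (l : List (HomVF c)) : ∑ j ∈ s, sel (H j) l = sel (fun X l' => ∑ j ∈ s, H j X l') l := by
  simp only [sel, Finset.smul_sum]
  exact Finset.sum_comm

end Sel

namespace Frame

variable (F : Frame c)

theorem iota_mon (i : Fin F.N) (l : List (HomVF c)) :
    F.iota i (mon l) = sel (K := K) (fun X l' => sfn c (F.ival i X) * mon l') l := by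
  induction l with
  | nil => rw [mon_nil, ← sfn_one, iota_sfn, sel_nil]
  | cons X l ih =>
    rw [mon_cons, iota_vmul, ih, sel_cons]
    congr 1
    have := map_sel (K := K) (sgn K ((F.Y i).par * X.par) • lm (svf c X.vf))
      (fun X l' => sfn c (F.ival i X) * mon l') l
    simp only [LinearMap.smul_apply, lm_apply] at this
    rw [this]
    refine sel_congr fun Z l' _ => ?_
    rw [← mul_assoc, svf_mul_sfn X (F.ival_mem i Z), mon_cons, smul_mul_assoc, smul_smul,
      ← sgn_add, mul_assoc]
    congr 2
    generalize X.par = a; generalize Z.par = b; generalize (F.Y i).par = d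
    revert a b d; decide

/-- The bridge from sums over the dual basis to sums over the factors of a monomial: if the family
`T` reproduces `O X` when fed with the components of X, then contracting and applying `T` selects
each factor in turn. -/
theorem sum_iota_mon {N : Type*} [AddCommGroup N] [Module K N] {T : Fin F.N → SymT c →ₗ[K] N}
    {O : HomVF c → SymT c → N} {l : List (HomVF c)}
    (h : ∀ X l', ∑ i, T i (sfn c (F.ival i X) * mon l') = O X (mon l')) :
    ∑ i, T i (F.iota i (mon l)) = sel (fun X l' => O X (mon l')) l := by
  simp only [F.iota_mon, map_sel, sum_sel, h]

/-! ### Covariant and Lie derivatives of symmetric tensors -/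

variable {F} in
theorem IsDer.mem_symPow {p : ZMod 2} {d : Op c} (hd : F.IsDer p d)
    (hf : ∀ f, d (sfn c f) ∈ symPow c 0) (hX : ∀ X, d (svf c X) ∈ symPow c 1) {n : ℕ} {s : SymT c}
    (hs : s ∈ symPow c n) : d s ∈ symPow c n := by
  have key : ∀ l : List (HomVF c), d (mon l) ∈ symPow c l.length := by
    intro l
    induction l with
    | nil => simpa using hf 1
    | cons X l ih =>
      rw [mon_cons, hd.leib, List.length_cons, add_comm]
      refine add_mem (mul_mem_symPow F (hX _) (mon_mem' l)) (mul_mem_symPow F ?_ ih)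
      rw [tpow_svf]; exact svf_mem F _
  induction hs using Submodule.span_induction with
  | mem x h =>
    obtain ⟨f, l, rfl, rfl⟩ := h
    rw [hd.leib, ← zero_add l.length]
    refine add_mem (mul_mem_symPow F (hf f) (mon_mem' l)) (mul_mem_symPow F ?_ (key l))
    rw [tpow_sfn]; exact sfn_mem _
  | zero => simp
  | add x y _ _ h h' => rw [map_add]; exact add_mem h h'
  | smul a x _ h => rw [map_smul]; exact Submodule.smul_mem _ _ h

/-- Derivations of the symmetric algebra that come from functions and vector fields. -/
structure IsTan (p : ZMod 2) (d : Op c) : Prop extends F.IsDer p d where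
  fn : ∀ f, ∃ g, d (sfn c f) = sfn c g
  vf : ∀ X, ∃ Y, d (svf c X) = svf c Y

variable {F} in
theorem IsTan.mem {p : ZMod 2} {d : Op c} (hd : F.IsTan p d) {n : ℕ} {s : SymT c}
    (hs : s ∈ symPow c n) : d s ∈ symPow c n :=
  hd.toIsDer.mem_symPow (fun f => by obtain ⟨g, h⟩ := hd.fn f; rw [h]; exact sfn_mem g)
    (fun f => by obtain ⟨g, h⟩ := hd.vf f; rw [h]; exact svf_mem F g) hs

variable {F} in
theorem IsTan.pr {p : ZMod 2} {d : Op c} (hd : F.IsTan p d) (n : ℕ) (s : SymT c) :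
    pr c n (d s) = d (pr c n s) := by
  induction s using graded_induction F with
  | hadd s s' h h' => simp only [map_add, h, h']
  | h m s hs =>
    rw [pr_of_mem hs, pr_of_mem (hd.mem hs)]
    split_ifs <;> simp

theorem tauV_nabla (D : Connection c) (X : HomVF c) (Z : Vect c) :
    F.tauV (D.nabla X.vf Z) = sgn K X.par • D.nabla X.vf (F.tauV Z) := by
  induction Z using F.vf_induction with
  | hadd Z W h h' => simp only [map_add, smul_add, h, h']
  | hhom Z =>
    have := F.tauV_vf (D.ap X Z)
    rw [F.tauV_vf, map_smul, smul_smul, ← sgn_add]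
    exact this

theorem tauR_der (X : HomVF c) (f : R) : F.tauR (X.der f) = sgn K X.par • X.der (F.tauR f) := by
  have := F.tauR_vect X.vf f
  rw [F.tauV_vf] at this
  exact this

theorem nabla_leibniz (D : Connection c) (X : HomVF c) (f : R) (Z : Vect c) :
    D.nabla X.vf (f • Z) = X.der f • Z + F.trpow X.par f • D.nabla X.vf Z := by
  induction f using F.fn_induction with
  | hadd f g h h' => simp only [add_smul, map_add, h, h']; abel
  | hhom q f hf =>
    rw [D.leibniz q f hf X Z, F.trpow_apply _ hf, vect_sgn_smul (K := K), smul_assoc]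

theorem der_leibniz (X : HomVF c) (f g : R) :
    X.der (f * g) = X.der f * g + F.trpow X.par f * X.der g := by
  induction f using F.fn_induction with
  | hadd f g h h' => simp only [add_mul, map_add, h, h']; abel
  | hhom q f hf =>
    rw [X.mem.2 q f hf g, F.trpow_apply _ hf, units_smul (K := K), usgn_sgn, smul_mul_assoc]

theorem exists_nab (D : Connection c) (X : HomVF c) : ∃ d : Op c, F.IsDer X.par d ∧
    (∀ f, d (sfn c f) = sfn c (X.der f)) ∧ ∀ Z, d (svf c Z) = svf c (D.nabla X.vf Z) :=
  F.exists_der X.par ((sfnA c).toLinearMap ∘ₗ X.der) (svfL c ∘ₗ D.nabla X.vf)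
    (fun f => by
      change F.tauS (sfn c _) = _ • sfn c _
      rw [tauS_sfn, tauR_der, sfn_smul])
    (fun Z => by
      change F.tauS (svf c _) = _ • svf c _
      rw [tauS_svf, tauV_nabla, svf_smul])
    (fun f g => by
      change sfn c _ = sfn c _ * _ + _ * sfn c _
      rw [tpow_sfn, ← sfn_mul, ← sfn_mul, ← sfn_add, F.der_leibniz])
    (fun f Z => by
      change svf c _ = sfn c _ * _ + _ * svf c _
      rw [tpow_sfn, ← svf_fsmul, ← svf_fsmul, ← svf_add, F.nabla_leibniz])

/-- The covariant derivative `∇_X` of symmetric tensors. -/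
def nab (D : Connection c) (X : HomVF c) : Op c := (F.exists_nab D X).choose

theorem nab_der (D : Connection c) (X : HomVF c) : F.IsDer X.par (F.nab D X) :=
  (F.exists_nab D X).choose_spec.1

theorem nab_sfn (D : Connection c) (X : HomVF c) (f : R) :
    F.nab D X (sfn c f) = sfn c (X.der f) := (F.exists_nab D X).choose_spec.2.1 f

theorem nab_svf (D : Connection c) (X : HomVF c) (Z : Vect c) :
    F.nab D X (svf c Z) = svf c (D.nabla X.vf Z) := (F.exists_nab D X).choose_spec.2.2 Z

theorem nab_tan (D : Connection c) (X : HomVF c) : F.IsTan X.par (F.nab D X) :=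
  ⟨F.nab_der D X, fun f => ⟨_, F.nab_sfn D X f⟩, fun Z => ⟨_, F.nab_svf D X Z⟩⟩

/-- The Lie bracket with a homogeneous vector field. -/
def lieV (Z : HomVF c) : Vect c →ₗ[K] Vect c where
  toFun X := ⟨Z.der * X.1 - (F.tvpow Z.par X).1 * Z.der, by
    induction X using F.vf_induction with
    | hadd X Y h h' =>
      rw [map_add, Submodule.coe_add, Submodule.coe_add, mul_add, add_mul, add_sub_add_comm]
      exact add_mem h h'
    | hhom X =>
      have := (Z.lie X).vf.2
      rw [HomVF.vf_coe, HomVF.lie] at this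
      simp only [sgn_smul (K := K)] at this
      rw [F.tvpow_vf, Submodule.coe_smul_of_tower, smul_mul_assoc]
      exact this⟩
  map_add' X Y := Subtype.ext (by simp [mul_add, add_mul]; abel)
  map_smul' a X := Subtype.ext (by simp [smul_sub])

theorem lieV_vf (Z X : HomVF c) : F.lieV Z X.vf = (Z.lie X).vf := by
  apply Subtype.ext
  change Z.der * X.der - (F.tvpow Z.par X.vf).1 * Z.der = (Z.lie X).der
  rw [F.tvpow_vf, HomVF.lie, Submodule.coe_smul_of_tower, smul_mul_assoc]
  simp only [sgn_smul (K := K)]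
  rfl

theorem lieV_fsmul (Z : HomVF c) (f : R) (X : Vect c) :
    F.lieV Z (f • X) = Z.der f • X + F.trpow Z.par f • F.lieV Z X := by
  apply Subtype.ext
  ext g
  change Z.der (f * X.1 g) - (F.tvpow Z.par (f • X)).1 (Z.der g) = Z.der f * X.1 g +
    F.trpow Z.par f * (Z.der (X.1 g) - (F.tvpow Z.par X).1 (Z.der g))
  rw [F.der_leibniz, F.tvpow_smul, mul_sub]
  change _ - F.trpow Z.par f * _ = _
  abel

theorem tauV_lieV (Z : HomVF c) (X : Vect c) :
    F.tauV (F.lieV Z X) = sgn K Z.par • F.lieV Z (F.tauV X) := by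
  induction X using F.vf_induction with
  | hadd Z W h h' => simp only [map_add, smul_add, h, h']
  | hhom X => rw [F.lieV_vf, F.tauV_vf, F.tauV_vf, map_smul, F.lieV_vf, smul_smul, ← sgn_add]; rfl

theorem exists_lied (Z : HomVF c) : ∃ d : Op c, F.IsDer Z.par d ∧
    (∀ f, d (sfn c f) = sfn c (Z.der f)) ∧ ∀ X, d (svf c X) = svf c (F.lieV Z X) :=
  F.exists_der Z.par ((sfnA c).toLinearMap ∘ₗ Z.der) (svfL c ∘ₗ F.lieV Z)
    (fun f => by
      change F.tauS (sfn c _) = _ • sfn c _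
      rw [tauS_sfn, tauR_der, sfn_smul])
    (fun X => by
      change F.tauS (svf c _) = _ • svf c _
      rw [tauS_svf, tauV_lieV, svf_smul])
    (fun f g => by
      change sfn c _ = sfn c _ * _ + _ * sfn c _
      rw [tpow_sfn, ← sfn_mul, ← sfn_mul, ← sfn_add, F.der_leibniz])
    (fun f X => by
      change svf c _ = sfn c _ * _ + _ * svf c _
      rw [tpow_sfn, ← svf_fsmul, ← svf_fsmul, ← svf_add, F.lieV_fsmul])

/-- The Lie derivative of symmetric tensors. -/
def lied (Z : HomVF c) : Op c := (F.exists_lied Z).choose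

theorem lied_der (Z : HomVF c) : F.IsDer Z.par (F.lied Z) := (F.exists_lied Z).choose_spec.1

theorem lied_sfn (Z : HomVF c) (f : R) : F.lied Z (sfn c f) = sfn c (Z.der f) :=
  (F.exists_lied Z).choose_spec.2.1 f

theorem lied_svf (Z : HomVF c) (X : Vect c) : F.lied Z (svf c X) = svf c (F.lieV Z X) :=
  (F.exists_lied Z).choose_spec.2.2 X

theorem lied_tan (Z : HomVF c) : F.IsTan Z.par (F.lied Z) :=
  ⟨F.lied_der Z, fun f => ⟨_, F.lied_sfn Z f⟩, fun X => ⟨_, F.lied_svf Z X⟩⟩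

theorem nab_mon (D : Connection c) (X : HomVF c) (l : List (HomVF c)) :
    F.nab D X (mon l) = D.onMon X l := by
  induction l with
  | nil =>
    have : X.der 1 = 0 := by simpa [trpow] using F.der_leibniz X 1 1
    rw [mon_nil, ← sfn_one, nab_sfn, this, sfn_zero]; rfl
  | cons Y l ih =>
    rw [mon_cons, (F.nab_der D X).leib, ih, nab_svf, tpow_of_mem (svf_mem_spar Y), Connection.onMon,
      units_smul (K := K), usgn_sgn, smul_mul_assoc]
    rfl

theorem lied_mon (Q : Homological c) (l : List (HomVF c)) :
    F.lied Q.hom (mon l) = Q.onMon l := by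
  induction l with
  | nil =>
    have : Q.hom.der 1 = 0 := by simpa [trpow] using F.der_leibniz Q.hom 1 1
    rw [mon_nil, ← sfn_one, lied_sfn, this, sfn_zero]; rfl
  | cons Y l ih =>
    rw [mon_cons, (F.lied_der Q.hom).leib, ih, lied_svf, lieV_vf, tpow_of_mem (svf_mem_spar Y),
      Homological.onMon, units_smul (K := K), usgn_sgn, smul_mul_assoc]
    congr 4
    exact one_mul _

theorem der_eq (X : HomVF c) (f : R) :
    X.der f = ∑ i, sgn K (F.Y i).par • (X.der (F.g i) * (F.Y i).der f) := by
  have := congrArg (fun Z : Vect c => Z.1 f) (F.spec X.vf)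
  simpa using this

theorem nab_eq (D : Connection c) (X : HomVF c) :
    F.nab D X = ∑ i, sgn K (F.Y i).par • (lm (sfn c (X.der (F.g i))) * F.nab D (F.Y i)) := by
  refine (F.nab_der D X).ext (IsDer.sum fun i _ => IsDer.smul ?_ _) (fun f => ?_) fun Z => ?_
  · have := (F.nab_der D (F.Y i)).fmul (X.mem.1 _ _ (F.g_mem i))
    rwa [add_assoc, zmod_add_self, add_zero] at this
  · simp only [nab_sfn, LinearMap.sum_apply, LinearMap.smul_apply, Module.End.mul_apply, lm_apply,
      ← sfn_mul, ← sfn_smul, ← sfn_sum]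
    congr 1
    exact F.der_eq X f
  · simp only [nab_svf, LinearMap.sum_apply, LinearMap.smul_apply, Module.End.mul_apply, lm_apply,
      ← svf_fsmul, ← svf_smul, ← svf_sum]
    congr 1
    conv_lhs => rw [F.spec X.vf]
    simp only [map_sum, map_smul, LinearMap.sum_apply, LinearMap.smul_apply, D.smul_left]
    rfl

/-! ### The Poincaré–Birkhoff–Witt map -/

/-- The restriction of `pbw` to the symmetric powers. -/
def pbwN (D : Connection c) : ℕ → SymT c →ₗ[K] Module.End K R
  | 0 => LinearMap.mul K R ∘ₗ (counit c).toLinearMap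
  | n + 1 => ((n + 1 : ℕ) : K)⁻¹ • ∑ i,
      (LinearMap.mulLeft K (F.Y i).der ∘ₗ pbwN D n ∘ₗ F.iota i
        - pbwN D n ∘ₗ F.nab D (F.Y i) ∘ₗ F.iota i)

/-- The map `pbw`, with values in the operators on functions. -/
def pbw (D : Connection c) : SymT c →ₗ[K] Module.End K R :=
  Polynomial.lsum (fun n => F.pbwN D n) ∘ₗ (degHom c).toLinearMap

theorem degHom_of_mem {n : ℕ} {s : SymT c} (hs : s ∈ symPow c n) :
    degHom c s = Polynomial.monomial n s := by
  ext k
  rw [Polynomial.coeff_monomial]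
  exact pr_of_mem hs k

theorem pbw_of_mem (D : Connection c) {n : ℕ} {s : SymT c} (hs : s ∈ symPow c n) :
    F.pbw D s = F.pbwN D n s := by
  change Polynomial.lsum _ (degHom c s) = _
  rw [degHom_of_mem hs, Polynomial.lsum_apply, Polynomial.sum_monomial_index]
  simp

theorem mulLeft_mul (f g : R) : LinearMap.mulLeft K (f * g) =
    (LinearMap.mulLeft K f * LinearMap.mulLeft K g : Module.End K R) := by
  ext; simp

theorem der_mulLeft (X : HomVF c) (f : R) : (X.der * LinearMap.mulLeft K f : Module.End K R) =
    LinearMap.mulLeft K (X.der f) + LinearMap.mulLeft K (F.trpow X.par f) * X.der := by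
  ext g; simp [F.der_leibniz]

@[simp] theorem pbw_sfn (D : Connection c) (f : R) : F.pbw D (sfn c f) = LinearMap.mulLeft K f := by
  rw [F.pbw_of_mem D (sfn_mem f)]
  ext g
  simp [pbwN]

/-- The factor 1/n of the recursion is absorbed into the Euler operator. In this form it is linear
in `s` and also holds in degree 0, where both sides vanish. -/
theorem pbw_euler [CharZero K] (D : Connection c) (s : SymT c) :
    F.pbw D (F.euler s) = ∑ i, ((F.Y i).der * F.pbw D (F.iota i s)
      - F.pbw D (F.nab D (F.Y i) (F.iota i s))) := by
  induction s using graded_induction F with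
  | hadd s s' h h' =>
    simp only [map_add, h, h', ← Finset.sum_add_distrib]
    refine Finset.sum_congr rfl fun i _ => ?_
    rw [mul_add]; abel
  | h n s hs =>
    rw [F.euler_of_mem hs, map_smul, F.pbw_of_mem D hs]
    cases n with
    | zero => simp [F.iota_zero hs]
    | succ n =>
      simp only [pbwN, LinearMap.smul_apply, LinearMap.sum_apply, LinearMap.sub_apply,
        LinearMap.comp_apply, LinearMap.mulLeft_apply]
      rw [smul_inv_smul₀ (by exact_mod_cast n.succ_ne_zero)]
      refine Finset.sum_congr rfl fun i _ => ?_
      rw [F.pbw_of_mem D (F.iota_mem hs), F.pbw_of_mem D ((F.nab_tan D _).mem (F.iota_mem hs))]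

/-- Composing Yᵢ with multiplication by f produces the extra term Yᵢ(f), and so does the Leibniz
rule for ∇_{Yᵢ}; the two cancel. -/
theorem pbwN_fmul (D : Connection c) (n : ℕ) (f : R) (s : SymT c) :
    F.pbwN D n (sfn c f * s) = LinearMap.mulLeft K f * F.pbwN D n s := by
  induction n generalizing f s with
  | zero => ext g; simp [pbwN, mul_assoc]
  | succ n ih =>
    simp only [pbwN, LinearMap.smul_apply, LinearMap.sum_apply, LinearMap.sub_apply,
      LinearMap.comp_apply, LinearMap.mulLeft_apply, mul_smul_comm, Finset.mul_sum]
    congr 1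
    refine Finset.sum_congr rfl fun i _ => ?_
    have hh : F.trpow (F.Y i).par (F.trpow (F.Y i).par f) = f := by
      rcases zmod_two_cases (F.Y i).par with h | h <;> simp [h, trpow]
    rw [iota_fmul, ih, (F.nab_der D _).leib, nab_sfn, map_add, ih, tpow_sfn, ih, ← mul_assoc,
      F.der_mulLeft, hh, mul_sub, add_mul, mul_assoc]
    abel

theorem pbw_fmul (D : Connection c) (f : R) (s : SymT c) :
    F.pbw D (sfn c f * s) = LinearMap.mulLeft K f * F.pbw D s := by
  induction s using graded_induction F with
  | hadd s s' h h' => simp only [map_add, mul_add, h, h']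
  | h n s hs =>
    have := mul_mem_symPow F (sfn_mem f) hs
    rw [zero_add] at this
    rw [F.pbw_of_mem D hs, F.pbw_of_mem D this, pbwN_fmul]

/-- The operators `X · pbw(-) - pbw(∇_X -)` are tensorial in `X`. -/
theorem pbw_tensorial (D : Connection c) (X : HomVF c) (s : SymT c) :
    ∑ i, ((F.Y i).der * F.pbw D (sfn c (F.ival i X) * s)
      - F.pbw D (F.nab D (F.Y i) (sfn c (F.ival i X) * s)))
      = X.der * F.pbw D s - F.pbw D (F.nab D X s) := by
  have e1 : X.der * F.pbw D s = ∑ i, sgn K (F.Y i).par •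
      (LinearMap.mulLeft K (X.der (F.g i)) * ((F.Y i).der * F.pbw D s)) := by
    ext f
    simp only [Module.End.mul_apply, LinearMap.sum_apply, LinearMap.smul_apply,
      LinearMap.mulLeft_apply]
    exact F.der_eq X _
  have e2 : F.pbw D (F.nab D X s) = ∑ i, sgn K (F.Y i).par •
      (LinearMap.mulLeft K (X.der (F.g i)) * F.pbw D (F.nab D (F.Y i) s)) := by
    rw [F.nab_eq D X]
    simp only [LinearMap.sum_apply, LinearMap.smul_apply, Module.End.mul_apply, lm_apply, map_sum,
      map_smul, pbw_fmul]
  rw [e1, e2, ← Finset.sum_sub_distrib]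
  refine Finset.sum_congr rfl fun i _ => ?_
  rw [pbw_fmul, (F.nab_der D _).leib, nab_sfn, map_add, tpow_sfn, pbw_fmul, pbw_fmul, ← mul_assoc,
    F.der_mulLeft, add_mul, add_sub_add_left_eq_sub, F.trpow_apply _ (F.ival_mem i X), ival,
    smul_smul, ← sgn_add]
  have : (F.Y i).par * (X.par + (F.Y i).par) + X.par * (F.Y i).par = (F.Y i).par := by
    generalize (F.Y i).par = a; generalize X.par = b; revert a b; decide
  rw [this]
  have hm : ∀ (a : K) (f : R), (LinearMap.mulLeft K (a • f) : Module.End K R) =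
      a • LinearMap.mulLeft K f := fun a f => by ext; simp
  rw [hm, smul_mul_assoc, smul_mul_assoc, smul_mul_assoc, mul_assoc]

theorem pbw_mon [CharZero K] (D : Connection c) (l : List (HomVF c)) :
    (l.length : K) • F.pbw D (mon l) = sel (fun X l' => X.der * F.pbw D (mon l')
      - F.pbw D (F.nab D X (mon l'))) l := by
  rw [← map_smul, ← F.euler_of_mem (mon_mem' l), pbw_euler]
  exact F.sum_iota_mon (T := fun i => LinearMap.mulLeft K (F.Y i).der ∘ₗ F.pbw D -
    F.pbw D ∘ₗ F.nab D (F.Y i)) (O := fun X s => X.der * F.pbw D s - F.pbw D (F.nab D X s))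
    (fun X l' => F.pbw_tensorial D X (mon l'))

theorem nab_one (D : Connection c) (X : HomVF c) : F.nab D X 1 = 0 := by
  have := F.nab_mon D X []
  exact this

@[simp] theorem pbw_one (D : Connection c) : F.pbw D 1 = 1 := by
  rw [← sfn_one (c := c), pbw_sfn]; ext; simp

@[simp] theorem pbw_svf [CharZero K] (D : Connection c) (X : Vect c) :
    F.pbw D (svf c X) = X.1 := by
  induction X using F.vf_induction with
  | hadd X Y h h' => rw [svf_add, map_add, h, h']; rfl
  | hhom X =>
    have := F.pbw_mon D [X]
    rw [sel_cons, sel_nil, mon_singleton] at this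
    simpa [nab_one] using this

theorem tauS_mem {n : ℕ} {s : SymT c} (hs : s ∈ symPow c n) : F.tauS s ∈ symPow c n := by
  induction hs using Submodule.span_induction with
  | mem x h =>
    obtain ⟨f, l, rfl, rfl⟩ := h
    rw [map_mul, tauS_sfn, mem_spar.1 (mon_mem_spar (F := F) l), mul_smul_comm]
    exact Submodule.smul_mem _ _ (mon_mem _ _)
  | zero => simp
  | add x y _ _ h h' => rw [map_add]; exact add_mem h h'
  | smul a x _ h => rw [map_smul]; exact Submodule.smul_mem _ _ h

theorem pbw_tauS (D : Connection c) (s : SymT c) : F.pbw D (F.tauS s) = F.conjR (F.pbw D s) := by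
  have key : ∀ n s, F.pbwN D n (F.tauS s) = F.conjR (F.pbwN D n s) := by
    intro n
    induction n with
    | zero =>
      intro s
      have : counit c (F.tauS s) = F.tauR (counit c s) := by
        have : (counit c).comp F.tauS = F.tauR.comp (counit c) := sym_hom_ext (by simp) (by simp)
        exact DFunLike.congr_fun this s
      ext f
      simp [pbwN, this, conjR_apply]
    | succ n ih =>
      intro s
      simp only [pbwN, LinearMap.smul_apply, LinearMap.sum_apply, LinearMap.sub_apply,
        LinearMap.comp_apply, LinearMap.mulLeft_apply, map_smul, map_sum, map_sub, F.conjR_mul,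
        F.conjR_of_mem (F.Y _).mem, ← ih, (F.iota_der _).tau, (F.nab_der D _).tau,
        mul_smul_comm, smul_mul_assoc, sgn_smul_sgn_smul]
  induction s using graded_induction F with
  | hadd s s' h h' => simp only [map_add, h, h']
  | h n s hs => rw [F.pbw_of_mem D hs, F.pbw_of_mem D (F.tauS_mem hs), key]

theorem pbw_mem (D : Connection c) (s : SymT c) : F.pbw D s ∈ DiffOp c := by
  have key : ∀ n s, F.pbwN D n s ∈ DiffOp c := by
    intro n
    induction n with
    | zero =>
      intro s
      exact Algebra.subset_adjoin (Or.inl ⟨counit c s, rfl⟩)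
    | succ n ih =>
      intro s
      simp only [pbwN, LinearMap.smul_apply, LinearMap.sum_apply, LinearMap.sub_apply,
        LinearMap.comp_apply, LinearMap.mulLeft_apply]
      refine Subalgebra.smul_mem _ (Subalgebra.sum_mem _ fun i _ => Subalgebra.sub_mem _
        (Subalgebra.mul_mem _ ?_ (ih _)) (ih _)) _
      exact Algebra.subset_adjoin (Or.inr (F.Y i).vf.2)
  induction s using graded_induction F with
  | hadd s s' h h' => rw [map_add]; exact Subalgebra.add_mem _ h h'
  | h n s hs => rw [F.pbw_of_mem D hs]; exact key n s

end Frame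

end PBW

/-! ### Bijectivity of the PBW map -/

section Bijectivity

variable {K R : Type*} [Field K] [Ring R] [Algebra K R] {c : ℤ → R →ₗ[K] R}

/-! ### Locally finite sums of operators -/

/-- The sum of a family of operators of which the `n`-th kills the elements of degree less than
`n`. -/
def locSum (a : ℕ → Op c) : Op c :=
  Polynomial.lsum (fun m => ∑ n ∈ Finset.range (m + 1), a n) ∘ₗ (degHom c).toLinearMap

theorem locSum_of_mem (a : ℕ → Op c) {m : ℕ} {s : SymT c} (hs : s ∈ symPow c m) :
    locSum a s = ∑ n ∈ Finset.range (m + 1), a n s := by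
  change Polynomial.lsum _ (degHom c s) = _
  rw [Frame.degHom_of_mem hs, Polynomial.lsum_apply, Polynomial.sum_monomial_index] <;> simp

theorem locSum_apply (F : Frame c) {a : ℕ → Op c}
    (ha : ∀ n m, m < n → ∀ s ∈ symPow c m, a n s = 0) {N : ℕ} {s : SymT c} (hs : s ∈ fil c N) :
    locSum a s = ∑ n ∈ Finset.range N, a n s := by
  conv_lhs => rw [← sum_pr F hs, map_sum]
  conv_rhs => rw [← sum_pr F hs]
  simp only [map_sum]
  rw [Finset.sum_comm]
  refine Finset.sum_congr rfl fun m hm => ?_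
  rw [locSum_of_mem a (pr_mem F m s)]
  refine Finset.sum_subset (fun n hn => ?_) fun n _ hn => ?_
  · simp only [Finset.mem_range] at *; omega
  · exact ha n m (by simpa using hn) _ (pr_mem F m s)

theorem locSum_mem_cent (F : Frame c) {S : ZMod 2 → Set (Op c)} {p : ZMod 2} {a : ℕ → Op c}
    (ha : ∀ n m, m < n → ∀ s ∈ symPow c m, a n s = 0) (h : ∀ n, a n ∈ cent K S p) :
    locSum a ∈ cent K S p := by
  intro q u hu
  ext s
  obtain ⟨N, hN⟩ := exists_fil s
  obtain ⟨N', hN'⟩ := exists_fil (u s)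
  have h1 := fil_mono (le_max_left N N') hN
  have h2 := fil_mono (le_max_right N N') hN'
  simp only [br, LinearMap.sub_apply, LinearMap.smul_apply, Module.End.mul_apply,
    locSum_apply F ha h1, locSum_apply F ha h2, map_sum, Finset.smul_sum]
  rw [← Finset.sum_sub_distrib]
  refine Finset.sum_eq_zero fun n _ => ?_
  exact congrArg (fun x : Op c => x s) (h n q u hu)

namespace Frame

variable (F : Frame c)

/-! ### The centralizer of functions and contractions -/

/-- The multiplications by functions and the contractions. -/
def gens (q : ZMod 2) : Set (Op c) :=
  {a | (∃ f ∈ par c q, a = lm (sfn c f)) ∨ ∃ i, (F.Y i).par = q ∧ a = F.iota i}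

theorem lm_mem_cent2 {q : ZMod 2} {f : R} (hf : f ∈ par c q) :
    lm (sfn c f) ∈ cent2 K F.gens q := mem_cent2 (Or.inl ⟨f, hf, rfl⟩)

theorem iota_mem_cent2 (i : Fin F.N) : F.iota i ∈ cent2 K F.gens (F.Y i).par :=
  mem_cent2 (Or.inr ⟨i, rfl, rfl⟩)

theorem br_der_lm {p q : ZMod 2} {d : Op c} (hd : F.IsDer p d) {f : R} (hf : f ∈ par c q) :
    br K p q d (lm (sfn c f)) = lm (d (sfn c f)) := by
  ext s
  simp only [br, LinearMap.sub_apply, LinearMap.smul_apply, Module.End.mul_apply, lm_apply]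
  rw [hd.leib, tpow_of_mem (sfn_mem_spar hf), smul_mul_assoc, add_sub_cancel_right]

theorem br_iota_iota (i j : Fin F.N) :
    br K (F.Y i).par (F.Y j).par (F.iota i) (F.iota j) = 0 := by
  refine ((F.iota_der i).brDer (F.iota_der j)).ext (IsDer.zero _) (fun f => ?_) fun X => ?_ <;>
  simp [br, iota_vf]

theorem iota_mem_cent (i : Fin F.N) : F.iota i ∈ cent K F.gens (F.Y i).par := by
  rintro q s (⟨f, hf, rfl⟩ | ⟨j, rfl, rfl⟩)
  · rw [F.br_der_lm (F.iota_der i) hf, iota_sfn]; ext; simp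
  · exact F.br_iota_iota i j

/-- A derivation that kills functions and maps vector fields to functions is a combination of
contractions. -/
theorem der_eq_sum_iota {p : ZMod 2} {d : Op c} (hd : F.IsDer p d) (hf : ∀ f, d (sfn c f) = 0)
    {w : Fin F.N → R} (hw : ∀ i, w i ∈ par c (p + (F.Y i).par))
    (hX : ∀ i, d (svf c (F.Y i).vf) = sfn c (w i)) :
    d = ∑ i, lm (sfn c (w i)) * F.iota i := by
  refine hd.ext (IsDer.sum fun i _ => ?_) (fun f => ?_) fun X => ?_
  · have := (F.iota_der i).fmul (hw i)
    rwa [add_assoc, zmod_add_self, add_zero] at this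
  · simp [hf]
  · rw [← F.sum_ival X, map_sum]
    simp only [hd.leib, hf, mul_zero, add_zero, hX, LinearMap.sum_apply, Module.End.mul_apply,
      lm_apply, sum_ival, iota_vf]

/-- The bracket of `d` with a function is a function. Its bracket with a contraction is a derivation
that kills functions and sends vector fields to functions, hence a combination of contractions. Both
are in the double centralizer, so `mem_centNorm` applies. -/
theorem tan_mem_centNorm {p : ZMod 2} {d : Op c} (hd : F.IsTan p d) [CharZero K] :
    d ∈ centNorm K F.gens p := by
  refine mem_centNorm ?_
  rintro q s (⟨f, hf, rfl⟩ | ⟨j, rfl, rfl⟩)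
  · rw [F.br_der_lm hd.toIsDer hf]
    obtain ⟨g, hg⟩ := hd.fn f
    rw [hg]
    refine F.lm_mem_cent2 (F.mem_par_of_tauR (sfn_injective (c := c) ?_))
    rw [← tauS_sfn, ← hg, hd.tau, tauS_sfn, F.tauR_apply hf, sfn_smul, map_smul, hg, smul_smul,
      ← sgn_add, sfn_smul]
  · have hb := hd.toIsDer.brDer (F.iota_der j)
    have h1 : ∀ i, ∃ w, br K p (F.Y j).par d (F.iota j) (svf c (F.Y i).vf) = sfn c w := by
      intro i
      obtain ⟨Z, hZ⟩ := hd.vf (F.Y i).vf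
      obtain ⟨g, hg⟩ := hd.fn (F.ival j (F.Y i))
      refine ⟨g - sgn K (p * (F.Y j).par) • (F.tvpow (F.Y j).par Z).1 (F.g j), ?_⟩
      simp only [br, LinearMap.sub_apply, LinearMap.smul_apply, Module.End.mul_apply, iota_vf, hZ,
        iota_svf F j Z, hg, sfn_sub, sfn_smul]
    choose w hw using h1
    have hwp : ∀ i, w i ∈ par c (p + (F.Y j).par + (F.Y i).par) := by
      intro i
      refine F.mem_par_of_tauR (sfn_injective (c := c) ?_)
      rw [← tauS_sfn, ← hw, hb.tau, tauS_svf, F.tauV_vf, svf_smul, map_smul, hw, smul_smul,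
        ← sgn_add, sfn_smul]
    have h0 : ∀ f, br K p (F.Y j).par d (F.iota j) (sfn c f) = 0 := by
      intro f
      obtain ⟨g, hg⟩ := hd.fn f
      simp [br, hg]
    rw [F.der_eq_sum_iota hb h0 hwp hw]
    refine sum_mem fun i _ => ?_
    have := mul_mem_cent2 (F.lm_mem_cent2 (hwp i)) (F.iota_mem_cent2 i)
    rwa [add_assoc, zmod_add_self, add_zero] at this

/-! ### Right multiplication by functions, transported by `pbw` -/

/-- The homogeneous components of `rho`. -/
def rhoN (D : Connection c) (p : ZMod 2) (g : R) : ℕ → Op c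
  | 0 => lm (sfn c g)
  | n + 1 => ((n + 1 : ℕ) : K)⁻¹ • ∑ k, sgn K ((F.Y k).par * p) •
      (br K (F.Y k).par p (F.nab D (F.Y k)) (rhoN D p g n) * F.iota k)

/-- The operator on the symmetric algebra that corresponds to the right multiplication by a
function. -/
def rho (D : Connection c) (p : ZMod 2) (g : R) : Op c := locSum (F.rhoN D p g)

theorem rhoN_zero_of_lt (D : Connection c) (p : ZMod 2) (g : R) (n m : ℕ) (h : m < n) (s : SymT c)
    (hs : s ∈ symPow c m) : F.rhoN D p g n s = 0 := by
  induction n generalizing m s with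
  | zero => omega
  | succ n ih =>
    simp only [rhoN, LinearMap.smul_apply, LinearMap.sum_apply, Module.End.mul_apply]
    rw [Finset.sum_eq_zero, smul_zero]
    intro k _
    cases m with
    | zero => rw [F.iota_zero hs, map_zero, smul_zero]
    | succ m =>
      have h1 := F.iota_mem (i := k) hs
      simp only [br, LinearMap.sub_apply, LinearMap.smul_apply, Module.End.mul_apply]
      rw [ih m (by omega) _ h1, ih m (by omega) _ ((F.nab_tan D _).mem h1)]
      simp

theorem rhoN_mem (D : Connection c) (p : ZMod 2) (g : R) (n m : ℕ) (s : SymT c)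
    (hs : s ∈ symPow c (m + n)) : F.rhoN D p g n s ∈ symPow c m := by
  induction n generalizing s with
  | zero =>
    have := mul_mem_symPow F (sfn_mem g) hs
    simpa [rhoN] using this
  | succ n ih =>
    simp only [rhoN, LinearMap.smul_apply, LinearMap.sum_apply, Module.End.mul_apply]
    refine Submodule.smul_mem _ _ (sum_mem fun k _ => Submodule.smul_mem _ _ ?_)
    have h1 := F.iota_mem (i := k) hs
    simp only [br, LinearMap.sub_apply, LinearMap.smul_apply, Module.End.mul_apply]
    exact sub_mem ((F.nab_tan D _).mem (ih _ h1))
      (Submodule.smul_mem _ _ (ih _ ((F.nab_tan D _).mem h1)))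

theorem pr_rhoN (D : Connection c) (p : ZMod 2) (g : R) (n m : ℕ) (s : SymT c) :
    pr c m (F.rhoN D p g n s) = F.rhoN D p g n (pr c (m + n) s) := by
  induction s using graded_induction F with
  | hadd s s' h h' => simp only [map_add, h, h']
  | h k s hs =>
    rw [pr_of_mem hs]
    rcases lt_or_ge k n with h | h
    · have := F.rhoN_zero_of_lt D p g n k h s hs
      split_ifs <;> simp [this]
    · obtain ⟨j, rfl⟩ := Nat.exists_eq_add_of_le' h
      rw [pr_of_mem (F.rhoN_mem D p g n j s hs)]
      by_cases h : j = m
      · simp [h]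
      · rw [if_neg h, if_neg (by omega), map_zero]

theorem rhoN_mem_cent2 [CharZero K] (D : Connection c) {p : ZMod 2} {g : R} (hg : g ∈ par c p)
    (n : ℕ) : F.rhoN D p g n ∈ cent2 K F.gens p := by
  induction n with
  | zero => exact F.lm_mem_cent2 hg
  | succ n ih =>
    refine Submodule.smul_mem _ _ (sum_mem fun k _ => Submodule.smul_mem _ _ ?_)
    have := mul_mem_cent2 (br_mem_cent2 (F.tan_mem_centNorm (F.nab_tan D (F.Y k))) ih)
      (F.iota_mem_cent2 k)
    have e : (F.Y k).par + p + (F.Y k).par = p := by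
      rw [add_comm, ← add_assoc, zmod_add_self, zero_add]
    rwa [e] at this

theorem rho_mem_cent2 [CharZero K] (D : Connection c) {p : ZMod 2} {g : R} (hg : g ∈ par c p) :
    F.rho D p g ∈ cent2 K F.gens p :=
  locSum_mem_cent F (F.rhoN_zero_of_lt D p g) (F.rhoN_mem_cent2 D hg)

/-- The algebraic form of the symbol calculus: the commutator of a differential operator with gᵢ has
as principal symbol the contraction of the symbol with dgᵢ. Both sides are derivations killing
functions and are compared on vector fields. -/
theorem rhoN_one (D : Connection c) (i : Fin F.N) :
    F.rhoN D (F.Y i).par (F.g i) 1 = F.iota i := by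
  have hw : ∀ k, (F.Y k).der (F.g i) ∈ par c ((F.Y k).par + (F.Y i).par) := fun k =>
    (F.Y k).mem.1 _ _ (F.g_mem i)
  have e1 : F.rhoN D (F.Y i).par (F.g i) 1 = ∑ k, sgn K ((F.Y k).par * (F.Y i).par) •
      (lm (sfn c ((F.Y k).der (F.g i))) * F.iota k) := by
    simp only [rhoN, F.br_der_lm (F.nab_der D _) (F.g_mem i), nab_sfn]
    simp
  rw [e1]
  refine IsDer.ext (IsDer.sum fun k _ => IsDer.smul ?_ _) (F.iota_der i) (fun f => ?_) fun X => ?_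
  · have := (F.iota_der k).fmul (hw k)
    rwa [add_right_comm, zmod_add_self, zero_add] at this
  · simp
  · simp only [LinearMap.sum_apply, LinearMap.smul_apply, Module.End.mul_apply, lm_apply, iota_vf,
      ← sfn_mul, ← sfn_smul, ← sfn_sum]
    congr 1
    rw [ival, F.der_eq X, Finset.smul_sum]
    refine Finset.sum_congr rfl fun k _ => ?_
    rw [F.comm _ _ _ _ (hw k) (F.ival_mem k X), ival, smul_mul_assoc, smul_smul, smul_smul,
      smul_smul, ← sgn_add, ← sgn_add, ← sgn_add]
    congr 2
    generalize X.par = a; generalize (F.Y i).par = b; generalize (F.Y k).par = d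
    revert a b d; decide

theorem rho_fil (D : Connection c) (p : ZMod 2) (g : R) {n : ℕ} {s : SymT c}
    (hs : s ∈ fil c (n + 1)) : F.rho D p g s - sfn c g * s ∈ fil c n := by
  intro m hm
  rw [rho, locSum_apply F (F.rhoN_zero_of_lt D p g) hs, Finset.sum_range_succ', rhoN, lm_apply,
    add_sub_cancel_right, map_sum]
  refine Finset.sum_eq_zero fun k _ => ?_
  rw [pr_rhoN, hs _ (by omega), map_zero]

/-- On elements of degree at most n + 1, only the components 0 and 1 of ρ can reach degree n or
higher; the former is multiplication by gᵢ, which is subtracted, and the latter is ιᵢ. -/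
theorem pr_rho (D : Connection c) (i : Fin F.N) {n : ℕ} {s : SymT c}
    (hs : s ∈ fil c (n + 2)) : pr c n (F.rho D (F.Y i).par (F.g i) s - sfn c (F.g i) * s)
      = F.iota i (pr c (n + 1) s) := by
  rw [rho, locSum_apply F (F.rhoN_zero_of_lt D _ _) hs, Finset.sum_range_succ', rhoN, lm_apply,
    add_sub_cancel_right, map_sum, Finset.sum_range_succ', zero_add, rhoN_one, pr_iota,
    Finset.sum_eq_zero, zero_add]
  intro k _
  rw [pr_rhoN, hs _ (by omega), map_zero]

/-- The n-th component of ρ maps Sᵐ to Sᵐ⁻ⁿ, where the Euler operator contributes m - n, while the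
recursive definition of that component contributes n. The sum is m in every component. -/
theorem euler_rho [CharZero K] (D : Connection c) (p : ZMod 2) (g : R) {m : ℕ} {s : SymT c}
    (hs : s ∈ symPow c m) : F.euler (F.rho D p g s) + ∑ k, sgn K ((F.Y k).par * p) •
      (br K (F.Y k).par p (F.nab D (F.Y k)) (F.rho D p g)) (F.iota k s)
        = (m : K) • F.rho D p g s := by
  have hz := F.rhoN_zero_of_lt D p g
  have h1 : ∀ k, br K (F.Y k).par p (F.nab D (F.Y k)) (F.rho D p g) (F.iota k s)
      = ∑ n ∈ Finset.range m,
        br K (F.Y k).par p (F.nab D (F.Y k)) (F.rhoN D p g n) (F.iota k s) := by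
    intro k
    have h2 : F.iota k s ∈ fil c m := by
      cases m with
      | zero => rw [F.iota_zero hs]; exact zero_mem _
      | succ m => exact symPow_le_fil (Nat.lt_succ_self m) (F.iota_mem hs)
    have h3 : F.nab D (F.Y k) (F.iota k s) ∈ fil c m := fun j hj => by
      rw [(F.nab_tan D _).pr, h2 j hj, map_zero]
    simp only [br, LinearMap.sub_apply, LinearMap.smul_apply, Module.End.mul_apply, rho,
      locSum_apply F hz h2, locSum_apply F hz h3, map_sum, Finset.smul_sum,
      Finset.sum_sub_distrib]
  have h2 : ∑ k, sgn K ((F.Y k).par * p) •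
      (br K (F.Y k).par p (F.nab D (F.Y k)) (F.rho D p g)) (F.iota k s)
      = ∑ n ∈ Finset.range (m + 1), (n : K) • F.rhoN D p g n s := by
    simp only [h1, Finset.smul_sum]
    rw [Finset.sum_comm, Finset.sum_range_succ']
    simp only [Nat.cast_zero, zero_smul, add_zero]
    refine Finset.sum_congr rfl fun n _ => ?_
    simp only [rhoN, LinearMap.smul_apply, LinearMap.sum_apply, Module.End.mul_apply]
    rw [smul_inv_smul₀ (by exact_mod_cast n.succ_ne_zero)]
  rw [h2, rho, locSum_of_mem _ hs, map_sum, ← Finset.sum_add_distrib, Finset.smul_sum]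
  refine Finset.sum_congr rfl fun n hn => ?_
  obtain ⟨j, rfl⟩ := Nat.exists_eq_add_of_le' (Nat.lt_succ_iff.1 (Finset.mem_range.1 hn))
  rw [F.euler_of_mem (F.rhoN_mem D p g n j s hs), ← add_smul]
  norm_cast

/-- The operators `rho` are the conjugates by `pbw` of the right multiplications by functions. -/
theorem pbw_rho [CharZero K] (D : Connection c) {p : ZMod 2} {g : R} (hg : g ∈ par c p)
    (s : SymT c) : F.pbw D (F.rho D p g s) =
      F.pbw D (F.tpow p s) * LinearMap.mulLeft K g := by
  induction s using graded_induction F with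
  | hadd s s' h h' => simp only [map_add, add_mul, h, h']
  | h m s hs =>
  induction m generalizing s with
  | zero =>
    rw [eq_sfn_counit hs, rho, locSum_of_mem _ (sfn_mem _), zero_add, Finset.sum_range_one, rhoN,
      lm_apply, ← sfn_mul, tpow_sfn, pbw_sfn, pbw_sfn, ← mulLeft_mul]
    have := F.sfn_comm hg (sfn c (counit c s))
    rw [tpow_sfn, ← sfn_mul, ← sfn_mul] at this
    have hh : F.trpow p (F.trpow p (counit c s)) = counit c s := by
      rcases zmod_two_cases p with h | h <;> simp [h, trpow]
    have h2 := F.sfn_comm hg (sfn c (F.trpow p (counit c s)))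
    rw [tpow_sfn, hh, ← sfn_mul, ← sfn_mul] at h2
    rw [sfn_injective h2]
  | succ m ih =>
    have h0 : ((m + 1 : ℕ) : K) ≠ 0 := by exact_mod_cast m.succ_ne_zero
    have hts : F.tpow p s ∈ symPow c (m + 1) := by
      rcases zmod_two_cases p with rfl | rfl
      · exact hs
      · exact F.tauS_mem hs
    refine (smul_right_injective _ h0) ?_
    change ((m + 1 : ℕ) : K) • _ = ((m + 1 : ℕ) : K) • _
    -- After multiplication by m + 1 the PBW recursion applies to both sides. The commutators of ∇
    -- with ρ in `euler_rho` trade pbw(∇ ρ ι s) for pbw(ρ ∇ ι s), to which the induction hypothesis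
    -- applies because ι lowers the degree.
    rw [← map_smul, ← F.euler_rho D p g hs, ← smul_mul_assoc, ← map_smul, ← F.euler_of_mem hts,
      map_add, pbw_euler, pbw_euler, map_sum, ← Finset.sum_add_distrib, Finset.sum_mul]
    refine Finset.sum_congr rfl fun i _ => ?_
    have hi := F.iota_mem (i := i) hs
    -- Contractions are in the centralizer and ρ is in the double centralizer, so they supercommute.
    have hb : F.iota i (F.rho D p g s) = sgn K ((F.Y i).par * p) • F.rho D p g (F.iota i s) := by
      have := congrArg (fun x : Op c => x s)
        (br_of_cent_of_cent2 (F.iota_mem_cent i) (F.rho_mem_cent2 D hg))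
      exact sub_eq_zero.1 this
    have e1 := ih _ hi
    have e2 := ih _ ((F.nab_tan D (F.Y i)).mem hi)
    rw [(F.iota_der i).tpow, map_smul, mul_comm p] at e1
    rw [(F.nab_der D (F.Y i)).tpow, (F.iota_der i).tpow, map_smul, map_smul,
      map_smul, sgn_smul_sgn_smul] at e2
    rw [hb]
    simp only [br, LinearMap.sub_apply, LinearMap.smul_apply, Module.End.mul_apply, map_sub,
      map_smul, smul_sub, sgn_smul_sgn_smul, e1, e2, sub_mul, smul_mul_assoc,
      mul_assoc]
    abel

/-- If pbw(s) = 0 then pbw kills ρ(gᵢ) s - gᵢ s, which has lower degree and is therefore zero by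
induction. Its leading part is ιᵢ of the leading part of s, so the Euler operator annihilates the
latter, which must vanish unless it has degree 0. In degree 0 one evaluates the operator at 1. -/
theorem pbw_injective [CharZero K] (D : Connection c) : Function.Injective (F.pbw D) := by
  have key : ∀ n, ∀ s ∈ fil c n, F.pbw D s = 0 → s = 0 := by
    intro n
    induction n with
    | zero => exact fun s hs _ => eq_zero_of_fil_zero F hs
    | succ n ih =>
      intro s hs h
      have h1 : ∀ i, F.rho D (F.Y i).par (F.g i) s - sfn c (F.g i) * s = 0 := by
        intro i
        refine ih _ (F.rho_fil D _ _ hs) ?_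
        have h2 : F.pbw D (F.tpow (F.Y i).par s) = 0 := by
          rcases zmod_two_cases (F.Y i).par with hp | hp <;> rw [hp]
          · simpa using h
          · rw [tpow_one, pbw_tauS, h, map_zero]
        rw [map_sub, F.pbw_rho D (F.g_mem i), h2, pbw_fmul, h]
        simp
      cases n with
      | zero =>
        rw [eq_sfn_of_fil_one F hs, pbw_sfn] at h
        have : counit c s = 0 := by simpa using congrArg (fun A : Module.End K R => A 1) h
        rw [eq_sfn_of_fil_one F hs, this, sfn_zero]
      | succ n =>
        refine ih s (fun m hm => ?_) h
        rcases hm.eq_or_lt with rfl | hm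
        · have h2 := F.euler_of_mem (pr_mem F (n + 1) s)
          have h3 : F.euler (pr c (n + 1) s) = 0 := by
            simp only [euler, LinearMap.sum_apply, Module.End.mul_apply]
            refine Finset.sum_eq_zero fun i _ => ?_
            rw [← F.pr_rho D i hs, h1 i, map_zero, map_zero]
          rw [h3] at h2
          exact (smul_eq_zero_iff_right (by exact_mod_cast n.succ_ne_zero)).1 h2.symm
        · exact hs m hm
  refine (injective_iff_map_eq_zero _).2 fun s h => ?_
  obtain ⟨n, hn⟩ := exists_fil s
  exact key n s hn h

/-! ### Surjectivity -/

/-- Expand (n + 1) pbw(Y ⊙ s) and n Y pbw(s) by the PBW recursion. The leading terms match after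
exchanging Y with the Yᵢ, and the difference consists of covariant derivatives, Lie brackets [Y, Yᵢ]
and products covered by the induction. -/
theorem der_mul_pbw [CharZero K] (D : Connection c) (n : ℕ) (s : SymT c) (hs : s ∈ symPow c n)
    (Y : HomVF c) : Y.der * F.pbw D s - F.pbw D (svf c Y.vf * s) ∈ (fil c (n + 1)).map (F.pbw D) := by
  induction n using Nat.strong_induction_on generalizing s Y with
  | _ n ih =>
  have hP : ∀ {k} {t : SymT c}, t ∈ symPow c k → k < n + 1 →
      F.pbw D t ∈ (fil c (n + 1)).map (F.pbw D) := fun ht hk =>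
    Submodule.mem_map_of_mem (symPow_le_fil hk ht)
  have hY1 : ∀ (Z : HomVF c) {k} {t : SymT c}, t ∈ symPow c k → k < n →
      Z.der * F.pbw D t ∈ (fil c (n + 1)).map (F.pbw D) := by
    intro Z k t ht hk
    have := add_mem (Submodule.map_mono (fil_mono (by omega : k + 1 ≤ n + 1)) (ih k hk t ht Z))
      (hP (mul_mem_symPow F (svf_mem F Z.vf) ht) (by omega))
    rwa [sub_add_cancel] at this
  have hY2 : ∀ (Z : HomVF c) A, A ∈ (fil c n).map (F.pbw D) →
      Z.der * A ∈ (fil c (n + 1)).map (F.pbw D) := by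
    rintro Z _ ⟨t, ht, rfl⟩
    rw [← sum_pr F ht, map_sum, Finset.mul_sum]
    exact sum_mem fun k hk => hY1 Z (pr_mem F k t) (Finset.mem_range.1 hk)
  have hYs := mul_mem_symPow F (svf_mem F Y.vf) hs
  have h0 : ((n + 1 : ℕ) : K) ≠ 0 := by exact_mod_cast n.succ_ne_zero
  have e1 : ((n + 1 : ℕ) : K) • F.pbw D (svf c Y.vf * s) = Y.der * F.pbw D s - F.pbw D (F.nab D Y s)
      + ∑ i, (sgn K ((F.Y i).par * Y.par) • ((F.Y i).der * F.pbw D (svf c Y.vf * F.iota i s))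
      - F.pbw D (F.nab D (F.Y i) (sgn K ((F.Y i).par * Y.par) • (svf c Y.vf * F.iota i s)))) := by
    rw [← map_smul, add_comm n, ← F.euler_of_mem hYs, pbw_euler, ← F.pbw_tensorial D Y s,
      ← Finset.sum_add_distrib]
    refine Finset.sum_congr rfl fun i _ => ?_
    rw [iota_vmul, map_add, map_add, map_smul, mul_add, map_add, mul_smul_comm]
    abel
  have e2 : (n : K) • F.pbw D s = ∑ i, ((F.Y i).der * F.pbw D (F.iota i s)
      - F.pbw D (F.nab D (F.Y i) (F.iota i s))) := by
    rw [← pbw_euler, F.euler_of_mem hs, map_smul]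
  have key : ((n + 1 : ℕ) : K) • (Y.der * F.pbw D s - F.pbw D (svf c Y.vf * s))
      = F.pbw D (F.nab D Y s) + ∑ i, (Y.der * ((F.Y i).der * F.pbw D (F.iota i s))
        - sgn K ((F.Y i).par * Y.par) • ((F.Y i).der * F.pbw D (svf c Y.vf * F.iota i s))
        - Y.der * F.pbw D (F.nab D (F.Y i) (F.iota i s))
        + F.pbw D (F.nab D (F.Y i) (sgn K ((F.Y i).par * Y.par) • (svf c Y.vf * F.iota i s)))) := by
    have e3 : (n : K) • (Y.der * F.pbw D s) = ∑ i, (Y.der * ((F.Y i).der * F.pbw D (F.iota i s))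
        - Y.der * F.pbw D (F.nab D (F.Y i) (F.iota i s))) := by
      rw [← mul_smul_comm, e2, Finset.mul_sum]
      simp only [mul_sub]
    rw [smul_sub, e1, Nat.cast_succ, add_smul, e3, one_smul]
    simp only [Finset.sum_add_distrib, Finset.sum_sub_distrib]
    abel
  rw [← Submodule.smul_mem_iff _ h0, key]
  refine add_mem (hP ((F.nab_tan D Y).mem hs) (by omega)) (sum_mem fun i _ => ?_)
  cases n with
  | zero => rw [F.iota_zero hs]; simp
  | succ n =>
    have hi := F.iota_mem (i := i) hs
    have hvi := mul_mem_symPow F (svf_mem F Y.vf) hi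
    refine add_mem (sub_mem ?_ (hY1 _ ((F.nab_tan D _).mem hi) (by omega)))
      (hP ((F.nab_tan D _).mem (Submodule.smul_mem _ _ hvi)) (by omega))
    -- Exchanging Y and Yᵢ costs the first order operator [Y, Yᵢ]; what remains is Yᵢ applied to an
    -- instance of the statement in degree n.
    have e4 : Y.der * ((F.Y i).der * F.pbw D (F.iota i s))
        - sgn K ((F.Y i).par * Y.par) • ((F.Y i).der * F.pbw D (svf c Y.vf * F.iota i s))
        = (Y.lie (F.Y i)).der * F.pbw D (F.iota i s) + sgn K ((F.Y i).par * Y.par) •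
          ((F.Y i).der * (Y.der * F.pbw D (F.iota i s) - F.pbw D (svf c Y.vf * F.iota i s))) := by
      simp only [HomVF.lie, sgn_smul (K := K), sub_mul, mul_sub, smul_sub, smul_mul_assoc,
        mul_assoc, mul_comm (F.Y i).par]
      abel
    rw [e4]
    exact add_mem (hY1 _ hi (by omega))
      (Submodule.smul_mem _ _ (hY2 _ _ (ih n (by omega) _ hi Y)))

theorem pbw_range [CharZero K] (D : Connection c) {A : Module.End K R} (hA : A ∈ DiffOp c) :
    ∃ s, F.pbw D s = A := by
  have hv : ∀ (Y : HomVF c) (s : SymT c), Y.der * F.pbw D s ∈ LinearMap.range (F.pbw D) := by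
    intro Y s
    induction s using graded_induction F with
    | hadd s s' h h' => rw [map_add, mul_add]; exact add_mem h h'
    | h n s hs =>
      obtain ⟨t, -, ht⟩ := F.der_mul_pbw D n s hs Y
      exact ⟨t + svf c Y.vf * s, by rw [map_add, ht, sub_add_cancel]⟩
  have key : ∀ s, A * F.pbw D s ∈ LinearMap.range (F.pbw D) := by
    induction hA using Algebra.adjoin_induction with
    | mem x hx =>
      intro s
      rcases hx with ⟨f, rfl⟩ | hx
      · exact ⟨sfn c f * s, F.pbw_fmul D f s⟩
      · obtain ⟨X0, X1, -, -, h⟩ := F.vect_split ⟨x, hx⟩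
        have : x = X0.der + X1.der := congrArg Subtype.val h
        rw [this, add_mul]
        exact add_mem (hv X0 s) (hv X1 s)
    | algebraMap a =>
      intro s
      exact ⟨a • s, by rw [map_smul, Algebra.algebraMap_eq_smul_one, smul_mul_assoc, one_mul]⟩
    | add x y _ _ hx hy => intro s; rw [add_mul]; exact add_mem (hx s) (hy s)
    | mul x y _ _ hx hy =>
      intro s
      obtain ⟨t, ht⟩ := hy s
      rw [mul_assoc, ← ht]
      exact hx t
  simpa using key 1

/-- The map `pbw` as a linear equivalence. -/
def pbwEquiv [CharZero K] (D : Connection c) : SymT c ≃ₗ[K] DiffOp c :=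
  LinearEquiv.ofBijective ((F.pbw D).codRestrict (Subalgebra.toSubmodule (DiffOp c)) (F.pbw_mem D))
    ⟨fun s t h => F.pbw_injective D (congrArg Subtype.val h), fun A => by
      obtain ⟨s, hs⟩ := F.pbw_range D A.2
      exact ⟨s, Subtype.ext hs⟩⟩

@[simp] theorem pbwEquiv_coe [CharZero K] (D : Connection c) (s : SymT c) :
    (F.pbwEquiv D s : Module.End K R) = F.pbw D s := rfl

theorem diffOp_units_smul (v : ℤˣ) (A : DiffOp c) :
    ((v • A : DiffOp c) : Module.End K R) = usgn K v • (A : Module.End K R) := by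
  rcases Int.units_eq_one_or v with rfl | rfl
  · simp [usgn]
  · simp only [Units.smul_def, usgn, Units.val_neg, Units.val_one, Int.cast_neg, Int.cast_one]
    rw [neg_one_smul ℤ A]
    change -(A : Module.End K R) = _
    module

theorem isPBW [CharZero K] (D : Connection c) : D.IsPBW (F.pbwEquiv D) where
  fn f := Subtype.ext (F.pbw_sfn D f)
  vf X := Subtype.ext (F.pbw_svf D X)
  mon l hl := by
    have h0 : (l.length : K) ≠ 0 := by
      have : l.length ≠ 0 := by omega
      exact_mod_cast this
    apply Subtype.ext
    rw [pbwEquiv_coe, ← smul_right_injective _ h0 |>.eq_iff]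
    change (l.length : K) • F.pbw D (DGMfd.mon l) = _
    rw [F.pbw_mon, sel]
    simp only [F.nab_mon, SetLike.val_smul, smul_smul, mul_one_div_cancel h0, one_smul,
      AddSubmonoidClass.coe_finsetSum]
    refine Finset.sum_congr rfl fun k _ => ?_
    rw [diffOp_units_smul]
    rfl

/-- The recursion fixes the values on monomials by induction on the length, since covariant
derivatives preserve the degree. -/
theorem isPBW_unique (F : Frame c) (D : Connection c) (P P' : SymT c →ₗ[K] DiffOp c)
    (h : D.IsPBW P) (h' : D.IsPBW P') : P = P' := by
  have hmon : ∀ n, ∀ s ∈ symPow c n, P s = P' s := by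
    intro n
    induction n with
    | zero => intro s hs; rw [eq_sfn_counit hs, h.fn, h'.fn]
    | succ n ih =>
      have h2 : ∀ l : List (HomVF c), l.length = n + 1 → P (mon l) = P' (mon l) := by
        intro l hl
        rcases Nat.eq_zero_or_pos n with rfl | hn
        · obtain ⟨X, rfl⟩ := List.length_eq_one_iff.1 hl
          rw [mon_singleton, h.vf, h'.vf]
        · rw [h.mon l (by omega), h'.mon l (by omega)]
          congr 1
          refine Finset.sum_congr rfl fun k _ => ?_
          have hlen : (l.eraseIdx k).length = n := by
            have := List.length_eraseIdx_add_one k.2; omega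
          have h3 := mon_mem' (l.eraseIdx k)
          rw [hlen] at h3
          rw [ih _ h3, ih (D.onMon _ _)]
          rw [← F.nab_mon]; exact (F.nab_tan D _).mem h3
      intro s hs
      induction hs using Submodule.span_induction with
      | mem x hx =>
        obtain ⟨f, l, hl, rfl⟩ := hx
        cases l with
        | nil => simp at hl
        | cons X l =>
          -- Only linearity over the base field is available, so the function coefficient is
          -- absorbed into the first factor, which makes the element a sum of monomials.
          rw [mon_cons, ← mul_assoc, ← svf_fsmul]
          induction f using F.fn_induction with
          | hadd f g h h' => simp only [add_smul, svf_add, add_mul, map_add, h, h']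
          | hhom q f hf => 
            rw [← F.fsmul_vf hf X, ← mon_cons]
            exact h2 _ (by simpa using hl)
      | zero => simp
      | add x y _ _ h h' => rw [map_add, map_add, h, h']
      | smul a x _ h => rw [map_smul, map_smul, h]
  ext1 s
  induction s using graded_induction F with
  | hadd s s' h h' => rw [map_add, map_add, h, h']
  | h n s hs => exact hmon n s hs

end Frame

end Bijectivity

/-! ### Coderivations through centralizers -/

section Coderivations

variable {K R : Type*} [Field K] [Ring R] [Algebra K R] {c : ℤ → R →ₗ[K] R}

namespace Frame

variable (F : Frame c)

/-! ### The centralizer of functions and of the operators `rho` -/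

/-- The counterpart of the fact that an operator commuting with the coordinates has order 0: the
leading part of s is killed by every ιᵢ, hence by the Euler operator, as long as its degree is
positive. -/
theorem mem_fil_one_of_rho [CharZero K] (D : Connection c) {s : SymT c}
    (h : ∀ i, F.rho D (F.Y i).par (F.g i) s - sfn c (F.g i) * s = 0) : s ∈ fil c 1 := by
  obtain ⟨n, hn⟩ := exists_fil s
  induction n with
  | zero => exact fil_mono (Nat.zero_le _) hn
  | succ n ih =>
    cases n with
    | zero => exact hn
    | succ n =>
      refine ih fun m hm => ?_
      rcases hm.eq_or_lt with rfl | hm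
      · have h2 := F.euler_of_mem (pr_mem F (n + 1) s)
        have h3 : F.euler (pr c (n + 1) s) = 0 := by
          simp only [euler, LinearMap.sum_apply, Module.End.mul_apply]
          refine Finset.sum_eq_zero fun i _ => ?_
          rw [← F.pr_rho D i hn, h i, map_zero, map_zero]
        rw [h3] at h2
        exact (smul_eq_zero_iff_right (by exact_mod_cast n.succ_ne_zero)).1 h2.symm
      · exact hn m hm

/-- The multiplications by functions and the operators `rho`. -/
def gensRho (D : Connection c) (q : ZMod 2) : Set (Op c) :=
  {a | (∃ f ∈ par c q, a = lm (sfn c f)) ∨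
    ∃ i, (F.Y i).par = q ∧ a = F.rho D (F.Y i).par (F.g i)}

theorem cent_gens_le [CharZero K] (D : Connection c) {p : ZMod 2} {u : Op c}
    (hu : u ∈ cent K F.gens p) : u ∈ cent K (F.gensRho D) p := by
  rintro q s (⟨f, hf, rfl⟩ | ⟨j, rfl, rfl⟩)
  · exact hu _ _ (Or.inl ⟨f, hf, rfl⟩)
  · exact br_of_cent_of_cent2 hu (F.rho_mem_cent2 D (F.g_mem j))

/-- Induction on the filtration: `u` kills ρ(gᵢ) s - gᵢ s, which has lower degree, and commutes with
both operations up to a sign. So `u s` satisfies the hypothesis of `mem_fil_one_of_rho`; it is a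
function, equal to its counit, which is zero. -/
theorem eq_zero_of_cent_gensRho [CharZero K] (D : Connection c) {p : ZMod 2} {u : Op c}
    (hu : u ∈ cent K (F.gensRho D) p) (h : ∀ s, counit c (u s) = 0) : u = 0 := by
  have key : ∀ n, ∀ s ∈ fil c n, u s = 0 := by
    intro n
    induction n with
    | zero => intro s hs; rw [eq_zero_of_fil_zero F hs, map_zero]
    | succ n ih =>
      intro s hs
      have h1 : u s ∈ fil c 1 := by
        refine F.mem_fil_one_of_rho D fun i => ?_
        have h2 := ih _ (F.rho_fil D (F.Y i).par (F.g i) hs)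
        have h3 := congrArg (fun x : Op c => x s) (hu _ _ (Or.inr ⟨i, rfl, rfl⟩))
        have h4 := congrArg (fun x : Op c => x s) (hu _ _ (Or.inl ⟨F.g i, F.g_mem i, rfl⟩))
        simp only [br, LinearMap.sub_apply, LinearMap.smul_apply, Module.End.mul_apply, lm_apply,
          LinearMap.zero_apply, sub_eq_zero] at h3 h4
        rw [map_sub, h3, h4, ← smul_sub] at h2
        exact (smul_eq_zero_iff_right (sgn_ne_zero _)).1 h2
      rw [eq_sfn_of_fil_one F h1, h s, sfn_zero]
  ext s
  obtain ⟨n, hn⟩ := exists_fil s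
  exact key n s hn

/-- The homogeneous components of the operator in the centralizer of functions and contractions
with a given counit. -/
def liftN : ℕ → ZMod 2 → (SymT c →ₗ[K] R) → Op c
  | 0, p, α => LinearMap.mulRight K (sfn c (α 1)) ∘ₗ (F.tpow p).toLinearMap
  | n + 1, p, α => ((n + 1 : ℕ) : K)⁻¹ • ∑ i,
      liftN n (p + (F.Y i).par) (α ∘ₗ lm (svf c (F.Y i).vf)) * F.iota i

theorem liftN_zero (p : ZMod 2) (α : SymT c →ₗ[K] R) (s : SymT c) :
    F.liftN 0 p α s = F.tpow p s * sfn c (α 1) := rfl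

theorem liftN_zero_of_lt (n m : ℕ) (h : m < n) (p : ZMod 2) (α : SymT c →ₗ[K] R) (s : SymT c)
    (hs : s ∈ symPow c m) : F.liftN n p α s = 0 := by
  induction n generalizing m s p α with
  | zero => omega
  | succ n ih =>
    simp only [liftN, LinearMap.smul_apply, LinearMap.sum_apply, Module.End.mul_apply]
    rw [Finset.sum_eq_zero, smul_zero]
    intro k _
    cases m with
    | zero => rw [F.iota_zero hs, map_zero]
    | succ m => exact ih m (by omega) _ _ _ (F.iota_mem hs)

theorem liftN_mem (n m : ℕ) (p : ZMod 2) (α : SymT c →ₗ[K] R) (s : SymT c)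
    (hs : s ∈ symPow c (m + n)) : F.liftN n p α s ∈ symPow c m := by
  induction n generalizing s p α with
  | zero =>
    have h1 : F.tpow p s ∈ symPow c m := by
      rcases zmod_two_cases p with rfl | rfl
      · exact hs
      · exact F.tauS_mem hs
    have h2 := mul_mem_symPow F h1 (sfn_mem (α 1))
    rw [add_zero] at h2
    rw [liftN_zero]
    exact h2
  | succ n ih =>
    simp only [liftN, LinearMap.smul_apply, LinearMap.sum_apply, Module.End.mul_apply]
    exact Submodule.smul_mem _ _ (sum_mem fun k _ => ih _ _ _ (F.iota_mem hs))

theorem mulRight_mem_cent (p : ZMod 2) (g : R) :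
    (LinearMap.mulRight K (sfn c g) ∘ₗ (F.tpow p).toLinearMap : Op c) ∈ cent K F.gens p := by
  have e : ∀ s, (LinearMap.mulRight K (sfn c g) ∘ₗ (F.tpow p).toLinearMap : Op c) s =
    F.tpow p s * sfn c g := fun _ => rfl
  rintro q s (⟨f, hf, rfl⟩ | ⟨j, rfl, rfl⟩)
  · ext s
    simp only [br, LinearMap.sub_apply, LinearMap.smul_apply, Module.End.mul_apply]
    rw [e, e, lm_apply, lm_apply, map_mul, tpow_of_mem (sfn_mem_spar hf),
      smul_mul_assoc, smul_mul_assoc, mul_assoc, sub_self, LinearMap.zero_apply]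
  · ext s
    simp only [br, LinearMap.sub_apply, LinearMap.smul_apply, Module.End.mul_apply]
    rw [e, e, (F.iota_der j).leib, iota_sfn, mul_zero, add_zero,
      (F.iota_der j).tpow, smul_mul_assoc, sub_self, LinearMap.zero_apply]

theorem liftN_mem_cent (n : ℕ) (p : ZMod 2) (α : SymT c →ₗ[K] R) :
    F.liftN n p α ∈ cent K F.gens p := by
  induction n generalizing p α with
  | zero =>
    exact F.mulRight_mem_cent p (α 1)
  | succ n ih =>
    refine Submodule.smul_mem _ _ (sum_mem fun i _ => ?_)
    have := mul_mem_cent (ih (p + (F.Y i).par) (α ∘ₗ lm (svf c (F.Y i).vf))) (F.iota_mem_cent i)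
    rwa [add_assoc, zmod_add_self, add_zero] at this

/-- Iterates the identity n α(s) = ∑ α(Yᵢ ⊙ ιᵢ s) on Sⁿ until no argument is left. The twisted
linearity of α is what makes the final value at 1 determine its values on functions. -/
theorem counit_liftN [CharZero K] (n : ℕ) (p : ZMod 2) (α : SymT c →ₗ[K] R)
    (hα : ∀ q, ∀ f ∈ par c q, ∀ s, α (sfn c f * s) = sgn K (p * q) • (f * α s)) (s : SymT c)
    (hs : s ∈ symPow c n) : counit c (F.liftN n p α s) = α s := by
  induction n generalizing p α s with
  | zero =>
    rw [eq_sfn_counit hs]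
    generalize counit c s = f
    simp only [liftN, LinearMap.comp_apply, AlgHom.toLinearMap_apply, LinearMap.mulRight_apply,
      tpow_sfn, map_mul, counit_sfn]
    induction f using F.fn_induction with
    | hadd f g h h' => simp only [sfn_add, map_add, add_mul, h, h']
    | hhom q f hf =>
      have := hα q f hf 1
      rw [mul_one] at this
      rw [this, F.trpow_apply _ hf, smul_mul_assoc]
  | succ n ih =>
    simp only [liftN, LinearMap.smul_apply, LinearMap.sum_apply, Module.End.mul_apply, map_smul,
      map_sum]
    have h0 : ((n + 1 : ℕ) : K) ≠ 0 := by exact_mod_cast n.succ_ne_zero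
    rw [inv_smul_eq_iff₀ h0, ← map_smul, ← F.euler_of_mem hs, euler]
    simp only [LinearMap.sum_apply, Module.End.mul_apply, map_sum]
    refine Finset.sum_congr rfl fun i _ => ih _ _ ?_ _ (F.iota_mem hs)
    intro q f hf s
    simp only [LinearMap.comp_apply, lm_apply]
    rw [← mul_assoc, svf_mul_sfn _ hf, smul_mul_assoc, map_smul, mul_assoc, hα q f hf, smul_smul,
      ← sgn_add]
    congr 2
    ring

/-- An element v of the centralizer of the contractions with the same counit as `u` is built by
`liftN`. By `cent_gens_le` it also commutes with the ρ, so `eq_zero_of_cent_gensRho` gives u = v.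
The two centralizers coincide. -/
theorem cent_gensRho [CharZero K] (D : Connection c) {p : ZMod 2} {u : Op c}
    (hu : u ∈ cent K (F.gensRho D) p) : u ∈ cent K F.gens p := by
  set α : SymT c →ₗ[K] R := (counit c).toLinearMap ∘ₗ u with hα
  have hlin : ∀ q, ∀ f ∈ par c q, ∀ s, α (sfn c f * s) = sgn K (p * q) • (f * α s) := by
    intro q f hf s
    have h4 := congrArg (fun x : Op c => x s) (hu _ _ (Or.inl ⟨f, hf, rfl⟩))
    simp only [br, LinearMap.sub_apply, LinearMap.smul_apply, Module.End.mul_apply, lm_apply,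
      LinearMap.zero_apply, sub_eq_zero] at h4
    simp [hα, h4]
  set v : Op c := locSum fun n => F.liftN n p α with hv
  have hvc : v ∈ cent K F.gens p := locSum_mem_cent F
    (fun n m h s hs => F.liftN_zero_of_lt n m h p α s hs) (fun n => F.liftN_mem_cent n p α)
  have hve : ∀ s, counit c (v s) = α s := by
    intro s
    induction s using graded_induction F with
    | hadd s s' h h' => simp only [map_add, h, h']
    | h n s hs =>
      rw [hv, locSum_of_mem _ hs, Finset.sum_range_succ, map_add,
        F.counit_liftN n p α hlin s hs, map_sum, Finset.sum_eq_zero, zero_add]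
      intro k hk
      obtain ⟨j, rfl⟩ := Nat.exists_eq_add_of_lt (Finset.mem_range.1 hk)
      refine counit_of_mem (n := j + 1) (by omega) (F.liftN_mem k (j + 1) p α s ?_)
      rwa [show j + 1 + k = k + j + 1 by omega]
  have h0 : u - v = 0 := F.eq_zero_of_cent_gensRho D (sub_mem_cent hu (F.cent_gens_le D hvc)) (by
    intro s
    simp only [LinearMap.sub_apply, map_sub, hve]
    exact sub_self _)
  have h1 : u = v := LinearMap.ext fun s => sub_eq_zero.1 (congrArg (fun x : Op c => x s) h0)
  rw [h1]
  exact hvc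

/-- The contractions may be replaced by the operators ρ as test elements. The latter interact simply
with left composition and commutators, whose brackets with contractions are not directly accessible.
-/
theorem mem_centNorm_of_rho [CharZero K] (D : Connection c) {p : ZMod 2} {a : Op c}
    (h1 : ∀ q, ∀ f ∈ par c q, br K p q a (lm (sfn c f)) ∈ cent2 K F.gens (p + q))
    (h2 : ∀ i, br K p (F.Y i).par a (F.rho D (F.Y i).par (F.g i)) ∈
      cent2 K F.gens (p + (F.Y i).par)) : a ∈ centNorm K F.gens p := by
  intro q u hu
  refine F.cent_gensRho D ?_
  rintro r s (⟨f, hf, rfl⟩ | ⟨i, rfl, rfl⟩)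
  · rw [br_jacobi, br_of_cent_of_cent2 hu (F.lm_mem_cent2 hf), br_of_cent_of_cent2 hu (h1 r f hf)]
    simp
  · rw [br_jacobi, br_of_cent_of_cent2 hu (F.rho_mem_cent2 D (F.g_mem i)),
      br_of_cent_of_cent2 hu (h2 i)]
    simp

/-! ### Transport along `pbw` -/

/-- The composition with a vector field, transported by `pbw`. -/
def lam [CharZero K] (D : Connection c) (X : HomVF c) : Op c :=
  (F.pbwEquiv D).symm.toLinearMap ∘ₗ LinearMap.mulLeft K (opVF c X.vf) ∘ₗ
    (F.pbwEquiv D).toLinearMap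

theorem pbw_lam [CharZero K] (D : Connection c) (X : HomVF c) (s : SymT c) :
    F.pbw D (F.lam D X s) = X.der * F.pbw D s := by
  rw [← pbwEquiv_coe, lam]
  simp only [LinearMap.comp_apply, LinearEquiv.coe_coe, LinearEquiv.apply_symm_apply]
  rfl

/-- The supercommutator with a vector field, transported by `pbw`. -/
def dlt [CharZero K] (D : Connection c) (X : HomVF c) : Op c :=
  F.lam D X - (F.pbwEquiv D).symm.toLinearMap ∘ₗ LinearMap.mulRight K (opVF c X.vf) ∘ₗ
    (F.pbwEquiv D).toLinearMap ∘ₗ (F.tpow X.par).toLinearMap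

theorem pbw_dlt [CharZero K] (D : Connection c) (X : HomVF c) (s : SymT c) :
    F.pbw D (F.dlt D X s) = X.der * F.pbw D s - F.pbw D (F.tpow X.par s) * X.der := by
  rw [dlt, LinearMap.sub_apply, map_sub, pbw_lam]
  congr 1
  rw [← pbwEquiv_coe]
  simp only [LinearMap.comp_apply, LinearEquiv.coe_coe, LinearEquiv.apply_symm_apply]
  rfl

theorem conjR_der (X : HomVF c) : F.conjR X.der = sgn K X.par • X.der := F.conjR_of_mem X.mem

theorem lam_tau [CharZero K] (D : Connection c) (X : HomVF c) (s : SymT c) :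
    F.tauS (F.lam D X s) = sgn K X.par • F.lam D X (F.tauS s) := by
  refine F.pbw_injective D ?_
  rw [pbw_tauS, pbw_lam, F.conjR_mul, conjR_der, map_smul, pbw_lam, pbw_tauS, smul_mul_assoc]

theorem tpow_op {p : ZMod 2} {a : Op c} (h : ∀ s, F.tauS (a s) = sgn K p • a (F.tauS s))
    (q : ZMod 2) (s : SymT c) : F.tpow q (a s) = sgn K (q * p) • a (F.tpow q s) := by
  rcases zmod_two_cases q with rfl | rfl <;> simp [h]

theorem dlt_tau [CharZero K] (D : Connection c) (X : HomVF c) (s : SymT c) :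
    F.tauS (F.dlt D X s) = sgn K X.par • F.dlt D X (F.tauS s) := by
  refine F.pbw_injective D ?_
  have h : F.tpow X.par (F.tauS s) = F.tauS (F.tpow X.par s) := by
    rcases zmod_two_cases X.par with h | h <;> simp [h]
  rw [pbw_tauS, pbw_dlt, map_sub, F.conjR_mul, conjR_der, map_smul, pbw_dlt, pbw_tauS, h, pbw_tauS,
    F.conjR_mul, conjR_der, smul_mul_assoc, mul_smul_comm, smul_sub]

theorem rho_tau [CharZero K] (D : Connection c) {p : ZMod 2} {g : R} (hg : g ∈ par c p)
    (s : SymT c) : F.tauS (F.rho D p g s) = sgn K p • F.rho D p g (F.tauS s) := by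
  refine F.pbw_injective D ?_
  have h : F.tpow p (F.tauS s) = F.tauS (F.tpow p s) := by
    rcases zmod_two_cases p with h | h <;> simp [h]
  have h2 : F.conjR (LinearMap.mulLeft K g) = sgn K p • LinearMap.mulLeft K g := by
    ext f; simp [conjR_apply, F.tauR_apply hg]
  rw [pbw_tauS, pbw_rho _ _ hg, map_smul, pbw_rho _ _ hg, h, pbw_tauS, F.conjR_mul, h2,
    mul_smul_comm]

/-- Left and right multiplications of differential operators commute. -/
theorem br_lam_rho [CharZero K] (D : Connection c) (X : HomVF c) {p : ZMod 2} {g : R}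
    (hg : g ∈ par c p) : br K X.par p (F.lam D X) (F.rho D p g) = 0 := by
  ext s
  refine F.pbw_injective D ?_
  simp only [br, LinearMap.sub_apply, LinearMap.smul_apply, Module.End.mul_apply, map_sub, map_smul,
    LinearMap.zero_apply, map_zero, pbw_lam, F.pbw_rho D hg, F.tpow_op (F.lam_tau D X)]
  rw [mul_comm p, smul_mul_assoc, sgn_smul_sgn_smul, mul_assoc, sub_self]

/-- The transport of the identity that the commutator with X, applied to P g, differs from its value
on P multiplied by g by ± P · X(g). -/
theorem br_dlt_rho [CharZero K] (D : Connection c) (X : HomVF c) {p : ZMod 2} {g : R}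
    (hg : g ∈ par c p) : br K X.par p (F.dlt D X) (F.rho D p g)
      = F.rho D (X.par + p) (X.der g) := by
  ext s
  refine F.pbw_injective D ?_
  simp only [br, LinearMap.sub_apply, LinearMap.smul_apply, Module.End.mul_apply, map_sub, map_smul,
    pbw_dlt, F.pbw_rho D hg, F.tpow_op (F.dlt_tau D X), F.tpow_op (F.rho_tau D hg),
    F.pbw_rho D (X.mem.1 _ _ hg)]
  have h := F.der_mulLeft X g
  have hm : LinearMap.mulLeft K (F.trpow X.par g) =
      (sgn K (X.par * p) • LinearMap.mulLeft K g : Module.End K R) := by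
    rw [F.trpow_apply _ hg]; ext; simp
  rw [hm, ← sub_eq_iff_eq_add] at h
  rw [← h, tpow_tpow, tpow_tpow, add_comm p, mul_comm p]
  simp only [smul_mul_assoc, smul_sub, sub_mul, mul_sub, sgn_smul_sgn_smul, mul_smul_comm,
    mul_assoc]
  abel

theorem br_lam_lm [CharZero K] (D : Connection c) (X : HomVF c) {p : ZMod 2} {f : R}
    (hf : f ∈ par c p) : br K X.par p (F.lam D X) (lm (sfn c f)) = lm (sfn c (X.der f)) := by
  ext s
  refine F.pbw_injective D ?_
  have h := F.der_mulLeft X f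
  have hm : LinearMap.mulLeft K (F.trpow X.par f) =
      (sgn K (X.par * p) • LinearMap.mulLeft K f : Module.End K R) := by
    rw [F.trpow_apply _ hf]; ext; simp
  rw [hm, ← sub_eq_iff_eq_add] at h
  simp only [br, LinearMap.sub_apply, LinearMap.smul_apply, Module.End.mul_apply, lm_apply, map_sub,
    map_smul, pbw_lam, pbw_fmul, ← h, sub_mul, smul_mul_assoc, mul_assoc]

theorem br_dlt_lm [CharZero K] (D : Connection c) (X : HomVF c) {p : ZMod 2} {f : R}
    (hf : f ∈ par c p) : br K X.par p (F.dlt D X) (lm (sfn c f)) = lm (sfn c (X.der f)) := by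
  ext s
  refine F.pbw_injective D ?_
  have h := F.der_mulLeft X f
  have hm : LinearMap.mulLeft K (F.trpow X.par f) =
      (sgn K (X.par * p) • LinearMap.mulLeft K f : Module.End K R) := by
    rw [F.trpow_apply _ hf]; ext; simp
  rw [hm, ← sub_eq_iff_eq_add] at h
  simp only [br, LinearMap.sub_apply, LinearMap.smul_apply, Module.End.mul_apply, lm_apply, map_sub,
    map_smul, pbw_dlt, pbw_fmul, ← h, sub_mul, smul_mul_assoc, mul_assoc, map_mul,
    tpow_of_mem (sfn_mem_spar hf), mul_sub, smul_sub]
  abel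

theorem lam_mem_centNorm [CharZero K] (D : Connection c) (X : HomVF c) :
    F.lam D X ∈ centNorm K F.gens X.par :=
  F.mem_centNorm_of_rho D
    (fun q f hf => by rw [F.br_lam_lm D X hf]; exact F.lm_mem_cent2 (X.mem.1 _ _ hf))
    (fun i => by rw [F.br_lam_rho D X (F.g_mem i)]; exact zero_mem _)

theorem dlt_mem_centNorm [CharZero K] (D : Connection c) (X : HomVF c) :
    F.dlt D X ∈ centNorm K F.gens X.par :=
  F.mem_centNorm_of_rho D
    (fun q f hf => by rw [F.br_dlt_lm D X hf]; exact F.lm_mem_cent2 (X.mem.1 _ _ hf))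
    (fun i => by
      rw [F.br_dlt_rho D X (F.g_mem i)]; exact F.rho_mem_cent2 D (X.mem.1 _ _ (F.g_mem i)))

/-- By the recursion the operators coming from positive degree kill the constant 1. The counit is
thus evaluation of an operator at 1, which makes the counits of λ and δ computable. -/
theorem counit_eq_pbw [CharZero K] (D : Connection c) (s : SymT c) :
    counit c s = F.pbw D s 1 := by
  have key : ∀ n, ∀ s ∈ symPow c (n + 1), F.pbw D s 1 = 0 := by
    intro n
    induction n with
    | zero =>
      intro s hs
      rw [eq_svf_vpart F hs, pbw_svf]
      induction F.vpart s using F.vf_induction with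
      | hadd X Y h h' => rw [Submodule.coe_add, LinearMap.add_apply, h, h', add_zero]
      | hhom X => simpa [trpow] using F.der_leibniz X 1 1
    | succ n ih =>
      intro s hs
      have h0 : ((n + 1 + 1 : ℕ) : K) ≠ 0 := by exact_mod_cast (n + 1).succ_ne_zero
      rw [← smul_eq_zero_iff_right h0, ← LinearMap.smul_apply, ← map_smul, ← F.euler_of_mem hs,
        pbw_euler, LinearMap.sum_apply]
      refine Finset.sum_eq_zero fun i _ => ?_
      rw [LinearMap.sub_apply, Module.End.mul_apply, ih _ (F.iota_mem hs),
        ih _ ((F.nab_tan D _).mem (F.iota_mem hs)), map_zero, sub_zero]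
  induction s using graded_induction F with
  | hadd s s' h h' => rw [map_add, map_add, h, h', LinearMap.add_apply]
  | h n s hs =>
    cases n with
    | zero => rw [eq_sfn_counit hs, pbw_sfn, counit_sfn]; simp
    | succ n => rw [key n s hs, counit_of_mem n.succ_ne_zero hs]

/-! ### Coderivations -/

theorem vpart_tau {p : ZMod 2} {a : Op c} (h : ∀ s, F.tauS (a s) = sgn K p • a (F.tauS s))
    (l : List (HomVF c)) : F.tauV (F.vpart (a (mon l))) =
      sgn K (p + lpar l) • F.vpart (a (mon l)) := by
  rw [← vpart_tauS, h, mem_spar.1 (mon_mem_spar (F := F) l), map_smul, map_smul, map_smul, smul_smul,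
    ← sgn_add]

/-- The terms of the convolution with the identity. -/
def convS (T : List (HomVF c) → SymT c) (l : List (HomVF c)) : SymT c :=
  ((coprod l).map fun t => usgn K t.1 • (T t.2.1 * mon t.2.2)).sum

theorem convS_cons (T : List (HomVF c) → SymT c) (X : HomVF c) (l : List (HomVF c)) :
    convS T (X :: l) = convS (fun l => T (X :: l)) l +
      convS (fun l => sgn K (X.par * lpar l) • (T l * svf c X.vf)) l := by
  simp only [convS, coprod]
  induction coprod l with
  | nil => simp
  | cons t L ih =>
    simp only [List.flatMap_cons, List.cons_append, List.nil_append, List.map_cons, List.sum_cons,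
      ih, usgn_mul, usgn_sgn, mon_cons, smul_mul_assoc, mul_assoc, smul_smul]
    rw [mul_comm (sgn K _)]
    abel

theorem convS_congr {T T' : List (HomVF c) → SymT c} (h : ∀ l, T l = T' l) (l : List (HomVF c)) :
    convS T l = convS T' l := by rw [funext h]

theorem mul_convS (a : SymT c) (T : List (HomVF c) → SymT c) (l : List (HomVF c)) :
    convS (fun l => a * T l) l = a * convS T l := by
  simp only [convS, mul_assoc, ← mul_smul_comm]
  exact List.sum_map_mul_left _ _ _

theorem conv_eq_convS (T : List (HomVF c) → Vect c) (l : List (HomVF c)) :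
    conv T l = convS (fun l => svf c (T l)) l := by
  simp only [conv, convS]
  congr 1

/-- Operators that satisfy a suitable Leibniz rule are convolutions with the identity. -/
theorem eq_convS (C : ZMod 2 → Op c → Prop) (π : SymT c →ₗ[K] SymT c)
    (h1 : ∀ p a, C p a → a 1 = π (a 1))
    (h2 : ∀ p a (X : HomVF c), C p a → C (p + X.par) (br K p X.par a (lm (svf c X.vf))))
    (h3 : ∀ p a (X : HomVF c) l, C p a → π (svf c X.vf * a (mon l)) = 0)
    (h4 : ∀ p a l, C p a → π (a (mon l)) ∈ F.spar (p + lpar l))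
    {p : ZMod 2} {a : Op c} (ha : C p a) (l : List (HomVF c)) :
    a (mon l) = convS (fun l => π (a (mon l))) l := by
  induction l generalizing p a with
  | nil => simp [convS, coprod, ← h1 p a ha]
  | cons X l ih =>
    -- In the coproduct of X ⊙ 𝐗 the factor X falls on either side: the bracket [a, X ⊙] accounts
    -- for the terms with X in the first factor, and X ⊙ a(𝐗) for those with X in the second.
    have e : ∀ l, a (mon (X :: l)) = br K p X.par a (lm (svf c X.vf)) (mon l)
        + sgn K (p * X.par) • (svf c X.vf * a (mon l)) := by
      intro l
      simp only [br, LinearMap.sub_apply, LinearMap.smul_apply, Module.End.mul_apply, lm_apply,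
        mon_cons, sub_add_cancel]
    rw [convS_cons, e, ih (h2 p a X ha), ih ha]
    congr 1
    · refine convS_congr (fun l => ?_) l
      rw [e, map_add, map_smul, h3 p a X l ha, smul_zero, add_zero]
    · rw [← smul_mul_assoc, ← mul_convS]
      refine convS_congr (fun l => ?_) l
      have := spar_comm (F := F) (h4 p a l ha) (svf c X.vf)
      rw [tpow_of_mem (svf_mem_spar X)] at this
      rw [smul_mul_assoc, this, mul_smul_comm, smul_smul, ← sgn_add]
      congr 2
      have e : ∀ p x y : ZMod 2, p * x + (p + y) * x = x * y := by decide
      exact e _ _ _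

/-- Coderivations of parity `p`. -/
structure IsCod (p : ZMod 2) (a : Op c) : Prop where
  mem : a ∈ centNorm K F.gens p
  tau : ∀ s, F.tauS (a s) = sgn K p • a (F.tauS s)
  counit : ∀ l, counit c (a (mon l)) = 0

theorem br_tau {p q : ZMod 2} {a b : Op c} (ha : ∀ s, F.tauS (a s) = sgn K p • a (F.tauS s))
    (hb : ∀ s, F.tauS (b s) = sgn K q • b (F.tauS s)) (s : SymT c) :
    F.tauS (br K p q a b s) = sgn K (p + q) • br K p q a b (F.tauS s) := by
  simp only [br, LinearMap.sub_apply, LinearMap.smul_apply, Module.End.mul_apply, map_sub,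
    map_smul, ha, hb, smul_sub, smul_smul, sgn_add]
  congr 2; ring

theorem svf_tau (X : HomVF c) (s : SymT c) :
    F.tauS (lm (svf c X.vf) s) = sgn K X.par • lm (svf c X.vf) (F.tauS s) := by
  rw [lm_apply, map_mul, mem_spar.1 (svf_mem_spar (F := F) X), smul_mul_assoc, lm_apply]

theorem br_iota_svf (i : Fin F.N) (X : HomVF c) :
    br K (F.Y i).par X.par (F.iota i) (lm (svf c X.vf)) = lm (sfn c (F.ival i X)) := by
  ext s
  simp [br, iota_vmul]

theorem svf_mem_centNorm (X : HomVF c) : lm (svf c X.vf) ∈ centNorm K F.gens X.par := by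
  refine mem_centNorm ?_
  rintro q s (⟨f, hf, rfl⟩ | ⟨i, rfl, rfl⟩)
  · have : br K X.par q (lm (svf c X.vf) : Op c) (lm (sfn c f)) = 0 := by
      ext s
      simp only [br, LinearMap.sub_apply, LinearMap.smul_apply, Module.End.mul_apply, lm_apply,
        LinearMap.zero_apply]
      rw [← mul_assoc, svf_mul_sfn X hf, smul_mul_assoc, mul_assoc, sub_self]
    rw [this]; exact zero_mem _
  · rw [br_antisymm, br_iota_svf]
    exact neg_mem_cent2 (Submodule.smul_mem _ _ (F.lm_mem_cent2 (F.ival_mem i X)))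

theorem pr_svf_mul (F : Frame c) (n : ℕ) (X : Vect c) (s : SymT c) :
    pr c (n + 1) (svf c X * s) = svf c X * pr c n s := by
  induction s using graded_induction F with
  | hadd s s' h h' => simp only [map_add, mul_add, h, h']
  | h m s hs =>
    rw [pr_of_mem (mul_mem_symPow F (svf_mem F X) hs), pr_of_mem hs, add_comm 1]
    simp only [add_left_inj]
    split_ifs <;> simp

theorem pr_zero_svf_mul (F : Frame c) (X : Vect c) (s : SymT c) : pr c 0 (svf c X * s) = 0 := by
  induction s using graded_induction F with
  | hadd s s' h h' => simp only [map_add, mul_add, h, h', add_zero]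
  | h m s hs => rw [pr_of_mem (mul_mem_symPow F (svf_mem F X) hs), if_neg (by omega)]

theorem pr_zero (F : Frame c) (s : SymT c) : pr c 0 s = sfn c (counit c s) := by
  induction s using graded_induction F with
  | hadd s s' h h' => simp only [map_add, sfn_add, h, h']
  | h m s hs =>
    rw [pr_of_mem hs]
    split_ifs with h
    · subst h; exact eq_sfn_counit hs
    · rw [counit_of_mem h hs, sfn_zero]

/-- For a component of degree at least 2, applying the Euler operator after a contraction shows that
the contraction vanishes, and applying it once more shows that the component does. The counit
removes degree 0. -/
theorem eq_pr_one [CharZero K] {s : SymT c} (h0 : counit c s = 0)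
    (h : ∀ i j, F.iota j (F.iota i s) = 0) : s = pr c 1 s := by
  have hf : s ∈ fil c 2 := by
    intro n hn
    obtain ⟨n, rfl⟩ := Nat.exists_eq_add_of_le' hn
    have hz : ∀ i, F.iota i (pr c (n + 2) s) = 0 := by
      intro i
      have h1 := F.euler_of_mem (F.iota_mem (i := i) (pr_mem F (n + 2) s))
      have h2 : F.euler (F.iota i (pr c (n + 2) s)) = 0 := by
        simp only [euler, LinearMap.sum_apply, Module.End.mul_apply]
        refine Finset.sum_eq_zero fun j _ => ?_
        rw [← pr_iota, ← pr_iota, h i j, map_zero, map_zero]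
      rw [h2] at h1
      exact (smul_eq_zero_iff_right (by exact_mod_cast n.succ_ne_zero)).1 h1.symm
    have h1 := F.euler_of_mem (pr_mem F (n + 2) s)
    have h2 : F.euler (pr c (n + 2) s) = 0 := by
      simp only [euler, LinearMap.sum_apply, Module.End.mul_apply, hz, map_zero,
        Finset.sum_const_zero]
    rw [h2] at h1
    exact (smul_eq_zero_iff_right (by exact_mod_cast (n + 1).succ_ne_zero)).1 h1.symm
  have h1 := sum_pr F hf
  rw [Finset.sum_range_succ, Finset.sum_range_one, pr_zero F, h0, sfn_zero, zero_add] at h1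
  exact h1.symm

theorem iota_apply_one (i : Fin F.N) : F.iota i (1 : SymT c) = 0 := by
  rw [← sfn_one, iota_sfn]

theorem iota_cent {p : ZMod 2} {u : Op c} (hu : u ∈ cent K F.gens p) (i : Fin F.N) (s : SymT c) :
    F.iota i (u s) = sgn K (p * (F.Y i).par) • u (F.iota i s) := by
  have h := congrArg (fun x : Op c => x s) (hu _ _ (Or.inr ⟨i, rfl, rfl⟩))
  simp only [br, LinearMap.sub_apply, LinearMap.smul_apply, Module.End.mul_apply,
    LinearMap.zero_apply, sub_eq_zero] at h
  rw [h, sgn_smul_sgn_smul]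

/-- Coderivations in this sense are stable under brackets with multiplication by a vector field, so
the inductive principle `eq_convS` applies with the projection onto degree one. -/
theorem IsCod.eq_conv [CharZero K] {p : ZMod 2} {a : Op c} (ha : F.IsCod p a)
    (l : List (HomVF c)) : a (mon l) = conv (fun l => F.vpart (a (mon l))) l := by
  rw [conv_eq_convS]
  simp only [svf_vpart]
  refine F.eq_convS F.IsCod (pr c 1) ?_ ?_ ?_ ?_ ha l
  · intro p a ha
    -- The bracket of `a` with ιᵢ is in the centralizer, so it commutes with ιⱼ; as contractions
    -- kill 1, this gives ιⱼ ιᵢ a(1) = 0.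
    refine F.eq_pr_one (ha.counit []) fun i j => ?_
    have h2 := F.iota_cent (ha.mem _ _ (F.iota_mem_cent i)) j 1
    simp only [br, LinearMap.sub_apply, LinearMap.smul_apply, Module.End.mul_apply,
      iota_apply_one, map_zero, zero_sub, smul_zero, map_neg, map_smul, neg_eq_zero] at h2
    exact (smul_eq_zero_iff_right (sgn_ne_zero _)).1 h2
  · intro p a X ha
    refine ⟨br_mem_centNorm ha.mem (F.svf_mem_centNorm X), F.br_tau ha.tau (F.svf_tau X),
      fun l => ?_⟩
    simp only [br, LinearMap.sub_apply, LinearMap.smul_apply, Module.End.mul_apply, lm_apply,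
      map_sub, map_smul, map_mul, counit_svf, zero_mul, smul_zero, sub_zero]
    exact ha.counit (X :: l)
  · intro p a X l ha
    rw [pr_svf_mul F, pr_zero F, ha.counit, sfn_zero, mul_zero]
  · intro p a l ha
    rw [mem_spar, ← svf_vpart, tauS_svf, F.vpart_tau ha.tau, svf_smul]

/-- The analogue for the centralizer itself, with values in degree 0: its elements are the
convolutions of function-valued maps with the identity. -/
theorem cent_eq_convS [CharZero K] {p : ZMod 2} {a : Op c} (ha : a ∈ cent K F.gens p)
    (ht : ∀ s, F.tauS (a s) = sgn K p • a (F.tauS s)) (l : List (HomVF c)) :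
    a (mon l) = convS (fun l => sfn c (counit c (a (mon l)))) l := by
  simp only [← pr_zero F]
  refine F.eq_convS (fun p a => a ∈ cent K F.gens p ∧ ∀ s, F.tauS (a s) = sgn K p • a (F.tauS s))
    (pr c 0) ?_ ?_ ?_ ?_ ⟨ha, ht⟩ l
  · rintro p a ⟨ha, -⟩
    have hz : ∀ i, F.iota i (a 1) = 0 := fun i => by
      rw [F.iota_cent ha, iota_apply_one, map_zero, smul_zero]
    have hf : a 1 ∈ fil c 1 := by
      intro n hn
      obtain ⟨n, rfl⟩ := Nat.exists_eq_add_of_le' hn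
      have h1 := F.euler_of_mem (pr_mem F (n + 1) (a 1))
      have h2 : F.euler (pr c (n + 1) (a 1)) = 0 := by
        simp only [euler, LinearMap.sum_apply, Module.End.mul_apply, ← pr_iota, hz, map_zero,
          Finset.sum_const_zero]
      rw [h2] at h1
      exact (smul_eq_zero_iff_right (by exact_mod_cast n.succ_ne_zero)).1 h1.symm
    rw [pr_zero F]
    exact eq_sfn_of_fil_one F hf
  · rintro p a X ⟨ha, ht⟩
    refine ⟨?_, F.br_tau ht (F.svf_tau X)⟩
    have := F.svf_mem_centNorm X _ _ ha
    rw [br_antisymm, add_comm]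
    rw [← neg_one_smul K]
    exact Submodule.smul_mem _ _ (Submodule.smul_mem _ _ this)
  · rintro p a X l -
    exact pr_zero_svf_mul F _ _
  · rintro p a l ⟨ha, ht⟩
    rw [mem_spar, pr_zero F, tauS_sfn]
    have h : ∀ s, F.tauR (counit c s) = counit c (F.tauS s) := by
      intro s
      have : (counit c).comp F.tauS = F.tauR.comp (counit c) := sym_hom_ext (by simp) (by simp)
      exact (DFunLike.congr_fun this s).symm
    rw [h, ht, mem_spar.1 (mon_mem_spar (F := F) l), map_smul, map_smul, map_smul, smul_smul,
      ← sgn_add, sfn_smul]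

end Frame

end Coderivations

/-! ### The commutator with the Euler operator -/

section Master

variable {K R : Type*} [Field K] [Ring R] [Algebra K R] {c : ℤ → R →ₗ[K] R}

theorem lm_add (a b : SymT c) : lm (a + b) = lm a + lm b := by ext; simp [add_mul]

theorem lm_smul (x : K) (a : SymT c) : lm (x • a) = x • lm a := by ext; simp

theorem lm_mul (a b : SymT c) : lm (a * b) = lm a * lm b := by ext; simp [mul_assoc]

namespace Frame

variable (F : Frame c)

/-! ### The operators `∇_X`, `λ_X` and `B(X, -)` for arbitrary vector fields -/

/-- The covariant derivative of symmetric tensors along an arbitrary vector field. -/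
def nabV (D : Connection c) : Vect c →ₗ[K] Op c where
  toFun X := ∑ i, sgn K (F.Y i).par • (lm (sfn c (X.1 (F.g i))) * F.nab D (F.Y i))
  map_add' X Y := by
    simp only [Submodule.coe_add, LinearMap.add_apply, sfn_add, lm_add, add_mul, smul_add,
      Finset.sum_add_distrib]
  map_smul' a X := by
    simp only [Submodule.coe_smul_of_tower, LinearMap.smul_apply, sfn_smul, lm_smul,
      smul_mul_assoc, Finset.smul_sum, RingHom.id_apply]
    exact Finset.sum_congr rfl fun i _ => smul_comm _ _ _

theorem nabV_vf (D : Connection c) (X : HomVF c) : F.nabV D X.vf = F.nab D X := (F.nab_eq D X).symm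

theorem nabV_fsmul (D : Connection c) (f : R) (X : Vect c) :
    F.nabV D (f • X) = lm (sfn c f) * F.nabV D X := by
  have e : ∀ X, F.nabV D X = ∑ i, sgn K (F.Y i).par • (lm (sfn c (X.1 (F.g i))) *
    F.nab D (F.Y i)) := fun _ => rfl
  rw [e, e, Finset.mul_sum]
  refine Finset.sum_congr rfl fun i _ => ?_
  rw [mul_smul_comm, ← mul_assoc, ← lm_mul, ← sfn_mul]
  rfl

/-- The composition with an arbitrary vector field, transported by `pbw`. -/
def lamV [CharZero K] (D : Connection c) : Vect c →ₗ[K] Op c where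
  toFun X := (F.pbwEquiv D).symm.toLinearMap ∘ₗ LinearMap.mulLeft K (opVF c X) ∘ₗ
    (F.pbwEquiv D).toLinearMap
  map_add' X Y := by
    have : opVF c (X + Y) = opVF c X + opVF c Y := rfl
    ext s
    simp [this, add_mul]
  map_smul' a X := by
    have : opVF c (a • X) = a • opVF c X := rfl
    ext s
    simp [this]

theorem lamV_vf [CharZero K] (D : Connection c) (X : HomVF c) : F.lamV D X.vf = F.lam D X := rfl

theorem pbw_lamV [CharZero K] (D : Connection c) (X : Vect c) (s : SymT c) :
    F.pbw D (F.lamV D X s) = X.1 * F.pbw D s := by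
  rw [← pbwEquiv_coe, lamV]
  simp only [LinearMap.coe_mk, AddHom.coe_mk, LinearMap.comp_apply, LinearEquiv.coe_coe,
    LinearEquiv.apply_symm_apply]
  rfl

theorem lamV_fsmul [CharZero K] (D : Connection c) (f : R) (X : Vect c) :
    F.lamV D (f • X) = lm (sfn c f) * F.lamV D X := by
  ext s
  refine F.pbw_injective D ?_
  rw [pbw_lamV, Module.End.mul_apply, lm_apply, pbw_fmul, pbw_lamV, ← mul_assoc]
  rfl

/-- The map `B(X, -)`. -/
def bop [CharZero K] (D : Connection c) : Vect c →ₗ[K] Op c where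
  toFun X := F.lamV D X - F.nabV D X
  map_add' X Y := by
    ext s
    simp only [map_add, LinearMap.sub_apply, LinearMap.add_apply]
    abel
  map_smul' a X := by
    ext s
    simp only [map_smul, LinearMap.sub_apply, LinearMap.smul_apply, RingHom.id_apply, smul_sub]

theorem bop_apply [CharZero K] (D : Connection c) (X : Vect c) :
    F.bop D X = F.lamV D X - F.nabV D X := rfl

theorem bop_vf [CharZero K] (D : Connection c) (X : HomVF c) :
    F.bop D X.vf = F.lam D X - F.nab D X := by rw [bop_apply, lamV_vf, nabV_vf]

theorem bop_fsmul [CharZero K] (D : Connection c) (f : R) (X : Vect c) :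
    F.bop D (f • X) = lm (sfn c f) * F.bop D X := by
  ext s
  simp [bop_apply, lamV_fsmul, nabV_fsmul, mul_sub]

theorem bop_mon [CharZero K] (D : Connection c) (X : HomVF c) (l : List (HomVF c)) :
    F.bop D X.vf (mon l) = D.bmap (F.pbwEquiv D) X l := by
  rw [bop_vf, LinearMap.sub_apply, nab_mon]
  rfl

theorem counit_nab (D : Connection c) (X : HomVF c) (s : SymT c) :
    counit c (F.nab D X s) = X.der (counit c s) := by
  induction s using graded_induction F with
  | hadd s s' h h' => simp only [map_add, h, h']
  | h n s hs =>
    cases n with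
    | zero => rw [eq_sfn_counit hs, nab_sfn, counit_sfn, counit_sfn]
    | succ n =>
      rw [counit_of_mem n.succ_ne_zero hs, map_zero,
        counit_of_mem n.succ_ne_zero ((F.nab_tan D X).mem hs)]

theorem counit_lied (X : HomVF c) (s : SymT c) :
    counit c (F.lied X s) = X.der (counit c s) := by
  induction s using graded_induction F with
  | hadd s s' h h' => simp only [map_add, h, h']
  | h n s hs =>
    cases n with
    | zero => rw [eq_sfn_counit hs, lied_sfn, counit_sfn, counit_sfn]
    | succ n =>
      rw [counit_of_mem n.succ_ne_zero hs, map_zero,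
        counit_of_mem n.succ_ne_zero ((F.lied_tan X).mem hs)]

theorem counit_lam [CharZero K] (D : Connection c) (X : HomVF c) (s : SymT c) :
    counit c (F.lam D X s) = X.der (counit c s) := by
  rw [F.counit_eq_pbw D, F.counit_eq_pbw D, pbw_lam]; rfl

theorem counit_dlt [CharZero K] (D : Connection c) (X : HomVF c) (s : SymT c) :
    counit c (F.dlt D X s) = X.der (counit c s) := by
  have : X.der 1 = 0 := by simpa [trpow] using F.der_leibniz X 1 1
  rw [F.counit_eq_pbw D, F.counit_eq_pbw D, pbw_dlt]
  simp [this]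

/-- Coderivations that are linear over the functions. -/
structure IsLinCod (p : ZMod 2) (a : Op c) : Prop extends F.IsCod p a where
  lin : ∀ q, ∀ f ∈ par c q, br K p q a (lm (sfn c f)) = 0
  counit_zero : ∀ s, DGMfd.counit c (a s) = 0

theorem sub_tau {p : ZMod 2} {a b : Op c} (ha : ∀ s, F.tauS (a s) = sgn K p • a (F.tauS s))
    (hb : ∀ s, F.tauS (b s) = sgn K p • b (F.tauS s)) (s : SymT c) :
    F.tauS ((a - b) s) = sgn K p • (a - b) (F.tauS s) := by
  simp only [LinearMap.sub_apply, map_sub, ha, hb, smul_sub]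

theorem bop_isLinCod [CharZero K] (D : Connection c) (X : HomVF c) :
    F.IsLinCod X.par (F.bop D X.vf) := by
  rw [bop_vf]
  have hc : ∀ s, counit c ((F.lam D X - F.nab D X) s) = 0 := fun s => by
    rw [LinearMap.sub_apply, map_sub, counit_nab, counit_lam, sub_self]
  exact ⟨⟨sub_mem_centNorm (F.lam_mem_centNorm D X) (F.tan_mem_centNorm (F.nab_tan D X)),
    F.sub_tau (F.lam_tau D X) (F.nab_der D X).tau, fun l => hc _⟩, fun q f hf => by
      rw [br_sub_left, F.br_lam_lm D X hf, F.br_der_lm (F.nab_der D X) hf, nab_sfn, sub_self], hc⟩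

theorem phi_isLinCod [CharZero K] (D : Connection c) (X : HomVF c) :
    F.IsLinCod X.par (F.dlt D X - F.lied X) := by
  have hc : ∀ s, counit c ((F.dlt D X - F.lied X) s) = 0 := fun s => by
    rw [LinearMap.sub_apply, map_sub, counit_lied, counit_dlt, sub_self]
  exact ⟨⟨sub_mem_centNorm (F.dlt_mem_centNorm D X) (F.tan_mem_centNorm (F.lied_tan X)),
    F.sub_tau (F.dlt_tau D X) (F.lied_der X).tau, fun l => hc _⟩, fun q f hf => by
      rw [br_sub_left, F.br_dlt_lm D X hf, F.br_der_lm (F.lied_der X) hf, lied_sfn, sub_self], hc⟩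

/-! ### Tensoriality -/

/-- If A is tensorial in X, with `o` the parity by which its operators are shifted, and takes
`R`-linear values, the coefficient functions of the expansion in the dual basis can be moved to the
right of the operators. That is the form required for composition with contractions. -/
theorem tensor_sum {o : ZMod 2} {A : HomVF c → Op c}
    (h1 : ∀ X, A X = ∑ i, (sgn K (F.Y i).par * sgn K (o * (X.par + (F.Y i).par))) •
      (lm (sfn c (X.der (F.g i))) * A (F.Y i)))
    (h2 : ∀ i q, ∀ f ∈ par c q, br K (o + (F.Y i).par) q (A (F.Y i)) (lm (sfn c f)) = 0)
    (X : HomVF c) : ∑ i, A (F.Y i) * lm (sfn c (F.ival i X)) = A X := by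
  rw [h1 X]
  refine Finset.sum_congr rfl fun i _ => ?_
  have h := h2 i _ _ (X.mem.1 _ _ (F.g_mem i))
  have h3 : A (F.Y i) * lm (sfn c (X.der (F.g i))) =
      sgn K ((o + (F.Y i).par) * (X.par + (F.Y i).par)) •
        (lm (sfn c (X.der (F.g i))) * A (F.Y i)) := by
    ext s
    exact sub_eq_zero.1 (congrArg (fun x : Op c => x s) h)
  rw [ival, sfn_smul, lm_smul, mul_smul_comm, h3, smul_smul, ← sgn_add, ← sgn_add]
  congr 2
  have e : ∀ o x y : ZMod 2, x * y + (o + y) * (x + y) = y + o * (x + y) := by decide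
  exact e _ _ _

theorem bop_tensor [CharZero K] (D : Connection c) (W : Vect c) :
    ∑ i, F.bop D (F.Y i).vf * lm (F.iota i (svf c W)) = F.bop D W := by
  induction W using F.vf_induction with
  | hadd X Y h h' =>
    simp only [svf_add, map_add, lm_add, mul_add, Finset.sum_add_distrib, h, h']
  | hhom X =>
    simp only [iota_vf]
    refine F.tensor_sum (o := 0) (A := fun X => F.bop D X.vf) (fun X => ?_) (fun i q f hf => ?_) X
    · conv_lhs => rw [F.spec X.vf]
      simp only [map_sum, map_smul, bop_fsmul, zero_mul, sgn_zero, mul_one, HomVF.vf_coe]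
    · rw [zero_add]
      exact (F.bop_isLinCod D (F.Y i)).lin q f hf

theorem br_lin {p q : ZMod 2} {a b : Op c} (ha : ∀ q, ∀ f ∈ par c q, br K p q a (lm (sfn c f)) = 0)
    (hb : F.IsTan q b) [CharZero K] (r : ZMod 2) (f : R) (hf : f ∈ par c r) :
    br K (p + q) r (br K p q a b) (lm (sfn c f)) = 0 := by
  obtain ⟨g, hg⟩ := hb.fn f
  have hgp : g ∈ par c (q + r) := by
    refine F.mem_par_of_tauR (sfn_injective (c := c) ?_)
    rw [← tauS_sfn, ← hg, hb.tau, tauS_sfn, F.tauR_apply hf, sfn_smul, map_smul, hg, smul_smul,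
      ← sgn_add, sfn_smul]
  rw [br_jacobi, F.br_der_lm hb.toIsDer hf, hg, ha r f hf, ha _ _ hgp]
  simp

theorem br_nab_tensor [CharZero K] (D : Connection c) {o : ZMod 2} {a : Op c}
    (ha : ∀ q, ∀ f ∈ par c q, br K o q a (lm (sfn c f)) = 0) (X : HomVF c) :
    ∑ i, br K o (F.Y i).par a (F.nab D (F.Y i)) * lm (sfn c (F.ival i X)) =
      br K o X.par a (F.nab D X) := by
  refine F.tensor_sum (o := o) (A := fun X => br K o X.par a (F.nab D X)) (fun X => ?_)
    (fun i q f hf => F.br_lin ha (F.nab_tan D _) q f hf) X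
  rw [F.nab_eq D X, br_sum_right]
  refine Finset.sum_congr rfl fun i _ => ?_
  have hp := X.mem.1 _ _ (F.g_mem i)
  have h := br_mul_right (K := K) o (X.par + (F.Y i).par) (F.Y i).par a
    (lm (sfn c (X.der (F.g i)))) (F.nab D (F.Y i))
  rw [add_assoc, zmod_add_self, add_zero, ha _ _ hp, zero_mul, zero_add] at h
  rw [br_smul_right, h, smul_smul]

/-- The defect of the compatibility of a derivation `L` with the connection. -/
def defect (D : Connection c) (Z : HomVF c) (L : Op c) (X : HomVF c) : Op c :=
  F.nabV D (F.lieV Z X.vf) - br K Z.par X.par L (F.nab D X)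

theorem defect_eq (D : Connection c) (Z : HomVF c) (L : Op c) (X : HomVF c) :
    F.defect D Z L X = F.nab D (Z.lie X) - br K Z.par X.par L (F.nab D X) := by
  rw [defect, lieV_vf, nabV_vf]

theorem defect_der (D : Connection c) (Z : HomVF c) {L : Op c} (hL : F.IsDer Z.par L)
    (X : HomVF c) : F.IsDer (Z.par + X.par) (F.defect D Z L X) := by
  rw [defect_eq]
  exact (F.nab_der D (Z.lie X)).sub (hL.brDer (F.nab_der D X))

theorem defect_sfn (D : Connection c) (Z : HomVF c) {L : Op c}
    (hf : ∀ f, L (sfn c f) = sfn c (Z.der f)) (X : HomVF c) (f : R) :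
    F.defect D Z L X (sfn c f) = 0 := by
  rw [defect_eq]
  simp only [br, LinearMap.sub_apply, LinearMap.smul_apply, Module.End.mul_apply, nab_sfn, hf,
    HomVF.lie, sgn_smul (K := K), sfn_sub, sfn_smul, sub_self]

theorem defect_tensor [CharZero K] (D : Connection c) (Z : HomVF c) {L : Op c}
    (hL : F.IsDer Z.par L) (hf : ∀ f, L (sfn c f) = sfn c (Z.der f)) (X : HomVF c) :
    ∑ i, F.defect D Z L (F.Y i) * lm (sfn c (F.ival i X)) = F.defect D Z L X := by
  refine F.tensor_sum (o := Z.par) (A := F.defect D Z L) (fun X => ?_) (fun i q f hh => ?_) X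
  · have e1 : F.lieV Z X.vf = ∑ i, sgn K (F.Y i).par • (Z.der (X.der (F.g i)) • (F.Y i).vf
        + sgn K (Z.par * (X.par + (F.Y i).par)) • X.der (F.g i) • F.lieV Z (F.Y i).vf) := by
      conv_lhs => rw [F.spec X.vf]
      simp only [map_sum, map_smul, HomVF.vf_coe]
      refine Finset.sum_congr rfl fun i _ => ?_
      rw [F.lieV_fsmul, F.trpow_apply _ (X.mem.1 _ _ (F.g_mem i)), smul_assoc]
    have e2 : br K Z.par X.par L (F.nab D X) = ∑ i, sgn K (F.Y i).par •
        (lm (sfn c (Z.der (X.der (F.g i)))) * F.nab D (F.Y i) +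
          sgn K (Z.par * (X.par + (F.Y i).par)) • (lm (sfn c (X.der (F.g i))) *
            br K Z.par (F.Y i).par L (F.nab D (F.Y i)))) := by
      rw [F.nab_eq D X, br_sum_right]
      refine Finset.sum_congr rfl fun i _ => ?_
      have hp := X.mem.1 _ _ (F.g_mem i)
      have h := br_mul_right (K := K) Z.par (X.par + (F.Y i).par) (F.Y i).par L
        (lm (sfn c (X.der (F.g i)))) (F.nab D (F.Y i))
      rw [add_assoc, zmod_add_self, add_zero, F.br_der_lm hL hp, hf] at h
      rw [br_smul_right, h]
    rw [defect, e1, e2]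
    simp only [map_sum, map_smul, map_add, nabV_fsmul, nabV_vf]
    ext s
    simp only [LinearMap.sub_apply, LinearMap.sum_apply]
    rw [← Finset.sum_sub_distrib]
    refine Finset.sum_congr rfl fun i _ => ?_
    simp only [defect, LinearMap.smul_apply, LinearMap.add_apply, LinearMap.sub_apply,
      Module.End.mul_apply, map_sub, smul_add, smul_sub, smul_smul]
    abel
  · rw [F.br_der_lm (F.defect_der D Z hL _) hh, F.defect_sfn D Z hf]
    ext; simp

theorem bop_nabla_tensor [CharZero K] (D : Connection c) (Y X : HomVF c) :
    ∑ i, (sgn K (Y.par * (F.Y i).par) • F.bop D (D.ap (F.Y i) Y).vf) * lm (sfn c (F.ival i X)) =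
      sgn K (Y.par * X.par) • F.bop D (D.ap X Y).vf := by
  refine F.tensor_sum (o := Y.par)
    (A := fun X => sgn K (Y.par * X.par) • F.bop D (D.ap X Y).vf) (fun X => ?_)
    (fun i q f hf => ?_) X
  · have : (D.ap X Y).vf = ∑ i, sgn K (F.Y i).par • X.der (F.g i) • (D.ap (F.Y i) Y).vf := by
      change D.nabla X.vf Y.vf = _
      conv_lhs => rw [F.spec X.vf]
      simp only [map_sum, map_smul, LinearMap.sum_apply, LinearMap.smul_apply, D.smul_left]
      rfl
    rw [this]
    simp only [map_sum, map_smul, bop_fsmul, Finset.smul_sum, mul_smul_comm, smul_smul]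
    refine Finset.sum_congr rfl fun i _ => ?_
    congr 1
    have e : ∀ x y z : ZMod 2, x + y * z = x + y * (z + x) + y * x := by decide
    simp only [← sgn_add]
    rw [add_comm, e]
  · rw [br_smul_left, add_comm]
    have := (F.bop_isLinCod D (D.ap (F.Y i) Y)).lin q f hf
    rw [show (D.ap (F.Y i) Y).par = (F.Y i).par + Y.par from rfl] at this
    rw [this, smul_zero]

/-! ### The commutator with the Euler operator -/

theorem br_term {A : Type*} [Ring A] [Algebra K A] (o p : ZMod 2) (O x n i : A) :
    O * ((x - n) * i) - ((x - n) * i) * O =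
      (br K o p O x - br K o p O n) * i - (x - n) * br K p o i O := by
  simp only [br, mul_comm p o, sub_mul, mul_sub, smul_sub, smul_mul_assoc, mul_smul_comm, mul_assoc]
  abel

theorem br_sum_term {A : Type*} [Ring A] [Algebra K A] {J : Type*} (t : Finset J) (o : ZMod 2)
    (p : J → ZMod 2) (O : A) (x n i : J → A) :
    O * (∑ j ∈ t, (x j - n j) * i j) - (∑ j ∈ t, (x j - n j) * i j) * O =
      ∑ j ∈ t, ((br K o (p j) O (x j) - br K o (p j) O (n j)) * i j
        - (x j - n j) * br K (p j) o (i j) O) := by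
  rw [Finset.mul_sum, Finset.sum_mul, ← Finset.sum_sub_distrib]
  exact Finset.sum_congr rfl fun j _ => br_term o (p j) O (x j) (n j) (i j)

theorem bop_sub_apply [CharZero K] (D : Connection c) (X Y : Vect c) (s : SymT c) :
    F.bop D (X - Y) s = F.bop D X s - F.bop D Y s := by
  have h := map_add (F.bop D) (X - Y) Y
  have e : X - Y + Y = X := Subtype.ext (sub_add_cancel X.1 Y.1)
  rw [e] at h
  rw [h, LinearMap.add_apply, add_sub_cancel_right]

/-- `pbw_euler` read through the injectivity of pbw. The Euler operator thus has two expressions, ∑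
Yᵢ ⊙ ιᵢ and ∑ B(Yᵢ; ιᵢ -); the recursions for the brackets and for B come from commuting with the
second while knowing its eigenvalues from the first. -/
theorem euler_eq [CharZero K] (D : Connection c) :
    F.euler = ∑ i, F.bop D (F.Y i).vf * F.iota i := by
  ext s
  refine F.pbw_injective D ?_
  rw [pbw_euler]
  simp only [LinearMap.sum_apply, Module.End.mul_apply, bop_vf, LinearMap.sub_apply, map_sum,
    map_sub, pbw_lam]

theorem iota_eq (i : Fin F.N) : F.iota i = ∑ j, lm (sfn c (F.ival i (F.Y j))) * F.iota j :=
  F.der_eq_sum_iota (F.iota_der i) (F.iota_sfn i)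
    (fun j => by rw [add_comm]; exact F.ival_mem i (F.Y j)) fun j => F.iota_vf i (F.Y j)

/-- Expresses the invariance under L of the canonical element ∑ Yⱼ ⊗ ιⱼ, where `w` is the action of
L on vector fields. Both sides are derivations, compared on a field expanded in the dual basis. -/
theorem sum_iota_tan {o : ZMod 2} {L : Op c} [CharZero K] (hL : F.IsTan o L)
    {w : Vect c → Vect c} (hw : ∀ X, L (svf c X) = svf c (w X)) (i : Fin F.N) :
    ∑ j, lm (F.iota i (svf c (w (F.Y j).vf))) * F.iota j =
      ∑ j, lm (sfn c (F.ival i (F.Y j))) * br K (F.Y j).par o (F.iota j) L := by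
  have hz : ∀ j f, F.iota j (L (sfn c f)) = 0 := fun j f => by
    obtain ⟨g, hg⟩ := hL.fn f
    rw [hg, iota_sfn]
  refine IsDer.ext (F := F) (p := (F.Y i).par + o) (IsDer.sum fun j _ => ?_)
    (IsDer.sum fun j _ => ?_) (fun f => ?_) fun X => ?_
  · have h1 : F.iota i (svf c (w (F.Y j).vf)) =
        sfn c ((F.tvpow (F.Y i).par (w (F.Y j).vf)).1 (F.g i)) := F.iota_svf i _
    have h2 : (F.tvpow (F.Y i).par (w (F.Y j).vf)).1 (F.g i) ∈
        par c ((F.Y i).par + o + (F.Y j).par) := by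
      refine F.mem_par_of_tauR (sfn_injective (c := c) ?_)
      rw [← tauS_sfn, ← h1, (F.iota_der i).tau, ← hw, hL.tau, tauS_svf, F.tauV_vf, svf_smul,
        map_smul, map_smul, map_smul, hw, h1, sfn_smul, smul_smul, smul_smul, ← sgn_add, ← sgn_add,
        add_assoc]
    rw [h1]
    have := (F.iota_der j).fmul h2
    rwa [add_assoc _ _ (F.Y j).par, zmod_add_self, add_zero] at this
  · have := ((F.iota_der j).brDer hL.toIsDer).fmul (F.ival_mem i (F.Y j))
    have e : ∀ x y z : ZMod 2, x + y + (x + z) = y + z := by decide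
    rwa [e] at this
  · simp [br, hz]
  · have e1 : F.iota i (L (svf c X.vf)) = ∑ j, (F.iota i (svf c (w (F.Y j).vf)) *
        sfn c (F.ival j X) + sgn K (o * (F.Y j).par) •
          (sfn c (F.ival i (F.Y j)) * L (sfn c (F.ival j X)))) := by
      conv_lhs => rw [← F.sum_ival X]
      simp only [map_sum, hL.leib, map_add, (F.iota_der i).leib, iota_sfn, mul_zero, add_zero, hz,
        hw, tpow_of_mem (svf_mem_spar (F.Y _)), map_smul, iota_vf, smul_mul_assoc]
    have e2 := congrArg (fun x : Op c => x (L (svf c X.vf))) (F.iota_eq i)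
    simp only [LinearMap.sum_apply, Module.End.mul_apply, lm_apply] at e2
    simp only [LinearMap.sum_apply, Module.End.mul_apply, lm_apply, br, LinearMap.sub_apply,
      LinearMap.smul_apply, mul_sub, Finset.sum_sub_distrib, iota_vf]
    rw [← e2, e1, Finset.sum_add_distrib]
    simp only [mul_smul_comm, mul_comm o]
    rw [add_sub_cancel_right]

theorem euler_comm_tan {o : ZMod 2} {L : Op c} (hL : F.IsTan o L) :
    L * F.euler = F.euler * L := by
  ext s
  simp only [Module.End.mul_apply]
  induction s using graded_induction F with
  | hadd s s' h h' => simp only [map_add, h, h']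
  | h n s hs => rw [F.euler_of_mem hs, F.euler_of_mem (hL.mem hs), map_smul]

/-- Commute O with E = ∑ (λ_{Yᵢ} - ∇_{Yᵢ}) ιᵢ factor by factor; by hypothesis [O, λ_X] = λ_{[Z,X]}.
The derivation L preserves degrees and so commutes with E, and by invariance of ∑ Yᵢ ⊗ ιᵢ its
contributions `e1` balance. Replacing O by O - L inside the brackets leaves the defect of L with
respect to ∇. -/
theorem euler_comm [CharZero K] (D : Connection c) (Z : HomVF c) {L O : Op c}
    (hL : F.IsTan Z.par L) {w : Vect c → Vect c}
    (hw : ∀ X, L (svf c X) = svf c (w X))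
    (hO : ∀ X, br K Z.par X.par O (F.lam D X) = F.lamV D (F.lieV Z X.vf)) :
    (O - L) * F.euler - F.euler * (O - L) =
      ∑ i, F.defect D Z L (F.Y i) * F.iota i
      - ∑ i, br K Z.par (F.Y i).par (O - L) (F.nab D (F.Y i)) * F.iota i
      + ∑ i, F.bop D (F.lieV Z (F.Y i).vf - w (F.Y i).vf) * F.iota i
      - ∑ i, F.bop D (F.Y i).vf * br K (F.Y i).par Z.par (F.iota i) (O - L) := by
  have e1 : ∑ i, F.bop D (w (F.Y i).vf) * F.iota i =
      ∑ i, F.bop D (F.Y i).vf * br K (F.Y i).par Z.par (F.iota i) L := by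
    have h1 : ∀ i, F.bop D (w (F.Y i).vf) * F.iota i =
        ∑ j, F.bop D (F.Y j).vf * (lm (F.iota j (svf c (w (F.Y i).vf))) * F.iota i) := fun i => by
      rw [← F.bop_tensor D (w (F.Y i).vf), Finset.sum_mul]
      simp only [mul_assoc]
    have h2 : ∀ i, F.bop D (F.Y i).vf * br K (F.Y i).par Z.par (F.iota i) L =
        ∑ j, F.bop D (F.Y j).vf * (lm (sfn c (F.ival j (F.Y i))) *
          br K (F.Y i).par Z.par (F.iota i) L) := fun i => by
      conv_lhs => rw [← F.bop_tensor D (F.Y i).vf, Finset.sum_mul]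
      simp only [mul_assoc, iota_vf]
    simp only [h1, h2]
    rw [Finset.sum_comm, Finset.sum_comm (f := fun i j => F.bop D (F.Y j).vf *
      (lm (sfn c (F.ival j (F.Y i))) * br K (F.Y i).par Z.par (F.iota i) L))]
    simp only [← Finset.mul_sum]
    refine Finset.sum_congr rfl fun j _ => ?_
    rw [F.sum_iota_tan hL hw j]
  have e2 : O * F.euler - F.euler * O = ∑ i, ((F.lamV D (F.lieV Z (F.Y i).vf)
      - br K Z.par (F.Y i).par O (F.nab D (F.Y i))) * F.iota i
      - F.bop D (F.Y i).vf * br K (F.Y i).par Z.par (F.iota i) O) := by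
    rw [F.euler_eq D]
    simp only [bop_vf]
    have h := br_sum_term (K := K) Finset.univ Z.par (fun i => (F.Y i).par) O
      (fun i => F.lam D (F.Y i)) (fun i => F.nab D (F.Y i)) F.iota
    simp only [hO] at h
    exact h
  have e3 := F.euler_comm_tan hL
  ext s
  have e1' := congrArg (fun x : Op c => x s) e1
  have e2' := congrArg (fun x : Op c => x s) e2
  have e3' := congrArg (fun x : Op c => x s) e3
  simp only [LinearMap.sub_apply, LinearMap.add_apply, LinearMap.sum_apply, Module.End.mul_apply,
    defect, br_sub_left, br_sub_right, bop_sub_apply, map_sub, Finset.sum_sub_distrib]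
    at e1' e2' e3' ⊢
  rw [e3', sub_sub_sub_cancel_right, e2', ← sub_eq_zero]
  rw [← sub_eq_zero] at e1'
  have e5 : ∑ x, F.bop D (F.lieV Z (F.Y x).vf) (F.iota x s) =
      ∑ x, F.lamV D (F.lieV Z (F.Y x).vf) (F.iota x s) -
        ∑ x, F.nabV D (F.lieV Z (F.Y x).vf) (F.iota x s) := by
    rw [← Finset.sum_sub_distrib]
    exact Finset.sum_congr rfl fun x _ => by rw [bop_apply, LinearMap.sub_apply]
  rw [← e1', e5]
  abel

end Frame

end Master

/-! ### Evaluation of the commutator identity on monomials -/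

section Recursion

variable {K R : Type*} [Field K] [Ring R] [Algebra K R] {c : ℤ → R →ₗ[K] R}

/-! ### Sums over the comultiplication -/

section Csum

variable {N : Type*} [AddCommGroup N] [Module K N]

/-- The sum of `f` over the terms of the comultiplication. -/
def csum (f : List (HomVF c) → List (HomVF c) → N) (l : List (HomVF c)) : N :=
  ((coprod l).map fun t => usgn K t.1 • f t.2.1 t.2.2).sum

@[simp] theorem csum_nil (f : List (HomVF c) → List (HomVF c) → N) : csum f [] = f [] [] := by
  simp [csum, coprod]

theorem csum_cons (f : List (HomVF c) → List (HomVF c) → N) (X : HomVF c) (l : List (HomVF c)) :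
    csum f (X :: l) = csum (fun l₁ l₂ => f (X :: l₁) l₂) l +
      csum (fun l₁ l₂ => sgn K (X.par * lpar l₁) • f l₁ (X :: l₂)) l := by
  simp only [csum, coprod]
  induction coprod l with
  | nil => simp
  | cons t L ih =>
    simp only [List.flatMap_cons, List.cons_append, List.nil_append, List.map_cons, List.sum_cons,
      ih, usgn_mul, usgn_sgn, smul_smul]
    rw [mul_comm (sgn K _)]
    abel

theorem csum_congr {f g : List (HomVF c) → List (HomVF c) → N} {l : List (HomVF c)}
    (h : ∀ l₁ l₂, l₁.length + l₂.length = l.length → f l₁ l₂ = g l₁ l₂) :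
    csum f l = csum g l := by
  induction l generalizing f g with
  | nil => simpa using h [] [] rfl
  | cons X l ih =>
    rw [csum_cons, csum_cons]
    congr 1
    · exact ih fun l₁ l₂ hl => h _ _ (by simp; omega)
    · exact ih fun l₁ l₂ hl => by rw [h _ _ (by simp; omega)]

theorem csum_add (f g : List (HomVF c) → List (HomVF c) → N) (l : List (HomVF c)) :
    csum (fun l₁ l₂ => f l₁ l₂ + g l₁ l₂) l = csum f l + csum g l := by
  simp only [csum, smul_add]
  exact List.sum_map_add

@[simp] theorem csum_zero (l : List (HomVF c)) : csum (fun _ _ => (0 : N)) l = 0 := by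
  simp [csum]

theorem map_csum {N' : Type*} [AddCommGroup N'] [Module K N'] (φ : N →ₗ[K] N')
    (f : List (HomVF c) → List (HomVF c) → N) (l : List (HomVF c)) :
    φ (csum f l) = csum (fun l₁ l₂ => φ (f l₁ l₂)) l := by
  simp only [csum]
  rw [map_list_sum]
  simp [Function.comp_def]

theorem csum_smul (a : K) (f : List (HomVF c) → List (HomVF c) → N) (l : List (HomVF c)) :
    csum (fun l₁ l₂ => a • f l₁ l₂) l = a • csum f l :=
  (map_csum (a • LinearMap.id : N →ₗ[K] N) f l).symm

theorem csum_sum {J : Type*} (s : Finset J) (f : J → List (HomVF c) → List (HomVF c) → N)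
    (l : List (HomVF c)) :
    csum (fun l₁ l₂ => ∑ j ∈ s, f j l₁ l₂) l = ∑ j ∈ s, csum (f j) l := by
  classical
  induction s using Finset.induction_on with
  | empty => simp
  | insert j s hj ih => simp only [Finset.sum_insert hj, csum_add, ih]

/-- The part of the sum for which the first factor has a given length. -/
def csumAt (j : ℕ) (f : List (HomVF c) → List (HomVF c) → N) (l : List (HomVF c)) : N :=
  csum (fun l₁ l₂ => if l₁.length = j then f l₁ l₂ else 0) l

theorem csum_eq_sum (f : List (HomVF c) → List (HomVF c) → N) (l : List (HomVF c)) :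
    csum f l = ∑ j ∈ Finset.range (l.length + 1), csumAt j f l := by
  simp only [csumAt]
  rw [← csum_sum]
  refine csum_congr fun l₁ l₂ hl => ?_
  rw [Finset.sum_ite_eq, if_pos (Finset.mem_range.2 (by omega))]

theorem csumAt_congr {j : ℕ} {f g : List (HomVF c) → List (HomVF c) → N} {l : List (HomVF c)}
    (h : ∀ l₁ l₂, l₁.length = j → l₁.length + l₂.length = l.length → f l₁ l₂ = g l₁ l₂) :
    csumAt j f l = csumAt j g l := by
  refine csum_congr fun l₁ l₂ hl => ?_
  split_ifs with h'
  · exact h _ _ h' hl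
  · rfl

theorem csumAt_eq_zero {j : ℕ} {f : List (HomVF c) → List (HomVF c) → N} {l : List (HomVF c)}
    (h : ∀ l₁ l₂, l₁.length = j → l₁.length + l₂.length = l.length → f l₁ l₂ = 0) :
    csumAt j f l = 0 := by
  rw [csumAt_congr (g := fun _ _ => 0) h, csumAt]
  simp

@[simp] theorem csumAt_zero (f : List (HomVF c) → List (HomVF c) → N) (l : List (HomVF c)) :
    csumAt 0 f l = f [] l := by
  unfold csumAt
  induction l generalizing f with
  | nil => simp
  | cons X l ih =>
    rw [csum_cons]
    simp only [List.length_cons, Nat.add_eq_zero_iff, one_ne_zero, and_false, if_false, csum_zero,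
      zero_add]
    have := ih (fun l₁ l₂ => f l₁ (X :: l₂))
    rw [← this]
    refine csum_congr fun l₁ l₂ _ => ?_
    split_ifs with h
    · rw [List.length_eq_zero_iff.1 h]; simp
    · simp

theorem csumAt_length (f : List (HomVF c) → List (HomVF c) → N) (l : List (HomVF c)) :
    csumAt l.length f l = f l [] := by
  unfold csumAt
  induction l generalizing f with
  | nil => simp
  | cons X l ih =>
    rw [csum_cons]
    have := ih (fun l₁ l₂ => f (X :: l₁) l₂)
    rw [← this]
    simp only [List.length_cons, add_left_inj]
    rw [add_eq_left]
    refine (csum_congr (g := fun _ _ => (0 : N)) fun l₁ l₂ h => ?_).trans (csum_zero l)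
    rw [if_neg (by omega), smul_zero]

end Csum

namespace Frame

variable (F : Frame c)

/-! ### The equations for the brackets -/

theorem br_dlt_lam [CharZero K] (D : Connection c) (Z X : HomVF c) :
    br K Z.par X.par (F.dlt D Z) (F.lam D X) = F.lamV D (F.lieV Z X.vf) := by
  ext s
  refine F.pbw_injective D ?_
  rw [pbw_lamV, lieV_vf]
  simp only [br, LinearMap.sub_apply, LinearMap.smul_apply, Module.End.mul_apply, map_sub, map_smul,
    pbw_dlt, pbw_lam, F.tpow_op (F.lam_tau D X), HomVF.vf_coe, HomVF.lie, sgn_smul (K := K),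
    sub_mul, mul_sub, smul_sub, smul_mul_assoc, mul_assoc]
  abel

theorem br_lam_lam [CharZero K] (D : Connection c) (Z X : HomVF c) :
    br K Z.par X.par (F.lam D Z) (F.lam D X) = F.lamV D (F.lieV Z X.vf) := by
  ext s
  refine F.pbw_injective D ?_
  rw [pbw_lamV, lieV_vf]
  simp only [br, LinearMap.sub_apply, LinearMap.smul_apply, Module.End.mul_apply, map_sub, map_smul,
    pbw_lam, HomVF.vf_coe, HomVF.lie, sgn_smul (K := K), sub_mul, smul_mul_assoc, mul_assoc]

theorem sum_op_iota_mon (A : HomVF c → Op c)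
    (hA : ∀ X, ∑ i, A (F.Y i) * lm (sfn c (F.ival i X)) = A X) (l : List (HomVF c)) :
    (∑ i, A (F.Y i) * F.iota i) (mon l) = sel (fun X l' => A X (mon l')) l := by
  simp only [LinearMap.sum_apply, Module.End.mul_apply]
  refine F.sum_iota_mon (T := fun i => A (F.Y i)) (O := fun X s => A X s) fun X l' => ?_
  rw [← hA X]
  simp

/-- The brackets [ιᵢ, a] are in the centralizer, so they are convolutions of functions, namely of
the contractions of the degree-one part of a. Recombining these with B(Yᵢ; -) through the dual basis
gives B(a₁(𝐗₍₁₎); 𝐗₍₂₎). -/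
theorem sum_bop_br [CharZero K] (D : Connection c) {o : ZMod 2} {a : Op c} (ha : F.IsLinCod o a)
    (l : List (HomVF c)) :
    (∑ i, F.bop D (F.Y i).vf * br K (F.Y i).par o (F.iota i) a) (mon l) =
      csum (fun l₁ l₂ => F.bop D (F.vpart (a (mon l₁))) (mon l₂)) l := by
  have h0 : ∀ i s, counit c (a (F.iota i s)) = 0 := fun i s => ha.counit_zero _
  have h1 : ∀ i, br K (F.Y i).par o (F.iota i) a (mon l) =
      csum (fun l₁ l₂ => F.iota i (svf c (F.vpart (a (mon l₁)))) * mon l₂) l := by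
    intro i
    have hc : br K (F.Y i).par o (F.iota i) a ∈ cent K F.gens ((F.Y i).par + o) := by
      rw [br_antisymm, add_comm, ← neg_one_smul K]
      exact Submodule.smul_mem _ _ (Submodule.smul_mem _ _ (ha.mem _ _ (F.iota_mem_cent i)))
    rw [F.cent_eq_convS hc (F.br_tau (F.iota_der i).tau ha.tau)]
    have e : ∀ l₁, sfn c (counit c (br K (F.Y i).par o (F.iota i) a (mon l₁))) =
        F.iota i (svf c (F.vpart (a (mon l₁)))) := by
      intro l₁
      rw [svf_vpart, ← pr_iota, pr_zero F]
      simp only [br, LinearMap.sub_apply, LinearMap.smul_apply, Module.End.mul_apply, map_sub,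
        map_smul, h0, smul_zero, sub_zero]
    simp only [e]
    rfl
  simp only [LinearMap.sum_apply, Module.End.mul_apply, h1, map_csum]
  rw [← csum_sum]
  refine csum_congr fun l₁ l₂ _ => ?_
  conv_rhs => rw [← F.bop_tensor D]
  simp

theorem vpart_euler (s : SymT c) : F.vpart (F.euler s) = F.vpart s := by
  induction s using graded_induction F with
  | hadd s s' h h' => simp only [map_add, h, h']
  | h n s hs =>
    rw [F.euler_of_mem hs, map_smul]
    by_cases h : n = 1
    · subst h; simp
    · rw [F.vpart_of_mem h hs, smul_zero]

theorem vpart_nab (D : Connection c) (X : HomVF c) (s : SymT c) :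
    F.vpart (F.nab D X s) = D.nabla X.vf (F.vpart s) := by
  apply F.svf_injective
  rw [svf_vpart, (F.nab_tan D X).pr, ← svf_vpart, nab_svf]

theorem defect_mem (D : Connection c) (Z : HomVF c) {L : Op c} (hL : F.IsTan Z.par L)
    (X : HomVF c) {n : ℕ} {s : SymT c} (hs : s ∈ symPow c n) :
    F.defect D Z L X s ∈ symPow c n := by
  rw [defect_eq]
  simp only [br, LinearMap.sub_apply, LinearMap.smul_apply, Module.End.mul_apply]
  exact sub_mem ((F.nab_tan D _).mem hs) (sub_mem (hL.mem ((F.nab_tan D _).mem hs))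
    (Submodule.smul_mem _ _ ((F.nab_tan D _).mem (hL.mem hs))))

/-- The operator `δ - L_Q`. -/
def phi [CharZero K] (D : Connection c) (Q : Homological c) : Op c :=
  F.dlt D Q.hom - F.lied Q.hom

/-- The Taylor coefficients of `δ - L_Q`. -/
def brk [CharZero K] (D : Connection c) (Q : Homological c) (l : List (HomVF c)) : Vect c :=
  F.vpart (F.phi D Q (mon l))

/-- The Taylor coefficients of `B(Y, -)`. -/
def bco [CharZero K] (D : Connection c) (Y : Vect c) (l : List (HomVF c)) : Vect c :=
  F.vpart (F.bop D Y (mon l))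

/-- `euler_comm` with O = δ and L = L_Q. Here L acts on vector fields by [Q, -], so the third sum of
that identity is zero. -/
theorem phi_master [CharZero K] (D : Connection c) (Q : Homological c) (l : List (HomVF c)) :
    (l.length : K) • F.phi D Q (mon l) - F.euler (F.phi D Q (mon l)) =
      sel (fun X l' => F.defect D Q.hom (F.lied Q.hom) X (mon l')) l
      - sel (fun X l' => br K 1 X.par (F.phi D Q) (F.nab D X) (mon l')) l
      - csum (fun l₁ l₂ => F.bop D (F.brk D Q l₁) (mon l₂)) l := by
  have h := F.euler_comm D Q.hom (F.lied_tan Q.hom) (w := F.lieV Q.hom) (F.lied_svf Q.hom)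
    (F.br_dlt_lam D Q.hom)
  have h' := congrArg (fun x : Op c => x (mon l)) h
  have hcod := F.phi_isLinCod D Q.hom
  simp only [LinearMap.sub_apply (M := SymT c), LinearMap.add_apply (M := SymT c)] at h'
  rw [F.sum_op_iota_mon (F.defect D Q.hom (F.lied Q.hom))
      (F.defect_tensor D Q.hom (F.lied_der _) (F.lied_sfn _)),
    F.sum_op_iota_mon (fun X => br K Q.hom.par X.par (F.dlt D Q.hom - F.lied Q.hom) (F.nab D X))
      (F.br_nab_tensor D hcod.lin),
    F.sum_bop_br D hcod] at h'
  simp only [Module.End.mul_apply, F.euler_of_mem (mon_mem' l), map_smul] at h'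
  have hz : (∑ i, F.bop D (F.lieV Q.hom (F.Y i).vf - F.lieV Q.hom (F.Y i).vf) * F.iota i) (mon l)
      = 0 := by
    simp [bop_sub_apply]
  rw [hz, add_zero] at h'
  exact h'

/-- `euler_comm` with O = λ_Y and L = ∇_Y. Now the third sum survives: torsion-freeness turns [Y, X]
- ∇_Y X into ∓ ∇_X Y, the term in which the first argument of B is differentiated. -/
theorem bop_master [CharZero K] (D : Connection c) (hD : D.TorsionFree) (Y : HomVF c)
    (l : List (HomVF c)) :
    (l.length : K) • F.bop D Y.vf (mon l) - F.euler (F.bop D Y.vf (mon l)) =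
      sel (fun X l' => F.defect D Y (F.nab D Y) X (mon l')) l
      - sel (fun X l' => br K Y.par X.par (F.bop D Y.vf) (F.nab D X) (mon l')) l
      - sel (fun X l' => sgn K (Y.par * X.par) • F.bop D (D.ap X Y).vf (mon l')) l
      - csum (fun l₁ l₂ => F.bop D (F.bco D Y.vf l₁) (mon l₂)) l := by
  have h := F.euler_comm D Y (F.nab_tan D Y) (w := D.nabla Y.vf) (F.nab_svf D Y)
    (F.br_lam_lam D Y)
  rw [← bop_vf] at h
  have h' := congrArg (fun x : Op c => x (mon l)) h
  have hcod := F.bop_isLinCod D Y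
  simp only [LinearMap.sub_apply (M := SymT c), LinearMap.add_apply (M := SymT c)] at h'
  rw [F.sum_op_iota_mon (F.defect D Y (F.nab D Y))
      (F.defect_tensor D Y (F.nab_der D Y) (F.nab_sfn D Y)),
    F.sum_op_iota_mon (fun X => br K Y.par X.par (F.bop D Y.vf) (F.nab D X))
      (F.br_nab_tensor D hcod.lin),
    F.sum_bop_br D hcod] at h'
  simp only [Module.End.mul_apply, F.euler_of_mem (mon_mem' l), map_smul] at h'
  have e : ∀ X : HomVF c, F.lieV Y X.vf - D.nabla Y.vf X.vf =
      -(sgn K (Y.par * X.par) • (D.ap X Y).vf) := by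
    intro X
    rw [lieV_vf, ← hD Y X, vect_sgn_smul]
    change (D.nabla Y.vf X.vf - _) - D.nabla Y.vf X.vf = _
    abel
  have hz : (∑ i, F.bop D (F.lieV Y (F.Y i).vf - D.nabla Y.vf (F.Y i).vf) * F.iota i) (mon l)
      = -sel (fun X l' => sgn K (Y.par * X.par) • F.bop D (D.ap X Y).vf (mon l')) l := by
    have := F.sum_op_iota_mon (fun X => sgn K (Y.par * X.par) • F.bop D (D.ap X Y).vf)
      (F.bop_nabla_tensor D Y) l
    rw [show (fun (X : HomVF c) l' => sgn K (Y.par * X.par) • F.bop D (D.ap X Y).vf (mon l')) =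
      fun X l' => (sgn K (Y.par * X.par) • F.bop D (D.ap X Y).vf) (mon l') from rfl, ← this]
    have hb : ∀ (a : K) (V : Vect c) (s : SymT c),
        F.bop D (-(a • V)) s = -((a • F.bop D V) s) := by
      intro a V s
      rw [← zero_sub (a • V), bop_sub_apply, map_zero, map_smul, LinearMap.zero_apply, zero_sub]
    simp only [e, LinearMap.sum_apply, Module.End.mul_apply, hb, Finset.sum_neg_distrib]
  rw [hz] at h'
  rw [show F.bco D Y.vf = fun l₁ => F.vpart (F.bop D Y.vf (mon l₁)) from rfl]
  rw [h']
  abel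

theorem vpart_br_nab (D : Connection c) (o : ZMod 2) (a : Op c) (X : HomVF c)
    (l : List (HomVF c)) : F.vpart (br K o X.par a (F.nab D X) (mon l)) =
      F.vpart (a (D.onMon X l)) - sgn K (o * X.par) • D.nabla X.vf (F.vpart (a (mon l))) := by
  simp only [br, LinearMap.sub_apply, LinearMap.smul_apply, Module.End.mul_apply, map_sub,
    map_smul, vpart_nab, nab_mon]

theorem lamV_one [CharZero K] (D : Connection c) (Y : Vect c) : F.lamV D Y 1 = svf c Y := by
  refine F.pbw_injective D ?_
  rw [pbw_lamV, pbw_one, pbw_svf, mul_one]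

theorem nabV_one (D : Connection c) (Y : Vect c) : F.nabV D Y 1 = 0 := by
  induction Y using F.vf_induction with
  | hadd X Y h h' => rw [map_add, LinearMap.add_apply, h, h', add_zero]
  | hhom X => rw [nabV_vf, nab_one]

theorem bco_nil [CharZero K] (D : Connection c) (Y : Vect c) : F.bco D Y [] = Y := by
  rw [bco, mon_nil, bop_apply, LinearMap.sub_apply, lamV_one, nabV_one, sub_zero, vpart_svf]

theorem bco_zero [CharZero K] (D : Connection c) (l : List (HomVF c)) : F.bco D 0 l = 0 := by
  rw [bco, map_zero, LinearMap.zero_apply, map_zero]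

theorem brk_nil [CharZero K] (D : Connection c) (Q : Homological c) : F.brk D Q [] = 0 := by
  have h1 : F.dlt D Q.hom 1 = 0 := by
    refine F.pbw_injective D ?_
    rw [pbw_dlt, map_one (F.tpow _), pbw_one, mul_one, one_mul, sub_self, map_zero]
  have h2 : F.lied Q.hom 1 = 0 := F.lied_mon Q []
  rw [brk, mon_nil, phi, LinearMap.sub_apply, h1, h2, sub_zero, map_zero]

theorem brk_singleton [CharZero K] (D : Connection c) (Q : Homological c) (X : HomVF c) :
    F.brk D Q [X] = 0 := by
  have h1 : F.dlt D Q.hom (svf c X.vf) = svf c (F.lieV Q.hom X.vf) := by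
    refine F.pbw_injective D ?_
    rw [pbw_dlt, tpow_of_mem (svf_mem_spar (F := F) X), map_smul, pbw_svf, pbw_svf, lieV_vf,
      HomVF.vf_coe, HomVF.vf_coe, smul_mul_assoc]
    simp only [HomVF.lie, sgn_smul (K := K)]
  rw [brk, mon_singleton, phi, LinearMap.sub_apply, h1, lied_svf, sub_self, map_zero]

end Frame

end Recursion

/-! ### Recursions for the coefficients of B and of δ - L_Q, and the flat case -/

section Brackets

variable {K R : Type*} [Field K] [Ring R] [Algebra K R] {c : ℤ → R →ₗ[K] R}

/-- The terms of a covariant derivative in which an argument is differentiated. -/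
def covSum (D : Connection c) (X : HomVF c) : (List (HomVF c) → Vect c) → List (HomVF c) → Vect c
  | _, [] => 0
  | f, Y :: l => f (D.ap X Y :: l) + sgn K (X.par * Y.par) • covSum D X (fun l => f (Y :: l)) l

/-- Covariant derivative of a tensor of parity `p`. -/
def covL (D : Connection c) (p : ZMod 2) (f : List (HomVF c) → Vect c) (X : HomVF c)
    (l : List (HomVF c)) : Vect c :=
  sgn K (p * X.par) • D.nabla X.vf (f l) - covSum D X f l

theorem covSum_map (D : Connection c) (X : HomVF c) (φ : SymT c →ₗ[K] Vect c)
    (l : List (HomVF c)) : covSum D X (fun l => φ (mon l)) l = φ (D.onMon X l) := by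
  induction l generalizing φ with
  | nil => simp [covSum, Connection.onMon]
  | cons Y l ih =>
    have := ih (φ ∘ₗ LinearMap.mulLeft K (svf c Y.vf))
    simp only [LinearMap.comp_apply, LinearMap.mulLeft_apply, ← mon_cons] at this
    simp only [covSum, Connection.onMon, map_add, this]
    rw [units_smul (K := K), usgn_sgn, map_smul, mon_cons]

theorem covSum_congr (D : Connection c) (X : HomVF c) {f g : List (HomVF c) → Vect c}
    {l : List (HomVF c)} (h : ∀ l', l'.length = l.length → f l' = g l') :
    covSum D X f l = covSum D X g l := by
  induction l generalizing f g with
  | nil => rfl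
  | cons Y l ih =>
    rw [covSum, covSum, h _ (by simp), ih fun l' hl' => h _ (by simp [hl'])]

theorem csum_eq_ends {N : Type*} [AddCommGroup N] [Module K N]
    (f : List (HomVF c) → List (HomVF c) → N) (l : List (HomVF c)) (hl : 1 ≤ l.length) :
    csum f l = f [] l + ∑ j ∈ Finset.Ico 1 l.length, csumAt j f l + f l [] := by
  rw [csum_eq_sum, Finset.sum_range_succ, csumAt_length, Finset.range_eq_Ico,
    Finset.sum_eq_sum_Ico_succ_bot (by omega), csumAt_zero]

namespace Frame

variable (F : Frame c)

/-- The defect preserves the symmetric degree, so only a single remaining argument gives a vector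
field. The Atiyah cocycle and the curvature therefore enter the recursions in one degree only. -/
theorem vpart_defect (D : Connection c) (Z : HomVF c) {L : Op c} (hL : F.IsTan Z.par L)
    (X : HomVF c) {l : List (HomVF c)} (hl : l.length ≠ 1) :
    F.vpart (F.defect D Z L X (mon l)) = 0 :=
  F.vpart_of_mem hl (F.defect_mem D Z hL X (mon_mem' l))

theorem vpart_defect_nab (D : Connection c) (Y X Z : HomVF c) :
    F.vpart (F.defect D Y (F.nab D Y) X (mon [Z])) = -D.curv Y X Z := by
  rw [defect_eq, mon_singleton]
  simp only [br, LinearMap.sub_apply, LinearMap.smul_apply, Module.End.mul_apply, nab_svf, map_sub,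
    map_smul, vpart_svf, Connection.curv, vect_sgn_smul]
  change D.nabla _ _ - (D.nabla _ (D.nabla _ _) - _ • D.nabla _ (D.nabla _ _)) =
    -(D.nabla _ (D.nabla _ _) - _ • D.nabla _ (D.nabla _ _) - D.nabla _ _)
  abel

theorem vpart_defect_lied (D : Connection c) (Q : Homological c) (X Z : HomVF c) :
    F.vpart (F.defect D Q.hom (F.lied Q.hom) X (mon [Z])) = -D.atiyah Q X Z := by
  have e1 : ∀ W, (Q.hom.lie W).vf = F.lieV Q.hom W.vf := fun W => (F.lieV_vf _ _).symm
  have e2 : Q.hom.par = 1 := rfl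
  rw [defect_eq, mon_singleton]
  simp only [br, LinearMap.sub_apply, LinearMap.smul_apply, Module.End.mul_apply, nab_svf, map_sub,
    map_smul, vpart_svf, Connection.atiyah, vect_sgn_smul, lied_svf, e2, one_mul]
  rw [e1 (D.ap X Z)]
  change D.nabla _ _ - (_ - _ • D.nabla _ _) =
    -(F.lieV Q.hom (D.nabla X.vf Z.vf) - D.nabla _ _ - _ • D.nabla _ (Q.hom.lie Z).vf)
  rw [e1 Z]
  abel

/-- Torsion-freeness turns the graded antisymmetric part into the failure of [Q, -] to be a
derivation of the Lie bracket, which is zero by the Jacobi identity `hJ`. -/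
theorem atiyah_symm (F : Frame c) (D : Connection c) (hD : D.TorsionFree) (Q : Homological c) (X Y : HomVF c) :
    D.atiyah Q X Y = sgn K (X.par * Y.par) • D.atiyah Q Y X := by
  have e1 : ∀ W, (Q.hom.lie W).vf = F.lieV Q.hom W.vf := fun W => (F.lieV_vf _ _).symm
  have h : ∀ X Y : HomVF c, D.nabla X.vf Y.vf =
      sgn K (X.par * Y.par) • D.nabla Y.vf X.vf + (X.lie Y).vf := by
    intro X Y
    rw [← hD X Y, vect_sgn_smul]
    change _ = _ + (D.nabla X.vf Y.vf - sgn K _ • D.nabla Y.vf X.vf)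
    abel
  have hA : ∀ X Y : HomVF c, D.atiyah Q X Y = F.lieV Q.hom (D.nabla X.vf Y.vf)
      - D.nabla (Q.hom.lie X).vf Y.vf - sgn K X.par • D.nabla X.vf (Q.hom.lie Y).vf := by
    intro X Y
    rw [Connection.atiyah, vect_sgn_smul, e1 (D.ap X Y)]
    rfl
  have hJ : F.lieV Q.hom (X.lie Y).vf - ((Q.hom.lie X).lie Y).vf
      - sgn K X.par • (X.lie (Q.hom.lie Y)).vf = 0 := by
    rw [← e1, ← vect_sgn_smul]
    apply Subtype.ext
    have hQ : Q.hom.par = 1 := rfl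
    change (Q.hom.lie (X.lie Y)).der - ((Q.hom.lie X).lie Y).der
      - (-1 : ℤˣ) ^ X.par • (X.lie (Q.hom.lie Y)).der = 0
    simp only [HomVF.lie, hQ]
    rcases zmod_two_cases X.par with hx | hx <;> rcases zmod_two_cases Y.par with hy | hy <;>
      simp [hx, hy, Units.smul_def, mul_sub, sub_mul, mul_assoc, zmod_add_self, mul_add, add_mul] <;> abel
  rw [hA X Y, hA Y X, h X Y, h (Q.hom.lie X) Y, h X (Q.hom.lie Y)]
  have e2 : (Q.hom.lie X).par = 1 + X.par := rfl
  have e3 : (Q.hom.lie Y).par = 1 + Y.par := rfl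
  have s1 : ∀ x y : ZMod 2, (1 + x) * y = x * y + y := by decide
  have s2 : ∀ x y : ZMod 2, x * (1 + y) = x * y + x := by decide
  rw [e2, e3, map_add, map_smul, s1, s2, sgn_add, sgn_add, ← sub_eq_zero]
  refine Eq.trans ?_ hJ
  rcases sgn_cases (K := K) X.par with h' | h' <;> simp only [h'] <;> module

theorem vpart_sel (H : HomVF c → List (HomVF c) → SymT c) (l : List (HomVF c)) :
    F.vpart (sel H l) = sel (fun X l' => F.vpart (H X l')) l := by
  simp [sel]

theorem vpart_csum (H : List (HomVF c) → List (HomVF c) → SymT c) (l : List (HomVF c)) :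
    F.vpart (csum H l) = csum (fun l₁ l₂ => F.vpart (H l₁ l₂)) l := by
  simp only [csum]
  rw [map_list_sum]
  simp [Function.comp_def]

/-- The tensor `B(Y; X₁, …, Xₙ)`. -/
def bl [CharZero K] (D : Connection c) : List (HomVF c) → Vect c
  | [] => 0
  | Y :: l => F.vpart (F.bop D Y.vf (mon l))

variable [CharZero K]

theorem covL_bl (D : Connection c) (X Y : HomVF c) (l : List (HomVF c)) :
    covL D 0 (F.bl D) X (Y :: l) = D.nabla X.vf (F.bl D (Y :: l)) - F.bco D (D.ap X Y).vf l
      - sgn K (X.par * Y.par) • F.vpart (F.bop D Y.vf (D.onMon X l)) := by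
  have h := covSum_map D X (F.vpart ∘ₗ F.bop D Y.vf) l
  simp only [LinearMap.comp_apply] at h
  rw [covL, zero_mul, covSum]
  simp only [bl, h, bco]
  rw [show sgn K (0 : ZMod 2) = 1 by simp [sgn], one_smul]
  abel

theorem covL_brk (D : Connection c) (Q : Homological c) (X : HomVF c) (l : List (HomVF c)) :
    covL D 1 (F.brk D Q) X l = sgn K X.par • D.nabla X.vf (F.brk D Q l)
      - F.vpart (F.phi D Q (D.onMon X l)) := by
  have h := covSum_map D X (F.vpart ∘ₗ F.phi D Q) l
  simp only [LinearMap.comp_apply] at h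
  rw [covL, one_mul, ← h]
  rfl

/-- The degree-one part of `bop_master`. The Euler operator is the identity there, whence n - 1; the
bracket of B(Y; -) with ∇_X and the term B(∇_X Y; -) combine to the covariant derivative of B in all
its arguments. -/
theorem bl_eq (D : Connection c) (hD : D.TorsionFree) (Y : HomVF c) (l : List (HomVF c)) :
    (l.length - 1 : K) • F.bl D (Y :: l) =
      sel (fun X l' => F.vpart (F.defect D Y (F.nab D Y) X (mon l'))) l
      + sel (fun X l' => sgn K (X.par * Y.par) • covL D 0 (F.bl D) X (Y :: l')) l
      - csum (fun l₁ l₂ => F.bco D (F.bl D (Y :: l₁)) l₂) l := by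
  have h := congrArg F.vpart (F.bop_master D hD Y l)
  simp only [map_sub, map_smul, vpart_euler, vpart_sel, vpart_csum, vpart_br_nab] at h
  have e : (l.length - 1 : K) • F.bl D (Y :: l) =
    (l.length : K) • F.bl D (Y :: l) - F.bl D (Y :: l) := by module
  rw [e]
  refine h.trans ?_
  have hE : sel (fun X l' => sgn K (X.par * Y.par) • covL D 0 (F.bl D) X (Y :: l')) l
      + (sel (fun X l' => F.vpart (F.bop D Y.vf (D.onMon X l')) - sgn K (Y.par * X.par) •
        D.nabla X.vf (F.vpart (F.bop D Y.vf (mon l')))) l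
      + sel (fun X l' => sgn K (Y.par * X.par) • F.vpart (F.bop D (D.ap X Y).vf (mon l'))) l)
      = 0 := by
    rw [← sel_add, ← sel_add]
    refine (sel_congr (H' := fun _ _ => 0) fun X l' _ => ?_).trans (by simp [sel])
    rw [covL_bl, mul_comm Y.par]
    simp only [bl, bco]
    rcases sgn_cases (K := K) (X.par * Y.par) with h' | h' <;> simp only [h'] <;> module
  simp only [bl, bco] at hE ⊢
  have e' : ∀ a b d f g : Vect c, f + (b + d) = 0 → a - b - d - g = a + f - g := by
    intro a b d f g h
    have : a + f - g = (a - b - d - g) + (f + (b + d)) := by abel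
    rw [this, h]
    abel
  exact e' _ _ _ _ _ hE

theorem brk_eq (D : Connection c) (Q : Homological c) (l : List (HomVF c)) :
    (l.length - 1 : K) • F.brk D Q l =
      sel (fun X l' => F.vpart (F.defect D Q.hom (F.lied Q.hom) X (mon l'))) l
      + sel (fun X l' => covL D 1 (F.brk D Q) X l') l
      - csum (fun l₁ l₂ => F.bco D (F.brk D Q l₁) l₂) l := by
  have h := congrArg F.vpart (F.phi_master D Q l)
  simp only [map_sub, map_smul, vpart_euler, vpart_sel, vpart_csum, vpart_br_nab] at h
  have e : (l.length - 1 : K) • F.brk D Q l =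
    (l.length : K) • F.brk D Q l - F.brk D Q l := by module
  rw [e]
  refine h.trans ?_
  have hE : sel (fun X l' => covL D 1 (F.brk D Q) X l') l
      + sel (fun X l' => F.vpart (F.phi D Q (D.onMon X l')) - sgn K (1 * X.par) •
        D.nabla X.vf (F.vpart (F.phi D Q (mon l')))) l = 0 := by
    rw [← sel_add]
    refine (sel_congr (H' := fun _ _ => 0) fun X l' _ => ?_).trans (by simp [sel])
    rw [covL_brk, one_mul]
    simp only [brk]
    abel
  simp only [bco] at hE ⊢
  have e' : ∀ a b f g : Vect c, f + b = 0 → a - b - g = a + f - g := by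
    intro a b f g h
    have : a + f - g = (a - b - g) + (f + b) := by abel
    rw [this, h]
    abel
  exact e' _ _ _ _ hE

theorem bl_singleton (D : Connection c) (Y : HomVF c) : F.bl D [Y] = Y.vf := F.bco_nil D Y.vf

/-- Both extreme terms of the coproduct equal B(Y; 𝐗), since B(Y; 1) = Y and B(Z; 1) = Z. Moved to
the left they change n - 1 into n + 1. -/
theorem bl_rec (D : Connection c) (hD : D.TorsionFree) (Y : HomVF c) (l : List (HomVF c))
    (hl : 1 ≤ l.length) :
    (l.length + 1 : K) • F.bl D (Y :: l) =
      sel (fun X l' => F.vpart (F.defect D Y (F.nab D Y) X (mon l'))) l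
      + sel (fun X l' => sgn K (X.par * Y.par) • covL D 0 (F.bl D) X (Y :: l')) l
      - ∑ j ∈ Finset.Ico 1 l.length, csumAt j (fun l₁ l₂ => F.bco D (F.bl D (Y :: l₁)) l₂) l := by
  have h := F.bl_eq D hD Y l
  rw [csum_eq_ends _ _ hl, bl_singleton, bco_nil,
    show F.bco D Y.vf l = F.bl D (Y :: l) from rfl] at h
  have e : (l.length + 1 : K) • F.bl D (Y :: l) =
    (l.length - 1 : K) • F.bl D (Y :: l) + F.bl D (Y :: l) + F.bl D (Y :: l) := by module
  rw [e, h]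
  abel

/-- Of the two extreme terms only the one with all arguments in the bracket survives, so n - 1
becomes n; brackets of fewer than two arguments vanish. -/
theorem brk_rec (D : Connection c) (Q : Homological c) (l : List (HomVF c))
    (hl : 2 ≤ l.length) :
    (l.length : K) • F.brk D Q l =
      sel (fun X l' => F.vpart (F.defect D Q.hom (F.lied Q.hom) X (mon l'))) l
      + sel (fun X l' => covL D 1 (F.brk D Q) X l') l
      - ∑ j ∈ Finset.Ico 2 l.length, csumAt j (fun l₁ l₂ => F.bco D (F.brk D Q l₁) l₂) l := by
  have h := F.brk_eq D Q l
  have h1 : csumAt 1 (fun l₁ l₂ => F.bco D (F.brk D Q l₁) l₂) l = 0 :=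
    csumAt_eq_zero fun l₁ l₂ h1 _ => by
      obtain ⟨X, rfl⟩ := List.length_eq_one_iff.1 h1
      rw [brk_singleton, bco_zero]
  rw [csum_eq_ends _ _ (by omega), brk_nil, bco_nil, bco_zero, zero_add,
    Finset.sum_eq_sum_Ico_succ_bot (by omega), h1, zero_add] at h
  have e : (l.length : K) • F.brk D Q l =
    (l.length - 1 : K) • F.brk D Q l + F.brk D Q l := by module
  rw [e, h]
  abel

/-- In this degree there is no defect, and the covariant derivative of the identity tensor Y ↦ Y is
zero. -/
theorem bl_two (D : Connection c) (hD : D.TorsionFree) (Y X : HomVF c) : F.bl D [Y, X] = 0 := by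
  have h := F.bl_rec D hD Y [X] le_rfl
  have h1 : F.vpart (F.defect D Y (F.nab D Y) X (mon [])) = 0 :=
    F.vpart_defect D Y (F.nab_tan D Y) X (by simp)
  have h2 : covL D 0 (F.bl D) X [Y] = 0 := by
    rw [covL_bl, bl_singleton, bco_nil, Connection.onMon, map_zero, map_zero, smul_zero]
    change D.nabla X.vf Y.vf - D.nabla X.vf Y.vf - 0 = 0
    abel
  simp only [sel_cons, sel_nil, h1, h2, smul_zero, List.length_singleton, Finset.Ico_self,
    Finset.sum_empty] at h
  have h' : ((1 : ℕ) + 1 : K) • F.bl D [Y, X] = 0 := h.trans (by abel)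
  exact (smul_eq_zero_iff_right (by norm_num)).1 h'

theorem bco_singleton (D : Connection c) (hD : D.TorsionFree) (Y : Vect c) (X : HomVF c) :
    F.bco D Y [X] = 0 := by
  induction Y using F.vf_induction with
  | hadd Y Z h h' =>
    rw [bco] at h h' ⊢
    rw [map_add, LinearMap.add_apply, map_add, h, h', add_zero]
  | hhom Y => exact F.bl_two D hD Y X

theorem bl_three (D : Connection c) (hD : D.TorsionFree) (Y X Z : HomVF c) :
    (3 : K) • F.bl D [Y, X, Z] =
      -D.curv Y X Z - sgn K (X.par * Z.par) • D.curv Y Z X := by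
  have h := F.bl_rec D hD Y [X, Z] (by simp)
  have h2 : ∀ X Z, covL D 0 (F.bl D) X [Y, Z] = 0 := by
    intro X Z
    rw [covL_bl, bl_two F D hD, bco_singleton F D hD, map_zero,
      show D.onMon X [Z] = mon [D.ap X Z] by
        rw [Connection.onMon, Connection.onMon, mul_zero, units_smul (K := K), smul_zero, add_zero,
          mon_nil, mul_one, mon_singleton],
      show F.vpart (F.bop D Y.vf (mon [D.ap X Z])) = 0 from F.bl_two D hD Y _, smul_zero]
    abel
  have h3 : csumAt 1 (fun l₁ l₂ => F.bco D (F.bl D (Y :: l₁)) l₂) [X, Z] = 0 :=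
    csumAt_eq_zero fun l₁ l₂ h1 _ => by
      obtain ⟨X, rfl⟩ := List.length_eq_one_iff.1 h1
      rw [bl_two F D hD, bco_zero]
  have e : Finset.Ico 1 [X, Z].length = {1} := rfl
  simp only [sel_cons, sel_nil, vpart_defect_nab, h2, smul_zero, e, Finset.sum_singleton, h3] at h
  have e2 : (3 : K) = ([X, Z].length + 1 : K) := by norm_num
  rw [e2, h]
  module

/-- The terms with j = 1 and j = n - 1 contain a coefficient with one symmetric argument and vanish
by `bl_two`. Every remaining factor has fewer arguments, which permits an induction starting from
the curvature. -/
theorem bl_rec_ge (D : Connection c) (hD : D.TorsionFree) (Y : HomVF c) (l : List (HomVF c))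
    (hl : 3 ≤ l.length) :
    (l.length + 1 : K) • F.bl D (Y :: l) =
      sel (fun X l' => sgn K (X.par * Y.par) • covL D 0 (F.bl D) X (Y :: l')) l
      - ∑ j ∈ Finset.Ico 2 (l.length - 1),
        csumAt j (fun l₁ l₂ => F.bco D (F.bl D (Y :: l₁)) l₂) l := by
  have h := F.bl_rec D hD Y l (by omega)
  have h0 : sel (fun X l' => F.vpart (F.defect D Y (F.nab D Y) X (mon l'))) l = 0 :=
    (sel_congr (H' := fun _ _ => 0) fun X l' hl' =>
      F.vpart_defect D Y (F.nab_tan D Y) X (by omega)).trans (by simp [sel])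
  obtain ⟨n, hn⟩ : ∃ n, l.length = n + 1 := ⟨l.length - 1, by omega⟩
  have h1 : csumAt 1 (fun l₁ l₂ => F.bco D (F.bl D (Y :: l₁)) l₂) l = 0 :=
    csumAt_eq_zero fun l₁ l₂ h1 _ => by
      obtain ⟨X, rfl⟩ := List.length_eq_one_iff.1 h1
      rw [bl_two F D hD, bco_zero]
  have h2 : csumAt n (fun l₁ l₂ => F.bco D (F.bl D (Y :: l₁)) l₂) l = 0 :=
    csumAt_eq_zero fun l₁ l₂ h1 _ => by
      obtain ⟨X, rfl⟩ := List.length_eq_one_iff.1 (show l₂.length = 1 by omega)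
      rw [bco_singleton F D hD]
  rw [h, h0, hn, Finset.sum_Ico_succ_top (by omega), h2,
    Finset.sum_eq_sum_Ico_succ_bot (by omega), h1, zero_add, zero_add, add_zero]
  rfl

theorem brk_two (D : Connection c) (hD : D.TorsionFree) (Q : Homological c) (X Y : HomVF c) :
    F.brk D Q [X, Y] = -D.atiyah Q X Y := by
  have h := F.brk_rec D Q [X, Y] (by simp)
  have h2 : ∀ X Z, covL D 1 (F.brk D Q) X [Z] = 0 := by
    intro X Z
    rw [covL_brk, brk_singleton, map_zero, smul_zero,
      show D.onMon X [Z] = mon [D.ap X Z] by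
        rw [Connection.onMon, Connection.onMon, mul_zero, units_smul (K := K), smul_zero, add_zero,
          mon_nil, mul_one, mon_singleton],
      show F.vpart (F.phi D Q (mon [D.ap X Z])) = 0 from F.brk_singleton D Q _]
    abel
  have e : Finset.Ico 2 [X, Y].length = ∅ := rfl
  simp only [sel_cons, sel_nil, vpart_defect_lied, h2, smul_zero, e, Finset.sum_empty] at h
  rw [F.atiyah_symm D hD Q Y X, mul_comm Y.par] at h
  refine smul_right_injective _ (show (2 : K) ≠ 0 by norm_num) ?_
  have e2 : (2 : K) = ([X, Y].length : K) := by norm_num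
  change (2 : K) • _ = (2 : K) • _
  refine (congrArg (· • F.brk D Q [X, Y]) e2).trans (h.trans ?_)
  rcases sgn_cases (K := K) (X.par * Y.par) with h' | h' <;> simp only [h'] <;> module

theorem brk_rec_ge (D : Connection c) (hD : D.TorsionFree) (Q : Homological c)
    (l : List (HomVF c)) (hl : 3 ≤ l.length) :
    (l.length : K) • F.brk D Q l = sel (fun X l' => covL D 1 (F.brk D Q) X l') l
      - ∑ j ∈ Finset.Ico 2 (l.length - 1), csumAt j (fun l₁ l₂ => F.bco D (F.brk D Q l₁) l₂) l := by
  have h := F.brk_rec D Q l (by omega)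
  have h0 : sel (fun X l' => F.vpart (F.defect D Q.hom (F.lied Q.hom) X (mon l'))) l = 0 :=
    (sel_congr (H' := fun _ _ => 0) fun X l' hl' =>
      F.vpart_defect D Q.hom (F.lied_tan Q.hom) X (by omega)).trans (by simp [sel])
  obtain ⟨n, hn⟩ : ∃ n, l.length = n + 1 := ⟨l.length - 1, by omega⟩
  have h2 : csumAt n (fun l₁ l₂ => F.bco D (F.brk D Q l₁) l₂) l = 0 :=
    csumAt_eq_zero fun l₁ l₂ h1 _ => by
      obtain ⟨X, rfl⟩ := List.length_eq_one_iff.1 (show l₂.length = 1 by omega)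
      rw [bco_singleton F D hD]
  rw [h, h0, hn, Finset.sum_Ico_succ_top (by omega), h2, zero_add, add_zero]
  rfl

/-- Strong induction in `bl_rec`: the defect is the curvature, the covariant derivatives are those
of the identity tensor or of tensors already known to vanish, and the outer factor of each composite
vanishes too. -/
theorem bl_flat (D : Connection c) (hD : D.TorsionFree) (hR : D.Flat) (Y : HomVF c)
    (l : List (HomVF c)) (hl : 1 ≤ l.length) : F.bl D (Y :: l) = 0 := by
  induction h : l.length using Nat.strong_induction_on generalizing l Y with
  | _ n ih =>
    subst h
    have ih' : ∀ (Z : Vect c) (l' : List (HomVF c)), 1 ≤ l'.length → l'.length < l.length →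
        F.bco D Z l' = 0 := by
      intro Z l' h1 h2
      induction Z using F.vf_induction with
      | hadd Y Z h h' =>
        rw [bco] at h h' ⊢
        rw [map_add, LinearMap.add_apply, map_add, h, h', add_zero]
      | hhom Y => exact ih _ h2 Y l' h1 rfl
    have hs : (l.length + 1 : K) • F.bl D (Y :: l) = 0 := by
      rw [F.bl_rec D hD Y l hl]
      have h1 : sel (fun X l' => F.vpart (F.defect D Y (F.nab D Y) X (mon l'))) l = 0 := by
        refine (sel_congr (H' := fun _ _ => 0) fun X l' hl' => ?_).trans (by simp [sel])
        by_cases h : l'.length = 1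
        · obtain ⟨Z, rfl⟩ := List.length_eq_one_iff.1 h
          rw [vpart_defect_nab, hR]
          abel
        · exact F.vpart_defect D Y (F.nab_tan D Y) X h
      have h2 : sel (fun X l' => sgn K (X.par * Y.par) • covL D 0 (F.bl D) X (Y :: l')) l = 0 := by
        refine (sel_congr (H' := fun _ _ => 0) fun X l' hl' => ?_).trans (by simp [sel])
        have h0 : covL D 0 (F.bl D) X (Y :: l') = 0 := by
          cases l' with
          | nil =>
            rw [covL_bl, bl_singleton, bco_nil, Connection.onMon, map_zero, map_zero, smul_zero]
            change D.nabla X.vf Y.vf - D.nabla X.vf Y.vf - 0 = 0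
            abel
          | cons Z t =>
            have hlt : (Z :: t).length < l.length := by omega
            have e := covSum_map D X (F.vpart ∘ₗ F.bop D Y.vf) (Z :: t)
            simp only [LinearMap.comp_apply] at e
            have e0 : covSum D X (fun l => F.vpart (F.bop D Y.vf (mon l))) (Z :: t) =
                covSum D X (fun _ => 0) (Z :: t) := covSum_congr D X fun l'' hl'' =>
              ih' Y.vf l'' (by rw [hl'']; simp) (by rw [hl'']; exact hlt)
            rw [covL_bl, ← e, e0,
              ih' _ _ (by simp) hlt, show F.bl D (Y :: Z :: t) = 0 from ih' Y.vf _ (by simp) hlt]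
            have : covSum D X (fun _ => 0) (Z :: t) = 0 := by
              simpa using covSum_map D X 0 (Z :: t)
            rw [this, map_zero, smul_zero]
            abel
        rw [h0, smul_zero]
      have h3 : ∑ j ∈ Finset.Ico 1 l.length,
          csumAt j (fun l₁ l₂ => F.bco D (F.bl D (Y :: l₁)) l₂) l = 0 :=
        Finset.sum_eq_zero fun j hj => csumAt_eq_zero fun l₁ l₂ hj' hl' => by
          rw [Finset.mem_Ico] at hj
          exact ih' _ _ (by omega) (by omega)
      rw [h1, h2, h3]
      abel
    refine (smul_eq_zero_iff_right ?_).1 hs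
    exact_mod_cast Nat.succ_ne_zero l.length

theorem bco_flat (D : Connection c) (hD : D.TorsionFree) (hR : D.Flat) (Y : Vect c)
    (l : List (HomVF c)) (hl : 1 ≤ l.length) : F.bco D Y l = 0 := by
  induction Y using F.vf_induction with
  | hadd Y Z h h' =>
    rw [bco] at h h' ⊢
    rw [map_add, LinearMap.add_apply, map_add, h, h', add_zero]
  | hhom Y => exact F.bl_flat D hD hR Y l hl

theorem brk_flat (D : Connection c) (hD : D.TorsionFree) (hR : D.Flat) (Q : Homological c)
    (l : List (HomVF c)) (hl : 3 ≤ l.length) :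
    (l.length : K) • F.brk D Q l = sel (fun X l' => covL D 1 (F.brk D Q) X l') l := by
  rw [F.brk_rec_ge D hD Q l hl]
  have h3 : ∑ j ∈ Finset.Ico 2 (l.length - 1),
      csumAt j (fun l₁ l₂ => F.bco D (F.brk D Q l₁) l₂) l = 0 :=
    Finset.sum_eq_zero fun j hj => csumAt_eq_zero fun l₁ l₂ hj' hl' => by
      rw [Finset.mem_Ico] at hj
      exact F.bco_flat D hD hR _ _ (by omega)
  rw [h3]
  abel

end Frame

end Brackets

/-! ### The brackets as sections, and the recursive formula -/

section Kapranov

variable {K R : Type*} [Field K] [Ring R] [Algebra K R] {c : ℤ → R →ₗ[K] R}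

theorem conv_eq_csum (T : List (HomVF c) → Vect c) (l : List (HomVF c)) :
    conv T l = csum (fun l₁ l₂ => svf c (T l₁) * mon l₂) l := by
  rw [Frame.conv_eq_convS]
  rfl

theorem conv_congr {T T' : List (HomVF c) → Vect c} {l : List (HomVF c)}
    (h : ∀ l', l'.length ≤ l.length → T l' = T' l') : conv T l = conv T' l := by
  rw [conv_eq_csum, conv_eq_csum]
  exact csum_congr fun l₁ l₂ hl => by rw [h l₁ (by omega)]

theorem conv_add (T T' : List (HomVF c) → Vect c) (l : List (HomVF c)) :
    conv (fun l => T l + T' l) l = conv T l + conv T' l := by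
  simp only [conv_eq_csum, svf_add, add_mul, csum_add]

theorem conv_smul (a : K) (T : List (HomVF c) → Vect c) (l : List (HomVF c)) :
    conv (fun l => a • T l) l = a • conv T l := by
  simp only [conv_eq_csum, svf_smul, smul_mul_assoc, csum_smul]

theorem conv_zero (l : List (HomVF c)) : conv (fun _ => (0 : Vect c)) l = 0 := by
  simp [conv_eq_csum]

theorem conv_sum {J : Type*} (s : Finset J) (T : J → List (HomVF c) → Vect c)
    (l : List (HomVF c)) : conv (fun l => ∑ j ∈ s, T j l) l = ∑ j ∈ s, conv (T j) l := by
  classical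
  induction s using Finset.induction_on with
  | empty => simpa using conv_zero l
  | insert j s hj ih => simp only [Finset.sum_insert hj, conv_add, ih]

/-- A map of degree `k` contributes to the convolution only through the terms of length `k`. -/
theorem conv_eq_csumAt {k : ℕ} {T : List (HomVF c) → Vect c} (hT : ∀ l, l.length ≠ k → T l = 0)
    (l : List (HomVF c)) : conv T l = csumAt k (fun l₁ l₂ => svf c (T l₁) * mon l₂) l := by
  rw [conv_eq_csum]
  refine csum_congr fun l₁ l₂ _ => ?_
  split_ifs with h
  · rfl
  · rw [hT _ h, svf_zero, zero_mul]

theorem conv_of_length {T : List (HomVF c) → Vect c} {l : List (HomVF c)}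
    (hT : ∀ l', l'.length ≠ l.length → T l' = 0) : conv T l = svf c (T l) := by
  rw [conv_eq_csumAt hT, csumAt_length, mon_nil, mul_one]

theorem csum_mem {N : Type*} [AddCommGroup N] [Module K N] (S : Submodule K N)
    {f : List (HomVF c) → List (HomVF c) → N} {l : List (HomVF c)}
    (h : ∀ l₁ l₂, l₁.length + l₂.length = l.length → f l₁ l₂ ∈ S) : csum f l ∈ S := by
  induction l generalizing f with
  | nil => simpa using h [] [] rfl
  | cons X l ih =>
    rw [csum_cons]
    exact add_mem (ih fun l₁ l₂ hl => h _ _ (by simp; omega))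
      (ih fun l₁ l₂ hl => S.smul_mem _ (h _ _ (by simp; omega)))

namespace SymSection

variable {n : ℕ} (T : SymSection c n)

theorem ap_eq_zero {l : List (HomVF c)} (h : l.length ≠ n) : T.ap l = 0 :=
  T.supp _ h _ (mon_mem' l)

theorem symCov_eq (D : Connection c) (l : List (HomVF c)) :
    T.symCov D l = sel (fun X l' => covL D 1 T.ap X l') l := by
  unfold symCov sel
  refine Finset.sum_congr rfl fun k _ => ?_
  have e : covSum D (l.get k) T.ap (l.eraseIdx k) = T.map (D.onMon (l.get k) (l.eraseIdx k)) :=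
    covSum_map D _ T.map _
  rw [vect_units_smul, vect_units_smul, ← e]
  simp only [covL, one_mul]
  rfl

theorem bconv_eq [CharZero K] (F : Frame c) (D : Connection c) (l : List (HomVF c)) :
    T.bconv D (F.pbwEquiv D) l = csum (fun l₁ l₂ => F.bop D (T.ap l₁) (mon l₂)) l := by
  simp only [bconv, csum]
  congr 2
  funext t
  rw [units_smul (K := K), ← F.bop_mon]
  rfl

theorem ext_ap (F : Frame c) {T T' : SymSection c n} (h : ∀ l, l.length = n → T.ap l = T'.ap l) :
    T = T' := by
  have : T.map = T'.map := by
    ext s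
    induction s using sym_induction F with
    | hadd s s' h h' => simp only [map_add, Submodule.coe_add, LinearMap.add_apply, h, h']
    | hmon q f hf l =>
      rw [T.smul q f hf, T'.smul q f hf]
      have : T.map (mon l) = T'.map (mon l) := by
        by_cases hl : l.length = n
        · exact h l hl
        · exact (T.ap_eq_zero hl).trans (T'.ap_eq_zero hl).symm
      rw [this]
  cases T; cases T'; simp only [mk.injEq]; exact this

end SymSection

namespace Frame

variable (F : Frame c)

theorem vpart_svf_mul_mon (X : Vect c) {l : List (HomVF c)} (hl : l.length ≠ 0) :
    F.vpart (svf c X * mon l) = 0 :=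
  F.vpart_of_mem (n := 1 + l.length) (by omega) (mul_mem_symPow F (svf_mem F X) (mon_mem' l))

theorem vpart_conv (T : List (HomVF c) → Vect c) (l : List (HomVF c)) :
    F.vpart (conv T l) = T l := by
  rw [conv_eq_csum, vpart_csum, csum_eq_sum, Finset.sum_range_succ, csumAt_length, mon_nil,
    mul_one, vpart_svf, Finset.sum_eq_zero, zero_add]
  intro j hj
  rw [Finset.mem_range] at hj
  exact csumAt_eq_zero fun l₁ l₂ h h' => F.vpart_svf_mul_mon _ (by omega)

theorem euler_conv {k : ℕ} {T : List (HomVF c) → Vect c} (hT : ∀ l, l.length ≠ k → T l = 0)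
    {l : List (HomVF c)} (hk : k ≤ l.length) :
    F.euler (conv T l) = (l.length - k + 1 : K) • conv T l := by
  have : conv T l ∈ symPow c (1 + (l.length - k)) := by
    rw [conv_eq_csumAt hT]
    refine csum_mem _ fun l₁ l₂ hl => ?_
    split_ifs with h
    · rw [show l.length - k = l₂.length by omega]
      exact mul_mem_symPow F (svf_mem F _) (mon_mem' _)
    · exact zero_mem _
  rw [F.euler_of_mem this]
  congr 1
  push_cast [hk]
  ring

theorem mul_tau {p q : ZMod 2} {a b : Op c} (ha : ∀ s, F.tauS (a s) = sgn K p • a (F.tauS s))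
    (hb : ∀ s, F.tauS (b s) = sgn K q • b (F.tauS s)) (s : SymT c) :
    F.tauS ((a * b) s) = sgn K (p + q) • (a * b) (F.tauS s) := by
  simp only [Module.End.mul_apply, ha, hb, map_smul, smul_smul, sgn_add]

theorem covL_zero (D : Connection c) (p : ZMod 2) {f : List (HomVF c) → Vect c} {X : HomVF c}
    {l : List (HomVF c)} (h : ∀ l', l'.length = l.length → f l' = 0) : covL D p f X l = 0 := by
  have h0 : covSum D X (fun _ => 0) l = 0 := by simpa using covSum_map D X 0 l
  rw [covL, covSum_congr D X h, h0, h l rfl, map_zero, smul_zero]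
  abel

variable [CharZero K]

/-- The sum over selected factors is the operator ∑ A(Yᵢ) ιᵢ. By `mul_mem_centNorm` its brackets
preserve the centralizer, so it is a coderivation and is recovered from its degree-one part. -/
theorem sel_eq_conv {o : ZMod 2} (A : HomVF c → Op c)
    (hA : ∀ X, ∑ i, A (F.Y i) * lm (sfn c (F.ival i X)) = A X)
    (hN : ∀ X, A X ∈ centNorm K F.gens (o + X.par))
    (ht : ∀ X s, F.tauS (A X s) = sgn K (o + X.par) • A X (F.tauS s))
    (h0 : ∀ X l, counit c (A X (mon l)) = 0) (l : List (HomVF c)) :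
    sel (fun X l' => A X (mon l')) l =
      conv (fun l => sel (fun X l' => F.vpart (A X (mon l'))) l) l := by
  have e : ∀ x : ZMod 2, o + x + x = o := fun x => by rw [add_assoc, zmod_add_self, add_zero]
  have h := (F.sum_op_iota_mon A hA)
  have hs : F.IsCod o (∑ i, A (F.Y i) * F.iota i) := by
    refine ⟨sum_mem fun i _ => ?_, fun s => ?_, fun l => ?_⟩
    · have := mul_mem_centNorm (hN (F.Y i)) (F.iota_mem_cent i) (F.iota_mem_cent2 i)
      rwa [e] at this
    · simp only [LinearMap.sum_apply, map_sum, Finset.smul_sum]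
      refine Finset.sum_congr rfl fun i _ => ?_
      rw [F.mul_tau (ht _) (F.iota_der i).tau, e]
    · rw [h]
      simp [sel, h0]
  have h2 := IsCod.eq_conv F hs l
  simp only [h, vpart_sel] at h2
  exact h2

theorem phi_eq_conv (D : Connection c) (Q : Homological c) (l : List (HomVF c)) :
    F.phi D Q (mon l) = conv (F.brk D Q) l := IsCod.eq_conv F (F.phi_isLinCod D Q.hom).toIsCod l

theorem sel_defect_eq_conv (D : Connection c) (Q : Homological c) (l : List (HomVF c)) :
    sel (fun X l' => F.defect D Q.hom (F.lied Q.hom) X (mon l')) l =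
      conv (fun l => sel (fun X l' => F.vpart (F.defect D Q.hom (F.lied Q.hom) X (mon l'))) l) l := by
  refine F.sel_eq_conv (o := 1) _ (F.defect_tensor D Q.hom (F.lied_der _) (F.lied_sfn _))
    (fun X => ?_) (fun X => (F.defect_der D Q.hom (F.lied_der _) X).tau) (fun X l => ?_) l
  · rw [defect_eq]
    exact sub_mem_centNorm (F.tan_mem_centNorm (F.nab_tan D (Q.hom.lie X)))
      (br_mem_centNorm (F.tan_mem_centNorm (F.lied_tan Q.hom)) (F.tan_mem_centNorm (F.nab_tan D X)))
  · rw [defect_eq]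
    simp only [br, LinearMap.sub_apply, LinearMap.smul_apply, Module.End.mul_apply, map_sub,
      map_smul, counit_nab, counit_lied, HomVF.lie, sgn_smul (K := K), sub_self]

theorem sel_br_eq_conv (D : Connection c) (Q : Homological c) (l : List (HomVF c)) :
    sel (fun X l' => br K 1 X.par (F.phi D Q) (F.nab D X) (mon l')) l =
      conv (fun l => sel (fun X l' => F.vpart (br K 1 X.par (F.phi D Q) (F.nab D X) (mon l'))) l)
        l := by
  have hc := F.phi_isLinCod D Q.hom
  refine F.sel_eq_conv (o := 1) (fun X => br K 1 X.par (F.phi D Q) (F.nab D X))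
    (F.br_nab_tensor D hc.lin)
    (fun X => ?_) (fun X => F.br_tau hc.tau (F.nab_der D X).tau) (fun X l => ?_) l
  · exact br_mem_centNorm hc.mem (F.tan_mem_centNorm (F.nab_tan D X))
  · have h0 : ∀ s, counit c (F.phi D Q s) = 0 := hc.counit_zero
    simp only [br, LinearMap.sub_apply, LinearMap.smul_apply, Module.End.mul_apply, map_sub,
      map_smul, counit_nab, h0, map_zero, smul_zero, sub_zero]

/-- The brackets as sections, provided that they have degree `+1`. -/
def brkSec (D : Connection c) (Q : Homological c) (n : ℕ)
    (hdeg : ∀ (l : List (HomVF c)) (d : List ℤ), l.length = n →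
      List.Forall₂ (fun (X : HomVF c) k => HasDeg c k X.der) l d →
        HasDeg c (1 + d.sum) (F.brk D Q l).1) : SymSection c n where
  map := F.vpart ∘ₗ F.phi D Q ∘ₗ pr c n
  supp m hm s hs := by
    simp only [LinearMap.comp_apply]
    rw [pr_of_mem hs, if_neg hm, map_zero, map_zero]
  smul q f hf s := by
    have h1 : pr c n (sfn c f * s) = sfn c f * pr c n s := by
      induction s using graded_induction F with
      | hadd s s' h h' => simp only [mul_add, map_add, h, h']
      | h m s hs =>
        have := mul_mem_symPow F (sfn_mem (c := c) f) hs
        rw [zero_add] at this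
        rw [pr_of_mem this, pr_of_mem hs]
        split_ifs <;> simp
    have h2 := (F.phi_isLinCod D Q.hom).lin q f hf
    have h3 := congrArg (fun x : Op c => x (pr c n s)) h2
    simp only [br, LinearMap.sub_apply, LinearMap.smul_apply, Module.End.mul_apply, lm_apply,
      LinearMap.zero_apply, sub_eq_zero] at h3
    simp only [LinearMap.comp_apply]
    rw [h1, show F.phi D Q (sfn c f * pr c n s) = _ from h3, map_smul, vpart_fmul,
      vect_units_smul, show Q.hom.par = 1 from rfl, one_mul]
    rfl
  parity l := by
    refine F.mem_derPar_of_tauV ?_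
    simp only [LinearMap.comp_apply]
    rw [pr_of_mem (mon_mem' l)]
    split_ifs
    · exact F.vpart_tau (F.phi_isLinCod D Q.hom).tau l
    · simp
  degree l d hd := by
    simp only [LinearMap.comp_apply]
    rw [pr_of_mem (mon_mem' l)]
    split_ifs with h
    · exact hdeg l d h hd
    · simp only [map_zero]
      exact ⟨zero_mem _, fun j f _ => by simp [IsDeg]⟩

variable {F} in
theorem brkSec_ap {D : Connection c} {Q : Homological c} {n : ℕ} (hdeg) {l : List (HomVF c)}
    (hl : l.length = n) : (F.brkSec D Q n hdeg).ap l = F.brk D Q l := by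
  change F.vpart (F.phi D Q (pr c n (mon l))) = _
  rw [pr_of_mem (mon_mem' l), if_pos hl]
  rfl

theorem delta_eq (D : Connection c) (Q : Homological c) (l : List (HomVF c)) :
    delta Q (F.pbwEquiv D) l = F.dlt D Q.hom (mon l) := by
  rw [delta, LinearEquiv.symm_apply_eq]
  apply Subtype.ext
  rw [pbwEquiv_coe, pbw_dlt, tpow_of_mem (mon_mem_spar l), show Q.hom.par = 1 from rfl, one_mul]
  change Q.hom.der * F.pbw D (mon l) - ((((-1 : ℤˣ) ^ lpar l •
    (F.pbwEquiv D (mon l) * opVF c Q.hom.vf) : DiffOp c)) : Module.End K R) = _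
  rw [diffOp_units_smul, map_smul, smul_mul_assoc]
  rfl

theorem delta_sub_onMon (D : Connection c) (Q : Homological c) (l : List (HomVF c)) :
    delta Q (F.pbwEquiv D) l - Q.onMon l = conv (F.brk D Q) l := by
  rw [← phi_eq_conv, delta_eq, phi, LinearMap.sub_apply, lied_mon]

variable {F} in
/-- A family of sections that agrees with the brackets. -/
theorem sum_ap {D : Connection c} {Q : Homological c} {T : (n : ℕ) → SymSection c n}
    (hT : ∀ n l, l.length = n → (T n).ap l = F.brk D Q l) {N : ℕ} {l : List (HomVF c)}
    (hl : l.length < N) : ∑ k ∈ Finset.range N, (T k).ap l = F.brk D Q l := by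
  rw [Finset.sum_eq_single l.length, hT _ _ rfl]
  · intro k _ hk
    exact (T k).ap_eq_zero (Ne.symm hk)
  · intro h
    exact absurd (Finset.mem_range.2 hl) h

theorem isKapranov (D : Connection c) (Q : Homological c) {T : (n : ℕ) → SymSection c n}
    (hT : ∀ n l, l.length = n → (T n).ap l = F.brk D Q l) : IsKapranov Q (F.pbwEquiv D) T := by
  intro l
  rw [delta_sub_onMon, ← conv_sum]
  exact conv_congr fun l' hl' => (sum_ap hT (by omega)).symm

/-- The degree-one part of T̄ ⋆ id is T itself, so each section can be read off from the defining
identity. This is the uniqueness of the family. -/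
theorem ap_of_isKapranov (D : Connection c) (Q : Homological c) {T : (n : ℕ) → SymSection c n}
    (hT : IsKapranov Q (F.pbwEquiv D) T) (n : ℕ) (l : List (HomVF c)) (hl : l.length = n) :
    (T n).ap l = F.brk D Q l := by
  have h := hT l
  rw [delta_sub_onMon] at h
  have h2 := congrArg F.vpart h
  rw [map_sum] at h2
  simp only [vpart_conv] at h2
  rw [h2, Finset.sum_eq_single l.length, hl]
  · intro k _ hk
    exact (T k).ap_eq_zero (Ne.symm hk)
  · intro h
    exact absurd (Finset.mem_range.2 (by omega)) h

/-- The recursive formula for the brackets. -/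
theorem bracket_formula (D : Connection c) (hD : D.TorsionFree) (Q : Homological c)
    {T : (n : ℕ) → SymSection c n} (hT : ∀ n l, l.length = n → (T n).ap l = F.brk D Q l)
    (l : List (HomVF c)) (hl : 3 ≤ l.length) :
    svf c ((T l.length).ap l) = (2 / (l.length : K)) • conv (T 2).ap l
      + (1 / (l.length : K)) • ∑ k ∈ Finset.Ico 2 l.length,
        (conv ((T k).symCov D) l + (1 - (k : K)) • conv (T k).ap l
          - (T k).bconv D (F.pbwEquiv D) l) := by
  have hm := F.phi_master D Q l
  have hphi : F.phi D Q (mon l) = ∑ k ∈ Finset.range (l.length + 1), conv (T k).ap l := by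
    rw [phi_eq_conv, ← conv_sum]
    exact conv_congr fun l' hl' => (sum_ap hT (by omega)).symm
  have h0 : ∀ k < 2, (T k).ap = fun _ => 0 := by
    intro k hk
    funext l'
    by_cases h : l'.length = k
    · rw [hT k l' h]
      interval_cases k
      · rw [List.length_eq_zero_iff.1 h, brk_nil]
      · obtain ⟨X, rfl⟩ := List.length_eq_one_iff.1 h
        rw [brk_singleton]
    · exact (T k).ap_eq_zero h
  -- A pair of arguments is met in both orders, and by symmetry of the Atiyah cocycle the two
  -- contributions agree. This is the origin of the coefficient 2.
  have hW1 : sel (fun X l' => F.defect D Q.hom (F.lied Q.hom) X (mon l')) l =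
      (2 : K) • conv (T 2).ap l := by
    rw [sel_defect_eq_conv, ← conv_smul]
    refine conv_congr fun l' _ => ?_
    by_cases h2 : l'.length = 2
    · obtain ⟨X, Y, rfl⟩ := List.length_eq_two.1 h2
      rw [hT 2 _ rfl, brk_two F D hD]
      simp only [sel_cons, sel_nil, vpart_defect_lied]
      rw [F.atiyah_symm D hD Q Y X, mul_comm Y.par]
      rcases sgn_cases (K := K) (X.par * Y.par) with h' | h' <;> simp only [h'] <;> module
    · rw [(T 2).ap_eq_zero h2, smul_zero]
      exact (sel_congr (H' := fun _ _ => 0) fun X l' hl' =>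
        F.vpart_defect D Q.hom (F.lied_tan Q.hom) X (by omega)).trans (by simp [sel])
  have hW2 : sel (fun X l' => br K 1 X.par (F.phi D Q) (F.nab D X) (mon l')) l =
      (-1 : K) • ∑ k ∈ Finset.Ico 2 l.length, conv ((T k).symCov D) l := by
    rw [sel_br_eq_conv, ← conv_sum, ← conv_smul]
    refine conv_congr fun l' hl' => ?_
    have e1 : ∀ k, (T k).symCov D l' = if k + 1 = l'.length then
        sel (fun X l'' => covL D 1 (F.brk D Q) X l'') l' else 0 := by
      intro k
      rw [SymSection.symCov_eq]
      split_ifs with hk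
      · refine sel_congr fun X l'' hl'' => ?_
        have e : ∀ m, m.length = l''.length → (T k).ap m = F.brk D Q m :=
          fun m hm => hT k m (by omega)
        rw [covL, covL, covSum_congr D X e, e l'' rfl]
      · refine (sel_congr (H' := fun _ _ => 0) fun X l'' hl'' => ?_).trans (by simp [sel])
        exact covL_zero D 1 fun m hm => (T k).ap_eq_zero (by omega)
    have e2 : sel (fun X l'' => F.vpart (br K 1 X.par (F.phi D Q) (F.nab D X) (mon l''))) l' =
        (-1 : K) • sel (fun X l'' => covL D 1 (F.brk D Q) X l'') l' := by
      simp only [sel, Finset.smul_sum]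
      refine Finset.sum_congr rfl fun k _ => ?_
      rw [vpart_br_nab, covL_brk, one_mul]
      change _ • (_ - _ • D.nabla _ (F.brk D Q _)) = _
      module
    rw [e2]
    congr 1
    simp only [e1]
    -- On fewer than three arguments both sides vanish, because brackets of length 0 and 1 do.
    -- Otherwise only the summand k with k + 1 arguments contributes; as k starts at 2 it occurs in
    -- the sum.
    rcases Nat.lt_or_ge l'.length 3 with h3 | h3
    · rw [Finset.sum_eq_zero]
      · refine (sel_congr (H' := fun _ _ => 0) fun X l'' hl'' => ?_).trans (by simp [sel])
        refine covL_zero D 1 fun m hm => ?_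
        rw [← hT _ m rfl, h0 _ (by omega)]
      · intro k hk
        rw [Finset.mem_Ico] at hk
        rw [if_neg (by omega)]
    · rw [Finset.sum_eq_single (l'.length - 1), if_pos (by omega)]
      · intro k _ hk
        rw [if_neg (by omega)]
      · intro h
        exact absurd (Finset.mem_Ico.2 ⟨by omega, by omega⟩) h
  -- The summand k = n is split off: with all arguments inside, it is B(Rₙ(𝐗); 1) = Rₙ(𝐗).
  have hW3 : csum (fun l₁ l₂ => F.bop D (F.brk D Q l₁) (mon l₂)) l =
      ∑ k ∈ Finset.Ico 2 l.length, (T k).bconv D (F.pbwEquiv D) l + svf c ((T l.length).ap l) := by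
    have e1 : csum (fun l₁ l₂ => F.bop D (F.brk D Q l₁) (mon l₂)) l =
        ∑ k ∈ Finset.range (l.length + 1), (T k).bconv D (F.pbwEquiv D) l := by
      simp only [SymSection.bconv_eq _ F]
      rw [← csum_sum]
      refine csum_congr fun l₁ l₂ h => ?_
      rw [← sum_ap hT (N := l.length + 1) (l := l₁) (by omega), map_sum, LinearMap.sum_apply]
    have e2 : (T l.length).bconv D (F.pbwEquiv D) l = svf c ((T l.length).ap l) := by
      rw [SymSection.bconv_eq _ F, csum_eq_sum, Finset.sum_range_succ, csumAt_length, mon_nil,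
        bop_apply, LinearMap.sub_apply, lamV_one, nabV_one, sub_zero, Finset.sum_eq_zero, zero_add]
      intro j hj
      rw [Finset.mem_range] at hj
      exact csumAt_eq_zero fun l₁ l₂ h h' => by
        rw [(T _).ap_eq_zero (by omega), map_zero, LinearMap.zero_apply]
    have e3 : ∀ k < 2, (T k).bconv D (F.pbwEquiv D) l = 0 := by
      intro k hk
      rw [SymSection.bconv_eq _ F, h0 k hk]
      simp
    rw [e1, Finset.sum_range_succ, e2, Finset.range_eq_Ico,
      Finset.sum_eq_sum_Ico_succ_bot (by omega), Finset.sum_eq_sum_Ico_succ_bot (by omega),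
      e3 0 (by omega), e3 1 (by omega), zero_add, zero_add]
  -- The convolution with Rₖ has degree n - k + 1, so n minus the Euler operator multiplies it by k
  -- - 1. For k = n this combines with the term split off in `hW3` to give n Rₙ.
  have hL : (l.length : K) • F.phi D Q (mon l) - F.euler (F.phi D Q (mon l)) =
      ∑ k ∈ Finset.Ico 2 l.length, ((k : K) - 1) • conv (T k).ap l
        + ((l.length : K) - 1) • svf c ((T l.length).ap l) := by
    have e1 : ∀ k < 2, conv (T k).ap l = 0 := by
      intro k hk
      rw [h0 k hk, conv_zero]
    have e2 : conv (T l.length).ap l = svf c ((T l.length).ap l) :=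
      conv_of_length fun l' h => (T _).ap_eq_zero h
    rw [hphi, map_sum, Finset.smul_sum, ← Finset.sum_sub_distrib, Finset.sum_range_succ,
      Finset.range_eq_Ico,
      Finset.sum_eq_sum_Ico_succ_bot (by omega), Finset.sum_eq_sum_Ico_succ_bot (by omega),
      e1 0 (by omega), e1 1 (by omega), smul_zero, map_zero, sub_zero, zero_add, zero_add]
    congr 1
    · refine Finset.sum_congr rfl fun k hk => ?_
      rw [Finset.mem_Ico] at hk
      rw [F.euler_conv (fun l' h => (T k).ap_eq_zero h) (by omega)]
      module
    · rw [F.euler_conv (fun l' h => (T _).ap_eq_zero h) le_rfl, e2]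
      module
  rw [hL, hW1, hW2, hW3] at hm
  have hn : (l.length : K) ≠ 0 := by exact_mod_cast (by omega : l.length ≠ 0)
  refine smul_right_injective _ hn ?_
  change (l.length : K) • _ = (l.length : K) • _
  rw [smul_add, smul_smul, smul_smul, mul_div_cancel₀ _ hn, mul_one_div_cancel hn, one_smul,
    Finset.sum_sub_distrib, Finset.sum_add_distrib]
  have e3 : ∑ k ∈ Finset.Ico 2 l.length, (1 - (k : K)) • conv (T k).ap l =
      (-1 : K) • ∑ k ∈ Finset.Ico 2 l.length, ((k : K) - 1) • conv (T k).ap l := by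
    rw [Finset.smul_sum]
    exact Finset.sum_congr rfl fun k _ => by module
  rw [e3]
  have e4 : ∀ (A S B v C : SymT c) (n : K), A + (n - 1) • v = (2 : K) • C - (-1 : K) • S - (B + v) →
      n • v = (2 : K) • C + (S + (-1 : K) • A - B) := by
    intro A S B v C n h
    have : n • v = (A + (n - 1) • v) + v + (-1 : K) • A := by module
    rw [this, h]
    module
  exact e4 _ _ _ _ _ _ hm

theorem bracket_flat (D : Connection c) (hD : D.TorsionFree) (hR : D.Flat) (Q : Homological c)
    {T : (n : ℕ) → SymSection c n} (hT : ∀ n l, l.length = n → (T n).ap l = F.brk D Q l)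
    (n : ℕ) (hn : 3 ≤ n) (l : List (HomVF c)) (hl : l.length = n) :
    (T n).ap l = (1 / (n : K)) • (T (n - 1)).symCov D l := by
  have h0 : (n : K) ≠ 0 := by exact_mod_cast (by omega : n ≠ 0)
  refine smul_right_injective _ h0 ?_
  change (n : K) • _ = (n : K) • _
  rw [smul_smul, mul_one_div_cancel h0, one_smul, hT n l hl, SymSection.symCov_eq, ← hl,
    F.brk_flat D hD hR Q l (by omega)]
  refine sel_congr fun X l' hl' => ?_
  have e : ∀ m, m.length = l'.length → (T (l.length - 1)).ap m = F.brk D Q m :=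
    fun m hm => hT _ m (by omega)
  rw [covL, covL, covSum_congr D X e, e l' rfl]

end Frame

end Kapranov

/-- `T` is an expression for tensors of degree `k`. -/
inductive TExpr.IsDeg : {n : ℕ} → {p : ZMod 2} → TExpr n p → ℤ → Prop
  | atiyah : IsDeg .atiyah 1
  | curv : IsDeg .curv 0
  | cov {n : ℕ} {p : ZMod 2} {T : TExpr n p} {k : ℤ} : IsDeg T k → IsDeg (.cov T) k
  | comp {n m : ℕ} {p q : ZMod 2} {T : TExpr (n + 1) p} {S : TExpr m q} {k k' : ℤ} :
      IsDeg T k → IsDeg S k' → IsDeg (.comp T S) (k + k')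
  | perm {n : ℕ} {p : ZMod 2} (σ : Equiv.Perm (Fin n)) {T : TExpr n p} {k : ℤ} :
      IsDeg T k → IsDeg (.perm σ T) k
  | add {n : ℕ} {p : ZMod 2} {S T : TExpr n p} {k : ℤ} :
      IsDeg S k → IsDeg T k → IsDeg (.add S T) k
  | smul {n : ℕ} {p : ZMod 2} (r : ℚ) {T : TExpr n p} {k : ℤ} : IsDeg T k → IsDeg (.smul r T) k

/-! ### Integer degrees of the tensor expressions -/

section Degree

variable {K R : Type*} [Field K] [Ring R] [Algebra K R] {c : ℤ → R →ₗ[K] R}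

theorem HasDeg.zero (k : ℤ) : HasDeg c k 0 := ⟨zero_mem _, fun j f _ => by simp [IsDeg]⟩

theorem HasDeg.add {k : ℤ} {X Y : Module.End K R} (hX : HasDeg c k X) (hY : HasDeg c k Y) :
    HasDeg c k (X + Y) :=
  ⟨add_mem hX.1 hY.1, fun j f hf => by
    have h := hX.2 j f hf
    have h' := hY.2 j f hf
    rw [IsDeg] at h h' ⊢
    rw [LinearMap.add_apply, map_add, h, h']⟩

theorem HasDeg.smul {k : ℤ} {X : Module.End K R} (a : K) (hX : HasDeg c k X) :
    HasDeg c k (a • X) :=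
  ⟨Submodule.smul_mem _ _ hX.1, fun j f hf => by
    have h := hX.2 j f hf
    rw [IsDeg] at h ⊢
    rw [LinearMap.smul_apply, map_smul, h]⟩

theorem HasDeg.units_smul {k : ℤ} {X : Module.End K R} (v : ℤˣ) (hX : HasDeg c k X) :
    HasDeg c k (v • X) := by
  rw [DGMfd.units_smul (K := K)]
  exact hX.smul _

theorem HasDeg.sub {k : ℤ} {X Y : Module.End K R} (hX : HasDeg c k X) (hY : HasDeg c k Y) :
    HasDeg c k (X - Y) := by
  rw [sub_eq_add_neg, ← neg_one_smul K Y]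
  exact hX.add (hY.smul _)

theorem HasDeg.sum {J : Type*} {s : Finset J} {k : ℤ} {X : J → Module.End K R}
    (h : ∀ j ∈ s, HasDeg c k (X j)) : HasDeg c k (∑ j ∈ s, X j) := by
  classical
  induction s using Finset.induction_on with
  | empty => simpa using HasDeg.zero k
  | insert j s hj ih =>
    rw [Finset.sum_insert hj]
    exact (h j (by simp)).add (ih fun i hi => h i (by simp [hi]))

namespace Frame

variable (F : Frame c)

/-- The parity label of a homogeneous vector field need not be the parity of a degree it is known to
have; when the labels disagree, the field is zero, and degree statements are trivial. -/
theorem der_eq_zero_of_ne (F : Frame c) {p q : ZMod 2} (hpq : p ≠ q) {X : Module.End K R}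
    (hp : X ∈ derPar c p) (hq : X ∈ derPar c q) : X = 0 := by
  ext f
  induction f using F.fn_induction with
  | hadd f g h h' => rw [map_add, h, h', map_add]
  | hhom r f hf =>
    have h1 := hp.1 r f hf
    have h2 := hq.1 r f hf
    have h0 : ∀ a b : ZMod 2, a ≠ b → X f ∈ par c a → X f ∈ par c b → X f = 0 := by
      intro a b hab ha hb
      have hd := F.compl.disjoint
      rw [Submodule.disjoint_def] at hd
      rcases zmod_two_cases a with rfl | rfl <;> rcases zmod_two_cases b with rfl | rfl
      · exact absurd rfl hab
      · exact hd _ ha hb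
      · exact hd _ hb ha
      · exact absurd rfl hab
    exact h0 _ _ (fun h => hpq (add_right_cancel h)) h1 h2

theorem hasDeg_lie (F : Frame c) {i j : ℤ} {X Y : HomVF c} (hX : HasDeg c i X.der)
    (hY : HasDeg c j Y.der) : HasDeg c (i + j) (X.lie Y).der := by
  by_cases hx : X.par = (i : ZMod 2)
  · by_cases hy : Y.par = (j : ZMod 2)
    · refine ⟨?_, fun k f hf => ?_⟩
      · have := (X.lie Y).mem
        simp only [HomVF.lie, hx, hy] at this ⊢
        push_cast
        exact this
      · have h1 := hX.2 _ _ (hY.2 _ _ hf)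
        have h2 := hY.2 _ _ (hX.2 _ _ hf)
        rw [IsDeg] at h1 h2 ⊢
        rw [← add_assoc] at h1
        rw [show j + (i + k) = i + j + k by ring] at h2
        simp only [HomVF.lie, DGMfd.units_smul (K := K), LinearMap.sub_apply, LinearMap.smul_apply,
          Module.End.mul_apply, map_sub, map_smul, h1, h2]
    · have : Y.der = 0 := F.der_eq_zero_of_ne hy Y.mem hY.1
      simpa [HomVF.lie, this] using HasDeg.zero _
  · have : X.der = 0 := F.der_eq_zero_of_ne hx X.mem hX.1
    simpa [HomVF.lie, this] using HasDeg.zero _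

theorem eval_hasDeg (F : Frame c) (D : Connection c) (Q : Homological c) {n : ℕ} {p : ZMod 2} {T : TExpr n p}
    {k : ℤ} (hT : T.IsDeg k) (X : Fin n → HomVF c) (d : Fin n → ℤ)
    (hX : ∀ i, HasDeg c (d i) (X i).der) : HasDeg c (k + ∑ i, d i) ((T.eval D Q).val X).1 := by
  have hQ : HasDeg c 1 Q.hom.der := Q.hasDeg
  have hap : ∀ {i j : ℤ} {X Y : HomVF c}, HasDeg c i X.der → HasDeg c j Y.der →
    HasDeg c (i + j) (D.ap X Y).der := fun h h' => D.degree _ _ _ _ h h'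
  induction hT with
  | atiyah =>
    rw [Fin.sum_univ_two]
    refine HasDeg.sub (HasDeg.sub (F.hasDeg_lie hQ (hap (hX 0) (hX 1))) ?_) ?_
    · rw [← add_assoc]
      exact hap (F.hasDeg_lie hQ (hX 0)) (hX 1)
    · rw [show 1 + (d 0 + d 1) = d 0 + (1 + d 1) by ring]
      exact (hap (hX 0) (F.hasDeg_lie hQ (hX 1))).units_smul _
  | curv =>
    rw [Fin.sum_univ_three, zero_add]
    refine HasDeg.sub (HasDeg.sub ?_ ?_) ?_
    · rw [add_assoc]
      exact hap (hX 0) (hap (hX 1) (hX 2))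
    · rw [show d 0 + d 1 + d 2 = d 1 + (d 0 + d 2) by ring]
      exact (hap (hX 1) (hap (hX 0) (hX 2))).units_smul _
    · exact hap (F.hasDeg_lie (hX 0) (hX 1)) (hX 2)
  | @cov n p T k _ ih =>
    have h1 := hap (Y := (T.eval D Q).hom (Fin.tail X)) (hX 0)
      (ih (Fin.tail X) (Fin.tail d) fun i => hX i.succ)
    rw [Fin.sum_univ_succ]
    refine HasDeg.sub ?_ ?_
    · rw [show k + (d 0 + ∑ i : Fin n, d i.succ) = d 0 + (k + ∑ i, Fin.tail d i) by
        simp only [Fin.tail]; ring]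
      exact h1.units_smul _
    · rw [AddSubmonoidClass.coe_finsetSum]
      refine HasDeg.sum fun j _ => HasDeg.units_smul _ ?_
      have h2 := ih (Function.update (Fin.tail X) j (D.ap (X 0) (Fin.tail X j)))
        (Function.update (Fin.tail d) j (d 0 + Fin.tail d j)) fun i => by
          by_cases hij : i = j
          · subst hij
            rw [Function.update_self, Function.update_self]
            exact hap (hX 0) (hX _)
          · rw [Function.update_of_ne hij, Function.update_of_ne hij]
            exact hX _
      rw [Finset.sum_update_of_mem (Finset.mem_univ j), add_assoc,
        ← Finset.erase_eq, Finset.add_sum_erase _ _ (Finset.mem_univ j)] at h2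
      exact h2
  | @comp n m p q T S k k' _ _ ih ih' =>
    have h1 := ih (Fin.cons ((S.eval D Q).hom fun i => X (Fin.castAdd n i))
      fun j => X (Fin.natAdd m j)) (Fin.cons (k' + ∑ i, d (Fin.castAdd n i))
      fun j => d (Fin.natAdd m j)) (fun i => by
        refine Fin.cases ?_ (fun i => ?_) i
        · exact ih' _ _ fun i => hX _
        · exact hX _)
    rw [Fin.sum_univ_succ] at h1
    simp only [Fin.cons_zero, Fin.cons_succ] at h1
    rw [Fin.sum_univ_add]
    rw [show k + k' + (∑ i, d (Fin.castAdd n i) + ∑ i, d (Fin.natAdd m i)) =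
      k + (k' + ∑ i, d (Fin.castAdd n i) + ∑ i, d (Fin.natAdd m i)) by ring]
    exact h1
  | @perm n p σ T k _ ih =>
    have h1 := ih (X ∘ σ) (d ∘ σ) fun i => hX _
    rw [show ∑ i, (d ∘ σ) i = ∑ i, d i from Equiv.sum_comp σ d] at h1
    exact h1.units_smul _
  | add _ _ ih ih' => exact (ih X d hX).add (ih' X d hX)
  | smul r _ ih => exact (ih X d hX).smul _

end Frame

end Degree

/-! ### Universal families of tensors -/

/-- The data from which the brackets are computed. -/
structure Setup where
  K : Type
  R : Type u
  [field : Field K]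
  [charZero : CharZero K]
  [ring : Ring R]
  [algebra : Algebra K R]
  c : ℤ → R →ₗ[K] R
  F : Frame c
  D : Connection c
  Q : Homological c
  torsionFree : D.TorsionFree

attribute [instance] Setup.field Setup.charZero Setup.ring Setup.algebra

/-- Families of multilinear expressions in homogeneous vector fields. -/
abbrev Fam := (S : Setup.{u}) → List (HomVF S.c) → Vect S.c

/-- The family `f` is given by an expression for tensors of type `(1, n)`, parity `p` and
degree `k`. -/
def Univ (n : ℕ) (p : ZMod 2) (k : ℤ) (f : Fam.{u}) : Prop :=
  ∃ E : TExpr n p, E.IsDeg k ∧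
    ∀ (S : Setup.{u}) (X : Fin n → HomVF S.c), f S (List.ofFn X) = (E.eval S.D S.Q).val X

theorem exists_ofFn {α : Type*} {n : ℕ} {l : List α} (h : l.length = n) :
    ∃ X : Fin n → α, l = List.ofFn X := by
  subst h
  exact ⟨l.get, (List.ofFn_get l).symm⟩

namespace Univ

variable {n m : ℕ} {p q : ZMod 2} {k k' : ℤ} {f g h : Fam.{u}}

theorem congr (hf : Univ n p k f) (h : ∀ S l, l.length = n → g S l = f S l) : Univ n p k g := by
  obtain ⟨E, hd, hE⟩ := hf
  exact ⟨E, hd, fun S X => by rw [h _ _ (by simp), hE]⟩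

theorem add (hf : Univ n p k f) (hg : Univ n p k g) : Univ n p k fun S l => f S l + g S l := by
  obtain ⟨E, hd, hE⟩ := hf
  obtain ⟨E', hd', hE'⟩ := hg
  exact ⟨.add E E', .add hd hd', fun S X => by beta_reduce; rw [hE, hE']; rfl⟩

theorem smul (r : ℚ) (hf : Univ n p k f) : Univ n p k fun S l => (r : S.K) • f S l := by
  obtain ⟨E, hd, hE⟩ := hf
  exact ⟨.smul r E, .smul r hd, fun S X => by beta_reduce; rw [hE]; rfl⟩

/-- There is no expression for zero among the constructors; it is obtained as 0 times an existing
expression, which is why one is assumed. -/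
theorem zero (hf : Univ n p k f) : Univ n p k fun (_ : Setup.{u}) _ => 0 :=
  (hf.smul 0).congr fun S l _ => by simp

theorem sum (hf : Univ n p k f) {s : Finset ℕ} {g : ℕ → Fam.{u}}
    (hg : ∀ j ∈ s, Univ n p k (g j)) : Univ n p k fun S l => ∑ j ∈ s, g j S l := by
  induction s using Finset.induction_on with
  | empty => exact hf.zero.congr fun S l _ => by simp
  | insert j s hj ih =>
    exact ((hg j (by simp)).add (ih fun i hi => hg i (by simp [hi]))).congr fun S l _ => by
      rw [Finset.sum_insert hj]

end Univ

theorem covSum_ofFn {K R : Type*} [Field K] [Ring R] [Algebra K R] {c : ℤ → R →ₗ[K] R}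
    (D : Connection c) (X : HomVF c) {n : ℕ} (f : List (HomVF c) → Vect c)
    (Z : Fin n → HomVF c) : covSum D X f (List.ofFn Z) =
      ∑ j : Fin n, (-1 : ℤˣ) ^ (X.par * ∑ i ∈ Finset.Iio j, (Z i).par) •
        f (List.ofFn (Function.update Z j (D.ap X (Z j)))) := by
  induction n generalizing f with
  | zero => simp [covSum]
  | succ n ih =>
    rw [List.ofFn_succ, covSum, ih, Fin.sum_univ_succ, Finset.smul_sum]
    congr 1
    · rw [show Finset.Iio (0 : Fin (n + 1)) = ∅ by ext i; simp, Finset.sum_empty, mul_zero,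
        uzpow_zero, one_smul, List.ofFn_succ]
      congr 2
    · refine Finset.sum_congr rfl fun j _ => ?_
      have e : ∑ i ∈ Finset.Iio j.succ, (Z i).par =
          (Z 0).par + ∑ i ∈ Finset.Iio j, (Z i.succ).par := by
        have : Finset.Iio j.succ = insert 0 ((Finset.Iio j).map (Fin.succEmb n)) := by
          ext i
          refine Fin.cases ?_ (fun i => ?_) i <;> simp
        rw [this, Finset.sum_insert (by simp), Finset.sum_map]
        rfl
      rw [e, vect_units_smul, vect_units_smul, usgn_sgn, usgn_sgn, mul_add, sgn_add, smul_smul,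
        List.ofFn_succ (f := Function.update Z j.succ _)]
      congr 3
      · congr 1
        funext i
        by_cases hij : i = j
        · subst hij; simp
        · rw [Function.update_of_ne hij, Function.update_of_ne (by simpa using hij)]

namespace Univ

variable {n m : ℕ} {p q : ZMod 2} {k k' : ℤ} {f g h : Fam.{u}}

theorem cov (hf : Univ n p k f) : ∃ h : Fam.{u}, Univ (n + 1) p k h ∧
    ∀ (S : Setup.{u}) (X : HomVF S.c) (l : List (HomVF S.c)),
      h S (X :: l) = covL S.D p (f S) X l := by
  refine ⟨fun S l => match l with
    | [] => 0
    | X :: l => covL S.D p (f S) X l, ?_, fun _ _ _ => rfl⟩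
  obtain ⟨E, hd, hE⟩ := hf
  refine ⟨.cov E, .cov hd, fun S X => ?_⟩
  rw [List.ofFn_succ]
  simp only [covL]
  rw [covSum_ofFn, hE]
  simp only [hE, TExpr.eval, Tens.cov]
  rw [vect_units_smul ((-1 : ℤˣ) ^ (p * (X 0).par)), usgn_sgn]
  rfl

/-- Composition needs the inner value as a homogeneous field with its parity label. The expression
supplies such a `Z`, and only its underlying field has to be known. -/
theorem comp (hf : Univ (n + 1) p k f) (hg : Univ m q k' g) :
    ∃ h : Fam.{u}, Univ (m + n) (p + q) (k + k') h ∧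
      ∀ (S : Setup.{u}) (l₁ l₂ : List (HomVF S.c)), l₁.length = m → l₂.length = n →
        ∃ Z : HomVF S.c, Z.vf = g S l₁ ∧ h S (l₁ ++ l₂) = f S (Z :: l₂) := by
  obtain ⟨E, hd, hE⟩ := hf
  obtain ⟨E', hd', hE'⟩ := hg
  refine ⟨fun S l => if hl : l.length = m + n then
    ((TExpr.comp E E').eval S.D S.Q).val fun i => l.get (i.cast hl.symm) else 0,
    ⟨.comp E E', .comp hd hd', fun S X => ?_⟩, fun S l₁ l₂ h1 h2 => ?_⟩
  · beta_reduce
    rw [dif_pos (by simp)]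
    congr 1
    funext i
    simp
  · obtain ⟨X, rfl⟩ := exists_ofFn h1
    obtain ⟨Y, rfl⟩ := exists_ofFn h2
    refine ⟨(E'.eval S.D S.Q).hom X, (hE' S X).symm, ?_⟩
    beta_reduce
    rw [dif_pos (by simp), ← List.ofFn_cons, hE]
    simp only [TExpr.eval, Tens.comp]
    congr 1
    funext i
    refine Fin.cases ?_ (fun i => ?_) i
    · simp only [Fin.cons_zero]
      congr 1
      funext j
      simp
    · simp

/-- An adjacent transposition has exactly one inversion, so a single factor of the product differs
from 1. -/
theorem koszul_swap {K R : Type*} [Field K] [Ring R] [Algebra K R] {c : ℤ → R →ₗ[K] R}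
    {n : ℕ} (X : Fin n → HomVF c) (a : ℕ) (ha : a + 1 < n) :
    koszul (Equiv.swap ⟨a, by omega⟩ ⟨a + 1, ha⟩) X =
      (-1 : ℤˣ) ^ ((X ⟨a, by omega⟩).par * (X ⟨a + 1, ha⟩).par) := by
  set i : Fin n := ⟨a, by omega⟩ with hi
  set j : Fin n := ⟨a + 1, ha⟩ with hj
  have hs : ∀ i' j' : Fin n, (i' < j' ∧ Equiv.swap i j j' < Equiv.swap i j i') ↔
      (i' = i ∧ j' = j) := by
    intro i' j'
    simp only [Equiv.swap_apply_def, hi, hj, Fin.lt_def, Fin.ext_iff]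
    split_ifs <;> simp_all <;> omega
  unfold koszul
  simp only [hs]
  rw [Finset.prod_eq_single i, Finset.prod_eq_single j, if_pos ⟨rfl, rfl⟩, Equiv.swap_apply_left,
    Equiv.swap_apply_right, mul_comm]
  · intro j' _ h'
    rw [if_neg fun h => h' h.2]
  · simp
  · intro i' _ h'
    exact Finset.prod_eq_one fun j' _ => if_neg fun h => h' h.1
  · simp

theorem swap (a : ℕ) (hf : Univ n p k f) : ∃ h : Fam.{u}, Univ n p k h ∧
    ∀ (S : Setup.{u}) (A B : List (HomVF S.c)) (X Y : HomVF S.c), A.length = a →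
      a + 2 + B.length = n →
        h S (A ++ X :: Y :: B) = sgn S.K (X.par * Y.par) • f S (A ++ Y :: X :: B) := by
  by_cases ha : a + 1 < n
  swap
  · exact ⟨f, hf, fun S A B X Y _ h => by omega⟩
  obtain ⟨E, hd, hE⟩ := hf
  set σ : Equiv.Perm (Fin n) := Equiv.swap ⟨a, by omega⟩ ⟨a + 1, ha⟩ with hσ
  refine ⟨fun S l => if hl : l.length = n then
    ((TExpr.perm σ E).eval S.D S.Q).val fun i => l.get (i.cast hl.symm) else 0,
    ⟨.perm σ E, .perm σ hd, fun S X => ?_⟩, fun S A B X Y h1 h2 => ?_⟩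
  · beta_reduce
    rw [dif_pos (by simp)]
    congr 1
    funext i
    simp
  · have hl : (A ++ X :: Y :: B).length = n := by simp; omega
    beta_reduce
    rw [dif_pos hl]
    simp only [TExpr.eval, Tens.perm]
    rw [hσ, koszul_swap _ a ha, ← hE, vect_units_smul, usgn_sgn]
    subst h1
    congr 2
    · simp [List.getElem_append_right]
    · refine List.ext_getElem (by simp; omega) fun i hi hi' => ?_
      rw [List.getElem_ofFn]
      simp only [Function.comp_apply, Equiv.swap_apply_def, Fin.ext_iff, List.get_eq_getElem]
      simp only [List.length_append, List.length_cons] at hi'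
      split_ifs with h3 h4
      · subst h3; simp
      · subst h4; simp
      · rcases Nat.lt_or_ge i A.length with h | h
        · simp [List.getElem_append_left, h]
        · obtain ⟨t, rfl⟩ := Nat.exists_eq_add_of_le h
          obtain ⟨t, rfl⟩ : ∃ s, t = s + 2 := ⟨t - 2, by omega⟩
          simp [List.getElem_append_right]

/-- A composite of adjacent transpositions, each contributing the sign of passing one factor of `l`.
-/
theorem move (j : ℕ) (a : ℕ) (hf : Univ n p k f) : ∃ h : Fam.{u}, Univ n p k h ∧
    ∀ (S : Setup.{u}) (A l B : List (HomVF S.c)) (X : HomVF S.c), A.length = a → l.length = j →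
      a + 1 + j + B.length = n →
        h S (A ++ X :: (l ++ B)) = sgn S.K (X.par * lpar l) • f S (A ++ (l ++ X :: B)) := by
  induction j generalizing a with
  | zero =>
    refine ⟨f, hf, fun S A l B X h1 h2 h3 => ?_⟩
    rw [List.length_eq_zero_iff.1 h2]
    simp [sgn]
  | succ j ih =>
    obtain ⟨f', hf', e⟩ := ih (a + 1)
    obtain ⟨f'', hf'', e'⟩ := hf'.swap a
    refine ⟨f'', hf'', fun S A l B X h1 h2 h3 => ?_⟩
    cases l with
    | nil => simp at h2
    | cons Y l =>
      rw [List.cons_append, e' S A (l ++ B) X Y h1 (by simp at h2 ⊢; omega)]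
      have := e S (A ++ [Y]) l B X (by simp [h1]) (by simpa using h2) (by omega)
      simp only [List.append_assoc, List.cons_append, List.nil_append] at this
      rw [this, smul_smul, lpar_cons, mul_add, sgn_add]
      rfl

/-- The induction follows `sel_cons`: the first argument of the tail is either selected or becomes
part of the fixed prefix `A`, after a transposition. -/
theorem sel (a m : ℕ) (hm : a + m = n) (hf : Univ n p k f) : ∃ h : Fam.{u}, Univ n p k h ∧
    ∀ (S : Setup.{u}) (A l : List (HomVF S.c)), A.length = a → l.length = m →
      h S (A ++ l) = DGMfd.sel (fun X l' => f S (A ++ X :: l')) l := by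
  induction m generalizing a f with
  | zero =>
    refine ⟨_, hf.zero, fun S A l h1 h2 => ?_⟩
    rw [List.length_eq_zero_iff.1 h2, sel_nil]
  | succ m ih =>
    obtain ⟨f', hf', e⟩ := hf.swap a
    obtain ⟨f'', hf'', e'⟩ := ih (a + 1) (by omega) hf'
    refine ⟨_, hf.add hf'', fun S A l h1 h2 => ?_⟩
    cases l with
    | nil => simp at h2
    | cons X l =>
      have h3 : l.length = m := by simpa using h2
      have := e' S (A ++ [X]) l (by simp [h1]) h3
      simp only [List.append_assoc, List.cons_append, List.nil_append] at this
      rw [sel_cons, this]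
      congr 1
      refine sel_congr fun Y l' hl' => ?_
      rw [e S A l' X Y h1 (by omega)]

/-- Follows the recursive construction of the shuffles: the next argument either joins the first
factor, lowering `j`, or is moved behind the `j` arguments of the first factor. In both cases it
enters the prefix for the remaining induction. -/
theorem csumAt (a m : ℕ) (hm : a + m = n) (j : ℕ) (hf : Univ n p k f) :
    ∃ h : Fam.{u}, Univ n p k h ∧
    ∀ (S : Setup.{u}) (A l : List (HomVF S.c)), A.length = a → l.length = m →
      h S (A ++ l) = DGMfd.csumAt j (fun l₁ l₂ => f S (A ++ (l₁ ++ l₂))) l := by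
  induction m generalizing a j f with
  | zero =>
    by_cases hj : j = 0
    · refine ⟨_, hf, fun S A l h1 h2 => ?_⟩
      rw [List.length_eq_zero_iff.1 h2, hj, csumAt_zero]
      simp
    · refine ⟨_, hf.zero, fun S A l h1 h2 => ?_⟩
      rw [List.length_eq_zero_iff.1 h2, DGMfd.csumAt, csum_nil, if_neg (by simpa using Ne.symm hj)]
  | succ m ih =>
    obtain ⟨f', hf', e⟩ := hf.move j a
    obtain ⟨f'', hf'', e'⟩ := ih (a + 1) (by omega) j hf'
    have e2 : ∀ (S : Setup.{u}) (A l : List (HomVF S.c)) (X : HomVF S.c), A.length = a →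
        l.length = m → f'' S (A ++ X :: l) =
          csum (fun l₁ l₂ => sgn S.K (X.par * lpar l₁) •
            if l₁.length = j then f S (A ++ (l₁ ++ X :: l₂)) else 0) l := by
      intro S A l X h1 h2
      have := e' S (A ++ [X]) l (by simp [h1]) h2
      simp only [List.append_assoc, List.cons_append, List.nil_append] at this
      rw [this]
      refine csum_congr fun l₁ l₂ hl => ?_
      split_ifs with hj
      · exact e S A l₁ l₂ X h1 hj (by omega)
      · rw [smul_zero]
    cases j with
    | zero =>
      refine ⟨_, hf'', fun S A l h1 h2 => ?_⟩
      cases l with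
      | nil => simp at h2
      | cons X l =>
        rw [e2 S A l X h1 (by simpa using h2), DGMfd.csumAt, csum_cons]
        simp
    | succ j =>
      obtain ⟨g, hg, e3⟩ := ih (a + 1) (by omega) j hf
      refine ⟨_, hg.add hf'', fun S A l h1 h2 => ?_⟩
      cases l with
      | nil => simp at h2
      | cons X l =>
        have := e3 S (A ++ [X]) l (by simp [h1]) (by simpa using h2)
        simp only [List.append_assoc, List.cons_append, List.nil_append] at this
        rw [e2 S A l X h1 (by simpa using h2), this, DGMfd.csumAt, DGMfd.csumAt, csum_cons]
        simp

end Univ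

theorem univ_curv : Univ.{u} 3 0 0 fun S l => match l with
    | [X, Y, Z] => S.D.curv X Y Z
    | _ => 0 :=
  ⟨.curv, .curv, fun S X => by simp [List.ofFn_succ]; rfl⟩

theorem univ_atiyah : Univ.{u} 2 1 1 fun S l => match l with
    | [X, Y] => S.D.atiyah S.Q X Y
    | _ => 0 :=
  ⟨.atiyah, .atiyah, fun S X => by simp [List.ofFn_succ]; rfl⟩

/-- The base case is one third of the symmetrized curvature, with a minus sign; the step divides
`bl_rec_ge` by n. Here n counts all arguments, including the first one, in which B is not symmetric.
-/
theorem univ_bl (n : ℕ) (hn : 3 ≤ n) : Univ.{u} n 0 0 fun S l => S.F.bl S.D l := by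
  induction n using Nat.strong_induction_on with
  | _ n ih =>
    rcases Nat.eq_or_lt_of_le hn with rfl | hn
    · obtain ⟨h, hh, e⟩ := univ_curv.{u}.swap 1
      refine ((univ_curv.add hh).smul (-1 / 3)).congr fun S l hl => ?_
      obtain ⟨Y, X, Z, rfl⟩ := List.length_eq_three.1 hl
      have e' := e S [Y] [] X Z rfl rfl
      simp only [List.cons_append, List.nil_append] at e'
      simp only [e']
      have h3 := S.F.bl_three S.D S.torsionFree Y X Z
      refine smul_right_injective _ (show (3 : S.K) ≠ 0 by norm_num) ?_
      change (3 : S.K) • _ = (3 : S.K) • _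
      rw [h3, smul_smul]
      have : (3 : S.K) * ((-1 / 3 : ℚ) : S.K) = -1 := by push_cast; field_simp
      rw [this]
      module
    · obtain ⟨C, hC, eC⟩ := (ih (n - 1) (by omega) (by omega)).cov
      rw [show n - 1 + 1 = n by omega] at hC
      -- The covariant derivative carries its direction in the first place. It is exchanged with Y,
      -- so that Y forms the fixed prefix and the direction is selected among the other arguments.
      obtain ⟨C', hC', eC'⟩ := hC.swap 0
      obtain ⟨T, hT, eT⟩ := hC'.sel 1 (n - 1) (by omega)
      have hB : ∀ j ∈ Finset.Ico 2 (n - 2), Univ.{u} n 0 0 fun S l => match l with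
          | [] => 0
          | Y :: l => csumAt j (fun l₁ l₂ => S.F.bco S.D (S.F.bl S.D (Y :: l₁)) l₂) l := by
        intro j hj
        rw [Finset.mem_Ico] at hj
        have h1 := ih (n - 1 - j + 1) (by omega) (by omega)
        have h2 := ih (j + 1) (by omega) (by omega)
        obtain ⟨h, hh, e⟩ := h1.comp h2
        rw [show j + 1 + (n - 1 - j) = n by omega] at hh
        obtain ⟨h', hh', e'⟩ := hh.csumAt 1 (n - 1) (by omega) j
        refine hh'.congr fun S l hl => ?_
        cases l with
        | nil => simp at hl; omega
        | cons Y l =>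
          simp only [List.length_cons] at hl
          have := e' S [Y] l rfl (by omega)
          simp only [List.cons_append, List.nil_append] at this
          rw [this]
          refine csumAt_congr fun l₁ l₂ h1 h2 => ?_
          obtain ⟨Z, hZ, hZ'⟩ := e S (Y :: l₁) l₂ (by simp [h1]) (by omega)
          rw [List.cons_append] at hZ'
          rw [hZ', ← hZ]
          rfl
      refine ((hT.smul (1 / n)).add ((hT.sum hB).smul (-1 / n))).congr fun S l hl => ?_
      cases l with
      | nil => simp at hl; omega
      | cons Y l =>
        simp only [List.length_cons] at hl
        have h1 := S.F.bl_rec_ge S.D S.torsionFree Y l (by omega)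
        have h2 := eT S [Y] l rfl (by omega)
        simp only [List.cons_append, List.nil_append] at h2
        have h3 : T S (Y :: l) = sel (fun X l' => sgn S.K (X.par * Y.par) •
            covL S.D 0 (S.F.bl S.D) X (Y :: l')) l := by
          rw [h2]
          refine sel_congr fun X l' hl' => ?_
          have := eC' S [] l' Y X rfl (by omega)
          simp only [List.nil_append] at this
          rw [this, eC, mul_comm]
        rw [← h3, show l.length - 1 = n - 2 by omega,
          show (l.length + 1 : S.K) = n by rw [← hl]; push_cast; rfl] at h1
        have hn0 : (n : S.K) ≠ 0 := by exact_mod_cast (by omega : n ≠ 0)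
        refine smul_right_injective _ hn0 ?_
        change (n : S.K) • _ = (n : S.K) • _
        rw [h1, smul_add, smul_smul, smul_smul]
        have e1 : (n : S.K) * ((1 / n : ℚ) : S.K) = 1 := by push_cast; field_simp
        have e2 : (n : S.K) * ((-1 / n : ℚ) : S.K) = -1 := by push_cast; field_simp
        rw [e1, e2]
        module

/-- The same induction with `brk_rec_ge`, starting from minus the Atiyah cocycle. The outer factors
B have at least three arguments and are covered by `univ_bl`. -/
theorem univ_brk (n : ℕ) (hn : 2 ≤ n) : Univ.{u} n 1 1 fun S l => S.F.brk S.D S.Q l := by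
  induction n using Nat.strong_induction_on with
  | _ n ih =>
    rcases Nat.eq_or_lt_of_le hn with rfl | hn
    · refine (univ_atiyah.smul (-1)).congr fun S l hl => ?_
      obtain ⟨X, Y, rfl⟩ := List.length_eq_two.1 hl
      rw [S.F.brk_two S.D S.torsionFree]
      push_cast
      module
    · obtain ⟨C, hC, eC⟩ := (ih (n - 1) (by omega) (by omega)).cov
      rw [show n - 1 + 1 = n by omega] at hC
      obtain ⟨T, hT, eT⟩ := hC.sel 0 n (by omega)
      have hB : ∀ j ∈ Finset.Ico 2 (n - 1), Univ.{u} n 1 1 fun S l =>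
          csumAt j (fun l₁ l₂ => S.F.bco S.D (S.F.brk S.D S.Q l₁) l₂) l := by
        intro j hj
        rw [Finset.mem_Ico] at hj
        have h1 := univ_bl.{u} (n - j + 1) (by omega)
        have h2 := ih j (by omega) (by omega)
        obtain ⟨h, hh, e⟩ := h1.comp h2
        rw [show j + (n - j) = n by omega, zero_add, zero_add] at hh
        obtain ⟨h', hh', e'⟩ := hh.csumAt 0 n (by omega) j
        refine hh'.congr fun S l hl => ?_
        have := e' S [] l rfl hl
        simp only [List.nil_append] at this
        rw [this]
        refine csumAt_congr fun l₁ l₂ h1 h2 => ?_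
        obtain ⟨Z, hZ, hZ'⟩ := e S l₁ l₂ h1 (by omega)
        rw [hZ', ← hZ]
        rfl
      refine ((hT.smul (1 / n)).add ((hT.sum hB).smul (-1 / n))).congr fun S l hl => ?_
      have h1 := S.F.brk_rec_ge S.D S.torsionFree S.Q l (by omega)
      have h2 := eT S [] l rfl hl
      simp only [List.nil_append] at h2
      have h3 : T S l = sel (fun X l' => covL S.D 1 (S.F.brk S.D S.Q) X l') l := by
        rw [h2]
        exact sel_congr fun X l' hl' => eC S X l'
      rw [← h3, hl] at h1
      have hn0 : (n : S.K) ≠ 0 := by exact_mod_cast (by omega : n ≠ 0)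
      refine smul_right_injective _ hn0 ?_
      change (n : S.K) • _ = (n : S.K) • _
      rw [h1, smul_add, smul_smul, smul_smul]
      have e1 : (n : S.K) * ((1 / n : ℚ) : S.K) = 1 := by push_cast; field_simp
      have e2 : (n : S.K) * ((-1 / n : ℚ) : S.K) = -1 := by push_cast; field_simp
      rw [e1, e2]
      module


/-- The dual basis is homogeneous only for parity, so the construction of δ does not show integer
degrees. They are read off from the universal expression, whose constructors all respect degree;
brackets of fewer than two arguments are zero. -/
theorem HasDeg.brk {K : Type} {R : Type u} [Field K] [CharZero K] [Ring R] [Algebra K R]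
    {c : ℤ → R →ₗ[K] R} (F : Frame c) (D : Connection c) (hD : D.TorsionFree) (Q : Homological c)
    (l : List (HomVF c)) (d : List ℤ)
    (h : List.Forall₂ (fun (X : HomVF c) k => HasDeg c k X.der) l d) :
    HasDeg c (1 + d.sum) (F.brk D Q l).1 := by
  rcases Nat.lt_or_ge l.length 2 with hl | hl
  · have : F.brk D Q l = 0 := by
      match l, hl with
      | [], _ => exact F.brk_nil D Q
      | [X], _ => exact F.brk_singleton D Q X
    rw [this]
    exact HasDeg.zero _
  · obtain ⟨E, hE, e⟩ := univ_brk.{u} l.length hl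
    obtain ⟨X, hX⟩ := exists_ofFn (rfl : l.length = l.length)
    obtain ⟨d', hd'⟩ := exists_ofFn h.length_eq.symm
    have h1 := e ⟨K, R, c, F, D, Q, hD⟩ X
    have h2 : ∀ i, HasDeg c (d' i) (X i).der := by
      intro i
      have h3 := (List.forall₂_iff_get.1 h).2 i i.2 (by rw [hd']; simp)
      have hx : l.get i = X i := by
        conv_lhs => rw [List.get_of_eq hX]
        simp
      have hd : d.get ⟨i, by rw [hd']; simp⟩ = d' i := by
        conv_lhs => rw [List.get_of_eq hd']
        simp
      rwa [hx, hd] at h3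
    have h3 := F.eval_hasDeg D Q hE X d' h2
    have h4 : d.sum = ∑ i, d' i := by rw [hd', List.sum_ofFn]
    rw [h4, show F.brk D Q l = (E.eval D Q).val X by rw [← h1, ← hX]]
    exact h3

theorem kapranov_of_frame : ∃ E : (n : ℕ) → TExpr (n + 2) 1,
    ∀ (K : Type) (R : Type u) [Field K] [CharZero K] [Ring R] [Algebra K R]
      (c : ℤ → R →ₗ[K] R) (_ : Frame c) (Q : Homological c) (D : Connection c), D.TorsionFree →
    ∃ P : SymT c ≃ₗ[K] DiffOp c, D.IsPBW P ∧
      (∀ P' : SymT c →ₗ[K] DiffOp c, D.IsPBW P' → P' = P) ∧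
    ∃ R : (n : ℕ) → SymSection c n, IsKapranov Q P R ∧
      (∀ R' : (n : ℕ) → SymSection c n, IsKapranov Q P R' → R' = R) ∧
      (∀ X Y, (R 2).ap [X, Y] = - D.atiyah Q X Y) ∧
      (∀ n, 3 ≤ n → ∀ l : List (HomVF c), l.length = n →
        svf c ((R n).ap l) = (2 / (n : K)) • conv (R 2).ap l
          + (1 / (n : K)) • ∑ k ∈ Finset.Ico 2 n,
              (conv ((R k).symCov D) l + (1 - (k : K)) • conv (R k).ap l
                - (R k).bconv D P l)) ∧
      (∀ (n : ℕ) (X : Fin (n + 2) → HomVF c),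
        (R (n + 2)).ap (List.ofFn X) = ((E n).eval D Q).val X) ∧
      (D.Flat → (∀ X Y, (R 2).ap [X, Y] = - D.atiyah Q X Y) ∧
        ∀ n, 3 ≤ n → ∀ l : List (HomVF c), l.length = n →
          (R n).ap l = (1 / (n : K)) • (R (n - 1)).symCov D l) := by
  choose E hE e using fun n : ℕ => univ_brk.{u} (n + 2) (by omega)
  refine ⟨E, fun K R _ _ _ _ c F Q D hD => ⟨F.pbwEquiv D, F.isPBW D, fun P' hP' => ?_, ?_⟩⟩
  · exact Frame.isPBW_unique F D P' (F.pbwEquiv D).toLinearMap hP' (F.isPBW D)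
  have hT : ∀ n l, l.length = n → (F.brkSec D Q n fun l d _ h =>
    HasDeg.brk F D hD Q l d h).ap l = F.brk D Q l := fun n l hl => Frame.brkSec_ap _ hl
  have h2 : ∀ X Y, (F.brkSec D Q 2 fun l d _ h =>
      HasDeg.brk F D hD Q l d h).ap [X, Y] = - D.atiyah Q X Y := fun X Y => by
    rw [hT 2 _ rfl, F.brk_two D hD]
  refine ⟨fun n => F.brkSec D Q n fun l d _ h => HasDeg.brk F D hD Q l d h,
    F.isKapranov D Q hT, fun R' hR' => ?_, h2, ?_, ?_, fun hR => ⟨h2, ?_⟩⟩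
  · funext n
    refine SymSection.ext_ap F fun l hl => ?_
    rw [F.ap_of_isKapranov D Q hR' n l hl, hT n l hl]
  · rintro n hn l rfl
    exact F.bracket_formula D hD Q hT l hn
  · intro n X
    rw [hT _ _ (by simp)]
    exact e n ⟨K, R, c, F, D, Q, hD⟩ X
  · exact F.bracket_flat D hD hR Q hT


/-! ### Finitely coloured covers -/

section Colouring

variable {M : Type*} [TopologicalSpace M]

/-- The set `B` is covered by finitely many open sets, indexed by `C`, each of which is a disjoint
union of open pieces that refine `𝒰`. -/
def Coloured (C : Type*) (𝒰 : Set (Set M)) (B : Set M) : Prop :=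
  ∃ W : C → Set (Set M), (∀ c, ∀ w ∈ W c, IsOpen w ∧ ∃ u ∈ 𝒰, w ⊆ u) ∧
    (∀ c, (W c).PairwiseDisjoint id) ∧ B ⊆ ⋃ c, ⋃₀ W c

/-- `Coloured` for all covers. -/
def Colourable (C : Type*) (B : Set M) : Prop :=
  ∀ 𝒰 : Set (Set M), (∀ u ∈ 𝒰, IsOpen u) → B ⊆ ⋃₀ 𝒰 → Coloured C 𝒰 B

/-- The number of colours must not grow. The colour classes of A are shrunk to sets `v c` with
closures inside, and B is covered so finely that a piece meeting the closure of `v c` lies in a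
single piece of colour c. Such pieces are merged with that one; the others stay on their own. -/
theorem Colourable.union {C : Type*} [Finite C] [NormalSpace M] {A B : Set M} (hA' : IsClosed A)
    (hA : Colourable C A) (hB : Colourable C B) : Colourable C (A ∪ B) := by
  intro 𝒰 ho hc
  obtain ⟨W, hW, hWd, hWc⟩ := hA 𝒰 ho (Set.subset_union_left.trans hc)
  obtain ⟨v, hv, hvo, hvc⟩ := exists_subset_iUnion_closure_subset hA'
    (fun c => isOpen_sUnion fun w hw => (hW c w hw).1) (fun x _ => Set.toFinite _) hWc
  obtain ⟨V, hV, hVd, hVc⟩ := hB {O | IsOpen O ∧ (∃ u ∈ 𝒰, O ⊆ u) ∧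
      ∀ c, (O ∩ closure (v c)).Nonempty → ∃ w ∈ W c, O ⊆ w} (fun u hu => hu.1) (by
    intro x hx
    obtain ⟨u, hu, hxu⟩ := hc (Or.inr hx)
    have : ∀ c, ∃ O, IsOpen O ∧ x ∈ O ∧ ((O ∩ closure (v c)).Nonempty → ∃ w ∈ W c, O ⊆ w) := by
      intro c
      by_cases h : x ∈ closure (v c)
      · obtain ⟨w, hw, hxw⟩ := hvc c h
        exact ⟨w, (hW c w hw).1, hxw, fun _ => ⟨w, hw, le_rfl⟩⟩
      · exact ⟨(closure (v c))ᶜ, isClosed_closure.isOpen_compl, h, fun ⟨y, hy, hy'⟩ =>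
          absurd hy' hy⟩
    choose O hO hxO hO' using this
    refine ⟨u ∩ ⋂ c, O c, ⟨(ho u hu).inter (isOpen_iInter_of_finite hO), ⟨u, hu,
      Set.inter_subset_left⟩, fun c ⟨y, hy, hy'⟩ => ?_⟩, hxu, Set.mem_iInter.2 hxO⟩
    obtain ⟨w, hw, h⟩ := hO' c ⟨y, Set.mem_iInter.1 hy.2 c, hy'⟩
    exact ⟨w, hw, fun z hz => h (Set.mem_iInter.1 hz.2 c)⟩)
  have key : ∀ c, ∀ O ∈ V c, (O ∩ closure (v c)).Nonempty → ∃ w ∈ W c, O ⊆ w := by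
    intro c O hO h
    obtain ⟨-, u, hu, hOu⟩ := hV c O hO
    obtain ⟨w, hw, h'⟩ := hu.2.2 c (h.mono (Set.inter_subset_inter_left _ hOu))
    exact ⟨w, hw, hOu.trans h'⟩
  -- Enlarged pieces remain inside their `w`, hence stay disjoint from one another. A piece left
  -- alone avoids the closure of `v c` and the other pieces of its colour, so it is disjoint from
  -- every enlarged piece.
  let big : C → Set M → Set M := fun c w =>
    (w ∩ v c) ∪ ⋃₀ {O | O ∈ V c ∧ (O ∩ closure (v c)).Nonempty ∧ O ⊆ w}
  have hbig : ∀ c w, big c w ⊆ w := fun c w => Set.union_subset Set.inter_subset_left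
    (Set.sUnion_subset fun O hO => hO.2.2)
  refine ⟨fun c => big c '' W c ∪ {O | O ∈ V c ∧ ¬ (O ∩ closure (v c)).Nonempty}, ?_, ?_, ?_⟩
  · rintro c _ (⟨w, hw, rfl⟩ | ⟨hO, -⟩)
    · refine ⟨((hW c w hw).1.inter (hvo c)).union (isOpen_sUnion fun O hO => (hV c O hO.1).1), ?_⟩
      obtain ⟨u, hu, hwu⟩ := (hW c w hw).2
      exact ⟨u, hu, (hbig c w).trans hwu⟩
    · obtain ⟨h1, u, hu, h2⟩ := hV c _ hO
      obtain ⟨u', hu', h3⟩ := hu.2.1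
      exact ⟨h1, u', hu', h2.trans h3⟩
  · have cross : ∀ c w O, O ∈ V c → ¬ (O ∩ closure (v c)).Nonempty → Disjoint (big c w) O := by
      intro c w O hO h
      rw [Set.disjoint_left]
      rintro x (hx | ⟨O', hO', hx⟩) hx'
      · exact h ⟨x, hx', subset_closure hx.2⟩
      · by_cases e : O' = O
        · subst e; exact h hO'.2.1
        · exact Set.disjoint_left.1 (hVd c hO'.1 hO e) hx hx'
    rintro c _ (⟨w, hw, rfl⟩ | ⟨hO, h⟩) _ (⟨w', hw', rfl⟩ | ⟨hO', h'⟩) hne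
    · have : w ≠ w' := fun e => hne (by rw [e])
      exact (hWd c hw hw' this).mono (hbig c w) (hbig c w')
    · exact cross c w _ hO' h'
    · exact (cross c w' _ hO h).symm
    · exact hVd c hO hO' hne
  · rintro x (hx | hx)
    · obtain ⟨c, hxc⟩ := Set.mem_iUnion.1 (hv hx)
      obtain ⟨w, hw, hxw⟩ := hvc c (subset_closure hxc)
      exact Set.mem_iUnion.2 ⟨c, big c w, Or.inl ⟨w, hw, rfl⟩, Or.inl ⟨hxw, hxc⟩⟩
    · obtain ⟨c, O, hO, hxO⟩ := Set.mem_iUnion.1 (hVc hx)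
      by_cases h : (O ∩ closure (v c)).Nonempty
      · obtain ⟨w, hw, hOw⟩ := key c O hO h
        exact Set.mem_iUnion.2 ⟨c, big c w, Or.inl ⟨w, hw, rfl⟩, Or.inr ⟨O, ⟨hO, h, hOw⟩, hxO⟩⟩
      · exact Set.mem_iUnion.2 ⟨c, O, Or.inr ⟨hO, h⟩, hxO⟩

/-- Cubes around the points of the lattice ε ℤᵐ, of half side 3ε/4, are coloured by the parity of
the centre. Centres of the same colour differ by at least 2ε in some coordinate, so their cubes are
disjoint, while rounding shows that the cubes cover. With ε half a Lebesgue number, each cube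
meeting the set lies in a member of the cover. -/
theorem colourable_of_chart {m : ℕ} (e : OpenPartialHomeomorph M (Fin m → ℝ)) {B : Set M}
    (hB : IsCompact B) (he : B ⊆ e.source) : Colourable (Fin m → ZMod 2) B := by
  intro 𝒰 ho hc
  obtain ⟨δ, hδ, hL⟩ := lebesgue_number_lemma_of_metric_sUnion
    (c := (fun u => e.target ∩ e.symm ⁻¹' u) '' 𝒰)
    (hB.image_of_continuousOn (e.continuousOn.mono he)) (by
      rintro _ ⟨u, hu, rfl⟩
      exact e.symm.isOpen_inter_preimage (ho u hu)) (by
      rintro _ ⟨x, hx, rfl⟩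
      obtain ⟨u, hu, hxu⟩ := hc hx
      refine ⟨_, ⟨u, hu, rfl⟩, e.map_source (he hx), ?_⟩
      simpa [e.left_inv (he hx)] using hxu)
  set ε := δ / 2 with hε
  have hε0 : 0 < ε := by positivity
  let Q : (Fin m → ℤ) → Set (Fin m → ℝ) := fun z => {y | ∀ a, |y a - ε * z a| < 3 / 4 * ε}
  have hQ : ∀ z, IsOpen (Q z) := fun z => by
    simp only [Q, Set.ofPred_forall]
    exact isOpen_iInter_of_finite fun a => isOpen_lt (by fun_prop) continuous_const
  refine ⟨fun c => {w | ∃ z : Fin m → ℤ, (∀ a, (z a : ZMod 2) = c a) ∧ (Q z ∩ e '' B).Nonempty ∧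
    w = e.source ∩ e ⁻¹' Q z}, ?_, ?_, ?_⟩
  · rintro c _ ⟨z, -, ⟨y, hy, hyB⟩, rfl⟩
    refine ⟨e.isOpen_inter_preimage (hQ z), ?_⟩
    obtain ⟨_, ⟨u, hu, rfl⟩, hb⟩ := hL y hyB
    refine ⟨u, hu, fun x hx => ?_⟩
    have : e x ∈ Metric.ball y δ := by
      rw [Metric.mem_ball, dist_pi_lt_iff hδ]
      intro a
      have h1 := abs_lt.1 (hx.2 a)
      have h2 := abs_lt.1 (hy a)
      rw [Real.dist_eq, abs_lt]
      constructor <;> linarith [h1.1, h1.2, h2.1, h2.2]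
    have := (hb this).2
    rwa [Set.mem_preimage, e.left_inv hx.1] at this
  · rintro c _ ⟨z, hz, -, rfl⟩ _ ⟨z', hz', -, rfl⟩ hne
    rw [Function.onFun, Set.disjoint_left]
    rintro x ⟨-, hx⟩ ⟨-, hx'⟩
    refine hne ?_
    suffices z = z' by rw [this]
    funext a
    by_contra h
    have h1 := abs_lt.1 (hx a)
    have h2 := abs_lt.1 (hx' a)
    have h3 := (ZMod.intCast_eq_intCast_iff_dvd_sub _ _ 2).1 ((hz a).trans (hz' a).symm)
    have h4 : 2 ≤ |z' a - z a| := by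
      obtain ⟨t, ht⟩ := h3
      rw [le_abs]
      push_cast at ht
      omega
    have h5 : (2 : ℝ) ≤ |(z' a : ℝ) - z a| := by exact_mod_cast h4
    rcases le_abs.1 h5 with h6 | h6 <;> nlinarith
  · intro x hx
    refine Set.mem_iUnion.2 ⟨fun a => (round (e x a / ε) : ZMod 2), e.source ∩ e ⁻¹' Q fun a =>
      round (e x a / ε), ⟨_, fun a => rfl, ⟨e x, ?_, x, hx, rfl⟩, rfl⟩, he hx, ?_⟩
    all_goals
      intro a
      have h1 := abs_sub_round (e x a / ε)
      have h2 : e x a - ε * (round (e x a / ε) : ℤ) = ε * (e x a / ε - round (e x a / ε)) := by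
        field_simp
      rw [h2, abs_mul, abs_of_pos hε0]
      nlinarith

/-- Compact induction with `Colourable.union` gives a colourable compact set that contains B.
Colourability descends to closed subsets by adding the complement to the cover and discarding the
pieces that miss the subset. -/
theorem colourable_of_isCompact {m : ℕ} [T2Space M] [NormalSpace M] [WeaklyLocallyCompactSpace M]
    [ChartedSpace (EuclideanSpace ℝ (Fin m)) M] {B : Set M} (hB : IsCompact B) :
    Colourable (Fin m → ZMod 2) B := by
  have mono : ∀ {A B : Set M}, A ⊆ B → IsClosed A → Colourable (Fin m → ZMod 2) B →
      Colourable (Fin m → ZMod 2) A := by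
    intro A B hAB hA hB 𝒰 ho hc
    obtain ⟨W, hW, hd, hWc⟩ := hB (insert Aᶜ 𝒰) (by
      rintro u (rfl | hu)
      · exact hA.isOpen_compl
      · exact ho u hu) (by
      intro x _
      by_cases hx : x ∈ A
      · obtain ⟨u, hu, hxu⟩ := hc hx
        exact ⟨u, Or.inr hu, hxu⟩
      · exact ⟨Aᶜ, Or.inl rfl, hx⟩)
    refine ⟨fun c => {w | w ∈ W c ∧ (w ∩ A).Nonempty}, fun c w hw => ?_, fun c w hw w' hw' =>
      hd c hw.1 hw'.1, fun x hx => ?_⟩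
    · obtain ⟨h1, u, rfl | hu, h2⟩ := hW c w hw.1
      · obtain ⟨y, hy, hy'⟩ := hw.2
        exact absurd hy' (h2 hy)
      · exact ⟨h1, u, hu, h2⟩
    · obtain ⟨c, w, hw, hxw⟩ := Set.mem_iUnion.1 (hWc (hAB hx))
      exact Set.mem_iUnion.2 ⟨c, w, ⟨hw, x, hxw, hx⟩, hxw⟩
  have : ∃ A : Set M, IsCompact A ∧ B ⊆ A ∧ Colourable (Fin m → ZMod 2) A := by
    refine hB.induction_on (p := fun s => ∃ A : Set M, IsCompact A ∧ s ⊆ A ∧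
      Colourable (Fin m → ZMod 2) A) ?_ ?_ ?_ ?_
    · exact ⟨∅, isCompact_empty, le_rfl, fun 𝒰 _ _ => ⟨fun _ => ∅, by simp, by simp, by simp⟩⟩
    · rintro s t hst ⟨A, h1, h2, h3⟩
      exact ⟨A, h1, hst.trans h2, h3⟩
    · rintro s t ⟨A, h1, h2, h3⟩ ⟨A', h1', h2', h3'⟩
      exact ⟨A ∪ A', h1.union h1', Set.union_subset_union h2 h2', h3.union h1.isClosed h3'⟩
    · intro x _
      obtain ⟨A, hA, hxA, hAs⟩ := exists_mem_nhds_isCompact_mapsTo (f := id) continuous_id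
        ((chartAt (EuclideanSpace ℝ (Fin m)) x).open_source.mem_nhds (mem_chart_source _ x))
      refine ⟨A, mem_nhdsWithin_of_mem_nhds hA, A, hxA, le_rfl, ?_⟩
      exact colourable_of_chart ((chartAt (EuclideanSpace ℝ (Fin m)) x).trans
        (EuclideanSpace.equiv (Fin m) ℝ).toHomeomorph.toOpenPartialHomeomorph) hxA
        (fun y hy => by simpa using hAs hy)
  obtain ⟨A, -, h1, h2⟩ := this
  exact mono h1 hB.isClosed h2

/-- The compact shells of an exhaustion are coloured separately, inside open neighbourhoods `A n`.
Neighbourhoods whose indices differ by at least 3 are disjoint, so recording the index modulo 3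
allows the colours to be reused. -/
theorem exists_coloured_cover {m : ℕ} [T2Space M] [SecondCountableTopology M]
    [ChartedSpace (EuclideanSpace ℝ (Fin m)) M] {𝒰 : Set (Set M)} (ho : ∀ u ∈ 𝒰, IsOpen u)
    (hc : ⋃₀ 𝒰 = Set.univ) : Coloured ((Fin m → ZMod 2) × Fin 3) 𝒰 Set.univ := by
  have := ChartedSpace.locallyCompactSpace (EuclideanSpace ℝ (Fin m)) M
  let L := CompactExhaustion.choice M
  -- The shifted exhaustion starts with the empty set, so that the shell of index 0 is the whole
  -- first compact set.
  let κ := L.shiftr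
  have h0 : κ 0 = ∅ := rfl
  have hin : ∀ {i j}, i < j → κ i ⊆ interior (κ j) := fun {i j} h =>
    (κ.subset_interior_succ i).trans (interior_mono (κ.subset h))
  let S : ℕ → Set M := fun n => κ (n + 1) \ interior (κ n)
  let A : ℕ → Set M := fun n => interior (κ (n + 2)) \ κ (n - 1)
  have hS : ∀ n, Colourable (Fin m → ZMod 2) (S n) := fun n =>
    colourable_of_isCompact ((κ.isCompact _).diff isOpen_interior)
  have hA : ∀ n, IsOpen (A n) := fun n => isOpen_interior.sdiff (κ.isCompact _).isClosed
  have hSA : ∀ n, S n ⊆ A n := by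
    intro n x hx
    refine ⟨hin (by omega) hx.1, fun h => ?_⟩
    rcases Nat.eq_zero_or_pos n with rfl | hn
    · simp [h0] at h
    · exact hx.2 (hin (by omega) h)
  have hAA : ∀ n n', n + 3 ≤ n' → Disjoint (A n) (A n') := by
    intro n n' h
    rw [Set.disjoint_left]
    intro x hx hx'
    exact hx'.2 (κ.subset (by omega) (interior_subset hx.1))
  choose W hW hWd hWc using fun n => hS n ((fun u => u ∩ A n) '' 𝒰)
    (by rintro _ ⟨u, hu, rfl⟩; exact (ho u hu).inter (hA n))
    (by
      intro x hx
      obtain ⟨u, hu, hxu⟩ : x ∈ ⋃₀ 𝒰 := hc ▸ Set.mem_univ x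
      exact ⟨_, ⟨u, hu, rfl⟩, hxu, hSA n hx⟩)
  have hWA : ∀ n c, ∀ w ∈ W n c, w ⊆ A n := by
    intro n c w hw
    obtain ⟨-, _, ⟨u, -, rfl⟩, h⟩ := hW n c w hw
    exact h.trans Set.inter_subset_right
  refine ⟨fun c => {w | ∃ n : ℕ, n % 3 = c.2 ∧ w ∈ W n c.1}, ?_, ?_, ?_⟩
  · rintro c w ⟨n, -, hw⟩
    obtain ⟨h1, _, ⟨u, hu, rfl⟩, h2⟩ := hW n _ w hw
    exact ⟨h1, u, hu, h2.trans Set.inter_subset_left⟩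
  · rintro c w ⟨n, hn, hw⟩ w' ⟨n', hn', hw'⟩ hne
    rcases lt_trichotomy n n' with h | rfl | h
    · exact (hAA n n' (by omega)).mono (hWA n _ w hw) (hWA n' _ w' hw')
    · exact hWd n _ hw hw' hne
    · exact (hAA n' n (by omega)).symm.mono (hWA n _ w hw) (hWA n' _ w' hw')
  · intro x _
    have hx := L.mem_sdiff_shiftr_find x
    obtain ⟨c, w, hw, hxw⟩ := Set.mem_iUnion.1 (hWc (L.find x)
      ⟨hx.1, fun h => hx.2 (interior_subset h)⟩)
    exact Set.mem_iUnion.2 ⟨(c, ⟨L.find x % 3, Nat.mod_lt _ (by norm_num)⟩), w,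
      ⟨L.find x, rfl, hw⟩, hxw⟩

end Colouring


/-! ### Signs of multi-indices -/

section MultiIndex

variable (K : Type*) [Field K] {r : ℕ} (d : Fin r → ℤ)

/-- The exponent of the sign in `ξᵃ ξᵇ = ± ξᵃ⁺ᵇ`. -/
def idxExp (a b : Fin r →₀ ℕ) : ZMod 2 :=
  ∑ i, ∑ j ∈ Finset.Iio i, (a i : ZMod 2) * b j * d i * d j

/-- The parity of `ξᵃ`. -/
def idxPar (a : Fin r →₀ ℕ) : ZMod 2 := ∑ i, (a i : ZMod 2) * d i

/-- The multi-index of the coordinate `ξⱼ`. -/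
abbrev idx (j : Fin r) : Fin r →₀ ℕ := Finsupp.single j 1

theorem usgn_idxSign (a b : Fin r →₀ ℕ) : usgn K (idxSign d a b) = sgn K (idxExp d a b) := by
  rw [idxSign, sgn, idxExp]
  congr 1
  rw [← uzpow_intCast (R := ZMod 2)]
  push_cast
  rfl

variable {K}

theorem idxExp_add_left (a a' b : Fin r →₀ ℕ) :
    idxExp d (a + a') b = idxExp d a b + idxExp d a' b := by
  simp only [idxExp, Finsupp.add_apply, Nat.cast_add, add_mul, Finset.sum_add_distrib]

theorem idxExp_add_right (a b b' : Fin r →₀ ℕ) :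
    idxExp d a (b + b') = idxExp d a b + idxExp d a b' := by
  simp only [idxExp, Finsupp.add_apply, Nat.cast_add, mul_add, add_mul, Finset.sum_add_distrib]

theorem idxPar_add (a b : Fin r →₀ ℕ) : idxPar d (a + b) = idxPar d a + idxPar d b := by
  simp only [idxPar, Finsupp.add_apply, Nat.cast_add, add_mul, Finset.sum_add_distrib]

theorem idxPar_idx (j : Fin r) : idxPar d (idx j) = d j := by
  rw [idxPar, Finset.sum_eq_single j]
  · simp
  · intro i _ h
    simp [Ne.symm h]
  · simp

theorem sum_antidiagonal_swap {N : Type*} [AddCommMonoid N] (b : Fin r →₀ ℕ)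
    (φ : (Fin r →₀ ℕ) × (Fin r →₀ ℕ) → N) :
    ∑ t ∈ Finset.HasAntidiagonal.antidiagonal b, φ t.swap =
      ∑ t ∈ Finset.HasAntidiagonal.antidiagonal b, φ t :=
  Finset.sum_equiv (Equiv.prodComm _ _)
    (by simp [Finset.HasAntidiagonal.mem_antidiagonal, add_comm]) (by simp)

/-- The product of the parities is a double sum, split into the parts below, above and on the
diagonal. The diagonal part vanishes when the total index is admissible, which leaves the
commutation sign. -/
theorem idxExp_swap (a b : Fin r →₀ ℕ) :
    idxExp d a b + idxExp d b a + ∑ i, (a i : ZMod 2) * b i * d i = idxPar d a * idxPar d b := by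
  have h1 : idxPar d a * idxPar d b =
      ∑ i, ∑ j, (a i : ZMod 2) * b j * d i * d j := by
    rw [idxPar, idxPar, Finset.sum_mul_sum]
    exact Finset.sum_congr rfl fun i _ => Finset.sum_congr rfl fun j _ => by ring
  have h2 : idxExp d b a = ∑ i, ∑ j ∈ Finset.Ioi i, (a i : ZMod 2) * b j * d i * d j := by
    rw [idxExp, Finset.sum_sigma', Finset.sum_sigma']
    exact Finset.sum_nbij' (fun x => ⟨x.2, x.1⟩) (fun x => ⟨x.2, x.1⟩)
      (fun x hx => by simpa using hx) (fun x hx => by simpa using hx) (fun x _ => rfl)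
      (fun x _ => rfl) (fun x _ => by ring)
  have h3 : ∀ z : ZMod 2, z * z = z := by decide
  rw [h1, h2, idxExp, ← Finset.sum_add_distrib, ← Finset.sum_add_distrib]
  refine Finset.sum_congr rfl fun i _ => ?_
  have h4 : (Finset.univ : Finset (Fin r)) = insert i (Finset.Iio i ∪ Finset.Ioi i) := by
    ext j
    simp only [Finset.mem_univ, Finset.mem_insert, Finset.mem_union, Finset.mem_Iio,
      Finset.mem_Ioi, true_iff]
    rcases lt_trichotomy j i with h | h | h
    · exact Or.inr (Or.inl h)
    · exact Or.inl h
    · exact Or.inr (Or.inr h)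
  have h5 : i ∉ Finset.Iio i ∪ Finset.Ioi i := by simp
  have h6 : Disjoint (Finset.Iio i) (Finset.Ioi i) := by
    rw [Finset.disjoint_left]; intro j; simp only [Finset.mem_Iio, Finset.mem_Ioi]
    exact fun h h' => absurd h (lt_asymm h')
  rw [h4, Finset.sum_insert h5, Finset.sum_union h6]
  rw [show (a i : ZMod 2) * b i * d i * d i = a i * b i * (d i * d i) by ring, h3]
  ring

theorem zmod_eq_one_of_odd {n : ℤ} : (n : ZMod 2) = 1 ↔ Odd n := by
  rw [ZMod.intCast_eq_one_iff_odd]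

theorem Admissible.diag_eq_zero {a b : Fin r →₀ ℕ} (h : Admissible d (a + b)) :
    ∑ i, (a i : ZMod 2) * b i * d i = 0 := by
  refine Finset.sum_eq_zero fun i _ => ?_
  by_cases hi : Odd (d i)
  · have := h i hi
    rw [Finsupp.add_apply] at this
    rcases Nat.eq_zero_or_pos (a i) with h0 | h0
    · simp [h0]
    · rw [show b i = 0 by omega]; simp
  · rw [(ZMod.intCast_zmod_eq_zero_iff_dvd _ _).2 (by simpa using (Int.not_odd_iff_even.1 hi).two_dvd), mul_zero]

theorem Admissible.mono {a b : Fin r →₀ ℕ} (h : Admissible d (a + b)) : Admissible d a :=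
  fun i hi => by
    have := h i hi
    rw [Finsupp.add_apply] at this
    omega

/-- The product of two power series. -/
def idxMul (F G : (Fin r →₀ ℕ) → K) (b : Fin r →₀ ℕ) : K :=
  ∑ t ∈ Finset.HasAntidiagonal.antidiagonal b, sgn K (idxExp d t.1 t.2) * (F t.1 * G t.2)

theorem idxMul_const_left (z : K)
    (F F' : (Fin r →₀ ℕ) → K) (b : Fin r →₀ ℕ) :
    idxMul d (fun a => z * F a) F' b = z * idxMul d F F' b := by
  rw [idxMul, idxMul, Finset.mul_sum]
  exact Finset.sum_congr rfl fun t _ => by ring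

theorem idxMul_const_right (z : K)
    (F F' : (Fin r →₀ ℕ) → K) (b : Fin r →₀ ℕ) :
    idxMul d F (fun a => z * F' a) b = z * idxMul d F F' b := by
  rw [idxMul, idxMul, Finset.mul_sum]
  exact Finset.sum_congr rfl fun t _ => by ring

theorem idxMul_zero (z : K)
    (F : (Fin r →₀ ℕ) → K) (b : Fin r →₀ ℕ) :
    idxMul d (fun a => if a = 0 then z else 0) F b = z * F b := by
  rw [idxMul, Finset.sum_eq_single (0, b)]
  · simp [idxExp]
  · rintro ⟨a, a'⟩ h hne
    rw [Finset.HasAntidiagonal.mem_antidiagonal] at h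
    rw [if_neg, zero_mul, mul_zero]
    rintro rfl
    exact hne (by rw [← h]; simp)
  · simp [Finset.HasAntidiagonal.mem_antidiagonal]

theorem idxMul_comm {p q : ZMod 2} {F G : (Fin r →₀ ℕ) → K} (hF : ∀ a, idxPar d a ≠ p → F a = 0)
    (hG : ∀ a, idxPar d a ≠ q → G a = 0) {b : Fin r →₀ ℕ} (hb : Admissible d b) :
    idxMul d F G b = sgn K (p * q) * idxMul d G F b := by
  rw [idxMul, idxMul, ← sum_antidiagonal_swap, Finset.mul_sum]
  refine Finset.sum_congr rfl fun t ht => ?_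
  rw [Finset.HasAntidiagonal.mem_antidiagonal] at ht
  simp only [Prod.fst_swap, Prod.snd_swap]
  by_cases h1 : idxPar d t.2 = p
  · by_cases h2 : idxPar d t.1 = q
    · have h3 := idxExp_swap d t.1 t.2
      rw [Admissible.diag_eq_zero d (by rwa [ht]), add_zero, h1, h2] at h3
      have e : ∀ x y z : ZMod 2, x + y = z → y = z + x := by decide
      rw [e _ _ _ h3, sgn_add, mul_comm q]
      ring
    · rw [hG _ h2]; ring
  · rw [hF _ h1]; ring

theorem idxMul_eq_zero {p q : ZMod 2} {F G : (Fin r →₀ ℕ) → K}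
    (hF : ∀ a, idxPar d a ≠ p → F a = 0) (hG : ∀ a, idxPar d a ≠ q → G a = 0) {b : Fin r →₀ ℕ}
    (hb : idxPar d b ≠ p + q) : idxMul d F G b = 0 := by
  refine Finset.sum_eq_zero fun t ht => ?_
  rw [Finset.HasAntidiagonal.mem_antidiagonal] at ht
  by_cases h1 : idxPar d t.1 = p
  · by_cases h2 : idxPar d t.2 = q
    · exact absurd (by rw [← ht, idxPar_add, h1, h2]) hb
    · rw [hG _ h2]; ring
  · rw [hF _ h1]; ring

theorem sum_antidiagonal_add {N : Type*} [AddCommMonoid N] (e b : Fin r →₀ ℕ)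
    (φ : (Fin r →₀ ℕ) × (Fin r →₀ ℕ) → N) (h0 : ∀ t, ¬ e ≤ t.1 → φ t = 0) :
    ∑ t ∈ Finset.HasAntidiagonal.antidiagonal (b + e), φ t =
      ∑ t ∈ Finset.HasAntidiagonal.antidiagonal b, φ (t.1 + e, t.2) := by
  refine (Finset.sum_of_injOn (fun t => (t.1 + e, t.2)) ?_ ?_ ?_ ?_).symm
  · rintro ⟨x, y⟩ _ ⟨x', y'⟩ _ h
    simpa using h
  · rintro ⟨x, y⟩ h
    simp only [Finset.mem_coe,
      Finset.HasAntidiagonal.mem_antidiagonal] at h ⊢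
    rw [← h]; abel
  · rintro ⟨x, y⟩ h h'
    refine h0 _ fun he => h' ?_
    rw [Finset.HasAntidiagonal.mem_antidiagonal] at h
    refine ⟨(x - e, y), ?_, ?_⟩
    · simp only [Finset.mem_coe, Finset.HasAntidiagonal.mem_antidiagonal]
      refine add_right_cancel (b := e) ?_
      rw [← h]
      simp only
      rw [add_right_comm, tsub_add_cancel_of_le he]
    · simp only [tsub_add_cancel_of_le he]
  · intro t _; rfl

theorem sum_antidiagonal_add' {N : Type*} [AddCommMonoid N] (e b : Fin r →₀ ℕ)
    (φ : (Fin r →₀ ℕ) × (Fin r →₀ ℕ) → N) (h0 : ∀ t, ¬ e ≤ t.2 → φ t = 0) :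
    ∑ t ∈ Finset.HasAntidiagonal.antidiagonal (b + e), φ t =
      ∑ t ∈ Finset.HasAntidiagonal.antidiagonal b, φ (t.1, t.2 + e) := by
  rw [← sum_antidiagonal_swap, ← sum_antidiagonal_swap b]
  exact sum_antidiagonal_add e b (fun t => φ t.swap) fun t h => h0 _ h

theorem idx_le {j : Fin r} {a : Fin r →₀ ℕ} : idx j ≤ a ↔ 1 ≤ a j := by
  rw [Finsupp.single_le_iff]

/-- The coefficients of the derivative in the direction of `ξⱼ`. -/
def idxDer (j : Fin r) (F : (Fin r →₀ ℕ) → K) (b : Fin r →₀ ℕ) : K :=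
  ((b j + 1 : ℕ) : K) * (sgn K (idxExp d (idx j) b) * F (b + idx j))

/-- Both terms on the right are reindexed over the decompositions of b + eⱼ, where they carry the
weight t₁(j) ± t₂(j). For an even coordinate the weight is b(j) + 1. For an odd one exactly one of
the two exponents is 1, and the sign comes from moving the derivative past the first factor. -/
theorem idxDer_mul (j : Fin r) {q : ZMod 2} {F G P : (Fin r →₀ ℕ) → K}
    (hF : ∀ a, idxPar d a ≠ q → F a = 0)
    (hFa : ∀ a, ¬ Admissible d a → F a = 0) (hGa : ∀ a, ¬ Admissible d a → G a = 0)
    (hPa : ∀ a, ¬ Admissible d a → P a = 0) (hP : ∀ a, Admissible d a → P a = idxMul d F G a)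
    {b : Fin r →₀ ℕ} (hb : Admissible d b) :
    idxDer d j P b = idxMul d (idxDer d j F) G b +
      sgn K (d j * q) * idxMul d F (idxDer d j G) b := by
  have key : idxMul d (idxDer d j F) G b + sgn K (d j * q) * idxMul d F (idxDer d j G) b =
      ∑ t ∈ Finset.HasAntidiagonal.antidiagonal (b + idx j), ((t.1 j : K) + t.2 j * sgn K (t.1 j * d j)) *
        (sgn K (idxExp d (idx j) b) * (sgn K (idxExp d t.1 t.2) * (F t.1 * G t.2))) := by
    simp only [add_mul]
    rw [Finset.sum_add_distrib, sum_antidiagonal_add (idx j) b (fun t => (t.1 j : K) *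
        (sgn K (idxExp d (idx j) b) * (sgn K (idxExp d t.1 t.2) * (F t.1 * G t.2))))
        (fun t ht => ?_),
      sum_antidiagonal_add' (idx j) b (fun t => (t.2 j : K) * sgn K (t.1 j * d j) *
        (sgn K (idxExp d (idx j) b) * (sgn K (idxExp d t.1 t.2) * (F t.1 * G t.2))))
        (fun t ht => ?_), idxMul, idxMul, Finset.mul_sum]
    · congr 1
      · refine Finset.sum_congr rfl fun t ht => ?_
        rw [Finset.HasAntidiagonal.mem_antidiagonal] at ht
        have e : sgn K (idxExp d t.1 t.2) * sgn K (idxExp d (idx j) t.1) =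
            sgn K (idxExp d (idx j) b) * sgn K (idxExp d (t.1 + idx j) t.2) := by
          rw [← sgn_add, ← sgn_add, ← ht, idxExp_add_left, idxExp_add_right]
          congr 1
          have : ∀ x y z : ZMod 2, x + y = y + z + (x + z) := by decide
          exact this _ _ _
        simp only [idxDer, Finsupp.add_apply, Finsupp.single_eq_same]
        linear_combination ((t.1 j + 1 : ℕ) : K) * F (t.1 + idx j) * G t.2 * e
      · refine Finset.sum_congr rfl fun t ht => ?_
        rw [Finset.HasAntidiagonal.mem_antidiagonal] at ht
        by_cases h1 : idxPar d t.1 = q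
        · have e : sgn K (d j * q) * (sgn K (idxExp d t.1 t.2) * sgn K (idxExp d (idx j) t.2)) =
              sgn K (t.1 j * d j) *
                (sgn K (idxExp d (idx j) b) * sgn K (idxExp d t.1 (t.2 + idx j))) := by
            have h3 := idxExp_swap d t.1 (idx j)
            have h4 : ∑ i, (t.1 i : ZMod 2) * (idx j i : ℕ) * d i = t.1 j * d j := by
              rw [Finset.sum_eq_single j]
              · simp
              · intro i _ h
                simp [Ne.symm h]
              · simp
            rw [h4, idxPar_idx, h1] at h3
            simp only [← sgn_add]
            rw [← ht, idxExp_add_right, idxExp_add_right, mul_comm (d j : ZMod 2), ← h3]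
            congr 1
            have : ∀ x y z w v : ZMod 2, x + y + z + (w + v) = z + (y + v + (w + x)) := by decide
            exact this _ _ _ _ _
          simp only [idxDer, Finsupp.add_apply, Finsupp.single_eq_same]
          linear_combination ((t.2 j + 1 : ℕ) : K) * F t.1 * G (t.2 + idx j) * e
        · rw [hF _ h1]; ring
    · rw [idx_le] at ht
      rw [show t.2 j = 0 by omega]; simp
    · rw [idx_le] at ht
      rw [show t.1 j = 0 by omega]; simp
  rw [key, idxDer]
  have hF' : ∀ t ∈ Finset.HasAntidiagonal.antidiagonal (b + idx j), F t.1 * G t.2 = 0 ∨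
      (Admissible d t.1 ∧ Admissible d t.2) := fun t _ => by
    by_cases h1 : Admissible d t.1
    · by_cases h2 : Admissible d t.2
      · exact Or.inr ⟨h1, h2⟩
      · exact Or.inl (by rw [hGa _ h2, mul_zero])
    · exact Or.inl (by rw [hFa _ h1, zero_mul])
  by_cases ha : Admissible d (b + idx j)
  · rw [hP _ ha, idxMul, Finset.mul_sum, Finset.mul_sum]
    refine Finset.sum_congr rfl fun t ht => ?_
    have htj : t.1 j + t.2 j = b j + 1 := by
      rw [Finset.HasAntidiagonal.mem_antidiagonal] at ht
      have := DFunLike.congr_fun ht j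
      simpa using this
    congr 1
    rcases zmod_two_cases (d j : ZMod 2) with h | h
    · rw [h, mul_zero, ← htj]
      simp [sgn]
    · have h1 := ha j (zmod_eq_one_of_odd.1 h)
      simp only [Finsupp.add_apply, Finsupp.single_eq_same] at h1
      rw [show b j = 0 by omega]
      rcases Nat.eq_zero_or_pos (t.1 j) with h2 | h2
      · rw [h2, show t.2 j = 1 by omega]; simp [sgn]
      · rw [show t.1 j = 1 by omega, show t.2 j = 0 by omega]; simp
  -- Inadmissibility of b + eⱼ forces ξⱼ to be odd with b(j) = 1. Both factors then contain ξⱼ once,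
  -- and the weight is 1 - 1 = 0.
  · rw [hPa _ ha, mul_zero, mul_zero]
    refine (Finset.sum_eq_zero fun t ht => ?_).symm
    rcases hF' t ht with h0 | ⟨h1, h2⟩
    · rw [h0]; ring
    · have htj : t.1 j + t.2 j = b j + 1 := by
        rw [Finset.HasAntidiagonal.mem_antidiagonal] at ht
        have := DFunLike.congr_fun ht j
        simpa using this
      have hj : Odd (d j) ∧ b j = 1 := by
        by_contra hcon
        refine ha fun i hi => ?_
        have := hb i hi
        by_cases hij : j = i
        · subst hij
          have : b j ≠ 1 := fun h => hcon ⟨hi, h⟩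
          simp only [Finsupp.add_apply, Finsupp.single_eq_same]
          omega
        · simpa [Finsupp.single_apply, hij] using this
      have e1 := h1 j hj.1
      have e2 := h2 j hj.1
      rw [show t.1 j = 1 by omega, show t.2 j = 1 by omega, zmod_eq_one_of_odd.2 hj.1]
      simp [sgn, usgn]

theorem idxMul_idx (j : Fin r) (a : K) (G : (Fin r →₀ ℕ) → K) (b : Fin r →₀ ℕ) :
    idxMul d (fun a' => if a' = idx j then a else 0) G b =
      if 1 ≤ b j then sgn K (idxExp d (idx j) (b - idx j)) * (a * G (b - idx j)) else 0 := by
  unfold idxMul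
  split_ifs with h
  · rw [Finset.sum_eq_single (idx j, b - idx j)]
    · simp
    · rintro ⟨x, y⟩ ht hne
      rw [Finset.HasAntidiagonal.mem_antidiagonal] at ht
      have : x ≠ idx j := fun h' => hne (by
        simp only at ht
        rw [← ht, h', add_tsub_cancel_left])
      simp [this]
    · intro h'
      exact absurd (Finset.HasAntidiagonal.mem_antidiagonal.2 (add_tsub_cancel_of_le (idx_le.2 h))) h'
  · refine Finset.sum_eq_zero fun t ht => ?_
    rw [Finset.HasAntidiagonal.mem_antidiagonal] at ht
    have : t.1 ≠ idx j := fun h' => h (by rw [← ht, h']; simp)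
    simp [this]

/-- The coefficients of the factor of `ξⱼ` in a power series. -/
def idxQuot (j : Fin r) (F : (Fin r →₀ ℕ) → K) (b : Fin r →₀ ℕ) : K :=
  if ∀ i < j, b i = 0 then F (b + idx j) else 0

/-- Every nonconstant monomial is assigned to the first coordinate that occurs in it, so it is
counted exactly once. As that coordinate already stands in front, no sign appears. -/
theorem sum_idxMul_idxQuot (F : (Fin r →₀ ℕ) → K) (b : Fin r →₀ ℕ) :
    ∑ j, idxMul d (fun a' => if a' = idx j then 1 else 0) (idxQuot j F) b =
      if b = 0 then 0 else F b := by
  simp only [idxMul_idx, one_mul]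
  split_ifs with hb
  · subst hb; simp
  · obtain ⟨i, hi⟩ : ∃ i, b i ≠ 0 := by
      by_contra h
      push Not at h
      exact hb (Finsupp.ext h)
    obtain ⟨j, hj, hmin⟩ := (Finset.univ.filter fun i => b i ≠ 0).exists_minimal ⟨i, by simp [hi]⟩
    have hj0 : b j ≠ 0 := by simpa using hj
    have hlt : ∀ i < j, b i = 0 := fun i hi => by
      by_contra h
      exact absurd (hmin (by simpa using h) hi.le) (not_le.2 hi)
    rw [Finset.sum_eq_single j, if_pos (by omega), idxQuot, if_pos]
    · rw [tsub_add_cancel_of_le (idx_le.2 (by omega))]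
      have : idxExp d (idx j) (b - idx j) = 0 := by
        refine Finset.sum_eq_zero fun i _ => Finset.sum_eq_zero fun i' hi' => ?_
        by_cases hij : i = j
        · subst hij
          have h0 := hlt i' (Finset.mem_Iio.1 hi')
          rw [Finsupp.tsub_apply, h0]; simp
        · simp [Finsupp.single_apply, Ne.symm hij]
      rw [this]; simp [sgn]
    · intro i hi
      rw [Finsupp.tsub_apply, hlt i hi]; simp
    · intro i _ hij
      split_ifs with h1
      · have hji : j < i := lt_of_le_of_ne (not_lt.1 fun h => by
          have := hlt i h; omega) (Ne.symm hij)
        rw [idxQuot, if_neg]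
        · simp
        · intro h
          have := h j hji
          rw [Finsupp.tsub_apply, Finsupp.single_apply, if_neg (ne_of_gt hji)] at this
          exact hj0 (by omega)
      · rfl
    · simp

end MultiIndex



/-! ### Sections of the structure sheaf -/

section Sections

variable {K : Type} [RCLike K] {m : ℕ} {M : Type u} [TopologicalSpace M]
  [ChartedSpace (EuclideanSpace ℝ (Fin m)) M]

/-- Sections over the open set `U`. -/
abbrev GradedSheaf.Sec (S : GradedSheaf K m M) (U : Opens M) : Type u := S.sheaf.1.obj (.op U)

/-- Restriction of sections. -/
def GradedSheaf.res (S : GradedSheaf K m M) {U V : Opens M} (h : V ≤ U) : S.Sec U →ₐ[K] S.Sec V :=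
  (S.sheaf.1.map (homOfLE h).op).hom

namespace GradedSheaf

variable (S : GradedSheaf K m M)

theorem res_res {U V W : Opens M} (h : V ≤ U) (h' : W ≤ V) (f : S.Sec U) :
    S.res h' (S.res h f) = S.res (h'.trans h) f := by
  have := S.sheaf.1.map_comp (homOfLE h).op (homOfLE h').op
  exact (DFunLike.congr_fun (congrArg AlgCat.Hom.hom this) f).symm

theorem exists_glue {ι : Type*} (U : ι → Opens M) (V : Opens M) (hU : ∀ i, U i ≤ V)
    (hV : V ≤ iSup U) (s : ∀ i, S.Sec (U i))
    (h : ∀ i j, S.res inf_le_left (s i) = S.res (V := U i ⊓ U j) inf_le_right (s j)) :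
    ∃ f : S.Sec V, ∀ i, S.res (hU i) f = s i :=
  (TopCat.Sheaf.existsUnique_gluing' S.sheaf U V (fun i => homOfLE (hU i)) hV s h).exists

theorem sec_ext {V : Opens M} {f g : S.Sec V}
    (h : ∀ x ∈ V, ∃ U : Opens M, x ∈ U ∧ ∃ hU : U ≤ V, S.res hU f = S.res hU g) : f = g := by
  choose U hxU hUV hfg using h
  refine TopCat.Sheaf.eq_of_locally_eq' S.sheaf (fun x : V => U x.1 x.2) V
    (fun x => homOfLE (hUV x.1 x.2)) (fun x hx => ?_) f g fun x => hfg x.1 x.2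
  exact Opens.mem_iSup.2 ⟨⟨x, hx⟩, hxU x hx⟩

end GradedSheaf

namespace LocalCoord

variable {S : GradedSheaf K m M} {r : ℕ} {d : Fin r → ℤ} {U : Opens M}

/-- Restriction of coordinates to a smaller domain. -/
def restrict (L : LocalCoord S d U) {U' : Opens M} (h : U' ≤ U) : LocalCoord S d U' where
  coeff V hV := L.coeff V (hV.trans h)
  coeff_res V W hV := L.coeff_res V W (hV.trans h)
  coeff_eq_zero V hV := L.coeff_eq_zero V (hV.trans h)
  exists_unique V hV := L.exists_unique V (hV.trans h)
  coeff_mul V hV := L.coeff_mul V (hV.trans h)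
  coeff_ofFn V hV := L.coeff_ofFn V (hV.trans h)
  coeff_comp V hV := L.coeff_comp V (hV.trans h)

theorem sec_ext (L : LocalCoord S d U) {V : Opens M} (hV : V ≤ U) {f g : S.Sec V}
    (h : ∀ a, L.coeff V hV a f = L.coeff V hV a g) : f = g :=
  (L.exists_unique V hV (fun a => L.coeff V hV a f)
    fun a ha => L.coeff_eq_zero V hV a ha f).unique (fun _ => rfl) fun a => (h a).symm

end LocalCoord

/-- A disjoint union of coordinate domains of a graded manifold. -/
structure Patch (G : GradedManifold K m M) where
  ι : Type u
  O : ι → Opens M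
  disj : ∀ i j x, x ∈ O i → x ∈ O j → i = j
  L : ∀ i, LocalCoord G.toGradedSheaf G.deg (O i)
  e : ι → OpenPartialHomeomorph M (EuclideanSpace ℝ (Fin m))
  e_mem : ∀ i, e i ∈ IsManifold.maximalAtlas (𝓡 m) ∞ M
  le_source : ∀ i, (O i : Set M) ⊆ (e i).source

variable {G : GradedManifold K m M}

/-- Restriction of global functions. -/
abbrev GradedManifold.resT (G : GradedManifold K m M) (V : Opens M) : G.Fn →ₐ[K] G.Sec V :=
  G.res le_top

/-- The global function `f` vanishes on a neighbourhood of `x`. -/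
def VanishesAt (f : G.Fn) (x : M) : Prop := ∃ V : Opens M, x ∈ V ∧ G.resT V f = 0

theorem VanishesAt.eq_zero {f : G.Fn} (h : ∀ x, VanishesAt f x) : f = 0 := by
  refine G.sec_ext fun x _ => ?_
  obtain ⟨V, hx, hV⟩ := h x
  exact ⟨V, hx, le_top, by rw [map_zero]; exact hV⟩

theorem vanishesAt_of_resT {f : G.Fn} {V : Opens M} (h : G.resT V f = 0) {x : M} (hx : x ∈ V) :
    VanishesAt f x := ⟨V, hx, h⟩

theorem vanishesAt_zero (x : M) : VanishesAt (0 : G.Fn) x := ⟨⊤, trivial, map_zero _⟩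

theorem VanishesAt.add {f g : G.Fn} {x : M} (hf : VanishesAt f x) (hg : VanishesAt g x) :
    VanishesAt (f + g) x := by
  obtain ⟨U, hU, h0⟩ := hf
  obtain ⟨V, hV, h1⟩ := hg
  refine ⟨U ⊓ V, ⟨hU, hV⟩, ?_⟩
  have h2 := congrArg (G.res (inf_le_left : U ⊓ V ≤ U)) h0
  have h3 := congrArg (G.res (inf_le_right : U ⊓ V ≤ V)) h1
  rw [map_zero, GradedSheaf.res_res] at h2 h3
  rw [map_add, h2, h3, add_zero]

theorem VanishesAt.mul_left {f : G.Fn} {x : M} (g : G.Fn) (hf : VanishesAt f x) :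
    VanishesAt (g * f) x := by
  obtain ⟨U, hU, h0⟩ := hf
  exact ⟨U, hU, by rw [map_mul, h0, mul_zero]⟩

theorem VanishesAt.mul_right {f : G.Fn} {x : M} (g : G.Fn) (hf : VanishesAt f x) :
    VanishesAt (f * g) x := by
  obtain ⟨U, hU, h0⟩ := hf
  exact ⟨U, hU, by rw [map_mul, h0, zero_mul]⟩

theorem VanishesAt.smul {f : G.Fn} {x : M} (a : K) (hf : VanishesAt f x) :
    VanishesAt (a • f) x := by
  obtain ⟨U, hU, h0⟩ := hf
  exact ⟨U, hU, by rw [map_smul, h0, smul_zero]⟩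

theorem VanishesAt.sub {f g : G.Fn} {x : M} (hf : VanishesAt f x) (hg : VanishesAt g x) :
    VanishesAt (f - g) x := by
  rw [sub_eq_add_neg, ← neg_one_smul K g]
  exact hf.add (hg.smul _)

theorem VanishesAt.sum {ι : Type*} {s : Finset ι} {f : ι → G.Fn} {x : M}
    (h : ∀ i ∈ s, VanishesAt (f i) x) : VanishesAt (∑ i ∈ s, f i) x :=
  Finset.sum_induction f (VanishesAt · x) (fun _ _ => VanishesAt.add) (vanishesAt_zero x) h

theorem VanishesAt.comp {f : G.Fn} {x : M} (k : ℤ) (hf : VanishesAt f x) :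
    VanishesAt (G.gr k f) x := by
  obtain ⟨U, hU, h0⟩ := hf
  refine ⟨U, hU, ?_⟩
  have := G.comp_res ⊤ U le_top k f
  change _ = G.resT U (G.gr k f) at this
  rw [← this]
  change G.comp U k (G.resT U f) = 0
  rw [h0, map_zero]

/-- A smooth function on `M` as a function on the graded manifold. -/
def GradedManifold.sm (G : GradedManifold K m M) (φ : M → K)
    (hφ : ContMDiff (𝓡 m) 𝓘(ℝ, K) ∞ φ) : G.Fn :=
  G.ofFn ⊤ ⟨fun x => φ x.1, fun x => contMDiffAt_subtype_iff.2 (hφ x.1)⟩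

theorem sm_vanishesAt {φ : M → K} (hφ : ContMDiff (𝓡 m) 𝓘(ℝ, K) ∞ φ) {V : Opens M}
    (h : ∀ x ∈ V, φ x = 0) {x : M} (hx : x ∈ V) : VanishesAt (G.sm φ hφ) x := by
  refine ⟨V, hx, ?_⟩
  have := G.ofFn_res ⊤ V le_top ⟨fun x => φ x.1, fun x => contMDiffAt_subtype_iff.2 (hφ x.1)⟩ 0
    fun x => (h x.1 x.2).symm
  rw [map_zero] at this
  exact this

namespace Patch

variable (P : Patch G)

/-- The union of the coordinate domains. -/
def W : Set M := ⋃ i, (P.O i : Set M)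

theorem mem_W {x : M} : x ∈ P.W ↔ ∃ i, x ∈ P.O i := Set.mem_iUnion

theorem isOpen_W : IsOpen P.W := isOpen_iUnion fun i => (P.O i).2

/-- The coefficients of a function. -/
def cf (b : Fin G.rank →₀ ℕ) : G.Fn →ₗ[K] M → K where
  toFun f x := open Classical in
    if h : ∃ i, x ∈ P.O i then
      ((P.L h.choose).coeff _ le_rfl b (G.resT _ f)).1 ⟨x, h.choose_spec⟩
    else 0
  map_add' f g := by
    ext x
    by_cases h : ∃ i, x ∈ P.O i
    · simp only [dif_pos h, Pi.add_apply, map_add]; rfl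
    · simp only [dif_neg h, Pi.add_apply, add_zero]
  map_smul' a f := by
    ext x
    by_cases h : ∃ i, x ∈ P.O i
    · simp only [dif_pos h, Pi.smul_apply, map_smul, RingHom.id_apply]; rfl
    · simp only [dif_neg h, Pi.smul_apply, smul_zero, RingHom.id_apply]

variable {P}

theorem cf_apply {i : P.ι} {V : Opens M} (hV : V ≤ P.O i) (b : Fin G.rank →₀ ℕ) (f : G.Fn)
    (x : V) : P.cf b f x = ((P.L i).coeff V hV b (G.resT V f)).1 x := by
  have h : ∃ i, x.1 ∈ P.O i := ⟨i, hV x.2⟩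
  have e : h.choose = i := P.disj _ _ _ h.choose_spec (hV x.2)
  have h1 : P.cf b f x = ((P.L h.choose).coeff _ le_rfl b (G.resT _ f)).1 ⟨x, h.choose_spec⟩ :=
    dif_pos h
  have h2 : ∀ (j : P.ι) (hj : x.1 ∈ P.O j), j = i →
      ((P.L j).coeff _ le_rfl b (G.resT _ f)).1 ⟨x, hj⟩ =
        ((P.L i).coeff V hV b (G.resT V f)).1 x := by
    rintro j hj rfl
    have := (P.L j).coeff_res _ V le_rfl hV b (G.resT _ f) x
    rw [← this]
    change ((P.L j).coeff V hV b (G.res hV (G.resT _ f))).1 x = _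
    rw [GradedSheaf.res_res]
  rw [h1, h2 _ _ e]

theorem cf_eq_of_mem {x : M} (hx : x ∈ P.W) : ∃ (i : P.ι) (hi : x ∈ P.O i),
    ∀ b f, P.cf b f x = ((P.L i).coeff _ le_rfl b (G.resT _ f)).1 ⟨x, hi⟩ := by
  obtain ⟨i, hi⟩ := P.mem_W.1 hx
  exact ⟨i, hi, fun b f => cf_apply le_rfl b f ⟨x, hi⟩⟩

theorem cf_smooth (b : Fin G.rank →₀ ℕ) (f : G.Fn) {x : M} (hx : x ∈ P.W) :
    ContMDiffAt (𝓡 m) 𝓘(ℝ, K) ∞ (P.cf b f) x := by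
  obtain ⟨i, hi⟩ := P.mem_W.1 hx
  have h := ((P.L i).coeff _ le_rfl b (G.resT _ f)).2
  refine (contMDiffAt_subtype_iff (U := P.O i) (x := ⟨x, hi⟩)).1 ?_
  have e : (fun y : P.O i => P.cf b f y) =
      ((P.L i).coeff _ le_rfl b (G.resT _ f)).1 := funext fun y => cf_apply le_rfl b f y
  rw [e]
  exact h _

theorem cf_eq_zero {b : Fin G.rank →₀ ℕ} (hb : ¬ Admissible G.deg b) (f : G.Fn) {x : M}
    (hx : x ∈ P.W) : P.cf b f x = 0 := by
  obtain ⟨i, hi, h⟩ := cf_eq_of_mem hx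
  rw [h, (P.L i).coeff_eq_zero _ _ _ hb]
  rfl

theorem cf_mul {b : Fin G.rank →₀ ℕ} (hb : Admissible G.deg b) (f g : G.Fn) {x : M}
    (hx : x ∈ P.W) :
    P.cf b (f * g) x = idxMul G.deg (fun a => P.cf a f x) (fun a => P.cf a g x) b := by
  obtain ⟨i, hi, h⟩ := cf_eq_of_mem hx
  simp only [h, map_mul, (P.L i).coeff_mul _ _ _ hb, idxMul, ← usgn_idxSign]
  rw [AddSubmonoidClass.coe_finsetSum, Finset.sum_apply]
  refine Finset.sum_congr rfl fun t _ => ?_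
  rcases Int.units_eq_one_or (idxSign G.deg t.1 t.2) with h' | h' <;> rw [h']
  · simp [usgn]
  · simp [usgn, Units.smul_def]

theorem cf_sm {φ : M → K} (hφ : ContMDiff (𝓡 m) 𝓘(ℝ, K) ∞ φ) (b : Fin G.rank →₀ ℕ) {x : M}
    (hx : x ∈ P.W) : P.cf b (G.sm φ hφ) x = if b = 0 then φ x else 0 := by
  obtain ⟨i, hi, h⟩ := cf_eq_of_mem hx
  have h1 : G.resT (P.O i) (G.sm φ hφ) =
      G.ofFn _ ⟨fun x => φ x.1, fun x => contMDiffAt_subtype_iff.2 (hφ x.1)⟩ :=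
    G.ofFn_res ⊤ _ le_top _ _ fun _ => rfl
  rw [h, h1, (P.L i).coeff_ofFn]
  split_ifs <;> rfl

theorem cf_one (b : Fin G.rank →₀ ℕ) {x : M} (hx : x ∈ P.W) :
    P.cf b (1 : G.Fn) x = if b = 0 then 1 else 0 := by
  have h : (1 : G.Fn) = G.sm (fun _ => 1) contMDiff_const := (map_one (G.ofFn ⊤)).symm
  rw [h, cf_sm _ _ hx]

theorem cf_sm_mul {φ : M → K} (hφ : ContMDiff (𝓡 m) 𝓘(ℝ, K) ∞ φ) (f : G.Fn)
    (b : Fin G.rank →₀ ℕ) {x : M} (hx : x ∈ P.W) :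
    P.cf b (G.sm φ hφ * f) x = φ x * P.cf b f x := by
  by_cases hb : Admissible G.deg b
  · rw [cf_mul hb _ _ hx]
    simp only [cf_sm _ _ hx, idxMul_zero]
  · rw [cf_eq_zero hb _ hx, cf_eq_zero hb _ hx, mul_zero]

theorem cf_comp (b : Fin G.rank →₀ ℕ) (k : ℤ) (f : G.Fn) {x : M} (hx : x ∈ P.W) :
    P.cf b (G.gr k f) x = if ∑ i, (b i : ℤ) * G.deg i = k then P.cf b f x else 0 := by
  obtain ⟨i, hi, h⟩ := cf_eq_of_mem hx
  have h1 : G.resT (P.O i) (G.gr k f) = G.comp _ k (G.resT _ f) :=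
    (G.comp_res ⊤ _ le_top k f).symm
  rw [h, h, h1, (P.L i).coeff_comp]
  split_ifs <;> rfl

theorem cf_of_vanishesAt {f : G.Fn} {x : M} (hx : x ∈ P.W) (h : VanishesAt f x)
    (b : Fin G.rank →₀ ℕ) : P.cf b f x = 0 := by
  obtain ⟨i, hi⟩ := P.mem_W.1 hx
  obtain ⟨V, hV, h0⟩ := h
  have h1 : G.resT (V ⊓ P.O i) f = 0 := by
    have h2 := congrArg (G.res (inf_le_left : V ⊓ P.O i ≤ V)) h0
    rwa [map_zero, GradedSheaf.res_res] at h2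
  rw [cf_apply (inf_le_right : V ⊓ P.O i ≤ _) b f ⟨x, hV, hi⟩, h1, map_zero]
  rfl

theorem vanishesAt_of_cf {f : G.Fn} {x : M} (hx : x ∈ P.W)
    (h : ∀ᶠ y in nhds x, ∀ b, P.cf b f y = 0) : VanishesAt f x := by
  obtain ⟨i, hi⟩ := P.mem_W.1 hx
  obtain ⟨V, hV, hVo, hxV⟩ := eventually_nhds_iff.1 h
  refine ⟨⟨V, hVo⟩ ⊓ P.O i, ⟨hxV, hi⟩, (P.L i).sec_ext inf_le_right fun b => ?_⟩
  rw [map_zero]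
  refine Subtype.ext (funext fun y => ?_)
  rw [← cf_apply]
  exact hV y.1 y.2.1 b

/-- The sections that vanish outside of a closed subset of `P.W` are given by their
coefficients. -/
theorem exists_section {Z : Set M} (hZ : IsClosed Z) (hZW : Z ⊆ P.W)
    (F : (Fin G.rank →₀ ℕ) → M → K) (hF : ∀ b, ∀ x ∈ P.W, ContMDiffAt (𝓡 m) 𝓘(ℝ, K) ∞ (F b) x)
    (hFZ : ∀ b, ∀ x ∈ P.W, x ∉ Z → F b x = 0)
    (hFa : ∀ b, ¬ Admissible G.deg b → ∀ x ∈ P.W, F b x = 0) :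
    ∃ f : G.Fn, (∀ b, ∀ x ∈ P.W, P.cf b f x = F b x) ∧ ∀ x ∉ Z, VanishesAt f x := by
  have hW : ∀ i, ∀ x : P.O i, x.1 ∈ P.W := fun i x => P.mem_W.2 ⟨i, x.2⟩
  have hex : ∀ i, ∃ s : G.Sec (P.O i), ∀ b, ∀ x : P.O i,
      ((P.L i).coeff _ le_rfl b s).1 x = F b x := fun i => by
    obtain ⟨s, hs, -⟩ := (P.L i).exists_unique _ le_rfl
      (fun b => ⟨fun x => F b x, fun x => contMDiffAt_subtype_iff.2 (hF b x.1 (hW i x))⟩)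
      fun b hb => Subtype.ext (funext fun x => hFa b hb x.1 (hW i x))
    exact ⟨s, fun b x => by rw [hs b]⟩
  choose s hs using hex
  have hres : ∀ i (V : Opens M) (hV : V ≤ P.O i) b (x : V),
      ((P.L i).coeff V hV b (G.res hV (s i))).1 x = F b x := fun i V hV b x => by
    have := (P.L i).coeff_res _ V le_rfl hV b (s i) x
    exact this.trans (hs i b ⟨x.1, hV x.2⟩)
  -- The local sections are glued with the zero section over the complement of Z; on overlaps with
  -- that complement all coefficients vanish, and distinct coordinate domains do not meet.
  let U : Option P.ι → Opens M := fun o => o.elim ⟨Zᶜ, hZ.isOpen_compl⟩ P.O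
  let t : ∀ o, G.Sec (U o) := fun o => match o with
    | none => 0
    | some i => s i
  have hzero : ∀ i (V : Opens M) (hV : V ≤ P.O i), (∀ x ∈ V, x ∉ Z) → G.res hV (s i) = 0 :=
    fun i V hV h => (P.L i).sec_ext hV fun b => by
      rw [map_zero]
      exact Subtype.ext (funext fun x => (hres i V hV b x).trans
        (hFZ b x.1 (P.mem_W.2 ⟨i, hV x.2⟩) (h x.1 x.2)))
  obtain ⟨f, hf⟩ := G.exists_glue U ⊤ (fun _ => le_top) (fun x _ => by
      by_cases hx : x ∈ Z
      · obtain ⟨i, hi⟩ := P.mem_W.1 (hZW hx)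
        exact Opens.mem_iSup.2 ⟨some i, hi⟩
      · exact Opens.mem_iSup.2 ⟨none, hx⟩) t (by
      rintro (_ | i) (_ | j)
      · rfl
      · refine (map_zero _).trans (hzero j _ inf_le_right ?_).symm
        rintro x ⟨hx, -⟩
        exact hx
      · refine (hzero i _ inf_le_left ?_).trans (map_zero _).symm
        rintro x ⟨-, hx⟩
        exact hx
      · by_cases hij : i = j
        · subst hij; rfl
        · refine (P.L i).sec_ext inf_le_left fun b => Subtype.ext (funext fun x => ?_)
          exact absurd (P.disj i j x.1 x.2.1 x.2.2) hij)
  refine ⟨f, fun b x hx => ?_, fun x hx => ⟨U none, hx, hf none⟩⟩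
  obtain ⟨i, hi, h⟩ := cf_eq_of_mem hx
  rw [h]
  have := hf (some i)
  change G.resT (P.O i) f = s i at this
  rw [this, hs i b ⟨x, hi⟩]

theorem eq_of_cf {Z : Set M} (hZW : Z ⊆ P.W) {f g : G.Fn} (hf : ∀ x ∉ Z, VanishesAt f x)
    (hg : ∀ x ∉ Z, VanishesAt g x) (h : ∀ b, ∀ x ∈ P.W, P.cf b f x = P.cf b g x) : f = g := by
  rw [← sub_eq_zero]
  refine VanishesAt.eq_zero fun x => ?_
  by_cases hx : x ∈ Z
  · refine vanishesAt_of_cf (hZW hx) ?_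
    filter_upwards [P.isOpen_W.mem_nhds (hZW hx)] with y hy b
    rw [map_sub, Pi.sub_apply, h b y hy, sub_self]
  · exact (hf x hx).sub (hg x hx)

theorem cf_of_mem_par {p : ZMod 2} {f : G.Fn} (hf : f ∈ par G.gr p) {b : Fin G.rank →₀ ℕ}
    (hb : idxPar G.deg b ≠ p) {x : M} (hx : x ∈ P.W) : P.cf b f x = 0 := by
  have h := hf (∑ i, (b i : ℤ) * G.deg i) (by
    push_cast
    exact hb)
  have h1 := cf_comp (P := P) b (∑ i, (b i : ℤ) * G.deg i) f hx
  rw [if_pos rfl, h, map_zero] at h1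
  exact h1.symm

theorem mem_par_of_cf {p : ZMod 2} {f : G.Fn} {Z : Set M} (hZW : Z ⊆ P.W)
    (hf : ∀ x ∉ Z, VanishesAt f x)
    (h : ∀ b, idxPar G.deg b ≠ p → ∀ x ∈ P.W, P.cf b f x = 0) : f ∈ par G.gr p := by
  intro k hk
  refine eq_of_cf hZW (fun x hx => (hf x hx).comp k) (fun x _ => vanishesAt_zero x) fun b x hx => ?_
  rw [cf_comp _ _ _ hx, map_zero]
  split_ifs with hb
  · refine h b (fun hp => hk ?_) x hx
    rw [← hp, ← hb, idxPar]
    push_cast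
    rfl
  · rfl

end Patch

end Sections



/-! ### Hadamard's lemma -/

section Hadamard

/-- Differentiation under the integral sign. The derivative is an integral of the same kind with
values in linear maps, so the target space must vary in the induction. -/
theorem contDiff_nat_integral {E F : Type} [NormedAddCommGroup E] [NormedSpace ℝ E]
    [ProperSpace E] [NormedAddCommGroup F] [NormedSpace ℝ F] [CompleteSpace F] (n : ℕ)
    {φ : ℝ × E → F} (hφ : ContDiff ℝ ∞ φ) : ContDiff ℝ n fun v => ∫ t in (0 : ℝ)..1, φ (t, v) := by
  induction n generalizing F with
  | zero =>
    refine contDiff_zero.2 ?_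
    exact intervalIntegral.continuous_parametric_intervalIntegral_of_continuous'
      (f := fun v t => φ (t, v)) (by
        have := hφ.continuous
        fun_prop) 0 1
  | succ n ih =>
    let φ' : ℝ × E → E →L[ℝ] F := fun p => (fderiv ℝ φ p).comp (.inr ℝ ℝ E)
    have hφ' : ContDiff ℝ ∞ φ' :=
      (hφ.fderiv_right (m := ∞) (by simp)).clm_comp contDiff_const
    have hd : ∀ t v, HasFDerivAt (fun v => φ (t, v)) (φ' (t, v)) v := fun t v => by
      have h1 : HasFDerivAt φ (fderiv ℝ φ (t, v)) (t, v) :=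
        (hφ.differentiable (by simp)).differentiableAt.hasFDerivAt
      exact h1.comp v (hasFDerivAt_prodMk_right t v)
    have hH : ∀ v, HasFDerivAt (fun v => ∫ t in (0 : ℝ)..1, φ (t, v))
        (∫ t in (0 : ℝ)..1, φ' (t, v)) v := fun v => by
      have hc : IsCompact (Set.uIcc (0 : ℝ) 1 ×ˢ Metric.closedBall v 1) :=
        isCompact_uIcc.prod (isCompact_closedBall v 1)
      obtain ⟨C, hC⟩ := hc.exists_bound_of_continuousOn hφ'.continuous.continuousOn
      have hcφ : ∀ v, Continuous fun t => φ (t, v) := fun v => by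
        have := hφ.continuous
        fun_prop
      have hcφ' : Continuous fun t => φ' (t, v) := by
        have := hφ'.continuous
        fun_prop
      refine (intervalIntegral.hasFDerivAt_integral_of_dominated_of_fderiv_le
        (F := fun v t => φ (t, v)) (F' := fun v t => φ' (t, v)) (bound := fun _ => C)
        (Metric.ball_mem_nhds v one_pos) ?_ ?_ ?_ ?_ ?_ ?_)
      · exact Filter.Eventually.of_forall fun w => (hcφ w).aestronglyMeasurable
      · exact (hcφ v).intervalIntegrable _ _
      · exact hcφ'.aestronglyMeasurable
      · refine Filter.Eventually.of_forall fun t ht w hw => hC (t, w) ⟨?_, ?_⟩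
        · exact Set.uIoc_subset_uIcc ht
        · exact Metric.ball_subset_closedBall hw
      · exact intervalIntegrable_const
      · exact Filter.Eventually.of_forall fun t _ w _ => hd t w
    push_cast
    refine contDiff_succ_iff_hasFDerivAt.2 ⟨_, ih hφ', hH⟩

theorem contDiff_integral {E F : Type} [NormedAddCommGroup E] [NormedSpace ℝ E]
    [ProperSpace E] [NormedAddCommGroup F] [NormedSpace ℝ F] [CompleteSpace F]
    {φ : ℝ × E → F} (hφ : ContDiff ℝ ∞ φ) : ContDiff ℝ ∞ fun v => ∫ t in (0 : ℝ)..1, φ (t, v) :=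
  contDiff_infty.2 fun n => contDiff_nat_integral n hφ

/-- Hadamard's lemma: a smooth function that vanishes at `v₀` is a combination of the coordinates
that vanish at `v₀`. -/
theorem exists_hadamard {K : Type} [RCLike K] {m : ℕ} {F : EuclideanSpace ℝ (Fin m) → K}
    (hF : ContDiff ℝ ∞ F) (v₀ : EuclideanSpace ℝ (Fin m)) :
    ∃ H : Fin m → EuclideanSpace ℝ (Fin m) → K, (∀ a, ContDiff ℝ ∞ (H a)) ∧
      ∀ v, F v = F v₀ + ∑ a, ((v a - v₀ a : ℝ) : K) * H a v := by
  let φ : Fin m → ℝ × EuclideanSpace ℝ (Fin m) → K := fun a p =>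
    fderiv ℝ F (v₀ + p.1 • (p.2 - v₀)) (EuclideanSpace.single a 1)
  have hφ : ∀ a, ContDiff ℝ ∞ (φ a) := fun a => by
    have h1 : ContDiff ℝ ∞ (fderiv ℝ F) := hF.fderiv_right (m := ∞) (by simp)
    refine ContDiff.clm_apply (h1.comp ?_) contDiff_const
    fun_prop
  refine ⟨fun a v => ∫ t in (0 : ℝ)..1, φ a (t, v), fun a => contDiff_integral (hφ a), fun v => ?_⟩
  have hi : ∀ a, IntervalIntegrable (fun t => φ a (t, v)) MeasureTheory.volume 0 1 := fun a => by
    have := (hφ a).continuous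
    exact Continuous.intervalIntegrable (by fun_prop) _ _
  -- The integrands are the partial derivatives along the segment from v₀ to v, so the fundamental
  -- theorem of calculus turns their combination into F(v) - F(v₀).
  have hd : ∀ t : ℝ, HasDerivAt (fun t : ℝ => F (v₀ + t • (v - v₀)))
      (∑ a, ((v a - v₀ a : ℝ) : K) * φ a (t, v)) t := fun t => by
    have h1 : HasFDerivAt F (fderiv ℝ F (v₀ + t • (v - v₀))) (v₀ + t • (v - v₀)) :=
      (hF.differentiable (by simp)).differentiableAt.hasFDerivAt
    have h2 : HasDerivAt (fun t : ℝ => v₀ + t • (v - v₀)) (v - v₀) t := by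
      simpa using ((hasDerivAt_id t).smul_const (v - v₀)).const_add v₀
    have h3 := h1.comp_hasDerivAt t h2
    have h4 : v - v₀ = ∑ a, (v a - v₀ a) • EuclideanSpace.single a (1 : ℝ) := by
      ext b
      simp [Finset.sum_apply, Pi.single_apply]
    have h5 : ∑ a, ((v a - v₀ a : ℝ) : K) * φ a (t, v) =
        fderiv ℝ F (v₀ + t • (v - v₀)) (v - v₀) := by
      refine Eq.trans ?_ (congrArg (fderiv ℝ F (v₀ + t • (v - v₀))) h4).symm
      rw [map_sum]
      refine Finset.sum_congr rfl fun a _ => ?_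
      rw [map_smul, RCLike.real_smul_eq_coe_mul]
    rw [h5]
    exact h3
  have h5 := intervalIntegral.integral_eq_sub_of_hasDerivAt (a := 0) (b := 1)
    (fun t _ => hd t) (by
      have e : (fun t => ∑ a, ((v a - v₀ a : ℝ) : K) * φ a (t, v)) =
          ∑ a, fun t => ((v a - v₀ a : ℝ) : K) * φ a (t, v) :=
        funext fun t => by simp
      rw [e]
      exact IntervalIntegrable.sum _ fun a _ => (hi a).const_mul _)
  rw [intervalIntegral.integral_finsetSum fun a _ => (hi a).const_mul _] at h5
  simp only [intervalIntegral.integral_const_mul, one_smul, zero_smul, add_zero,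
    add_sub_cancel] at h5
  rw [h5]
  ring

/-- Multiplication by a bump function supported where F is smooth makes F globally smooth without
changing it near v₀. -/
theorem exists_hadamard_of_contDiffAt {K : Type} [RCLike K] {m : ℕ}
    {F : EuclideanSpace ℝ (Fin m) → K} {v₀ : EuclideanSpace ℝ (Fin m)}
    (hF : ∀ᶠ v in nhds v₀, ContDiffAt ℝ ∞ F v) :
    ∃ H : Fin m → EuclideanSpace ℝ (Fin m) → K, (∀ a, ContDiff ℝ ∞ (H a)) ∧
      ∀ᶠ v in nhds v₀, F v = F v₀ + ∑ a, ((v a - v₀ a : ℝ) : K) * H a v := by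
  obtain ⟨f, hfs⟩ : ∃ f : ContDiffBump v₀, tsupport f ⊆ {v | ContDiffAt ℝ ∞ F v} := by
    obtain ⟨r, hr, h⟩ := Metric.nhds_basis_closedBall.mem_iff.1 hF
    exact ⟨⟨r / 2, r, half_pos hr, half_lt_self hr⟩, by rw [ContDiffBump.tsupport_eq]; exact h⟩
  have hG : ContDiff ℝ ∞ fun v => f v • F v := by
    refine contDiff_iff_contDiffAt.2 fun v => ?_
    by_cases hv : v ∈ tsupport f
    · exact f.contDiff.contDiffAt.smul (hfs hv)
    · refine (contDiffAt_const (c := (0 : K))).congr_of_eventuallyEq ?_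
      filter_upwards [notMem_tsupport_iff_eventuallyEq.1 hv] with w hw
      rw [hw, Pi.zero_apply, zero_smul]
  obtain ⟨H, hH, h⟩ := exists_hadamard hG v₀
  refine ⟨H, hH, ?_⟩
  filter_upwards [f.eventuallyEq_one] with v hv
  have h1 := h v
  rw [hv, f.eventuallyEq_one.eq_of_nhds] at h1
  simpa using h1

end Hadamard



/-! ### Partial derivatives of coefficients -/

section PartialDerivative

variable {K : Type} [RCLike K] {m : ℕ} {M : Type u} [TopologicalSpace M]
  [ChartedSpace (EuclideanSpace ℝ (Fin m)) M] {G : GradedManifold K m M}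

namespace Patch

variable (P : Patch G)

/-- The chart around `x`. -/
def ch (x : M) : OpenPartialHomeomorph M (EuclideanSpace ℝ (Fin m)) := open Classical in
  if h : ∃ i, x ∈ P.O i then P.e h.choose else chartAt _ x

/-- The coordinates of `x` in the chart around `x`. -/
def pos (x : M) : EuclideanSpace ℝ (Fin m) := P.ch x x

/-- The partial derivatives of a function on `M`. -/
def pd (a : Fin m) (F : M → K) (x : M) : K :=
  fderiv ℝ (F ∘ (P.ch x).symm) (P.pos x) (EuclideanSpace.single a 1)

variable {P}

theorem ch_eq {i : P.ι} {x : M} (hx : x ∈ P.O i) : P.ch x = P.e i := by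
  have h : ∃ i, x ∈ P.O i := ⟨i, hx⟩
  have h1 : P.ch x = P.e h.choose := dif_pos h
  rw [h1, P.disj _ _ _ h.choose_spec hx]

theorem mem_source {i : P.ι} {x : M} (hx : x ∈ P.O i) : x ∈ (P.e i).source := P.le_source i hx

theorem mem_ch_source {x : M} (hx : x ∈ P.W) : x ∈ (P.ch x).source := by
  obtain ⟨i, hi⟩ := P.mem_W.1 hx
  rw [ch_eq hi]
  exact mem_source hi

theorem ch_mem {x : M} (hx : x ∈ P.W) : P.ch x ∈ IsManifold.maximalAtlas (𝓡 m) ∞ M := by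
  obtain ⟨i, hi⟩ := P.mem_W.1 hx
  rw [ch_eq hi]
  exact P.e_mem i

/-- The chart depends only on the component of the patch, so it is locally constant in the base
point. This lets pointwise partial derivatives be treated as derivatives in one fixed chart. -/
theorem eventually_ch_eq {x : M} (hx : x ∈ P.W) :
    ∀ᶠ y in nhds x, y ∈ P.W ∧ P.ch y = P.ch x := by
  obtain ⟨i, hi⟩ := P.mem_W.1 hx
  filter_upwards [(P.O i).2.mem_nhds hi] with y hy
  exact ⟨P.mem_W.2 ⟨i, hy⟩, by rw [ch_eq hi, ch_eq hy]⟩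

theorem ch_symm_pos {x : M} (hx : x ∈ P.W) : (P.ch x).symm (P.pos x) = x :=
  (P.ch x).left_inv (mem_ch_source hx)

theorem tendsto_symm {x : M} (hx : x ∈ P.W) :
    Filter.Tendsto (P.ch x).symm (nhds (P.pos x)) (nhds x) := by
  have h := (P.ch x).tendsto_symm (mem_ch_source hx)
  exact h

theorem contDiffAt_comp {F : M → K} {x : M} (hx : x ∈ P.W)
    (hF : ContMDiffAt (𝓡 m) 𝓘(ℝ, K) ∞ F x) :
    ContDiffAt ℝ ∞ (F ∘ (P.ch x).symm) (P.pos x) := by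
  have h1 : ContMDiffAt 𝓘(ℝ, EuclideanSpace ℝ (Fin m)) (𝓡 m) ∞ (P.ch x).symm (P.pos x) :=
    contMDiffAt_symm_of_mem_maximalAtlas (ch_mem hx)
      ((P.ch x).map_source (mem_ch_source hx))
  rw [← contMDiffAt_iff_contDiffAt]
  refine ContMDiffAt.comp _ ?_ h1
  rwa [ch_symm_pos hx]

theorem contMDiffAt_pos {x : M} (hx : x ∈ P.W) :
    ContMDiffAt (𝓡 m) 𝓘(ℝ, EuclideanSpace ℝ (Fin m)) ∞ P.pos x := by
  have h1 : ContMDiffAt (𝓡 m) (𝓡 m) ∞ (P.ch x) x :=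
    contMDiffAt_of_mem_maximalAtlas (ch_mem hx) (mem_ch_source hx)
  refine ContMDiffAt.congr_of_eventuallyEq h1 ?_
  filter_upwards [eventually_ch_eq hx] with y hy
  rw [pos, hy.2]

theorem contMDiffAt_comp_pos {H : EuclideanSpace ℝ (Fin m) → K} {x : M} (hx : x ∈ P.W)
    (hH : ContDiffAt ℝ ∞ H (P.pos x)) : ContMDiffAt (𝓡 m) 𝓘(ℝ, K) ∞ (fun y => H (P.pos y)) x :=
  ContMDiffAt.comp x hH.contMDiffAt (contMDiffAt_pos hx)

theorem differentiableAt_comp {F : M → K} {x : M} (hx : x ∈ P.W)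
    (hF : ContMDiffAt (𝓡 m) 𝓘(ℝ, K) ∞ F x) :
    DifferentiableAt ℝ (F ∘ (P.ch x).symm) (P.pos x) :=
  (contDiffAt_comp hx hF).differentiableAt (by simp)

theorem pd_smooth (a : Fin m) {F : M → K} {x : M} (hx : x ∈ P.W)
    (hF : ContMDiffAt (𝓡 m) 𝓘(ℝ, K) ∞ F x) : ContMDiffAt (𝓡 m) 𝓘(ℝ, K) ∞ (P.pd a F) x := by
  have h1 : ContDiffAt ℝ ∞ (fun v => fderiv ℝ (F ∘ (P.ch x).symm) v (EuclideanSpace.single a 1))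
      (P.pos x) :=
    ((contDiffAt_comp hx hF).fderiv_right (m := ∞) (by simp)).clm_apply contDiffAt_const
  refine (contMDiffAt_comp_pos hx h1).congr_of_eventuallyEq ?_
  filter_upwards [eventually_ch_eq hx] with y hy
  rw [pd, hy.2]

theorem pd_congr (a : Fin m) {F F' : M → K} {x : M} (hx : x ∈ P.W) (h : F =ᶠ[nhds x] F') :
    P.pd a F x = P.pd a F' x := by
  have : F ∘ (P.ch x).symm =ᶠ[nhds (P.pos x)] F' ∘ (P.ch x).symm := (tendsto_symm hx).eventually h
  rw [pd, pd, this.fderiv_eq]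

theorem pd_const (a : Fin m) (z : K) (x : M) : P.pd a (fun _ => z) x = 0 := by
  have : (fun _ : M => z) ∘ (P.ch x).symm = fun _ => z := rfl
  rw [pd, this]
  simp

theorem pd_add (a : Fin m) {F F' : M → K} {x : M} (hx : x ∈ P.W)
    (hF : ContMDiffAt (𝓡 m) 𝓘(ℝ, K) ∞ F x) (hF' : ContMDiffAt (𝓡 m) 𝓘(ℝ, K) ∞ F' x) :
    P.pd a (fun y => F y + F' y) x = P.pd a F x + P.pd a F' x := by
  have h := fderiv_fun_add (differentiableAt_comp hx hF) (differentiableAt_comp hx hF')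
  exact DFunLike.congr_fun h _

theorem pd_mul (a : Fin m) {F F' : M → K} {x : M} (hx : x ∈ P.W)
    (hF : ContMDiffAt (𝓡 m) 𝓘(ℝ, K) ∞ F x) (hF' : ContMDiffAt (𝓡 m) 𝓘(ℝ, K) ∞ F' x) :
    P.pd a (fun y => F y * F' y) x = P.pd a F x * F' x + F x * P.pd a F' x := by
  have h := fderiv_fun_mul (differentiableAt_comp hx hF) (differentiableAt_comp hx hF')
  refine (DFunLike.congr_fun h _).trans ?_
  simp only [Function.comp_apply, ch_symm_pos hx, add_apply, smul_apply, smul_eq_mul]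
  rw [pd, pd]
  ring

theorem pd_const_mul (a : Fin m) (z : K) {F : M → K} {x : M} (hx : x ∈ P.W)
    (hF : ContMDiffAt (𝓡 m) 𝓘(ℝ, K) ∞ F x) : P.pd a (fun y => z * F y) x = z * P.pd a F x := by
  rw [pd_mul a hx contMDiffAt_const hF, pd_const, zero_mul, zero_add]

theorem pd_sum {ι : Type*} (a : Fin m) (s : Finset ι) {F : ι → M → K} {x : M} (hx : x ∈ P.W)
    (hF : ∀ i ∈ s, ContMDiffAt (𝓡 m) 𝓘(ℝ, K) ∞ (F i) x) :
    P.pd a (fun y => ∑ i ∈ s, F i y) x = ∑ i ∈ s, P.pd a (F i) x := by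
  have h := fderiv_fun_sum fun i hi => differentiableAt_comp hx (hF i hi)
  refine (DFunLike.congr_fun h _).trans ?_
  rw [sum_apply]
  rfl

theorem smooth_mul {F F' : M → K} {x : M} (hF : ContMDiffAt (𝓡 m) 𝓘(ℝ, K) ∞ F x)
    (hF' : ContMDiffAt (𝓡 m) 𝓘(ℝ, K) ∞ F' x) :
    ContMDiffAt (𝓡 m) 𝓘(ℝ, K) ∞ (fun y => F y * F' y) x :=
  (contDiff_mul (𝕜 := ℝ) (𝔸 := K) (n := ∞)).contMDiff.contMDiffAt.comp x (hF.prodMk_space hF')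

theorem pd_idxMul (a : Fin m) {r : ℕ} (d : Fin r → ℤ) {F F' : (Fin r →₀ ℕ) → M → K} {x : M}
    (hx : x ∈ P.W) (hF : ∀ b, ContMDiffAt (𝓡 m) 𝓘(ℝ, K) ∞ (F b) x)
    (hF' : ∀ b, ContMDiffAt (𝓡 m) 𝓘(ℝ, K) ∞ (F' b) x) (b : Fin r →₀ ℕ) :
    P.pd a (fun y => idxMul d (fun b => F b y) (fun b => F' b y) b) x =
      idxMul d (fun b => P.pd a (F b) x) (fun b => F' b x) b +
        idxMul d (fun b => F b x) (fun b => P.pd a (F' b) x) b := by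
  simp only [idxMul]
  rw [pd_sum a _ hx fun t _ => smooth_mul contMDiffAt_const (smooth_mul (hF _) (hF' _)),
    ← Finset.sum_add_distrib]
  refine Finset.sum_congr rfl fun t _ => ?_
  rw [pd_const_mul a _ hx (smooth_mul (hF _) (hF' _)), pd_mul a hx (hF _) (hF' _)]
  ring

/-- A coordinate as a `K`-valued function. -/
theorem pos_smooth (a : Fin m) {x : M} (hx : x ∈ P.W) :
    ContMDiffAt (𝓡 m) 𝓘(ℝ, K) ∞ (fun y => ((P.pos y a : ℝ) : K)) x :=
  contMDiffAt_comp_pos (H := fun v => ((v a : ℝ) : K)) hx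
    (((RCLike.ofRealCLM (K := K)).contDiff.comp (by fun_prop)).contDiffAt)

theorem pd_pos (a a' : Fin m) {x : M} (hx : x ∈ P.W) :
    P.pd a (fun y => ((P.pos y a' : ℝ) : K)) x = if a = a' then 1 else 0 := by
  have h1 : (fun y => ((P.pos y a' : ℝ) : K)) ∘ (P.ch x).symm =ᶠ[nhds (P.pos x)]
      fun v => RCLike.ofRealCLM (K := K) (EuclideanSpace.proj a' v) := by
    filter_upwards [(tendsto_symm hx).eventually (eventually_ch_eq hx),
      (P.ch x).open_target.mem_nhds ((P.ch x).map_source (mem_ch_source hx))] with v hv hv'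
    rw [Function.comp_apply, pos, hv.2, (P.ch x).right_inv hv']
    rfl
  rw [pd, h1.fderiv_eq]
  have h2 : HasFDerivAt (fun v => RCLike.ofRealCLM (K := K) (EuclideanSpace.proj a' v))
      ((RCLike.ofRealCLM (K := K)).comp (EuclideanSpace.proj (𝕜 := ℝ) a')) (P.pos x) :=
    ((RCLike.ofRealCLM (K := K)).comp (EuclideanSpace.proj (𝕜 := ℝ) a')).hasFDerivAt
  rw [h2.fderiv]
  change (((EuclideanSpace.single a (1 : ℝ) : EuclideanSpace ℝ (Fin m)) a' : ℝ) : K) = _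
  rw [PiLp.single_apply]
  by_cases h : a = a'
  · simp [h]
  · simp [h, Ne.symm h]

end Patch

end PartialDerivative

/-! ### Cutoff functions -/

section Cutoff

variable {K : Type} [RCLike K] {m : ℕ} {M : Type u} [TopologicalSpace M]
  [ChartedSpace (EuclideanSpace ℝ (Fin m)) M] {G : GradedManifold K m M}

theorem smooth_ofReal {φ : M → ℝ} (h : ContMDiff (𝓡 m) 𝓘(ℝ) ∞ φ) :
    ContMDiff (𝓡 m) 𝓘(ℝ, K) ∞ fun x => (φ x : K) :=
  (RCLike.ofRealCLM (K := K)).contDiff.contMDiff.comp h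

theorem sm_sub_one_vanishesAt {φ : M → K} (hφ : ContMDiff (𝓡 m) 𝓘(ℝ, K) ∞ φ) {x : M}
    (h : ∀ᶠ y in nhds x, φ y = 1) : VanishesAt (G.sm φ hφ - 1) x := by
  obtain ⟨V, hV, hVo, hxV⟩ := eventually_nhds_iff.1 h
  refine ⟨⟨V, hVo⟩, hxV, ?_⟩
  have := G.ofFn_res ⊤ ⟨V, hVo⟩ le_top
    ⟨fun x => φ x.1, fun x => contMDiffAt_subtype_iff.2 (hφ x.1)⟩ 1 fun x => (hV x.1 x.2).symm
  rw [map_one] at this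
  rw [map_sub, map_one, sub_eq_zero]
  exact this

variable [T2Space M] [SecondCountableTopology M] [IsManifold (𝓡 m) ∞ M]

theorem exists_cutoff (K : Type) [RCLike K] {Z V : Set M} (hZ : IsClosed Z) (hV : IsOpen V)
    (h : Z ⊆ V) : ∃ φ : M → K, ContMDiff (𝓡 m) 𝓘(ℝ, K) ∞ φ ∧ tsupport φ ⊆ V ∧
      ∀ x ∈ Z, ∀ᶠ y in nhds x, φ y = 1 := by
  have := ChartedSpace.locallyCompactSpace (EuclideanSpace ℝ (Fin m)) M
  obtain ⟨φ, h0, h1, -⟩ := exists_contMDiffMap_zero_one_nhds_of_isClosed (𝓡 m) (n := ⊤)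
    hV.isClosed_compl hZ (Set.disjoint_compl_left_iff_subset.2 h)
  refine ⟨fun x => (φ x : K), smooth_ofReal φ.contMDiff, fun x hx => ?_, fun x hx => ?_⟩
  · by_contra hxV
    refine notMem_tsupport_iff_eventuallyEq.2 ?_ hx
    filter_upwards [eventually_nhdsSet_iff_forall.1 h0 x hxV] with y hy
    simp [hy]
  · filter_upwards [eventually_nhdsSet_iff_forall.1 h1 x hx] with y hy
    simp [hy]

end Cutoff



/-! ### Derivations of the algebra of functions -/

section Derivations

variable {K : Type} [RCLike K] {m : ℕ} {M : Type u} [TopologicalSpace M]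
  [ChartedSpace (EuclideanSpace ℝ (Fin m)) M] {G : GradedManifold K m M}

theorem der_one {p : ZMod 2} {D : Module.End K G.Fn} (hD : D ∈ derPar G.gr p)
    (h1 : (1 : G.Fn) ∈ par G.gr 0) : D 1 = 0 := by
  have h := hD.2 0 1 h1 1
  rw [mul_zero, uzpow_zero, one_smul, mul_one, mul_one, one_mul] at h
  simpa using h

namespace Patch

variable {P : Patch G}

/-- Operators that are given by their action on coefficients. -/
theorem exists_op {ρ : M → K} (hρ : ContMDiff (𝓡 m) 𝓘(ℝ, K) ∞ ρ) (hs : tsupport ρ ⊆ P.W)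
    (T : G.Fn → (Fin G.rank →₀ ℕ) → M → K)
    (hadd : ∀ f g b, ∀ x ∈ P.W, T (f + g) b x = T f b x + T g b x)
    (hsmul : ∀ (z : K) f b, ∀ x ∈ P.W, T (z • f) b x = z * T f b x)
    (hT : ∀ f b, ∀ x ∈ P.W, ContMDiffAt (𝓡 m) 𝓘(ℝ, K) ∞ (T f b) x)
    (hTa : ∀ f b, ¬ Admissible G.deg b → ∀ x ∈ P.W, T f b x = 0) :
    ∃ D : Module.End K G.Fn, (∀ f b, ∀ x ∈ P.W, P.cf b (D f) x = ρ x * T f b x) ∧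
      ∀ f, ∀ x ∉ tsupport ρ, VanishesAt (D f) x := by
  have h0 : ∀ x ∉ tsupport ρ, ρ x = 0 := fun x hx => image_eq_zero_of_notMem_tsupport hx
  choose D hD hDZ using fun f => exists_section (P := P) (isClosed_tsupport ρ) hs
    (fun b x => ρ x * T f b x) (fun b x hx => smooth_mul (hρ x) (hT f b x hx))
    (fun b x _ hx => by rw [h0 x hx, zero_mul])
    (fun b hb x hx => by rw [hTa f b hb x hx, mul_zero])
  refine ⟨{ toFun := D, map_add' := fun f g => ?_, map_smul' := fun z f => ?_ }, hD, hDZ⟩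
  · refine eq_of_cf hs (hDZ _) (fun x hx => (hDZ f x hx).add (hDZ g x hx)) fun b x hx => ?_
    rw [map_add, Pi.add_apply, hD _ _ _ hx, hD _ _ _ hx, hD _ _ _ hx, hadd _ _ _ _ hx, mul_add]
  · refine eq_of_cf hs (hDZ _) (fun x hx => (hDZ f x hx).smul z) fun b x hx => ?_
    rw [RingHom.id_apply, map_smul, Pi.smul_apply, hD _ _ _ hx, hD _ _ _ hx, hsmul _ _ _ _ hx,
      smul_eq_mul]
    ring

theorem op_mem_derPar {ρ : M → K} (hs : tsupport ρ ⊆ P.W) {p : ZMod 2}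
    {T : G.Fn → (Fin G.rank →₀ ℕ) → M → K} {D : Module.End K G.Fn}
    (hD : ∀ f b, ∀ x ∈ P.W, P.cf b (D f) x = ρ x * T f b x)
    (hDZ : ∀ f, ∀ x ∉ tsupport ρ, VanishesAt (D f) x)
    (hpar : ∀ q, ∀ f ∈ par G.gr q, ∀ b, idxPar G.deg b ≠ p + q → ∀ x ∈ P.W, T f b x = 0)
    (hmul : ∀ q, ∀ f ∈ par G.gr q, ∀ g b, Admissible G.deg b → ∀ x ∈ P.W, T (f * g) b x =
      idxMul G.deg (fun a => T f a x) (fun a => P.cf a g x) b +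
        sgn K (p * q) * idxMul G.deg (fun a => P.cf a f x) (fun a => T g a x) b) :
    D ∈ derPar G.gr p := by
  refine ⟨fun q f hf => ?_, fun q f hf g => ?_⟩
  · refine mem_par_of_cf hs (hDZ f) fun b hb x hx => ?_
    rw [hD _ _ _ hx, hpar q f hf b hb x hx, mul_zero]
  · rw [sgn_smul (K := K)]
    refine eq_of_cf hs (hDZ _) (fun x hx => ((hDZ f x hx).mul_right g).add
      (((hDZ g x hx).mul_left f).smul _)) fun b x hx => ?_
    by_cases hb : Admissible G.deg b
    · rw [hD _ _ _ hx, hmul q f hf g b hb x hx, map_add, map_smul, Pi.add_apply, Pi.smul_apply,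
        cf_mul hb _ _ hx, cf_mul hb _ _ hx]
      simp only [hD _ _ _ hx, idxMul_const_left, idxMul_const_right, smul_eq_mul]
      ring
    · rw [cf_eq_zero hb _ hx, cf_eq_zero hb _ hx]

end Patch

variable [T2Space M] [SecondCountableTopology M] [IsManifold (𝓡 m) ∞ M]

/-- Derivations are local: for a cutoff φ that equals 1 near x with φ f = 0, the Leibniz rule gives
φ D(f) = -D(φ) f, which vanishes near x together with f. -/
theorem VanishesAt.der {p : ZMod 2} {D : Module.End K G.Fn} (hD : D ∈ derPar G.gr p)
    (hsm : ∀ φ (hφ : ContMDiff (𝓡 m) 𝓘(ℝ, K) ∞ φ), G.sm φ hφ ∈ par G.gr 0) {f : G.Fn} {x : M}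
    (hf : VanishesAt f x) : VanishesAt (D f) x := by
  obtain ⟨V, hxV, hV⟩ := hf
  obtain ⟨φ, hφ, hs, h1⟩ := exists_cutoff (m := m) K (isClosed_singleton (x := x)) V.2
    (Set.singleton_subset_iff.2 hxV)
  have h0 : G.sm φ hφ * f = 0 := by
    refine VanishesAt.eq_zero fun y => ?_
    by_cases hy : y ∈ V
    · exact (vanishesAt_of_resT hV hy).mul_left _
    · refine VanishesAt.mul_right _ (sm_vanishesAt hφ
        (V := ⟨(tsupport φ)ᶜ, (isClosed_tsupport φ).isOpen_compl⟩) (fun z hz => ?_)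
        (fun hy' => hy (hs hy')))
      exact image_eq_zero_of_notMem_tsupport hz
  have h2 := hD.2 0 _ (hsm φ hφ) f
  rw [h0, map_zero, mul_zero, uzpow_zero, one_smul] at h2
  have h3 : D f = -(D (G.sm φ hφ) * f) - (G.sm φ hφ - 1) * D f := by
    rw [sub_mul, one_mul, eq_neg_of_add_eq_zero_right h2.symm]
    abel
  rw [h3, ← neg_one_smul K]
  exact (((vanishesAt_of_resT hV hxV).mul_left _).smul _).sub
    ((sm_sub_one_vanishesAt hφ (h1 x rfl)).mul_right _)

namespace Patch

variable {P : Patch G}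

variable (P) in
/-- Near `x`, the functions `g` are the coordinates. -/
structure IsCoord (g : Fin m ⊕ Fin G.rank → G.Fn) (x : M) : Prop where
  even : ∀ a, ∀ᶠ y in nhds x, ∀ b,
    P.cf b (g (.inl a)) y = if b = 0 then ((P.pos y a : ℝ) : K) else 0
  graded : ∀ j, ∀ᶠ y in nhds x, ∀ b, P.cf b (g (.inr j)) y = if b = idx j then 1 else 0

/-- The parity of a coordinate. -/
def coordPar (G : GradedManifold K m M) : Fin m ⊕ Fin G.rank → ZMod 2 :=
  Sum.elim (fun _ => 0) fun j => (G.deg j : ZMod 2)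

/-- Hadamard's lemma for functions on a graded manifold. -/
theorem exists_decomp {g : Fin m ⊕ Fin G.rank → G.Fn} {x : M} (hx : x ∈ P.W) (hg : P.IsCoord g x)
    (f : G.Fn) : ∃ h : Fin m ⊕ Fin G.rank → G.Fn,
      VanishesAt (f - (P.cf 0 f x • (1 : G.Fn) +
        (∑ a, (g (.inl a) - ((P.pos x a : ℝ) : K) • (1 : G.Fn)) * h (.inl a) +
          ∑ j, g (.inr j) * h (.inr j)))) x := by
  obtain ⟨φ, hφ, hs, h1⟩ := exists_cutoff (m := m) K (isClosed_singleton (x := x)) P.isOpen_W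
    (Set.singleton_subset_iff.2 hx)
  have hφ0 : ∀ y ∉ tsupport φ, φ y = 0 := fun y hy => image_eq_zero_of_notMem_tsupport hy
  -- The coefficient at multi-index 0 is expanded by the classical Hadamard lemma in the chart; all
  -- other coefficients are divided by a graded coordinate through `idxQuot`.
  obtain ⟨H, hH, hfH⟩ := exists_hadamard_of_contDiffAt (v₀ := P.pos x)
    (F := P.cf 0 f ∘ (P.ch x).symm) (by
      have h2 : ∀ᶠ y in nhds x, ContDiffAt ℝ ∞ (P.cf 0 f ∘ (P.ch x).symm) (P.ch x y) := by
        filter_upwards [eventually_ch_eq hx] with y hy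
        have := contDiffAt_comp hy.1 (cf_smooth 0 f hy.1)
        rwa [pos, hy.2] at this
      have h3 := (tendsto_symm hx).eventually h2
      filter_upwards [h3, (P.ch x).open_target.mem_nhds
        ((P.ch x).map_source (mem_ch_source hx))] with v hv hv'
      rwa [(P.ch x).right_inv hv'] at hv)
  have hf0 : ∀ᶠ y in nhds x, P.cf 0 f y = P.cf 0 f x +
      ∑ a, ((P.pos y a - P.pos x a : ℝ) : K) * H a (P.pos y) := by
    have h4 := ((P.ch x).continuousAt (mem_ch_source hx)).eventually hfH
    filter_upwards [h4, eventually_ch_eq hx] with y hy hy'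
    rw [Function.comp_apply, Function.comp_apply, ch_symm_pos hx, ← hy'.2] at hy
    have h5 : (P.ch y).symm (P.ch y y) = y := ch_symm_pos hy'.1
    rwa [h5] at hy
  have hxa : ∀ a, ∃ h : G.Fn, ∀ b, ∀ y ∈ P.W,
      P.cf b h y = φ y * if b = 0 then H a (P.pos y) else 0 := fun a => by
    obtain ⟨h, hh, -⟩ := exists_section (P := P) (isClosed_tsupport φ) hs
      (fun b y => φ y * if b = 0 then H a (P.pos y) else 0) (fun b y hy => by
        refine smooth_mul (hφ y) ?_
        split_ifs
        · exact contMDiffAt_comp_pos hy (hH a).contDiffAt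
        · exact contMDiffAt_const) (fun b y _ hy => by rw [hφ0 y hy, zero_mul])
      (fun b hb y hy => by
        rw [if_neg, mul_zero]
        rintro rfl
        exact hb fun i _ => by simp)
    exact ⟨h, hh⟩
  have hxj : ∀ j, ∃ h : G.Fn, ∀ b, ∀ y ∈ P.W,
      P.cf b h y = φ y * idxQuot j (fun b => P.cf b f y) b := fun j => by
    obtain ⟨h, hh, -⟩ := exists_section (P := P) (isClosed_tsupport φ) hs
      (fun b y => φ y * idxQuot j (fun b => P.cf b f y) b) (fun b y hy => by
        refine smooth_mul (hφ y) ?_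
        unfold idxQuot
        split_ifs
        · exact cf_smooth _ _ hy
        · exact contMDiffAt_const) (fun b y _ hy => by rw [hφ0 y hy, zero_mul])
      (fun b hb y hy => by
        unfold idxQuot
        split_ifs
        · exact mul_eq_zero_of_right _ (cf_eq_zero (fun h' => hb (Admissible.mono _ h')) _ hy)
        · rw [mul_zero])
    exact ⟨h, hh⟩
  choose ha hha using hxa
  choose hj hhj using hxj
  refine ⟨Sum.elim ha hj, vanishesAt_of_cf hx ?_⟩
  filter_upwards [hf0, h1 x rfl, P.isOpen_W.mem_nhds hx, Filter.eventually_all.2 hg.even,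
    Filter.eventually_all.2 hg.graded] with y hy0 hy1 hyW hya hyj b
  by_cases hb : Admissible G.deg b
  · have e1 : ∀ a, P.cf b ((g (.inl a) - ((P.pos x a : ℝ) : K) • (1 : G.Fn)) * ha a) y =
        if b = 0 then ((P.pos y a - P.pos x a : ℝ) : K) * H a (P.pos y) else 0 := fun a => by
      rw [cf_mul hb _ _ hyW]
      have : (fun b => P.cf b (g (.inl a) - ((P.pos x a : ℝ) : K) • (1 : G.Fn)) y) =
          fun b => if b = 0 then ((P.pos y a - P.pos x a : ℝ) : K) else 0 := by
        ext b
        rw [map_sub, map_smul, Pi.sub_apply, Pi.smul_apply, hya, cf_one _ hyW]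
        split_ifs <;> simp
      rw [this, idxMul_zero, hha a _ _ hyW, hy1, one_mul, mul_ite, mul_zero]
    have e2 : ∀ j, P.cf b (g (.inr j) * hj j) y =
        idxMul G.deg (fun a' => if a' = idx j then 1 else 0)
          (idxQuot j fun b => P.cf b f y) b := fun j => by
      rw [cf_mul hb _ _ hyW]
      simp only [hyj, hhj _ _ _ hyW, hy1, one_mul]
    simp only [map_sub, map_add, map_smul, map_sum, Pi.sub_apply, Pi.add_apply, Pi.smul_apply,
      Finset.sum_apply, Sum.elim_inl, Sum.elim_inr, e1, e2, cf_one _ hyW, sum_idxMul_idxQuot]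
    split_ifs with hb0
    · subst hb0
      rw [hy0, smul_eq_mul, mul_one]
      simp only [map_sub]
      abel
    · simp
  · exact cf_eq_zero hb _ hyW

/-- Apply D to the decomposition of f at x. Constants and coordinates are killed, the terms with a
base coordinate keep a factor vanishing at x, and ξⱼ D(hⱼ) involves only a coefficient of D(hⱼ) of
smaller degree, so induction on the degree of b applies. -/
theorem cf_der_eq_zero {g : Fin m ⊕ Fin G.rank → G.Fn} {x : M} (hx : x ∈ P.W)
    (hg : P.IsCoord g x) (hgp : ∀ i, g i ∈ par G.gr (coordPar G i)) {p : ZMod 2}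
    {D : Module.End K G.Fn} (hD : D ∈ derPar G.gr p)
    (hsm : ∀ φ (hφ : ContMDiff (𝓡 m) 𝓘(ℝ, K) ∞ φ), G.sm φ hφ ∈ par G.gr 0)
    (h1 : (1 : G.Fn) ∈ par G.gr 0) (hDg : ∀ i, D (g i) = 0) (b : Fin G.rank →₀ ℕ) (f : G.Fn) :
    P.cf b (D f) x = 0 := by
  obtain ⟨n, hn⟩ : ∃ n, b.degree = n := ⟨_, rfl⟩
  induction n using Nat.strong_induction_on generalizing b f with
  | _ n ih =>
  by_cases hb : Admissible G.deg b
  swap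
  · exact cf_eq_zero hb _ hx
  obtain ⟨h, hv⟩ := exists_decomp hx hg f
  have h2 := cf_of_vanishesAt hx (hv.der hD hsm) b
  have e0 : ∀ a, D ((g (.inl a) - ((P.pos x a : ℝ) : K) • (1 : G.Fn)) * h (.inl a)) =
      (g (.inl a) - ((P.pos x a : ℝ) : K) • (1 : G.Fn)) * D (h (.inl a)) := fun a => by
    rw [hD.2 0 _ (sub_mem (hgp (.inl a)) (Submodule.smul_mem _ _ h1)), map_sub, map_smul, hDg,
      der_one hD h1, smul_zero, sub_zero, zero_mul, zero_add, mul_zero, uzpow_zero, one_smul]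
  have e1 : ∀ a, P.cf b (D ((g (.inl a) - ((P.pos x a : ℝ) : K) • (1 : G.Fn)) * h (.inl a))) x =
      0 := fun a => by
    rw [e0, cf_mul hb _ _ hx]
    have : (fun b => P.cf b (g (.inl a) - ((P.pos x a : ℝ) : K) • (1 : G.Fn)) x) =
        fun b => if b = 0 then 0 else 0 := by
      ext b
      rw [map_sub, map_smul, Pi.sub_apply, Pi.smul_apply, (hg.even a).self_of_nhds,
        cf_one _ hx]
      split_ifs <;> simp
    rw [this, idxMul_zero, zero_mul]
  have e2 : ∀ j, P.cf b (D (g (.inr j) * h (.inr j))) x = 0 := fun j => by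
    rw [hD.2 _ _ (hgp (.inr j)), hDg, zero_mul, zero_add, sgn_smul (K := K), map_smul,
      Pi.smul_apply, cf_mul hb _ _ hx]
    simp only [(hg.graded j).self_of_nhds, idxMul_idx]
    split_ifs with hbj
    · rw [ih (b - idx j).degree ?_ _ _ rfl, mul_zero, mul_zero, smul_zero]
      have := congrArg Finsupp.degree (tsub_add_cancel_of_le (idx_le.2 hbj))
      rw [map_add, Finsupp.degree_single, hn] at this
      omega
    · rw [smul_zero]
  simp only [map_sub, map_add, map_smul, map_sum, der_one hD h1, Pi.sub_apply, Pi.add_apply,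
    Pi.smul_apply, Finset.sum_apply, e1, e2] at h2
  simpa using h2

end Patch

end Derivations



/-! ### A finite dual basis of the module of vector fields -/

section DualBasis

variable {K : Type} [RCLike K] {m : ℕ} {M : Type u} [TopologicalSpace M]
  [ChartedSpace (EuclideanSpace ℝ (Fin m)) M] {G : GradedManifold K m M}

theorem admissible_idx {r : ℕ} (d : Fin r → ℤ) (j : Fin r) : Admissible d (idx j) := fun i _ => by
  rw [Finsupp.single_apply]
  split_ifs <;> simp

namespace Patch

variable {P : Patch G} {ρ : M → K}

/-- The partial derivative in the direction of an even coordinate of the base, cut off by `ρ`. -/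
theorem exists_pd (hρ : ContMDiff (𝓡 m) 𝓘(ℝ, K) ∞ ρ) (hs : tsupport ρ ⊆ P.W) (a : Fin m) :
    ∃ D ∈ derPar G.gr 0, (∀ f b, ∀ x ∈ P.W, P.cf b (D f) x = ρ x * P.pd a (P.cf b f) x) ∧
      ∀ f, ∀ x ∉ tsupport ρ, VanishesAt (D f) x := by
  have hzero : ∀ {F : M → K}, (∀ x ∈ P.W, F x = 0) → ∀ x ∈ P.W, P.pd a F x = 0 :=
    fun {F} hF x hx => by
      rw [pd_congr a hx (F' := fun _ => 0), pd_const]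
      filter_upwards [P.isOpen_W.mem_nhds hx] with y hy using hF y hy
  obtain ⟨D, hD, hDZ⟩ := exists_op hρ hs (fun f b => P.pd a (P.cf b f)) (fun f g b x hx => by
      rw [map_add]
      exact pd_add a hx (cf_smooth b f hx) (cf_smooth b g hx)) (fun z f b x hx => by
      rw [map_smul]
      exact pd_const_mul a z hx (cf_smooth b f hx))
    (fun f b x hx => pd_smooth a hx (cf_smooth b f hx))
    (fun f b hb => hzero fun x hx => cf_eq_zero hb f hx)
  refine ⟨D, op_mem_derPar hs hD hDZ (fun q f hf b hb => hzero fun x hx =>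
    cf_of_mem_par hf (by rwa [zero_add] at hb) hx) fun q f _ g b hb x hx => ?_, hD, hDZ⟩
  rw [zero_mul, sgn_zero, one_mul, ← pd_idxMul a G.deg hx (fun b => cf_smooth b f hx)
    fun b => cf_smooth b g hx]
  refine pd_congr a hx ?_
  filter_upwards [P.isOpen_W.mem_nhds hx] with y hy using cf_mul hb f g hy

/-- The derivative in the direction of a graded coordinate, cut off by `ρ`. -/
theorem exists_idxDer (hρ : ContMDiff (𝓡 m) 𝓘(ℝ, K) ∞ ρ) (hs : tsupport ρ ⊆ P.W)
    (j : Fin G.rank) : ∃ D ∈ derPar G.gr (G.deg j : ZMod 2), (∀ f b, ∀ x ∈ P.W,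
      P.cf b (D f) x = ρ x * idxDer G.deg j (fun b => P.cf b f x) b) ∧
      ∀ f, ∀ x ∉ tsupport ρ, VanishesAt (D f) x := by
  obtain ⟨D, hD, hDZ⟩ := exists_op hρ hs
    (fun f b x => idxDer G.deg j (fun b => P.cf b f x) b) (fun f g b x hx => by
      simp only [idxDer, map_add, Pi.add_apply]
      ring) (fun z f b x hx => by
      simp only [idxDer, map_smul, Pi.smul_apply, smul_eq_mul]
      ring)
    (fun f b x hx => smooth_mul contMDiffAt_const
      (smooth_mul contMDiffAt_const (cf_smooth _ f hx)))
    (fun f b hb x hx => by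
      rw [idxDer, cf_eq_zero (fun h => hb (Admissible.mono _ h)) f hx, mul_zero, mul_zero])
  refine ⟨D, op_mem_derPar hs hD hDZ (fun q f hf b hb x hx => ?_)
    (fun q f hf g b hb x hx => ?_), hD, hDZ⟩
  · rw [idxDer, cf_of_mem_par hf (fun h => hb ?_) hx, mul_zero, mul_zero]
    rw [idxPar_add, idxPar_idx] at h
    have e : ∀ x y z : ZMod 2, x + y = z → x = y + z := by decide
    exact e _ _ _ h
  · exact idxDer_mul G.deg j (fun a ha => cf_of_mem_par hf ha hx)
      (fun a ha => cf_eq_zero ha f hx) (fun a ha => cf_eq_zero ha g hx)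
      (fun a ha => cf_eq_zero ha (f * g) hx) (fun a ha => cf_mul ha f g hx) hb

variable [T2Space M] [SecondCountableTopology M] [IsManifold (𝓡 m) ∞ M]

/-- Global functions that are the coordinates near a closed subset of `P.W`. -/
theorem exists_coord {Z : Set M} (hZ : IsClosed Z) (hZW : Z ⊆ P.W) :
    ∃ g : Fin m ⊕ Fin G.rank → G.Fn, (∀ i, g i ∈ par G.gr (coordPar G i)) ∧
      ∀ x ∈ Z, P.IsCoord g x := by
  obtain ⟨χ, hχ, hs, h1⟩ := exists_cutoff (m := m) K hZ P.isOpen_W hZW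
  have hχ0 : ∀ y ∉ tsupport χ, χ y = 0 := fun y hy => image_eq_zero_of_notMem_tsupport hy
  have ha : ∀ a, ∃ g ∈ par G.gr 0, ∀ b, ∀ y ∈ P.W,
      P.cf b g y = χ y * if b = 0 then ((P.pos y a : ℝ) : K) else 0 := fun a => by
    obtain ⟨g, hg, hgZ⟩ := exists_section (P := P) (isClosed_tsupport χ) hs
      (fun b y => χ y * if b = 0 then ((P.pos y a : ℝ) : K) else 0) (fun b y hy => by
        refine smooth_mul (hχ y) ?_
        split_ifs
        · exact pos_smooth a hy
        · exact contMDiffAt_const) (fun b y _ hy => by rw [hχ0 y hy, zero_mul])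
      (fun b hb y hy => by
        rw [if_neg, mul_zero]
        rintro rfl
        exact hb fun i _ => by simp)
    refine ⟨g, mem_par_of_cf hs hgZ fun b hb x hx => ?_, hg⟩
    rw [hg _ _ hx, if_neg, mul_zero]
    rintro rfl
    exact hb (by simp [idxPar])
  have hj : ∀ j, ∃ g ∈ par G.gr (G.deg j : ZMod 2), ∀ b, ∀ y ∈ P.W,
      P.cf b g y = χ y * if b = idx j then 1 else 0 := fun j => by
    obtain ⟨g, hg, hgZ⟩ := exists_section (P := P) (isClosed_tsupport χ) hs
      (fun b y => χ y * if b = idx j then 1 else 0)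
      (fun b y hy => smooth_mul (hχ y) contMDiffAt_const)
      (fun b y _ hy => by rw [hχ0 y hy, zero_mul])
      (fun b hb y hy => by
        rw [if_neg, mul_zero]
        rintro rfl
        exact hb (admissible_idx _ _))
    refine ⟨g, mem_par_of_cf hs hgZ fun b hb x hx => ?_, hg⟩
    rw [hg _ _ hx, if_neg, mul_zero]
    rintro rfl
    exact hb (idxPar_idx _ _)
  choose ga hga hga' using ha
  choose gj hgj hgj' using hj
  refine ⟨Sum.elim ga gj, ?_, fun x hx => ⟨fun a => ?_, fun j => ?_⟩⟩
  · rintro (a | j)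
    · exact hga a
    · exact hgj j
  · filter_upwards [h1 x hx, P.isOpen_W.mem_nhds (hZW hx)] with y hy hyW b
    rw [Sum.elim_inl, hga' _ _ _ hyW, hy, one_mul]
  · filter_upwards [h1 x hx, P.isOpen_W.mem_nhds (hZW hx)] with y hy hyW b
    rw [Sum.elim_inr, hgj' _ _ _ hyW, hy, one_mul]

/-- The derivation ρ X - ∑ X(gᵢ) Yᵢ kills every gₖ because Yᵢ gₖ = δᵢₖ ρ. On the support of ρ the gₖ
are coordinates, so `cf_der_eq_zero` makes all coefficients of its values vanish; off the support
every term is locally zero. -/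
theorem exists_dual_basis (hρ : ContMDiff (𝓡 m) 𝓘(ℝ, K) ∞ ρ) (hs : tsupport ρ ⊆ P.W)
    (comm : ∀ (p q : ZMod 2) (f g : G.Fn), f ∈ par G.gr p → g ∈ par G.gr q →
      f * g = sgn K (p * q) • (g * f))
    (mul_mem : ∀ (p q : ZMod 2) (f g : G.Fn), f ∈ par G.gr p → g ∈ par G.gr q →
      f * g ∈ par G.gr (p + q))
    (hsm : ∀ φ (hφ : ContMDiff (𝓡 m) 𝓘(ℝ, K) ∞ φ), G.sm φ hφ ∈ par G.gr 0)
    (h1 : (1 : G.Fn) ∈ par G.gr 0) :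
    ∃ (g : Fin m ⊕ Fin G.rank → G.Fn) (Y : Fin m ⊕ Fin G.rank → Module.End K G.Fn),
      (∀ i, g i ∈ par G.gr (coordPar G i)) ∧ (∀ i, Y i ∈ derPar G.gr (coordPar G i)) ∧
        ∀ p, ∀ X ∈ derPar G.gr p, ∀ f, G.sm ρ hρ * X f = ∑ i, X (g i) * Y i f := by
  obtain ⟨g, hgp, hg⟩ := exists_coord (P := P) (isClosed_tsupport ρ) hs
  choose Ya hYa hYa' hYaZ using exists_pd (P := P) hρ hs
  choose Yj hYj hYj' hYjZ using exists_idxDer (P := P) hρ hs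
  have hsmZ : ∀ x ∉ tsupport ρ, VanishesAt (G.sm ρ hρ) x := fun x hx =>
    sm_vanishesAt hρ (V := ⟨(tsupport ρ)ᶜ, (isClosed_tsupport ρ).isOpen_compl⟩)
      (fun z hz => image_eq_zero_of_notMem_tsupport hz) hx
  let Y : Fin m ⊕ Fin G.rank → Module.End K G.Fn := Sum.elim Ya Yj
  have hYp : ∀ i, Y i ∈ derPar G.gr (coordPar G i) := by
    rintro (a | j)
    · exact hYa a
    · exact hYj j
  have hYZ : ∀ i f, ∀ x ∉ tsupport ρ, VanishesAt (Y i f) x := by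
    rintro (a | j)
    · exact hYaZ a
    · exact hYjZ j
  -- Near the support of ρ the functions gₖ are exactly the coordinates, so their partial
  -- derivatives are Kronecker symbols; elsewhere the cutoff removes both sides.
  have hYg : ∀ i k, Y i (g k) = if i = k then G.sm ρ hρ else 0 := fun i k => by
    refine eq_of_cf hs (hYZ i _) (fun x hx => ?_) fun b x hx => ?_
    · split_ifs
      · exact hsmZ x hx
      · exact vanishesAt_zero x
    have e1 : P.cf b (if i = k then G.sm ρ hρ else 0) x =
        ρ x * if i = k ∧ b = 0 then 1 else 0 := by
      by_cases hik : i = k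
      · simp only [hik, if_true, cf_sm _ _ hx, true_and, mul_ite, mul_one, mul_zero]
      · simp only [hik, if_false, map_zero, false_and, mul_zero, Pi.zero_apply]
    rw [e1]
    by_cases hxZ : x ∈ tsupport ρ
    swap
    · rw [cf_of_vanishesAt hx (hYZ i _ x hxZ), image_eq_zero_of_notMem_tsupport hxZ, zero_mul]
    have hc := hg x hxZ
    rcases i with a | j
    · rw [show Y (.inl a) = Ya a from rfl, hYa' _ _ _ _ hx]
      congr 1
      rcases k with a' | j'
      · rw [pd_congr a hx (F' := fun y => if b = 0 then ((P.pos y a' : ℝ) : K) else 0)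
          ((hc.even a').mono fun y hy => hy b)]
        by_cases hb : b = 0
        · simp only [hb, if_true, and_true, pd_pos a a' hx, Sum.inl.injEq]
        · simp only [hb, if_false, and_false, pd_const]
      · rw [pd_congr a hx (F' := fun _ => if b = idx j' then 1 else 0)
          ((hc.graded j').mono fun y hy => hy b), pd_const]
        simp
    · rw [show Y (.inr j) = Yj j from rfl, hYj' _ _ _ _ hx]
      congr 1
      rcases k with a' | j'
      · have hne : b + idx j ≠ 0 := fun h => by
          have := DFunLike.congr_fun h j
          simp at this
        simp only [idxDer, (hc.even a').self_of_nhds, if_neg hne, mul_zero]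
        simp
      · simp only [idxDer, (hc.graded j').self_of_nhds, Sum.inr.injEq]
        by_cases hb : b = 0
        · subst hb
          have hinj : idx j = idx j' ↔ j = j' :=
            ⟨fun h => Finsupp.single_left_injective one_ne_zero h, fun h => by rw [h]⟩
          simp only [zero_add, hinj, and_true]
          simp [idxExp]
        · have hne : b + idx j ≠ idx j' := fun h => hb (by
            have := congrArg Finsupp.degree h
            rw [map_add, Finsupp.degree_single, Finsupp.degree_single] at this
            exact (Finsupp.degree_eq_zero_iff b).1 (by omega))
          rw [if_neg hne, if_neg fun h => hb h.2, mul_zero, mul_zero]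
  refine ⟨g, Y, hgp, hYp, fun p X hX f => ?_⟩
  have hsmul := fun {p q : ZMod 2} {f : G.Fn} {X : Module.End K G.Fn} =>
    smul_mem_derPar_of_comm (c := G.gr) comm mul_mem (p := p) (q := q) (f := f) (X := X)
  let D : Module.End K G.Fn := G.sm ρ hρ • X - ∑ i, X (g i) • Y i
  have hD : D ∈ derPar G.gr p := by
    refine sub_mem ?_ (sum_mem fun i _ => ?_)
    · have := hsmul (hsm ρ hρ) hX
      rwa [zero_add] at this
    · have := hsmul (hX.1 _ _ (hgp i)) (hYp i)
      rwa [add_assoc, zmod_add_self, add_zero] at this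
  have hDf : ∀ f, D f = G.sm ρ hρ * X f - ∑ i, X (g i) * Y i f := fun f => by
    simp only [D, LinearMap.sub_apply, LinearMap.smul_apply, LinearMap.sum_apply, smul_eq_mul]
  have hDg : ∀ i, D (g i) = 0 := fun k => by
    simp only [hDf, hYg, mul_ite, mul_zero, Finset.sum_ite_eq', Finset.mem_univ, if_true]
    rw [comm _ _ _ _ (hsm ρ hρ) (hX.1 _ _ (hgp k)), zero_mul, sgn_zero, one_smul, sub_self]
  have hDZ : ∀ x ∉ tsupport ρ, VanishesAt (D f) x := fun x hx => by
    rw [hDf]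
    exact ((hsmZ x hx).mul_right _).sub (VanishesAt.sum fun i _ => (hYZ i f x hx).mul_left _)
  have h0 : D f = 0 := eq_of_cf hs hDZ (fun x _ => vanishesAt_zero x) fun b x hx => by
    rw [map_zero]
    by_cases hxZ : x ∈ tsupport ρ
    · exact cf_der_eq_zero hx (hg x hxZ) hgp hD hsm h1 hDg b f
    · exact cf_of_vanishesAt hx (hDZ x hxZ) b
  rw [hDf, sub_eq_zero] at h0
  exact h0

end Patch

end DualBasis

/-! ### Existence of a frame -/

section ExistsFrame

variable {K : Type} [RCLike K] {m : ℕ} {M : Type u} [TopologicalSpace M]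
  [ChartedSpace (EuclideanSpace ℝ (Fin m)) M] {G : GradedManifold K m M} {C : Type*}

theorem Patch.ext_of_cover {P : C → Patch G} (hP : ∀ x, ∃ c, x ∈ (P c).W) {f g : G.Fn}
    (h : ∀ c b, ∀ x ∈ (P c).W, (P c).cf b f x = (P c).cf b g x) : f = g := by
  rw [← sub_eq_zero]
  refine VanishesAt.eq_zero fun x => ?_
  obtain ⟨c, hc⟩ := hP x
  refine vanishesAt_of_cf hc ?_
  filter_upwards [(P c).isOpen_W.mem_nhds hc] with y hy b
  rw [map_sub, Pi.sub_apply, h c b y hy, sub_self]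

theorem Patch.mem_par_of_cover {P : C → Patch G} (hP : ∀ x, ∃ c, x ∈ (P c).W) {p : ZMod 2}
    {f : G.Fn} (h : ∀ c b, idxPar G.deg b ≠ p → ∀ x ∈ (P c).W, (P c).cf b f x = 0) :
    f ∈ par G.gr p := by
  intro k hk
  refine Patch.ext_of_cover hP fun c b x hx => ?_
  rw [cf_comp _ _ _ hx, map_zero]
  split_ifs with hb
  · refine h c b (fun hp => hk ?_) x hx
    rw [← hp, ← hb, idxPar]
    push_cast
    rfl
  · rfl

/-- A function may have infinitely many homogeneous components, so its even and odd parts are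
defined by selecting coefficients. The cutoff makes these selections extend to global sections. -/
theorem Patch.mem_sup {P : Patch G} {ρ : M → K} (hρ : ContMDiff (𝓡 m) 𝓘(ℝ, K) ∞ ρ)
    (hs : tsupport ρ ⊆ P.W) (f : G.Fn) : G.sm ρ hρ * f ∈ par G.gr 0 ⊔ par G.gr 1 := by
  have h0 : ∀ x ∉ tsupport ρ, ρ x = 0 := fun x hx => image_eq_zero_of_notMem_tsupport hx
  have hpart : ∀ p : ZMod 2, ∃ g ∈ par G.gr p, (∀ b, ∀ x ∈ P.W,
      P.cf b g x = if idxPar G.deg b = p then ρ x * P.cf b f x else 0) ∧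
      ∀ x ∉ tsupport ρ, VanishesAt g x := fun p => by
    obtain ⟨g, hg, hgZ⟩ := exists_section (P := P) (isClosed_tsupport ρ) hs
      (fun b x => if idxPar G.deg b = p then ρ x * P.cf b f x else 0) (fun b x hx => by
        split_ifs
        · exact smooth_mul (hρ x) (cf_smooth b f hx)
        · exact contMDiffAt_const) (fun b x _ hx => by rw [h0 x hx, zero_mul, ite_self])
      (fun b hb x hx => by rw [cf_eq_zero hb f hx, mul_zero, ite_self])
    exact ⟨g, mem_par_of_cf hs hgZ fun b hb x hx => by rw [hg _ _ hx, if_neg hb], hg, hgZ⟩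
  obtain ⟨g0, hg0, hg0', hg0Z⟩ := hpart 0
  obtain ⟨g1, hg1, hg1', hg1Z⟩ := hpart 1
  refine Submodule.mem_sup.2 ⟨g0, hg0, g1, hg1, eq_of_cf hs
    (fun x hx => (hg0Z x hx).add (hg1Z x hx)) (fun x hx => VanishesAt.mul_right _
      (sm_vanishesAt hρ (V := ⟨(tsupport ρ)ᶜ, (isClosed_tsupport ρ).isOpen_compl⟩) h0 hx))
    fun b x hx => ?_⟩
  rw [map_add, Pi.add_apply, hg0' _ _ hx, hg1' _ _ hx, cf_sm_mul _ _ _ hx]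
  rcases zmod_two_cases (idxPar G.deg b) with h | h <;> simp [h]

/-- The finiteness of the set of colours makes the dual basis finite. The pieces of one colour are
disjoint and refine both the coordinate domains and the charts, so together they form a single
patch. -/
theorem exists_patches [T2Space M] [SecondCountableTopology M] [IsManifold (𝓡 m) ∞ M]
    (G : GradedManifold K m M) :
    ∃ P : (Fin m → ZMod 2) × Fin 3 → Patch G, ∀ x, ∃ c, x ∈ (P c).W := by
  let 𝒰 : Set (Set M) := {u | IsOpen u ∧ (∃ U : Opens M, u ⊆ U ∧
    Nonempty (LocalCoord G.toGradedSheaf G.deg U)) ∧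
    ∃ y : M, u ⊆ (chartAt (EuclideanSpace ℝ (Fin m)) y).source}
  obtain ⟨W, hW, hd, hcov⟩ := exists_coloured_cover (m := m) (𝒰 := 𝒰) (fun u hu => hu.1) (by
    refine Set.eq_univ_of_forall fun x => ?_
    obtain ⟨U, hxU, hU⟩ := G.locally_free x
    exact ⟨U ∩ (chartAt (EuclideanSpace ℝ (Fin m)) x).source,
      ⟨U.2.inter (chartAt _ x).open_source, ⟨U, Set.inter_subset_left, hU⟩, x,
        Set.inter_subset_right⟩, hxU, mem_chart_source _ x⟩)
  have h : ∀ c, ∀ w : W c, IsOpen w.1 ∧ (∃ U : Opens M, w.1 ⊆ U ∧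
      Nonempty (LocalCoord G.toGradedSheaf G.deg U)) ∧
      ∃ y : M, w.1 ⊆ (chartAt (EuclideanSpace ℝ (Fin m)) y).source := fun c w => by
    obtain ⟨ho, u, ⟨-, ⟨U, hU, hL⟩, y, hy⟩, hwu⟩ := hW c w.1 w.2
    exact ⟨ho, ⟨U, hwu.trans hU, hL⟩, y, hwu.trans hy⟩
  choose ho hL y hy using h
  choose U hU hL using hL
  refine ⟨fun c =>
    { ι := W c
      O := fun w => ⟨w.1, ho c w⟩
      disj := fun v w x hv hw => Subtype.ext ((hd c).elim_set v.2 w.2 x hv hw)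
      L := fun w => (hL c w).some.restrict (hU c w)
      e := fun w => chartAt _ (y c w)
      e_mem := fun w => IsManifold.chart_mem_maximalAtlas _
      le_source := fun w => hy c w }, fun x => ?_⟩
  obtain ⟨c, w, hw, hx⟩ := Set.mem_iUnion.1 (hcov (Set.mem_univ x))
  exact ⟨c, (Patch.mem_W _).2 ⟨⟨w, hw⟩, hx⟩⟩

/-- The functions on a graded manifold are graded commutative, and the module of vector fields has
a finite dual basis. -/
theorem exists_frame (K : Type) [RCLike K] (m : ℕ) (M : Type u) [TopologicalSpace M] [T2Space M]
    [SecondCountableTopology M] [ChartedSpace (EuclideanSpace ℝ (Fin m)) M]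
    [IsManifold (𝓡 m) ∞ M] (G : GradedManifold K m M) : Nonempty (Frame G.gr) := by
  obtain ⟨P, hP⟩ := exists_patches G
  have := ChartedSpace.locallyCompactSpace (EuclideanSpace ℝ (Fin m)) M
  obtain ⟨τ, hτ⟩ := SmoothPartitionOfUnity.exists_isSubordinate (𝓡 m) isClosed_univ
    (fun c => (P c).W) (fun c => (P c).isOpen_W) fun x _ => Set.mem_iUnion.2 (hP x)
  let ρ : (Fin m → ZMod 2) × Fin 3 → M → K := fun c x => (τ c x : K)
  have hρ : ∀ c, ContMDiff (𝓡 m) 𝓘(ℝ, K) ∞ (ρ c) := fun c => smooth_ofReal (τ c).contMDiff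
  have hs : ∀ c, tsupport (ρ c) ⊆ (P c).W := fun c => by
    refine (closure_mono fun x hx => ?_).trans (hτ c)
    rw [Function.mem_support] at hx ⊢
    exact fun h => hx (by simp only [ρ, h, RCLike.ofReal_zero])
  have hsum : ∀ x, ∑ c, ρ c x = 1 := fun x => by
    have h := τ.sum_eq_one (Set.mem_univ x)
    rw [finsum_eq_sum_of_fintype] at h
    simp only [ρ]
    rw [← RCLike.ofReal_sum, h, RCLike.ofReal_one]
  have hone : ∀ f : G.Fn, ∑ c, G.sm (ρ c) (hρ c) * f = f := fun f => by
    refine Patch.ext_of_cover hP fun c b x hx => ?_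
    rw [map_sum, Finset.sum_apply]
    simp only [Patch.cf_sm_mul _ _ _ hx]
    rw [← Finset.sum_mul, hsum, one_mul]
  have comm : ∀ (p q : ZMod 2) (f g : G.Fn), f ∈ par G.gr p → g ∈ par G.gr q →
      f * g = sgn K (p * q) • (g * f) := fun p q f g hf hg => by
    refine Patch.ext_of_cover hP fun c b x hx => ?_
    rw [map_smul, Pi.smul_apply]
    by_cases hb : Admissible G.deg b
    · rw [Patch.cf_mul hb _ _ hx, Patch.cf_mul hb _ _ hx]
      exact idxMul_comm _ (fun a ha => Patch.cf_of_mem_par hf ha hx)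
        (fun a ha => Patch.cf_of_mem_par hg ha hx) hb
    · rw [Patch.cf_eq_zero hb _ hx, Patch.cf_eq_zero hb _ hx, smul_zero]
  have mul_mem : ∀ (p q : ZMod 2) (f g : G.Fn), f ∈ par G.gr p → g ∈ par G.gr q →
      f * g ∈ par G.gr (p + q) := fun p q f g hf hg => by
    refine Patch.mem_par_of_cover hP fun c b hb x hx => ?_
    by_cases hba : Admissible G.deg b
    · rw [Patch.cf_mul hba _ _ hx]
      exact idxMul_eq_zero _ (fun a ha => Patch.cf_of_mem_par hf ha hx)
        (fun a ha => Patch.cf_of_mem_par hg ha hx) hb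
    · exact Patch.cf_eq_zero hba _ hx
  have hsm : ∀ φ (hφ : ContMDiff (𝓡 m) 𝓘(ℝ, K) ∞ φ), G.sm φ hφ ∈ par G.gr 0 := fun φ hφ => by
    refine Patch.mem_par_of_cover hP fun c b hb x hx => ?_
    rw [Patch.cf_sm _ _ hx, if_neg]
    rintro rfl
    exact hb (by simp [idxPar])
  have h1 : (1 : G.Fn) ∈ par G.gr 0 := by
    have h : (1 : G.Fn) = G.sm (fun _ => 1) contMDiff_const := (map_one (G.ofFn ⊤)).symm
    rw [h]
    exact hsm _ _
  choose g Y hg hY hX using fun c => Patch.exists_dual_basis (hρ c) (hs c) comm mul_mem hsm h1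
  let I := ((Fin m → ZMod 2) × Fin 3) × (Fin m ⊕ Fin G.rank)
  let e : I ≃ Fin (Fintype.card I) := Fintype.equivFin I
  -- The sign built into `Z` cancels the sign required in the expansion of `Frame.spec`.
  let Z : I → HomVF G.gr := fun i => ⟨Patch.coordPar G i.2, sgn K (Patch.coordPar G i.2) • Y i.1 i.2,
    Submodule.smul_mem _ _ (hY i.1 i.2)⟩
  have hspec : ∀ X ∈ Vect G.gr,
      X = ∑ i : I, sgn K (Z i).par • (X (g i.1 i.2) • (Z i).der) := fun X hXm => by
    have hpar : ∀ i : I, ∀ r : G.Fn,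
        sgn K (Z i).par • (r • (Z i).der) = r • Y i.1 i.2 := fun i r => by
      ext f
      simp only [Z, LinearMap.smul_apply, smul_eq_mul, mul_smul_comm]
      rw [smul_smul, sgn_mul_self, one_smul]
    simp only [hpar]
    induction hXm using Submodule.span_induction with
    | mem X hXm =>
      obtain ⟨p, hp⟩ := Set.mem_iUnion.1 hXm
      ext f
      rw [LinearMap.sum_apply]
      simp only [LinearMap.smul_apply, smul_eq_mul]
      rw [Fintype.sum_prod_type]
      simp only [← hX _ p X hp]
      exact (hone (X f)).symm
    | zero => simp
    | add X X' _ _ h h' =>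
      simp only [LinearMap.add_apply, add_smul, Finset.sum_add_distrib]
      rw [← h, ← h']
    | smul r X _ h =>
      simp only [LinearMap.smul_apply, smul_assoc, ← Finset.smul_sum]
      rw [← h]
  refine ⟨{
    comm := comm
    mul_mem := mul_mem
    one_mem := h1
    compl := ⟨?_, ?_⟩
    N := Fintype.card I
    g := fun k => g (e.symm k).1 (e.symm k).2
    Y := fun k => Z (e.symm k)
    g_mem := fun k => hg _ _
    spec := fun X => ?_ }⟩
  · refine Submodule.disjoint_def.2 fun f h0 h1 => Patch.ext_of_cover hP fun c b x hx => ?_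
    rw [map_zero]
    rcases zmod_two_cases (idxPar G.deg b) with h | h
    · exact Patch.cf_of_mem_par h1 (by rw [h]; decide) hx
    · exact Patch.cf_of_mem_par h0 (by rw [h]; decide) hx
  · refine codisjoint_iff.2 (eq_top_iff.2 fun f _ => ?_)
    rw [← hone f]
    exact sum_mem fun c _ => Patch.mem_sup (hρ c) (hs c) f
  · refine Subtype.ext ?_
    rw [AddSubmonoidClass.coe_finsetSum,
      Equiv.sum_comp e.symm fun i =>
        ((sgn K (Z i).par • (X.1 (g i.1 i.2) • (Z i).vf) : Vect G.gr) : Module.End K G.Fn)]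
    exact hspec X.1 X.2

end ExistsFrame

end DGMfd

end

theorem theorem4p9 :
    ∃ E : (n : ℕ) → TExpr (n + 2) 1,
      ∀ (K : Type) [RCLike K] (m : ℕ) (M : Type u) [TopologicalSpace M] [T2Space M]
        [SecondCountableTopology M] [ChartedSpace (EuclideanSpace ℝ (Fin m)) M]
        [IsManifold (𝓡 m) ∞ M] (G : GradedManifold K m M) (Q : Homological G.gr)
        (D : Connection G.gr), D.TorsionFree →
      ∃ P : SymT G.gr ≃ₗ[K] DiffOp G.gr, D.IsPBW P ∧
        (∀ P' : SymT G.gr →ₗ[K] DiffOp G.gr, D.IsPBW P' → P' = P) ∧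
      ∃ R : (n : ℕ) → SymSection G.gr n, IsKapranov Q P R ∧
        (∀ R' : (n : ℕ) → SymSection G.gr n, IsKapranov Q P R' → R' = R) ∧
        (∀ X Y, (R 2).ap [X, Y] = - D.atiyah Q X Y) ∧
        (∀ n, 3 ≤ n → ∀ l : List (HomVF G.gr), l.length = n →
          svf G.gr ((R n).ap l) = (2 / (n : K)) • conv (R 2).ap l
            + (1 / (n : K)) • ∑ k ∈ Finset.Ico 2 n,
                (conv ((R k).symCov D) l + (1 - (k : K)) • conv (R k).ap l
                  - (R k).bconv D P l)) ∧
        (∀ (n : ℕ) (X : Fin (n + 2) → HomVF G.gr),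
          (R (n + 2)).ap (List.ofFn X) = ((E n).eval D Q).val X) ∧
        (D.Flat → (∀ X Y, (R 2).ap [X, Y] = - D.atiyah Q X Y) ∧
          ∀ n, 3 ≤ n → ∀ l : List (HomVF G.gr), l.length = n →
            (R n).ap l = (1 / (n : K)) • (R (n - 1)).symCov D l) := by
  obtain ⟨E, hE⟩ := kapranov_of_frame.{u}
  refine ⟨E, fun K _ m M _ _ _ _ _ G Q D hD => ?_⟩
  obtain ⟨F⟩ := exists_frame K m M G
  exact hE K G.Fn G.gr F Q D hD
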